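/- **Conventions.** A *prederivator* is a 2-functor (pseudofunctor) $\mathscr D\colon \mathrm{Cat}^{\mathrm{op}}\to\mathrm{CAT}$, contravariant on functors $u\mapsto u^*$ and covariant on natural transformations; morphisms of prederivators are pseudo-natural transformations, 2-morphisms are modifications, and "isomorphism" between parallel morphisms means invertible modification. It is a *derivator* if (Der1) it takes coproducts to products (up to equivalence), (Der2) a morphism in $\mathscr D(A)$ is invertible iff it is so at every object of $A$, (Der3) each $u^*$ has a left adjoint $u_!$ and a right adjoint $u_*$, and (Der4) these Kan extensions are computed pointwise (the mates of the comma squares are invertible). It is *stable* if moreover it has a zero object and a coherent square is cartesian iff it is cocartesian (then called bicartesian). For a small category $B$, $\mathscr D^B(A)=\mathscr D(B\times A)$. Suspension $\Sigma$ is: right Kan extension from the corner $00$ to the span $\ulcorner=[1]^2\setminus\{11\}$, left Kan extension to $\square=[1]^2$, evaluation at $11$; dually, $\Omega$ is left Kan extension from $11$ to the cospan, right Kan extension to $\square$, evaluation at $00$. **The derivator $\mathscr D^{C,\mathrm{ex}}$.** Let $C_0\subset\mathbb Z^3$ be the full subposet of the points $(n+\epsilon_1,n+\epsilon_2,n+\epsilon_3)$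 with $n\in\mathbb Z$, $\epsilon_i\in\{0,1\}$, and let $C\subset\mathbb Z^3$ be the full subposet of the points of $C_0$ and the points $(n,n+2,n+1)$, $(n+2,n+1,n)$, $(n+1,n,n+2)$, $n\in\mathbb Z$. The *small squares* of $C$ are the 2-dimensional faces of the cubes $[(n,n,n),(n+1,n+1,n+1)]$ and the squares $$(n+\alpha,\,n+1+\beta,\,n+1),\qquad (n+1+\beta,\,n+1,\,n+\alpha),\qquad (n+1,\,n+\alpha,\,n+1+\beta)\qquad(\alpha,\beta\in\{0,1\}).$$ $\mathscr D^{C,\mathrm{ex}}$ is the full subprederivator of $\mathscr D^C$ spanned by the $Y$ in which all small squares are bicartesian and which vanish at all points of $C\setminus C_0$ (both conditions being imposed at each object of the parameter category). Let $\mathrm{sh}(n_1,n_2,n_3)=(n_1+1,n_2+1,n_3+1)$ and $r(n_1,n_2,n_3)=(n_3,n_1,n_2)$; restriction along these automorphisms of $C$ gives endomorphisms $\mathrm{sh}^*$ and $r^*$ of $\mathscr D^{C,\mathrm{ex}}$. Let $[1]^3_{\le 1}=\{000,100,010,001\}\subset\mathbb Z^3$ and let $i\colon[1]^3_{\le1}\to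 C$ be the inclusion. **The endomorphism $T$.** Let $E$ be the poset obtained from the full subposet of $\mathbb Z^4$ on $[1]^4\cup\{0211,2101,1021,2111,1211,1121\}$ by adjoining elements $(-\infty,0)$ and $(-\infty,1)$, with generating relations $(-\infty,0)\le 0000$, $(-\infty,1)\le 0001$, $(-\infty,0)\le(-\infty,1)$. Consider the full subposets $E_1=\{(-\infty,0),1100,0110,1010,1110\}$, $E_2=E_1\cup[1]^3\times\{0\}$, $E_3=E_2\cup\{(-\infty,1)\}$, $E_4=E_3\cup[1]^3\times\{1\}$, $E_5=E_4\cup\{0211,2101,1021\}$, the map $v_1\colon[1]^3_{\le1}\to E_1$ with $000\mapsto(-\infty,0)$, $100\mapsto1100$, $010\mapsto0110$, $001\mapsto1010$, and the inclusions $E_1\xrightarrow{v_2}E_2\xrightarrow{v_3}E_3\xrightarrow{v_4}E_4\xrightarrow{v_5}E_5\xrightarrow{v_6}E$. Put $$H=(v_6)_!\,(v_5)_*\,(v_4)_!\,(v_3)_*\,(v_2)_*\,(v_1)_*\colon\ \mathscr D^{[1]^3_{\le1}}\to\mathscr D^E,$$ let $w\colon[1]^3_{\le1}\to E$, $w(x)=(x,1)$,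 and put $T'=w^*H$ and $T=F\,T'\,i^*\colon\mathscr D^{C,\mathrm{ex}}\to\mathscr D^{C,\mathrm{ex}}$, where $F$ is a quasi-inverse of $i^*\colon\mathscr D^{C,\mathrm{ex}}\to\mathscr D^{[1]^3_{\le1}}$. **Theorem.** Let $\mathscr D$ be a stable derivator. Then $\mathscr D^{C,\mathrm{ex}}$ is a stable derivator; the Kan extensions above (and those defining $\Sigma$, $\Omega$ for $\mathscr D$ and $\mathscr D^{C,\mathrm{ex}}$) exist as morphisms of prederivators adjoint to the restriction morphisms; $i^*$ is an equivalence, so that $T$ is defined; $T$ is an equivalence; and the following hold. 1. There are isomorphisms of endomorphisms of $\mathscr D^{C,\mathrm{ex}}$ $$T\cong(\mathrm{sh}^*)^{-1}\Sigma\cong\Sigma(\mathrm{sh}^*)^{-1},\qquad T^2\cong\mathrm{sh}^*,\qquad T^3\cong\Sigma .$$ In particular $T\,\mathrm{sh}^*\cong\mathrm{sh}^*\,T$ and $T\Sigma\cong\Sigma T$. 2. The objects in the underlying diagram of $TY$ are as follows, naturally in $Y\in\mathscr D^{C,\mathrm{ex}}$: $(TY)_x\cong\Sigma\, Y_{x-(1,1,1)}$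 for all $x\in C$; $(TY)_{000}\cong H(i^*Y)_{0001}$ and $\Sigma (TY)_{000}\cong Y_{222}$; $$(TY)_{100}\cong Y_{101},\quad (TY)_{010}\cong Y_{110},\quad (TY)_{001}\cong Y_{011},\quad (TY)_{110}\cong Y_{121},\quad (TY)_{101}\cong Y_{211},\quad (TY)_{011}\cong Y_{112}.$$ 3. The abstract Auslander–Reiten translation $\tau=r^*T^{-1}\colon\mathscr D^{C,\mathrm{ex}}\to\mathscr D^{C,\mathrm{ex}}$ (with $T^{-1}$ a quasi-inverse of $T$) satisfies $\tau^3\cong\Omega$. -/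

import Mathlib

open CategoryTheory Bicategory Opposite
open scoped Pseudofunctor.StrongTrans

universe w v u

set_option linter.checkUnivs false

/-! ### Prederivators -/

/-- A prederivator: a 2-functor from small categories to categories, contravariant on functors and
covariant on natural transformations. Strict 2-functors are the pseudofunctors whose structural
isomorphisms are identities. The 1-morphisms `D ⟶ E` are the pseudo-natural transformations and
the 2-morphisms between them are the modifications. -/
abbrev Prederivator := Pseudofunctor (Cat.{w, w})ᵒᵖ Cat.{v, u}

section
universe w₃ v₃ u₃
variable {E : Type u₃} [Bicategory.{w₃, v₃} E]

lemma coh_comp {a₀ a₁ a₂ b₀ b₁ b₂ : E} {P₁ : a₀ ⟶ a₁} {P₂ : a₁ ⟶ a₂} {P₁₂ : a₀ ⟶ a₂}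
    {Q₁ : b₀ ⟶ b₁} {Q₂ : b₁ ⟶ b₂} {Q₁₂ : b₀ ⟶ b₂} {N₀ : a₀ ⟶ b₀} {N₁ : a₁ ⟶ b₁} {N₂ : a₂ ⟶ b₂}
    {X₁ : a₀ ⟶ b₁} {X₂ : a₁ ⟶ b₂} {X : a₀ ⟶ b₂}
    (p₁₂ : P₁₂ ≅ P₁ ≫ P₂) (q₁₂ : Q₁₂ ≅ Q₁ ≫ Q₂)
    (x₁ : X₁ ≅ P₁ ≫ N₁) (y₁ : X₁ ≅ N₀ ≫ Q₁) (x₂ : X₂ ≅ P₂ ≫ N₂) (y₂ : X₂ ≅ N₁ ≫ Q₂)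
    (x : X ≅ P₁₂ ≫ N₂) (y : X ≅ N₀ ≫ Q₁₂) (z : X ≅ P₁ ≫ X₂) (t : X ≅ X₁ ≫ Q₂)
    (hA : z.hom ≫ P₁ ◁ x₂.hom = x.hom ≫ p₁₂.hom ▷ N₂ ≫ (α_ _ _ _).hom)
    (hB : z.hom ≫ P₁ ◁ y₂.hom = t.hom ≫ x₁.hom ▷ Q₂ ≫ (α_ _ _ _).hom)
    (hC : y.hom ≫ N₀ ◁ q₁₂.hom = t.hom ≫ y₁.hom ▷ Q₂ ≫ (α_ _ _ _).hom) :
    (x.symm ≪≫ y).hom ≫ N₀ ◁ q₁₂.hom = p₁₂.hom ▷ N₂ ≫ (α_ _ _ _).hom ≫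
      P₁ ◁ (x₂.symm ≪≫ y₂).hom ≫ (α_ _ _ _).inv ≫ (x₁.symm ≪≫ y₁).hom ▷ Q₂ ≫
      (α_ _ _ _).hom := by
  rw [← cancel_epi x.hom]
  have hB' : P₁ ◁ y₂.hom = z.inv ≫ t.hom ≫ x₁.hom ▷ Q₂ ≫ (α_ _ _ _).hom := by
    rw [Iso.eq_inv_comp, hB]
  simp only [Iso.trans_hom, Iso.symm_hom, Category.assoc, Iso.hom_inv_id_assoc, hC,
    whiskerLeft_comp, comp_whiskerRight]
  rw [← reassoc_of% hA]
  simp [hB', whiskerLeft_hom_inv_assoc]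

lemma coh_assoc {a b c d : E} {F : a ⟶ b} {G : b ⟶ c} {H : c ⟶ d} {GH : b ⟶ d} {FG : a ⟶ c}
    {X : a ⟶ d} (x : X ≅ F ≫ GH) (gh : GH ≅ G ≫ H) (y : X ≅ FG ≫ H) (fg : FG ≅ F ≫ G)
    (h : 𝟙 X = y.hom ≫ fg.hom ▷ H ≫ (α_ F G H).hom ≫ F ◁ gh.inv ≫ x.inv) :
    x.hom ≫ F ◁ gh.hom = y.hom ≫ fg.hom ▷ H ≫ (α_ F G H).hom := by
  have h' : x.hom = y.hom ≫ fg.hom ▷ H ≫ (α_ F G H).hom ≫ F ◁ gh.inv := by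
    rw [← cancel_mono x.inv, Iso.hom_inv_id, h]
    simp only [Category.assoc]
  rw [h']
  simp

lemma coh_id {a b : E} {I : a ⟶ a} {J : b ⟶ b} {N : a ⟶ b} (i : I ≅ 𝟙 a) (j : J ≅ 𝟙 b)
    (x : N ≅ I ≫ N) (y : N ≅ N ≫ J)
    (hx : x.hom ≫ i.hom ▷ N ≫ (λ_ N).hom = 𝟙 N)
    (hy : y.hom ≫ N ◁ j.hom ≫ (ρ_ N).hom = 𝟙 N) :
    (x.symm ≪≫ y).hom ≫ N ◁ j.hom = i.hom ▷ N ≫ (λ_ N).hom ≫ (ρ_ N).inv := by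
  rw [← cancel_epi x.hom]
  simp only [Iso.trans_hom, Iso.symm_hom, Category.assoc, Iso.hom_inv_id_assoc]
  rw [reassoc_of% hx, ← cancel_mono (ρ_ N).hom]
  simpa using hy

lemma coh_nat {a b c d: E} {P P' : a ⟶ b} {Q Q' : c ⟶ d} {N₀ : a ⟶ c} {N₁ : b ⟶ d}
    {X X' : a ⟶ d} (θ : P ⟶ P') (φ : Q ⟶ Q') (ξ : X ⟶ X')
    (x : X ≅ P ≫ N₁) (y : X ≅ N₀ ≫ Q) (x' : X' ≅ P' ≫ N₁) (y' : X' ≅ N₀ ≫ Q')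
    (hx : ξ = x.hom ≫ θ ▷ N₁ ≫ x'.inv) (hy : ξ = y.hom ≫ N₀ ◁ φ ≫ y'.inv) :
    θ ▷ N₁ ≫ (x'.symm ≪≫ y').hom = (x.symm ≪≫ y).hom ≫ N₀ ◁ φ := by
  have : x.hom ≫ θ ▷ N₁ ≫ x'.inv = y.hom ≫ N₀ ◁ φ ≫ y'.inv := hx.symm.trans hy
  rw [← cancel_epi x.hom, ← cancel_mono y'.inv]
  simpa using this
end


/-- The functor `B × -` on small categories, on 1-morphisms. -/
abbrev shMap (B : Type w) [SmallCategory B] {X Y : (Cat.{w, w})ᵒᵖ} (f : X ⟶ Y) :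
    (op (Cat.of (B × X.unop)) : (Cat.{w, w})ᵒᵖ) ⟶ op (Cat.of (B × Y.unop)) :=
  ((𝟭 B).prod f.unop.toFunctor).toCatHom.op

/-- The functor `B × -` on small categories, on 2-morphisms. -/
abbrev shMap₂ (B : Type w) [SmallCategory B] {X Y : (Cat.{w, w})ᵒᵖ} {f g : X ⟶ Y} (α : f ⟶ g) :
    shMap B f ⟶ shMap B g :=
  Bicategory.Opposite.op2
    (NatTrans.toCatHom₂ (NatTrans.prod (𝟙 (𝟭 B)) α.unop2.toNatTrans))

lemma shMap₂_comp (B : Type w) [SmallCategory B] {X Y : (Cat.{w, w})ᵒᵖ} {f g h : X ⟶ Y}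
    (α : f ⟶ g) (β : g ⟶ h) : shMap₂ B (α ≫ β) = shMap₂ B α ≫ shMap₂ B β := by
  apply congrArg Bicategory.Opposite.op2
  apply congrArg NatTrans.toCatHom₂
  ext X
  · exact (Category.id_comp _).symm
  · rfl

namespace Prederivator

variable (D : Prederivator.{w, v, u})

/-- `D.Diag A` is the category `D(A)` of coherent diagrams of shape `A`. -/
abbrev Diag (A : Type w) [SmallCategory A] : Cat.{v, u} := D.obj (op (Cat.of A))

/-- The restriction functor `F^* : D(B) ⥤ D(A)` along `F : A ⥤ B`. -/
abbrev res {A B : Type w} [SmallCategory A] [SmallCategory B] (F : A ⥤ B) :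
    D.Diag B ⥤ D.Diag A :=
  (D.map F.toCatHom.op).toFunctor

/-- The natural transformation `F^* ⟶ G^*` induced by `α : F ⟶ G`. -/
abbrev resTrans {A B : Type w} [SmallCategory A] [SmallCategory B] {F G : A ⥤ B} (α : F ⟶ G) :
    D.res F ⟶ D.res G :=
  (D.map₂ (Bicategory.Opposite.op2 (NatTrans.toCatHom₂ α))).toNatTrans

/-- The natural isomorphism `F^* ≅ G^*` induced by `α : F ≅ G`. -/
abbrev resIso {A B : Type w} [SmallCategory A] [SmallCategory B] {F G : A ⥤ B} (α : F ≅ G) :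
    D.res F ≅ D.res G :=
  Cat.Hom.toNatIso (D.map₂Iso ((Bicategory.Opposite.opFunctor _ _).mapIso (Cat.Hom.isoMk α)))

/-- Functoriality of restriction, `(F ⋙ G)^* ≅ F^* G^*`. -/
abbrev resComp {A B C : Type w} [SmallCategory A] [SmallCategory B] [SmallCategory C]
    (F : A ⥤ B) (G : B ⥤ C) : D.res (F ⋙ G) ≅ D.res G ⋙ D.res F :=
  Cat.Hom.toNatIso (D.mapComp G.toCatHom.op F.toCatHom.op)

/-- The terminal category. -/
abbrev Pt : Type w := Discrete PUnit.{w + 1}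

/-- The functor `a : Pt ⥤ A` given by an object `a` of `A`. -/
abbrev pt {A : Type w} [SmallCategory A] (a : A) : Pt.{w} ⥤ A := Functor.fromPUnit a

/-- The evaluation functor `a^* : D(A) ⥤ D(Pt)`. -/
abbrev eval {A : Type w} [SmallCategory A] (a : A) : D.Diag A ⥤ D.Diag Pt.{w} := D.res (pt a)

/-- A square `α : p ⋙ u ⟶ q ⋙ v` of small categories induces `p^* u^* ⟶ q^* v^*`. -/
def square {A B C E : Type w} [SmallCategory A] [SmallCategory B] [SmallCategory C]
    [SmallCategory E] {p : E ⥤ A} {u : A ⥤ C} {q : E ⥤ B} {v : B ⥤ C} (α : p ⋙ u ⟶ q ⋙ v) :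
    TwoSquare (D.res u) (D.res v) (D.res p) (D.res q) :=
  (D.resComp p u).inv ≫ D.resTrans α ≫ (D.resComp q v).hom

/-! ### Derivators -/

/-- The axioms of a derivator. -/
class IsDerivator : Prop where
  /-- (Der1) Coproducts are sent to products. -/
  der1 : ∀ (I : Type w) (A : I → Type w) [∀ i, SmallCategory (A i)],
    (Functor.pi' (fun i => D.res (Sigma.incl (C := A) i))).IsEquivalence
  /-- (Der2) Isomorphisms are detected pointwise. -/
  der2 : ∀ (A : Type w) [SmallCategory A] {X Y : D.Diag A} (f : X ⟶ Y),
    (∀ a : A, IsIso ((D.eval a).map f)) → IsIso f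
  /-- (Der3) Left Kan extensions exist. -/
  der3_left : ∀ {A B : Type w} [SmallCategory A] [SmallCategory B] (F : A ⥤ B),
    (D.res F).IsRightAdjoint
  /-- (Der3) Right Kan extensions exist. -/
  der3_right : ∀ {A B : Type w} [SmallCategory A] [SmallCategory B] (F : A ⥤ B),
    (D.res F).IsLeftAdjoint
  /-- (Der4) The canonical transformation `π_! p^* ⟶ b^* F_!`, the mate of the transformation
  induced by the comma square of `F / b`, is an isomorphism. -/
  der4_left : ∀ {A B : Type w} [SmallCategory A] [SmallCategory B] (F : A ⥤ B) (b : B)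
    {L : D.Diag A ⥤ D.Diag B} (adj : L ⊣ D.res F)
    {L' : D.Diag (Comma F (pt b)) ⥤ D.Diag Pt.{w}} (adj' : L' ⊣ D.res (Comma.snd F (pt b))),
    IsIso ((mateEquiv adj adj').symm (D.square (Comma.natTrans F (pt b)))).natTrans
  /-- (Der4) The canonical transformation `b^* F_* ⟶ π_* q^*`, the mate of the transformation
  induced by the comma square of `b / F`, is an isomorphism. -/
  der4_right : ∀ {A B : Type w} [SmallCategory A] [SmallCategory B] (F : A ⥤ B) (b : B)
    {R : D.Diag A ⥤ D.Diag B} (adj : D.res F ⊣ R)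
    {R' : D.Diag (Comma (pt b) F) ⥤ D.Diag Pt.{w}} (adj' : D.res (Comma.fst (pt b) F) ⊣ R'),
    IsIso ((mateEquiv adj adj') (D.square (Comma.natTrans (pt b) F))).natTrans

attribute [instance] IsDerivator.der3_left IsDerivator.der3_right

section KanExtensions

variable [D.IsDerivator] {A B : Type w} [SmallCategory A] [SmallCategory B]

/-- The left Kan extension functor `F_! : D(A) ⥤ D(B)`. -/
noncomputable abbrev lan (F : A ⥤ B) : D.Diag A ⥤ D.Diag B := (D.res F).leftAdjoint

/-- The right Kan extension functor `F_* : D(A) ⥤ D(B)`. -/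
noncomputable abbrev ran (F : A ⥤ B) : D.Diag A ⥤ D.Diag B := (D.res F).rightAdjoint

end KanExtensions

end Prederivator

/-! ### Posets as shapes -/

/-- A preorder, regarded as a small category in any universe. -/
abbrev Shape (P : Type) [Preorder P] : Type w := ULift.{w} P

namespace Shape

/-- The functor given by a monotone map. -/
def map {P Q : Type} [Preorder P] [Preorder Q] (f : P → Q) (hf : Monotone f) :
    Shape.{w} P ⥤ Shape.{w} Q :=
  Monotone.functor (f := fun x : ULift.{w} P => ULift.up.{w} (f x.down)) (fun _ _ h => hf h)

/-- The inclusion of a full subposet in a larger one. -/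
abbrev incl {P : Type} [Preorder P] {S T : Set P} (h : S ⊆ T) : Shape.{w} S ⥤ Shape.{w} T :=
  map (Set.inclusion h) (fun _ _ h' => h')

end Shape

/-- The commutative square `[1] × [1]`. -/
abbrev Sq : Type := Fin 2 × Fin 2

/-- The span `(1,0) ← (0,0) → (0,1)`, as a full subposet of the square. -/
abbrev Span : Type := {x : Sq // x ≠ (1, 1)}

/-- The cospan `(1,0) → (1,1) ← (0,1)`, as a full subposet of the square. -/
abbrev Cospan : Type := {x : Sq // x ≠ (0, 0)}

/-- The inclusion of the span in the square. -/
def spanIncl : Shape.{w} Span ⥤ Shape.{w} Sq := Shape.map Subtype.val (fun _ _ h => h)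

/-- The inclusion of the cospan in the square. -/
def cospanIncl : Shape.{w} Cospan ⥤ Shape.{w} Sq := Shape.map Subtype.val (fun _ _ h => h)

namespace Prederivator

variable (D : Prederivator.{w, v, u})

/-- A square is cocartesian if it lies in the essential image of left Kan extension from the
span. -/
def IsCocartesian [D.IsDerivator] (X : D.Diag (Shape.{w} Sq)) : Prop :=
  (D.lan spanIncl).essImage X

/-- A square is cartesian if it lies in the essential image of right Kan extension from the
cospan. -/
def IsCartesian [D.IsDerivator] (X : D.Diag (Shape.{w} Sq)) : Prop :=
  (D.ran cospanIncl).essImage X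

/-- A stable derivator: a derivator whose underlying category has a zero object and in which the
cocartesian squares and the cartesian squares coincide. -/
class IsStable : Prop extends D.IsDerivator where
  hasZeroObject : Limits.HasZeroObject (D.Diag Pt.{w})
  isCocartesian_iff_isCartesian : ∀ X : D.Diag (Shape.{w} Sq),
    D.IsCocartesian X ↔ D.IsCartesian X

/-! ### Shifted prederivators and their morphisms -/

/-- The shifted prederivator `D^B`, with `D^B(A) = D(B × A)`. -/
def shift (B : Type w) [SmallCategory B] : Prederivator.{w, v, u} where
  obj A := D.obj (op (Cat.of (B × A.unop)))
  map f := D.map (shMap B f)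
  map₂ α := D.map₂ (shMap₂ B α)
  mapId A := D.mapId (op (Cat.of (B × A.unop)))
  mapComp f g := D.mapComp (shMap B f) (shMap B g)
  map₂_id f := D.map₂_id (shMap B f)
  map₂_comp f g := (congrArg D.map₂ (shMap₂_comp B f g)).trans (D.map₂_comp _ _)
  map₂_whisker_left f _ _ η := D.map₂_whisker_left (shMap B f) (shMap₂ B η)
  map₂_whisker_right η h := D.map₂_whisker_right (shMap₂ B η) (shMap B h)
  map₂_associator f g h := D.map₂_associator (shMap B f) (shMap B g) (shMap B h)
  map₂_left_unitor f := D.map₂_left_unitor (shMap B f)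
  map₂_right_unitor f := D.map₂_right_unitor (shMap B f)

section
variable {W X Y Z : (Cat.{w,w})ᵒᵖ}

lemma map_assoc (f : W ⟶ X) (g : X ⟶ Y) (h : Y ⟶ Z) :
    (D.mapComp f (g ≫ h)).hom ≫ D.map f ◁ (D.mapComp g h).hom =
      (D.mapComp (f ≫ g) h).hom ≫ (D.mapComp f g).hom ▷ D.map h ≫
        (α_ (D.map f) (D.map g) (D.map h)).hom :=
  coh_assoc (D.mapComp f (g ≫ h)) (D.mapComp g h) (D.mapComp (f ≫ g) h) (D.mapComp f g)
    ((D.map₂_id ((f ≫ g) ≫ h)).symm.trans (D.map₂_associator f g h))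

lemma map_lunit (f : W ⟶ X) :
    (D.mapComp (𝟙 W) f).hom ≫ (D.mapId W).hom ▷ D.map f ≫ (λ_ (D.map f)).hom = 𝟙 (D.map f) :=
  (D.map₂_left_unitor f).symm.trans (D.map₂_id f)

lemma map_runit (f : W ⟶ X) :
    (D.mapComp f (𝟙 X)).hom ≫ D.map f ◁ (D.mapId X).hom ≫ (ρ_ (D.map f)).hom = 𝟙 (D.map f) :=
  (D.map₂_right_unitor f).symm.trans (D.map₂_id f)
end


/-- The restriction morphism `u^* : D^{B'} ⟶ D^B` along `u : B ⥤ B'`. -/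
def resMor {B B' : Type w} [SmallCategory B] [SmallCategory B'] (u : B ⥤ B') :
    D.shift B' ⟶ D.shift B where
  app A := D.map (u.prod (𝟭 A.unop)).toCatHom.op
  naturality {A A'} f := (D.mapComp (shMap B' f) (u.prod (𝟭 A'.unop)).toCatHom.op).symm ≪≫
    D.mapComp (u.prod (𝟭 A.unop)).toCatHom.op (shMap B f)
  naturality_naturality {A A'} f g θ := coh_nat (D.map₂ (shMap₂ B' θ)) (D.map₂ (shMap₂ B θ)) _
     (D.mapComp (shMap B' f) (u.prod (𝟭 A'.unop)).toCatHom.op)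
     (D.mapComp (u.prod (𝟭 A.unop)).toCatHom.op (shMap B f))
     (D.mapComp (shMap B' g) (u.prod (𝟭 A'.unop)).toCatHom.op)
     (D.mapComp (u.prod (𝟭 A.unop)).toCatHom.op (shMap B g))
     (D.map₂_whisker_right (shMap₂ B' θ) (u.prod (𝟭 A'.unop)).toCatHom.op)
     ((congrArg D.map₂ (by
        apply congrArg Bicategory.Opposite.op2
        apply congrArg NatTrans.toCatHom₂
        ext X
        exact Prod.ext (u.map_id _).symm rfl)).trans (D.map₂_whisker_left (u.prod (𝟭 A.unop)).toCatHom.op (shMap₂ B θ)))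
  naturality_id A := coh_id (D.mapId _) (D.mapId _)
    (D.mapComp (𝟙 (op (Cat.of (B' × A.unop)))) (u.prod (𝟭 A.unop)).toCatHom.op)
    (D.mapComp (u.prod (𝟭 A.unop)).toCatHom.op (𝟙 (op (Cat.of (B × A.unop)))))
    (D.map_lunit _) (D.map_runit _)
  naturality_comp {X Y Z} f g := coh_comp
    (D.mapComp (shMap B' f) (shMap B' g)) (D.mapComp (shMap B f) (shMap B g))
    (D.mapComp (shMap B' f) (u.prod (𝟭 Y.unop)).toCatHom.op)
    (D.mapComp (u.prod (𝟭 X.unop)).toCatHom.op (shMap B f))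
    (D.mapComp (shMap B' g) (u.prod (𝟭 Z.unop)).toCatHom.op)
    (D.mapComp (u.prod (𝟭 Y.unop)).toCatHom.op (shMap B g))
    (D.mapComp (shMap B' f ≫ shMap B' g) (u.prod (𝟭 Z.unop)).toCatHom.op)
    (D.mapComp (u.prod (𝟭 X.unop)).toCatHom.op (shMap B f ≫ shMap B g))
    (D.mapComp (shMap B' f) (shMap B' g ≫ (u.prod (𝟭 Z.unop)).toCatHom.op))
    (D.mapComp ((u.prod (𝟭 X.unop)).toCatHom.op ≫ shMap B f) (shMap B g))
    (D.map_assoc (shMap B' f) (shMap B' g) (u.prod (𝟭 Z.unop)).toCatHom.op)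
    (D.map_assoc (shMap B' f) (u.prod (𝟭 Y.unop)).toCatHom.op (shMap B g))
    (D.map_assoc (u.prod (𝟭 X.unop)).toCatHom.op (shMap B f) (shMap B g))

/-- The evaluation morphism `b^* : D^B ⟶ D` at an object `b` of `B`. -/
def ev {B : Type w} [SmallCategory B] (b : B) : D.shift B ⟶ D where
  app A := D.map (Prod.sectR b A.unop).toCatHom.op
  naturality {A A'} f := (D.mapComp (shMap B f) (Prod.sectR b A'.unop).toCatHom.op).symm ≪≫
    D.mapComp (Prod.sectR b A.unop).toCatHom.op f
  naturality_naturality {A A'} f g θ := coh_nat (D.map₂ (shMap₂ B θ)) (D.map₂ θ) _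
     (D.mapComp (shMap B f) (Prod.sectR b A'.unop).toCatHom.op)
     (D.mapComp (Prod.sectR b A.unop).toCatHom.op f)
     (D.mapComp (shMap B g) (Prod.sectR b A'.unop).toCatHom.op)
     (D.mapComp (Prod.sectR b A.unop).toCatHom.op g)
     (D.map₂_whisker_right (shMap₂ B θ) (Prod.sectR b A'.unop).toCatHom.op)
     (D.map₂_whisker_left (Prod.sectR b A.unop).toCatHom.op θ)
  naturality_id A := coh_id (D.mapId _) (D.mapId _)
    (D.mapComp (𝟙 (op (Cat.of (B × A.unop)))) (Prod.sectR b A.unop).toCatHom.op)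
    (D.mapComp (Prod.sectR b A.unop).toCatHom.op (𝟙 A))
    (D.map_lunit _) (D.map_runit _)
  naturality_comp {X Y Z} f g := coh_comp
    (D.mapComp (shMap B f) (shMap B g)) (D.mapComp f g)
    (D.mapComp (shMap B f) (Prod.sectR b Y.unop).toCatHom.op)
    (D.mapComp (Prod.sectR b X.unop).toCatHom.op f)
    (D.mapComp (shMap B g) (Prod.sectR b Z.unop).toCatHom.op)
    (D.mapComp (Prod.sectR b Y.unop).toCatHom.op g)
    (D.mapComp (shMap B f ≫ shMap B g) (Prod.sectR b Z.unop).toCatHom.op)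
    (D.mapComp (Prod.sectR b X.unop).toCatHom.op (f ≫ g))
    (D.mapComp (shMap B f) (shMap B g ≫ (Prod.sectR b Z.unop).toCatHom.op))
    (D.mapComp ((Prod.sectR b X.unop).toCatHom.op ≫ f) g)
    (D.map_assoc (shMap B f) (shMap B g) (Prod.sectR b Z.unop).toCatHom.op)
    (D.map_assoc (shMap B f) (Prod.sectR b Y.unop).toCatHom.op g)
    (D.map_assoc (Prod.sectR b X.unop).toCatHom.op f g)

/-- The restriction and evaluation morphisms between the shifts of `D` have left and right
adjoints in the 2-category of prederivators: the Kan extension morphisms of `D`. -/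
class HasKanMorphisms : Prop where
  lan : ∀ {B B' : Type w} [SmallCategory B] [SmallCategory B'] (u : B ⥤ B'),
    Bicategory.IsRightAdjoint (D.resMor u)
  ran : ∀ {B B' : Type w} [SmallCategory B] [SmallCategory B'] (u : B ⥤ B'),
    Bicategory.IsLeftAdjoint (D.resMor u)
  lanEv : ∀ {B : Type w} [SmallCategory B] (b : B), Bicategory.IsRightAdjoint (D.ev b)
  ranEv : ∀ {B : Type w} [SmallCategory B] (b : B), Bicategory.IsLeftAdjoint (D.ev b)

attribute [instance] HasKanMorphisms.lan HasKanMorphisms.ran HasKanMorphisms.lanEv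
  HasKanMorphisms.ranEv

section KanMorphisms

variable [D.HasKanMorphisms] {B B' : Type w} [SmallCategory B] [SmallCategory B']

/-- The left Kan extension morphism `u_! : D^B ⟶ D^{B'}`. -/
noncomputable def lanMor (u : B ⥤ B') : D.shift B ⟶ D.shift B' :=
  Bicategory.leftAdjoint (D.resMor u)

/-- The right Kan extension morphism `u_* : D^B ⟶ D^{B'}`. -/
noncomputable def ranMor (u : B ⥤ B') : D.shift B ⟶ D.shift B' :=
  Bicategory.rightAdjoint (D.resMor u)

/-- The left Kan extension morphism `b_! : D ⟶ D^B` along an object `b` of `B`. -/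
noncomputable def lanEv (b : B) : D ⟶ D.shift B := Bicategory.leftAdjoint (D.ev b)

/-- The right Kan extension morphism `b_* : D ⟶ D^B` along an object `b` of `B`. -/
noncomputable def ranEv (b : B) : D ⟶ D.shift B := Bicategory.rightAdjoint (D.ev b)

/-- The suspension `Σ : D ⟶ D`: right extension by zero from `(0,0)` to the span, left Kan
extension to the square, and evaluation at `(1,1)`. -/
noncomputable def suspension : D ⟶ D :=
  D.ranEv (ULift.up ⟨(0, 0), by decide⟩ : Shape.{w} Span) ≫ D.lanMor spanIncl ≫
    D.ev (ULift.up (1, 1) : Shape.{w} Sq)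

/-- The loop morphism `Ω : D ⟶ D`: left extension by zero from `(1,1)` to the cospan, right Kan
extension to the square, and evaluation at `(0,0)`. -/
noncomputable def loops : D ⟶ D :=
  D.lanEv (ULift.up ⟨(1, 1), by decide⟩ : Shape.{w} Cospan) ≫ D.ranMor cospanIncl ≫
    D.ev (ULift.up (0, 0) : Shape.{w} Sq)

end KanMorphisms

end Prederivator

/-! ### The category `C` and the derivator `D^{C,ex}` -/

/-- The points `(n+ε₁, n+ε₂, n+ε₃)` with `ε₁, ε₂, ε₃ ∈ {0, 1}`. -/
def cubePoints : Set (ℤ × ℤ × ℤ) :=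
  {x | ∃ n e₁ e₂ e₃ : ℤ, (e₁ = 0 ∨ e₁ = 1) ∧ (e₂ = 0 ∨ e₂ = 1) ∧ (e₃ = 0 ∨ e₃ = 1) ∧
    x = (n + e₁, n + e₂, n + e₃)}

/-- The points `(n, n+2, n+1)`, `(n+2, n+1, n)` and `(n+1, n, n+2)`. -/
def linkPoints : Set (ℤ × ℤ × ℤ) :=
  {x | ∃ n : ℤ, x = (n, n + 2, n + 1) ∨ x = (n + 2, n + 1, n) ∨ x = (n + 1, n, n + 2)}

/-- The poset `C`, a full subposet of `ℤ³`. -/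
abbrev CPts : Set (ℤ × ℤ × ℤ) := cubePoints ∪ linkPoints

/-- The point `(n+ε₁, n+ε₂, n+ε₃)` of `C`. -/
def cubePt (n : ℤ) (e₁ e₂ e₃ : Fin 2) : CPts :=
  ⟨(n + e₁.val, n + e₂.val, n + e₃.val),
    Or.inl ⟨n, e₁.val, e₂.val, e₃.val, by omega, by omega, by omega, rfl⟩⟩

/-- The small squares in `C`, given by the positions of their four vertices: the faces of the
cubes `[(n,n,n), (n+1,n+1,n+1)]` and the three reinforcing squares at each link
`(n+1,n+1,n+1)`, each of them in both orientations. -/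
inductive IsSmallSquare : (Fin 2 → Fin 2 → ℤ × ℤ × ℤ) → Prop
  | face₁₂ (n : ℤ) (e : Fin 2) : IsSmallSquare fun a b => (n + a.val, n + b.val, n + e.val)
  | face₁₃ (n : ℤ) (e : Fin 2) : IsSmallSquare fun a b => (n + a.val, n + e.val, n + b.val)
  | face₂₃ (n : ℤ) (e : Fin 2) : IsSmallSquare fun a b => (n + e.val, n + a.val, n + b.val)
  | link₁ (n : ℤ) : IsSmallSquare fun a b => (n + a.val, n + 1 + b.val, n + 1)
  | link₂ (n : ℤ) : IsSmallSquare fun a b => (n + 1 + b.val, n + 1, n + a.val)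
  | link₃ (n : ℤ) : IsSmallSquare fun a b => (n + 1, n + a.val, n + 1 + b.val)
  | swap (p : Fin 2 → Fin 2 → ℤ × ℤ × ℤ) : IsSmallSquare p → IsSmallSquare fun a b => p b a

namespace Prederivator

variable (D : Prederivator.{w, v, u})

/-- A diagram `Y ∈ D(C)` is exact if all small squares in it are bicartesian and it vanishes at the
points of `C` that do not lie on the chain of cubes. -/
structure IsExactDiagram [D.IsDerivator] (Y : D.Diag (Shape.{w} CPts)) : Prop where
  isCocartesian : ∀ (k : Sq → CPts) (hk : Monotone k),
    IsSmallSquare (fun a b => (k (a, b)).1) → D.IsCocartesian ((D.res (Shape.map k hk)).obj Y)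
  isCartesian : ∀ (k : Sq → CPts) (hk : Monotone k),
    IsSmallSquare (fun a b => (k (a, b)).1) → D.IsCartesian ((D.res (Shape.map k hk)).obj Y)
  isZero : ∀ x : CPts, x.1 ∉ cubePoints → Limits.IsZero ((D.eval (ULift.up.{w} x)).obj Y)

lemma IsExactDiagram.ofIso [D.IsDerivator] {Y Z : D.Diag (Shape.{w} CPts)}
    (h : D.IsExactDiagram Y) (e : Y ≅ Z) : D.IsExactDiagram Z where
  isCocartesian k hk hs := Functor.essImage.ofIso ((D.res (Shape.map k hk)).mapIso e)
    (h.isCocartesian k hk hs)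
  isCartesian k hk hs := Functor.essImage.ofIso ((D.res (Shape.map k hk)).mapIso e)
    (h.isCartesian k hk hs)
  isZero x hx := (h.isZero x hx).of_iso ((D.eval (ULift.up.{w} x)).mapIso e.symm)

/-- The objects `Y ∈ D^C(A) = D(C × A)` such that `Y_a ∈ D(C)` is exact for all `a` in `A`. -/
def exProp [D.IsDerivator] : Pseudofunctor.ObjectProperty (D.shift (Shape.{w} CPts)) where
  prop A Y := ∀ a : A.unop,
    D.IsExactDiagram ((D.res (Prod.sectL (Shape.{w} CPts) a)).obj Y)

instance [D.IsDerivator] : D.exProp.IsClosedUnderMapObj where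
  map_obj {_ _ M} hM f a :=
    IsExactDiagram.ofIso D (hM (f.unop.toFunctor.obj a))
      ((D.resIso (NatIso.ofComponents (F := Prod.sectL (Shape.{w} CPts) (f.unop.toFunctor.obj a))
        (G := Prod.sectL (Shape.{w} CPts) a ⋙ (𝟭 (Shape.{w} CPts)).prod f.unop.toFunctor)
        (fun _ => Iso.refl _)
        (fun _ => Prod.ext ((Category.comp_id _).trans (Category.id_comp _).symm)
          ((Category.comp_id _).trans
            ((f.unop.toFunctor.map_id a).symm.trans (Category.id_comp _).symm)))) ≪≫
        D.resComp (Prod.sectL (Shape.{w} CPts) a) ((𝟭 _).prod f.unop.toFunctor)).app M)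

/-- The prederivator `D^{C,ex}`, a full subprederivator of `D^C`. -/
noncomputable def ex [D.IsDerivator] : Prederivator.{w, v, u} := D.exProp.fullsubcategory

/-- The inclusion of `D^{C,ex}` in `D^C`. -/
noncomputable def exIncl [D.IsDerivator] : D.ex ⟶ D.shift (Shape.{w} CPts) := D.exProp.ι

/-- A morphism to a prederivator whose values satisfy a property of objects factors through the
corresponding full subprederivator. -/
def liftSub {F G : Prederivator.{w, v, u}} (P : Pseudofunctor.ObjectProperty F)
    [P.IsClosedUnderMapObj] (η : G ⟶ F)
    (h : ∀ X M, P.prop X ((η.app X).toFunctor.obj M)) : G ⟶ P.fullsubcategory where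
  app X := Cat.Hom.ofFunctor ((P.prop X).lift (η.app X).toFunctor (h X))
  naturality {X Y} f := Cat.Hom.isoMk
    (((P.prop Y).fullyFaithfulι.whiskeringRight _).preimageIso (Cat.Hom.toNatIso (η.naturality f)))
  naturality_naturality {X Y f g} θ := by
    apply Cat.Hom₂.ext
    ext M
    exact ObjectProperty.hom_ext _ congr(($(η.naturality_naturality θ)).toNatTrans.app M)
  naturality_id X := by
    apply Cat.Hom₂.ext
    ext M
    exact ObjectProperty.hom_ext _ congr(($(η.naturality_id X)).toNatTrans.app M)
  naturality_comp f g := by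
    apply Cat.Hom₂.ext
    ext M
    exact ObjectProperty.hom_ext _ congr(($(η.naturality_comp f g)).toNatTrans.app M)


/-- A monotone self-map of `C` which preserves the chain of cubes, its complement, and the small
squares. -/
structure IsExactMap (f : CPts → CPts) : Prop where
  monotone : Monotone f
  notMem : ∀ x : CPts, x.1 ∉ cubePoints → (f x).1 ∉ cubePoints
  isSmallSquare : ∀ k : Sq → CPts, IsSmallSquare (fun a b => (k (a, b)).1) →
    IsSmallSquare (fun a b => (f (k (a, b))).1)

lemma IsExactDiagram.res_map [D.IsDerivator] {Y : D.Diag (Shape.{w} CPts)}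
    (h : D.IsExactDiagram Y) {f : CPts → CPts} (hf : IsExactMap f) :
    D.IsExactDiagram ((D.res (Shape.map f hf.monotone)).obj Y) where
  isCocartesian k hk hs := Functor.essImage.ofIso
    ((D.resComp (Shape.map k hk) (Shape.map f hf.monotone)).app Y)
    (h.isCocartesian (f ∘ k) (hf.monotone.comp hk) (hf.isSmallSquare k hs))
  isCartesian k hk hs := Functor.essImage.ofIso
    ((D.resComp (Shape.map k hk) (Shape.map f hf.monotone)).app Y)
    (h.isCartesian (f ∘ k) (hf.monotone.comp hk) (hf.isSmallSquare k hs))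
  isZero x hx := (h.isZero (f x) (hf.notMem x hx)).of_iso
    ((D.resComp (pt (ULift.up.{w} x)) (Shape.map f hf.monotone)).app Y).symm

/-- The endomorphism `f^*` of `D^{C,ex}` induced by restriction along `f : C ⥤ C`. -/
noncomputable def exRes [D.IsDerivator] (f : CPts → CPts) (hf : IsExactMap f) : D.ex ⟶ D.ex :=
  liftSub D.exProp (D.exIncl ≫ D.resMor (Shape.map f hf.monotone)) (fun X M a =>
    IsExactDiagram.ofIso D ((M.2 a).res_map D hf)
      ((D.resComp (Shape.map f hf.monotone) (Prod.sectL (Shape.{w} CPts) a)).symm.app M.1 ≪≫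
        (D.resComp (Prod.sectL (Shape.{w} CPts) a)
          ((Shape.map f hf.monotone).prod (𝟭 X.unop))).app M.1))

/-- The translation `(n₁, n₂, n₃) ↦ (n₁+m, n₂+m, n₃+m)` of `C`. -/
def translate (m : ℤ) (x : CPts) : CPts :=
  ⟨(x.1.1 + m, x.1.2.1 + m, x.1.2.2 + m), by
    obtain ⟨x, ⟨n, e₁, e₂, e₃, h₁, h₂, h₃, rfl⟩ | ⟨n, h⟩⟩ := x
    · exact Or.inl ⟨n + m, e₁, e₂, e₃, h₁, h₂, h₃, by ext <;> dsimp <;> ring⟩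
    · refine Or.inr ⟨n + m, ?_⟩
      rcases h with rfl | rfl | rfl
      · exact Or.inl (by ext <;> dsimp <;> ring)
      · exact Or.inr (Or.inl (by ext <;> dsimp <;> ring))
      · exact Or.inr (Or.inr (by ext <;> dsimp <;> ring))⟩

lemma isExactMap_translate (m : ℤ) : IsExactMap (translate m) where
  monotone x y h := by
    obtain ⟨h₁, h₂, h₃⟩ := h
    exact ⟨by simpa [translate] using h₁, by simpa [translate] using h₂,
      by simpa [translate] using h₃⟩
  notMem := by
    rintro x hx ⟨n, e₁, e₂, e₃, h₁, h₂, h₃, h⟩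
    refine hx ⟨n - m, e₁, e₂, e₃, h₁, h₂, h₃, ?_⟩
    simp only [translate, Prod.mk.injEq] at h
    ext <;> dsimp <;> omega
  isSmallSquare k hs := by
    have key : ∀ p, IsSmallSquare p → IsSmallSquare fun a b =>
        ((p a b).1 + m, (p a b).2.1 + m, (p a b).2.2 + m) := by
      intro p hp
      induction hp with
      | face₁₂ n e => convert IsSmallSquare.face₁₂ (n + m) e using 4 <;> ring_nf
      | face₁₃ n e => convert IsSmallSquare.face₁₃ (n + m) e using 4 <;> ring_nf
      | face₂₃ n e => convert IsSmallSquare.face₂₃ (n + m) e using 4 <;> ring_nf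
      | link₁ n => convert IsSmallSquare.link₁ (n + m) using 4 <;> ring_nf
      | link₂ n => convert IsSmallSquare.link₂ (n + m) using 4 <;> ring_nf
      | link₃ n => convert IsSmallSquare.link₃ (n + m) using 4 <;> ring_nf
      | swap p _ ih => exact IsSmallSquare.swap _ ih
    exact key _ hs

/-- The cyclic rotation `(n₁, n₂, n₃) ↦ (n₃, n₁, n₂)` of `C`. -/
def rotate (x : CPts) : CPts :=
  ⟨(x.1.2.2, x.1.1, x.1.2.1), by
    obtain ⟨x, ⟨n, e₁, e₂, e₃, h₁, h₂, h₃, rfl⟩ | ⟨n, h⟩⟩ := x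
    · exact Or.inl ⟨n, e₃, e₁, e₂, h₃, h₁, h₂, rfl⟩
    · refine Or.inr ⟨n, ?_⟩
      rcases h with rfl | rfl | rfl
      · exact Or.inr (Or.inr rfl)
      · exact Or.inl rfl
      · exact Or.inr (Or.inl rfl)⟩

lemma isExactMap_rotate : IsExactMap rotate where
  monotone x y h := ⟨h.2.2, h.1, h.2.1⟩
  notMem := by
    rintro x hx ⟨n, e₁, e₂, e₃, h₁, h₂, h₃, h⟩
    refine hx ⟨n, e₂, e₃, e₁, h₂, h₃, h₁, ?_⟩
    simp only [rotate, Prod.mk.injEq] at h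
    ext <;> dsimp <;> omega
  isSmallSquare k hs := by
    have key : ∀ p, IsSmallSquare p → IsSmallSquare fun a b =>
        ((p a b).2.2, (p a b).1, (p a b).2.1) := by
      intro p hp
      induction hp with
      | face₁₂ n e => exact IsSmallSquare.face₂₃ n e
      | face₁₃ n e => exact IsSmallSquare.swap _ (IsSmallSquare.face₁₂ n e)
      | face₂₃ n e => exact IsSmallSquare.swap _ (IsSmallSquare.face₁₃ n e)
      | link₁ n => exact IsSmallSquare.link₃ n
      | link₂ n => exact IsSmallSquare.link₁ n
      | link₃ n => exact IsSmallSquare.link₂ n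
      | swap p _ ih => exact IsSmallSquare.swap _ ih
    exact key _ hs

/-- The endomorphism `(sh^*)^m` of `D^{C,ex}`, for `m ∈ ℤ`, where `sh : C ⥤ C` is the translation
by `(1, 1, 1)`: it is restriction along the automorphism `sh^m`. -/
noncomputable def sh [D.IsDerivator] (m : ℤ) : D.ex ⟶ D.ex :=
  D.exRes (translate m) (isExactMap_translate m)

/-- The endomorphism `r^*` of `D^{C,ex}`. -/
noncomputable def rot [D.IsDerivator] : D.ex ⟶ D.ex := D.exRes rotate isExactMap_rotate

/-- The evaluation morphism `x^* : D^{C,ex} ⟶ D` at a point `x` of `C`. -/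
noncomputable def exEv [D.IsDerivator] (x : CPts) : D.ex ⟶ D :=
  D.exIncl ≫ D.ev (ULift.up.{w} x)

end Prederivator

/-! ### The endomorphism `T` -/

/-- The trivalent source `[1]³_{≤ 1}`, as a full subposet of `ℤ³`. -/
abbrev SourcePts : Set (ℤ × ℤ × ℤ) := {(0, 0, 0), (1, 0, 0), (0, 1, 0), (0, 0, 1)}

lemma sourcePts_subset : SourcePts ⊆ CPts := by
  rintro x (rfl | rfl | rfl | rfl)
  · exact Or.inl ⟨0, 0, 0, 0, by simp⟩
  · exact Or.inl ⟨0, 1, 0, 0, by simp⟩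
  · exact Or.inl ⟨0, 0, 1, 0, by simp⟩
  · exact Or.inl ⟨0, 0, 0, 1, by simp⟩

/-- The objects `(-∞,0)`, `1100`, `0110`, `1010` and `1110`. Here and below, the objects `(-∞,0)`
and `(-∞,1)`, adjoined to the posets in question as lower bounds of the points with last coordinate
at least `0` and at least `1` respectively, are encoded as `(-1,-1,-1,0)` and `(-1,-1,-1,1)`
in `ℤ⁴`. -/
abbrev E₁ : Set (ℤ × ℤ × ℤ × ℤ) :=
  {(-1, -1, -1, 0), (1, 1, 0, 0), (0, 1, 1, 0), (1, 0, 1, 0), (1, 1, 1, 0)}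

/-- The upper cube `[1]³ × {0}` is added. -/
abbrev E₂ : Set (ℤ × ℤ × ℤ × ℤ) := E₁ ∪ Set.Icc (0, 0, 0, 0) (1, 1, 1, 0)

/-- The object `(-∞,1)` is added. -/
abbrev E₃ : Set (ℤ × ℤ × ℤ × ℤ) := E₂ ∪ {(-1, -1, -1, 1)}

/-- The lower cube `[1]³ × {1}` is added. -/
abbrev E₄ : Set (ℤ × ℤ × ℤ × ℤ) := E₃ ∪ Set.Icc (0, 0, 0, 1) (1, 1, 1, 1)

/-- The objects `0211`, `2101` and `1021` are added. -/
abbrev E₅ : Set (ℤ × ℤ × ℤ × ℤ) := E₄ ∪ {(0, 2, 1, 1), (2, 1, 0, 1), (1, 0, 2, 1)}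

/-- The poset `E`: the objects `2111`, `1211` and `1121` are added. It consists of the hypercube
`[1]⁴`, the objects `0211`, `2101`, `1021`, `2111`, `1211`, `1121` and the objects `(-∞,0)`
and `(-∞,1)`. -/
abbrev EPts : Set (ℤ × ℤ × ℤ × ℤ) := E₅ ∪ {(2, 1, 1, 1), (1, 2, 1, 1), (1, 1, 2, 1)}

/-- The map `000 ↦ (-∞,0)`, `100 ↦ 1100`, `010 ↦ 0110`, `001 ↦ 1010`. -/
def v₁Fun (x : SourcePts) : E₁ :=
  ⟨if x.1 = (0, 0, 0) then (-1, -1, -1, 0)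
    else (x.1.1 + x.1.2.2, x.1.1 + x.1.2.1, x.1.2.1 + x.1.2.2, 0), by
    obtain ⟨x, rfl | rfl | rfl | rfl⟩ := x <;> simp⟩

lemma v₁Fun_monotone : Monotone v₁Fun := by
  rintro ⟨x, rfl | rfl | rfl | rfl⟩ ⟨y, rfl | rfl | rfl | rfl⟩ h <;>
    first
    | (change _ ≤ (_ : ℤ × ℤ × ℤ × ℤ); simp [v₁Fun]; done)
    | (exfalso
       have h' : (_ : ℤ × ℤ × ℤ) ≤ _ := h
       simp [Prod.mk_le_mk] at h')

/-- The map `(n₁, n₂, n₃) ↦ (n₁, n₂, n₃, 1)`. -/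
def wFun (x : SourcePts) : EPts :=
  ⟨(x.1.1, x.1.2.1, x.1.2.2, 1), by
    obtain ⟨x, rfl | rfl | rfl | rfl⟩ := x <;>
      exact Or.inl (Or.inl (Or.inr (by simp [Set.mem_Icc, Prod.mk_le_mk])))⟩

lemma wFun_monotone : Monotone wFun := fun _ _ h => ⟨h.1, h.2.1, h.2.2, le_rfl⟩

/-- The point `0001` of `E`. -/
def ePt : EPts := wFun ⟨(0, 0, 0), Or.inl rfl⟩

/-- The trivalent source as a small category. -/
abbrev Source : Type w := Shape.{w} SourcePts

section Equivalences

variable {B : Type*} [Bicategory B] {a b : B}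

/-- A 1-morphism in a bicategory is an equivalence. -/
class IsEquivMor (f : a ⟶ b) : Prop where
  exists_equivalence : ∃ e : Bicategory.Equivalence a b, e.hom = f

/-- A quasi-inverse of an equivalence in a bicategory. -/
noncomputable def invMor (f : a ⟶ b) [IsEquivMor f] : b ⟶ a :=
  (IsEquivMor.exists_equivalence (f := f)).choose.inv

end Equivalences

namespace Prederivator

variable (D : Prederivator.{w, v, u})

/-- The restriction morphism `i^* : D^{C,ex} ⟶ D^{[1]³_{≤ 1}}`. -/
noncomputable def iStar [D.IsDerivator] : D.ex ⟶ D.shift Source.{w} :=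
  D.exIncl ≫ D.resMor (Shape.incl sourcePts_subset)

/-- The morphism `H : D^{[1]³_{≤ 1}} ⟶ D^E`. -/
noncomputable def H [D.HasKanMorphisms] : D.shift Source.{w} ⟶ D.shift (Shape.{w} EPts) :=
  D.ranMor (Shape.map v₁Fun v₁Fun_monotone) ≫
  D.ranMor (Shape.incl (Set.subset_union_left : E₁ ⊆ E₂)) ≫
  D.ranMor (Shape.incl (Set.subset_union_left : E₂ ⊆ E₃)) ≫
  D.lanMor (Shape.incl (Set.subset_union_left : E₃ ⊆ E₄)) ≫
  D.ranMor (Shape.incl (Set.subset_union_left : E₄ ⊆ E₅)) ≫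
  D.lanMor (Shape.incl (Set.subset_union_left : E₅ ⊆ EPts))

/-- The endomorphism `T' = w^* H` of `D^{[1]³_{≤ 1}}`. -/
noncomputable def T' [D.HasKanMorphisms] : D.shift Source.{w} ⟶ D.shift Source.{w} :=
  D.H ≫ D.resMor (Shape.map wFun wFun_monotone)

/-- The endomorphism `T = F T' i^*` of `D^{C,ex}`, where `F` is a quasi-inverse of `i^*`. -/
noncomputable def T [D.IsDerivator] [D.HasKanMorphisms] [IsEquivMor D.iStar] : D.ex ⟶ D.ex :=
  D.iStar ≫ D.T' ≫ invMor D.iStar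

/-- The Auslander–Reiten translation `τ = r^* T⁻¹`. -/
noncomputable def tau [D.IsDerivator] [D.HasKanMorphisms] [IsEquivMor D.iStar] [IsEquivMor D.T] :
    D.ex ⟶ D.ex :=
  invMor D.T ≫ D.rot

end Prederivator

/-! The relations between `T`, Σ and sh^* follow from two isomorphisms. Both are obtained from
coherent families of cocartesian squares that vanish at the vertices (1,0) and (0,1): by
`comp_suspension`, the value of such a family at (1,1) is the suspension of its value at (0,0).

The first is Σ ≅ sh^* T (`suspension_isoMor_T`). In a value of `H` there are such squares leading
from (-∞,0), 1100, 0110, 1010, the image of the source under v₁, to 1111, 2111, 1211, 1121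
(`IsHDiagram.isSuspSq`), so the last four points carry the suspension ΣX of the given diagram X. On
the other hand, the layer with last coordinate 1 is generated from w^* H X = T' X by the same
pushouts and zeros as the exact diagram F T' X (`IsHDiagram.isCoreDiagram`,
`isoMor_of_isCoreDiagram`), and in that layer the four points are the source translated by (1,1,1).

The second is Σ² ≅ (sh^*)³ (`suspension_suspension`). In an exact diagram Y, the object Y_000 is the
fibre of Y_010 ⟶ Y_112. Squares with two zeros suspend this map inside C to Y_221 ⟶ Y_233, whose
fibre is therefore ΣY_000. Pasting this fibre square with the pushout of Y_233 ⟵ Y_221 ⟶ 0, which is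
Y_333, gives a suspension square from ΣY_000 to Y_333. A table of squares, functorial in the source,
does the same for all four objects of the source at once (`table_squares`), and i^* is an
equivalence.

The rest of part 1 is formal: T ≅ Σ sh^{-1} ≅ sh^{-1} Σ, hence T² ≅ Σ² sh^{-2} ≅ sh^* and T³ ≅ sh^*
T ≅ Σ. Evaluation at a point of C commutes with Σ (`suspension_exEv`), and Σ is read off at 100, 010
and 001 from squares with two zeros, which gives the values of T. The rotation commutes with T and
has order three, so τ³ T³ ≅ 1 and τ³ is inverse to Σ.

That i^* is an equivalence holds because exact diagrams are exactly those obtained from the source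
by four extensions: zeros above the source, pushouts upwards, the remaining zeros, pullbacks
downwards (`isExactDiagram_iff`, `isEquivalence_iterRes`). The stability of `D.ex` is transported
from the shifted derivator `D.shift Source`.

Underneath lies a calculus of Kan extensions stated with universal arrows (`LUniv`, `RUniv`) instead
of chosen adjoints. A square of small categories satisfies base change if the induced functors of
comma categories are adjoints (`lEx_of_isRightAdjoint`). For posets this becomes the search for a
least or greatest element, so that recognising bicartesian squares and Kan extensions is
combinatorics (`LExt.isCocartesian`, `LExt.of_generation`). Base change in the parameter makes Kan
extensions morphisms of prederivators, and morphisms with extended values are isomorphic once their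
restrictions are (`LValued.isoMor`, `RValued.isoMor`). -/

namespace Prederivator

/-! ### Componentwise calculus of restriction along functors. -/

section Calculus

variable (D : Prederivator.{w, v, u})
variable {A B C E K : Type w} [SmallCategory A] [SmallCategory B] [SmallCategory C]
  [SmallCategory E] [SmallCategory K]

/-- The component at `X` of the transformation induced by `α : F ⟶ G`. -/
def tr {F G : A ⥤ B} (α : F ⟶ G) (X : D.Diag B) : (D.res F).obj X ⟶ (D.res G).obj X :=
  (D.resTrans α).app X

/-- The component at `X` of the isomorphism `(F ⋙ G)^* ≅ F^* G^*`. -/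
def cmp (F : A ⥤ B) (G : B ⥤ C) (X : D.Diag C) :
    (D.res (F ⋙ G)).obj X ≅ (D.res F).obj ((D.res G).obj X) :=
  (D.resComp F G).app X

/-- The component at `X` of the isomorphism `(𝟭 A)^* ≅ 𝟭`. -/
def rid (X : D.Diag A) : (D.res (𝟭 A)).obj X ≅ X :=
  (Cat.Hom.toNatIso (D.mapId (op (Cat.of A)))).app X

lemma tr_id (F : A ⥤ B) (X : D.Diag B) : D.tr (𝟙 F) X = 𝟙 _ :=
  congr($(D.map₂_id F.toCatHom.op).toNatTrans.app X)

lemma tr_comp {F G H : A ⥤ B} (α : F ⟶ G) (β : G ⟶ H) (X : D.Diag B) :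
    D.tr (α ≫ β) X = D.tr α X ≫ D.tr β X :=
  congr($(D.map₂_comp (op2 α.toCatHom₂) (op2 β.toCatHom₂)).toNatTrans.app X)

instance {F G : A ⥤ B} (α : F ⟶ G) [IsIso α] (X : D.Diag B) : IsIso (D.tr α X) :=
  ⟨D.tr (inv α) X, by rw [← tr_comp, IsIso.hom_inv_id, tr_id],
    by rw [← tr_comp, IsIso.inv_hom_id, tr_id]⟩

lemma tr_naturality {F G : A ⥤ B} (α : F ⟶ G) {X Y : D.Diag B} (f : X ⟶ Y) :
    (D.res F).map f ≫ D.tr α Y = D.tr α X ≫ (D.res G).map f :=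
  (D.resTrans α).naturality f

lemma cmp_naturality (F : A ⥤ B) (G : B ⥤ C) {X Y : D.Diag C} (f : X ⟶ Y) :
    (D.res (F ⋙ G)).map f ≫ (D.cmp F G Y).hom =
      (D.cmp F G X).hom ≫ (D.res F).map ((D.res G).map f) :=
  (D.resComp F G).hom.naturality f

lemma cmp_inv_naturality (F : A ⥤ B) (G : B ⥤ C) {X Y : D.Diag C} (f : X ⟶ Y) :
    (D.res F).map ((D.res G).map f) ≫ (D.cmp F G Y).inv =
      (D.cmp F G X).inv ≫ (D.res (F ⋙ G)).map f :=
  (D.resComp F G).inv.naturality f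

lemma rid_naturality {X Y : D.Diag A} (f : X ⟶ Y) :
    (D.res (𝟭 A)).map f ≫ (D.rid Y).hom = (D.rid X).hom ≫ f :=
  (Cat.Hom.toNatIso (D.mapId (op (Cat.of A)))).hom.naturality f

lemma tr_whiskerLeft (F : A ⥤ B) {G G' : B ⥤ C} (β : G ⟶ G') (X : D.Diag C) :
    D.tr (F.whiskerLeft β) X ≫ (D.cmp F G' X).hom = (D.cmp F G X).hom ≫ (D.res F).map (D.tr β X) := by
  have := congr($(D.map₂_whisker_right (op2 β.toCatHom₂) F.toCatHom.op).toNatTrans.app X)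
  rw [← Iso.eq_comp_inv]
  exact this.trans (Category.assoc _ _ _).symm

lemma tr_whiskerRight {F F' : A ⥤ B} (α : F ⟶ F') (G : B ⥤ C) (X : D.Diag C) :
    D.tr (Functor.whiskerRight α G) X ≫ (D.cmp F' G X).hom =
      (D.cmp F G X).hom ≫ D.tr α ((D.res G).obj X) := by
  have := congr($(D.map₂_whisker_left G.toCatHom.op (op2 α.toCatHom₂)).toNatTrans.app X)
  rw [← Iso.eq_comp_inv]
  exact this.trans (Category.assoc _ _ _).symm

lemma cmp_assoc (F : A ⥤ B) (G : B ⥤ C) (H : C ⥤ E) (X : D.Diag E) :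
    (D.cmp (F ⋙ G) H X).hom ≫ (D.cmp F G ((D.res H).obj X)).hom =
      (D.cmp F (G ⋙ H) X).hom ≫ (D.res F).map (D.cmp G H X).hom := by
  have := congr($(D.map_assoc H.toCatHom.op G.toCatHom.op F.toCatHom.op).toNatTrans.app X)
  exact this.trans congr((D.cmp F (G ⋙ H) X).hom ≫ $(Category.comp_id ((D.res F).map (D.cmp G H X).hom)))

lemma cmp_id_left (F : A ⥤ B) (X : D.Diag B) :
    (D.cmp (𝟭 A) F X).hom ≫ (D.rid ((D.res F).obj X)).hom = 𝟙 _ := by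
  have := congr($(D.map_runit F.toCatHom.op).toNatTrans.app X)
  refine Eq.trans ?_ this
  exact congr((D.cmp (𝟭 A) F X).hom ≫ $((Category.comp_id (D.rid ((D.res F).obj X)).hom).symm))

lemma cmp_id_right (F : A ⥤ B) (X : D.Diag B) :
    (D.cmp F (𝟭 B) X).hom ≫ (D.res F).map (D.rid X).hom = 𝟙 _ := by
  have := congr($(D.map_lunit F.toCatHom.op).toNatTrans.app X)
  refine Eq.trans ?_ this
  exact congr((D.cmp F (𝟭 B) X).hom ≫ $((Category.comp_id ((D.res F).map (D.rid X).hom)).symm))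

/-- Pullback along `p` of a morphism into a restricted diagram. -/
def pullL (p : E ⥤ A) {X : D.Diag A} {G : A ⥤ C} {Z : D.Diag C} (η : X ⟶ (D.res G).obj Z) :
    (D.res p).obj X ⟶ (D.res (p ⋙ G)).obj Z :=
  (D.res p).map η ≫ (D.cmp p G Z).inv

/-- Pullback along `p` of a morphism out of a restricted diagram. -/
def pullR (p : E ⥤ A) {X : D.Diag A} {G : A ⥤ C} {Z : D.Diag C} (η : (D.res G).obj Z ⟶ X) :
    (D.res (p ⋙ G)).obj Z ⟶ (D.res p).obj X :=
  (D.cmp p G Z).hom ≫ (D.res p).map η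

/-- Pullback along `p` of a morphism between restricted diagrams. -/
def pull (p : E ⥤ A) {F : A ⥤ B} {X : D.Diag B} {G : A ⥤ C} {Z : D.Diag C}
    (η : (D.res F).obj X ⟶ (D.res G).obj Z) :
    (D.res (p ⋙ F)).obj X ⟶ (D.res (p ⋙ G)).obj Z :=
  (D.cmp p F X).hom ≫ (D.res p).map η ≫ (D.cmp p G Z).inv

lemma pull_comp (p : E ⥤ A) {F : A ⥤ B} {X : D.Diag B} {G : A ⥤ C} {Z : D.Diag C}
    {B' : Type w} [SmallCategory B'] {H : A ⥤ B'} {W : D.Diag B'}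
    (η : (D.res F).obj X ⟶ (D.res G).obj Z) (θ : (D.res G).obj Z ⟶ (D.res H).obj W) :
    D.pull p (η ≫ θ) = D.pull p η ≫ D.pull p θ := by
  simp [pull]

lemma pullL_comp (p : E ⥤ A) {X : D.Diag A} {G : A ⥤ C} {Z : D.Diag C}
    {B' : Type w} [SmallCategory B'] {H : A ⥤ B'} {W : D.Diag B'}
    (η : X ⟶ (D.res G).obj Z) (θ : (D.res G).obj Z ⟶ (D.res H).obj W) :
    D.pullL p (η ≫ θ) = D.pullL p η ≫ D.pull p θ := by
  simp [pull, pullL]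

lemma pullR_comp (p : E ⥤ A) {X : D.Diag A} {G : A ⥤ C} {Z : D.Diag C}
    {B' : Type w} [SmallCategory B'] {H : A ⥤ B'} {W : D.Diag B'}
    (η : (D.res G).obj Z ⟶ X) (θ : (D.res H).obj W ⟶ (D.res G).obj Z) :
    D.pullR p (θ ≫ η) = D.pull p θ ≫ D.pullR p η := by
  simp [pull, pullR]

lemma pull_map (p : E ⥤ A) (F : A ⥤ B) {X Y : D.Diag B} (f : X ⟶ Y) :
    D.pull p ((D.res F).map f) = (D.res (p ⋙ F)).map f := by
  rw [pull, cmp_inv_naturality, Iso.hom_inv_id_assoc]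

lemma pull_tr (p : E ⥤ A) {F G : A ⥤ B} (α : F ⟶ G) (X : D.Diag B) :
    D.pull p (D.tr α X) = D.tr (p.whiskerLeft α) X := by
  rw [pull, ← Category.assoc, Iso.comp_inv_eq, tr_whiskerLeft]

lemma cmp_inv_assoc' (F : A ⥤ B) (G : B ⥤ C) (H : C ⥤ E) (X : D.Diag E) :
    (D.res F).map (D.cmp G H X).inv ≫ (D.cmp F (G ⋙ H) X).inv =
      (D.cmp F G ((D.res H).obj X)).inv ≫ (D.cmp (F ⋙ G) H X).inv := by
  rw [← Functor.mapIso_inv, ← Iso.trans_inv, ← Iso.trans_inv]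
  congr 1
  ext
  exact (D.cmp_assoc F G H X).symm

lemma pullL_pullL (p : E ⥤ A) (p' : K ⥤ E) {X : D.Diag A} {G : A ⥤ C} {Z : D.Diag C}
    (η : X ⟶ (D.res G).obj Z) :
    D.pullL p' (D.pullL p η) = (D.cmp p' p X).inv ≫ D.pullL (p' ⋙ p) η := by
  dsimp only [pullL]
  rw [Functor.map_comp, Category.assoc, cmp_inv_assoc', ← Category.assoc, cmp_inv_naturality,
    Category.assoc]

lemma pullR_pullR (p : E ⥤ A) (p' : K ⥤ E) {X : D.Diag A} {G : A ⥤ C} {Z : D.Diag C}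
    (η : (D.res G).obj Z ⟶ X) :
    D.pullR p' (D.pullR p η) = D.pullR (p' ⋙ p) η ≫ (D.cmp p' p X).hom := by
  dsimp only [pullR]
  rw [Functor.map_comp, ← Category.assoc, ← cmp_assoc, Category.assoc, ← cmp_naturality,
    Category.assoc]

lemma pull_pullL (p : E ⥤ A) (p' : K ⥤ E) {X : D.Diag A} {G : A ⥤ C} {Z : D.Diag C}
    (η : X ⟶ (D.res G).obj Z) :
    D.pull p' (D.pullL p η) = D.pullL (p' ⋙ p) η := by
  have := D.pullL_pullL p p' η
  rw [← cancel_epi (D.cmp p' p X).inv, ← this]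
  simp [pull, pullL]

lemma pullL_naturality {p p' : E ⥤ A} (θ : p ⟶ p') {X : D.Diag A} {G : A ⥤ C} {Z : D.Diag C}
    (η : X ⟶ (D.res G).obj Z) :
    D.pullL p η ≫ D.tr (Functor.whiskerRight θ G) Z = D.tr θ X ≫ D.pullL p' η := by
  rw [pullL, pullL, ← cancel_mono (D.cmp p' G Z).hom]
  simp [tr_whiskerRight, tr_naturality]

lemma pull_naturality {p p' : E ⥤ A} (θ : p ⟶ p') {F : A ⥤ B} {X : D.Diag B} {G : A ⥤ C}
    {Z : D.Diag C} (η : (D.res F).obj X ⟶ (D.res G).obj Z) :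
    D.pull p η ≫ D.tr (Functor.whiskerRight θ G) Z =
      D.tr (Functor.whiskerRight θ F) X ≫ D.pull p' η := by
  have h := D.pullL_naturality θ η
  have e (q : E ⥤ A) : D.pull q η = (D.cmp q F X).hom ≫ D.pullL q η := rfl
  rw [e, e, Category.assoc, h, ← Category.assoc, ← tr_whiskerRight, Category.assoc]

lemma pull_id {F : A ⥤ B} {X : D.Diag B} {G : A ⥤ C} {Z : D.Diag C}
    (η : (D.res F).obj X ⟶ (D.res G).obj Z) : D.pull (𝟭 A) η = η := by
  have h : ∀ {C : Type w} [SmallCategory C] (G : A ⥤ C) (Z : D.Diag C),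
      (D.cmp (𝟭 A) G Z).hom = (D.rid ((D.res G).obj Z)).inv := fun G Z => by
    rw [← Iso.comp_hom_eq_id, cmp_id_left]
  have h' : (D.cmp (𝟭 A) G Z).inv = (D.rid ((D.res G).obj Z)).hom := by
    exact ((Iso.hom_comp_eq_id _).1 (D.cmp_id_left G Z)).symm
  rw [pull, h, h']
  exact (congr(_ ≫ $(D.rid_naturality η))).trans (Iso.inv_hom_id_assoc _ _)

lemma pull_cmp (p : E ⥤ A) (F : A ⥤ B) (G : B ⥤ C) (Z : D.Diag C) :
    D.pull p (D.cmp F G Z).hom = (D.cmp (p ⋙ F) G Z).hom := by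
  rw [pull, ← Category.assoc, Iso.comp_inv_eq]
  exact (D.cmp_assoc p F G Z).symm

lemma pull_cmp_inv (p : E ⥤ A) (F : A ⥤ B) (G : B ⥤ C) (Z : D.Diag C) :
    D.pull p (D.cmp F G Z).inv = (D.cmp (p ⋙ F) G Z).inv := by
  rw [← cancel_epi (D.cmp (p ⋙ F) G Z).hom, Iso.hom_inv_id, ← pull_cmp, ← pull_comp,
    Iso.hom_inv_id]
  simp [pull]
  rfl

lemma pull_pull (p : E ⥤ A) (p' : K ⥤ E) {F : A ⥤ B} {X : D.Diag B} {G : A ⥤ C} {Z : D.Diag C}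
    (η : (D.res F).obj X ⟶ (D.res G).obj Z) :
    D.pull p' (D.pull p η) = D.pull (p' ⋙ p) η := by
  change D.pull p' ((D.cmp p F X).hom ≫ D.pullL p η) = _
  rw [pull_comp, pull_cmp, pull_pullL]
  rfl

/-- Regarding X as restricted along the identity reduces one-sided pullbacks to `pull`, for which
composition and naturality are available. -/
lemma pullL_eq_pull (p : E ⥤ A) {X : D.Diag A} {G : A ⥤ C} {Z : D.Diag C}
    (η : X ⟶ (D.res G).obj Z) : D.pullL p η = D.pull p ((D.rid X).hom ≫ η) := by
  rw [pull, Functor.map_comp, Category.assoc, reassoc_of% cmp_id_right]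
  rfl

lemma pullR_eq_pull (p : E ⥤ A) {X : D.Diag A} {G : A ⥤ C} {Z : D.Diag C}
    (η : (D.res G).obj Z ⟶ X) : D.pullR p η = D.pull p (η ≫ (D.rid X).inv) := by
  have : (D.res p).map (D.rid X).inv ≫ (D.cmp p (𝟭 A) X).inv = 𝟙 _ := by
    rw [← Functor.mapIso_inv, ← Iso.trans_inv, ← Iso.refl_inv]
    congr 1
    ext
    exact D.cmp_id_right p X
  rw [pull, Functor.map_comp, Category.assoc, this]
  exact congr((D.cmp p G Z).hom ≫ $((Category.comp_id _).symm))

lemma square_app {p : E ⥤ A} {F : A ⥤ C} {q : E ⥤ B} {G : B ⥤ C} (α : p ⋙ F ⟶ q ⋙ G)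
    (Z : D.Diag C) :
    (D.square α).natTrans.app Z = (D.cmp p F Z).inv ≫ D.tr α Z ≫ (D.cmp q G Z).hom := rfl

end Calculus

end Prederivator

/-! ### Universal arrows and the Beck–Chevalley condition. -/

section Universal

universe v₁ v₂ v₃ v₄ u₁ u₂ u₃ u₄

variable {𝒜 : Type u₁} [Category.{v₁} 𝒜] {ℬ : Type u₂} [Category.{v₂} ℬ]
  {𝒞 : Type u₃} [Category.{v₃} 𝒞] {ℰ : Type u₄} [Category.{v₄} ℰ]

/-- `θ : Y ⟶ R V` is a universal arrow from `Y` to the functor `R`. -/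
def LUniv (R : ℬ ⥤ 𝒜) {Y : 𝒜} {V : ℬ} (θ : Y ⟶ R.obj V) : Prop :=
  ∀ W : ℬ, Function.Bijective (fun g : V ⟶ W => θ ≫ R.map g)

/-- `θ : R V ⟶ Y` is a universal arrow from the functor `R` to `Y`. -/
def RUniv (R : ℬ ⥤ 𝒜) {Y : 𝒜} {V : ℬ} (θ : R.obj V ⟶ Y) : Prop :=
  ∀ W : ℬ, Function.Bijective (fun g : W ⟶ V => R.map g ≫ θ)

namespace LUniv

variable {R : ℬ ⥤ 𝒜} {Y : 𝒜} {V : ℬ} {θ : Y ⟶ R.obj V}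

lemma hom_ext (h : LUniv R θ) {W : ℬ} {f g : V ⟶ W} (e : θ ≫ R.map f = θ ≫ R.map g) : f = g :=
  (h W).1 e

lemma exists_desc (h : LUniv R θ) {W : ℬ} (k : Y ⟶ R.obj W) : ∃ g : V ⟶ W, θ ≫ R.map g = k :=
  (h W).2 k

lemma isIso (h : LUniv R θ) {V' : ℬ} {θ' : Y ⟶ R.obj V'} (h' : LUniv R θ') {m : V ⟶ V'}
    (hm : θ ≫ R.map m = θ') : IsIso m := by
  obtain ⟨n, hn⟩ := h'.exists_desc θ
  refine ⟨n, h.hom_ext ?_, h'.hom_ext ?_⟩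
  · rw [R.map_comp, ← Category.assoc, hm, hn, R.map_id, Category.comp_id]
  · rw [R.map_comp, ← Category.assoc, hn, hm, R.map_id, Category.comp_id]

lemma comp_map (h : LUniv R θ) {V' : ℬ} (e : V ⟶ V') [IsIso e] : LUniv R (θ ≫ R.map e) := by
  intro W
  have : (fun g : V' ⟶ W => (θ ≫ R.map e) ≫ R.map g) =
      (fun g : V ⟶ W => θ ≫ R.map g) ∘ (fun g => e ≫ g) := by
    ext g; simp
  rw [this]
  exact (h W).comp ⟨fun a b hab => (cancel_epi e).1 hab, fun b => ⟨inv e ≫ b, by simp⟩⟩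

lemma comp_left (h : LUniv R θ) {Y' : 𝒜} (e : Y' ⟶ Y) [IsIso e] : LUniv R (e ≫ θ) := by
  intro W
  have : (fun g : V ⟶ W => (e ≫ θ) ≫ R.map g) =
      (fun g : Y ⟶ R.obj W => e ≫ g) ∘ (fun g : V ⟶ W => θ ≫ R.map g) := by
    ext g; simp
  rw [this]
  exact Function.Bijective.comp
    ⟨fun a b hab => (cancel_epi e).1 hab, fun b => ⟨inv e ≫ b, by simp⟩⟩ (h W)

lemma of_natIso (h : LUniv R θ) {R' : ℬ ⥤ 𝒜} (e : R ≅ R') : LUniv R' (θ ≫ e.hom.app V) := by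
  intro W
  have : (fun g : V ⟶ W => (θ ≫ e.hom.app V) ≫ R'.map g) =
      (fun g : Y ⟶ R.obj W => g ≫ e.hom.app W) ∘ (fun g : V ⟶ W => θ ≫ R.map g) := by
    ext g; simp
  rw [this]
  exact Function.Bijective.comp
    ⟨fun a b hab => (cancel_mono (e.hom.app W)).1 hab, fun b => ⟨b ≫ e.inv.app W, by simp⟩⟩ (h W)

lemma of_adj {L : 𝒜 ⥤ ℬ} (adj : L ⊣ R) (Y : 𝒜) : LUniv R (adj.unit.app Y) := fun W => by
  have : (fun g : L.obj Y ⟶ W => adj.unit.app Y ≫ R.map g) = adj.homEquiv Y W := by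
    ext g; rw [Adjunction.homEquiv_unit]
  rw [this]
  exact Equiv.bijective _

lemma iff_isIso {L : 𝒜 ⥤ ℬ} (adj : L ⊣ R) {m : L.obj Y ⟶ V} (hm : adj.unit.app Y ≫ R.map m = θ) :
    LUniv R θ ↔ IsIso m :=
  ⟨fun h => (of_adj adj Y).isIso h hm, fun _ => hm ▸ (of_adj adj Y).comp_map m⟩

lemma exists_of_isRightAdjoint (R : ℬ ⥤ 𝒜) [R.IsRightAdjoint] (Y : 𝒜) :
    ∃ (V : ℬ) (θ : Y ⟶ R.obj V), LUniv R θ :=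
  ⟨_, _, of_adj (Adjunction.ofIsRightAdjoint R) Y⟩

/-- By the triangle identity the counit is the factorisation of the identity of R V through the
unit, so its invertibility is the universality of that identity. -/
lemma id_iff_counit {L : 𝒜 ⥤ ℬ} (adj : L ⊣ R) (V : ℬ) :
    LUniv R (𝟙 (R.obj V)) ↔ IsIso (adj.counit.app V) :=
  iff_isIso adj (adj.right_triangle_components V)

end LUniv

namespace RUniv

variable {R : ℬ ⥤ 𝒜} {Y : 𝒜} {V : ℬ} {θ : R.obj V ⟶ Y}

lemma hom_ext (h : RUniv R θ) {W : ℬ} {f g : W ⟶ V} (e : R.map f ≫ θ = R.map g ≫ θ) : f = g :=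
  (h W).1 e

lemma exists_lift (h : RUniv R θ) {W : ℬ} (k : R.obj W ⟶ Y) : ∃ g : W ⟶ V, R.map g ≫ θ = k :=
  (h W).2 k

lemma isIso (h : RUniv R θ) {V' : ℬ} {θ' : R.obj V' ⟶ Y} (h' : RUniv R θ') {m : V' ⟶ V}
    (hm : R.map m ≫ θ = θ') : IsIso m := by
  obtain ⟨n, hn⟩ := h'.exists_lift θ
  refine ⟨n, h'.hom_ext ?_, h.hom_ext ?_⟩
  · rw [R.map_comp, Category.assoc, hn, hm, R.map_id, Category.id_comp]
  · rw [R.map_comp, Category.assoc, hm, hn, R.map_id, Category.id_comp]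

lemma map_comp (h : RUniv R θ) {V' : ℬ} (e : V' ⟶ V) [IsIso e] : RUniv R (R.map e ≫ θ) := by
  intro W
  have : (fun g : W ⟶ V' => R.map g ≫ R.map e ≫ θ) =
      (fun g : W ⟶ V => R.map g ≫ θ) ∘ (fun g => g ≫ e) := by
    ext g; simp
  rw [this]
  exact (h W).comp ⟨fun a b hab => (cancel_mono e).1 hab, fun b => ⟨b ≫ inv e, by simp⟩⟩

lemma comp_right (h : RUniv R θ) {Y' : 𝒜} (e : Y ⟶ Y') [IsIso e] : RUniv R (θ ≫ e) := by
  intro W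
  have : (fun g : W ⟶ V => R.map g ≫ θ ≫ e) =
      (fun g : R.obj W ⟶ Y => g ≫ e) ∘ (fun g : W ⟶ V => R.map g ≫ θ) := by
    ext g; simp
  rw [this]
  exact Function.Bijective.comp
    ⟨fun a b hab => (cancel_mono e).1 hab, fun b => ⟨b ≫ inv e, by simp⟩⟩ (h W)

lemma of_natIso (h : RUniv R θ) {R' : ℬ ⥤ 𝒜} (e : R' ≅ R) : RUniv R' (e.hom.app V ≫ θ) := by
  intro W
  have : (fun g : W ⟶ V => R'.map g ≫ e.hom.app V ≫ θ) =
      (fun g : R.obj W ⟶ Y => e.hom.app W ≫ g) ∘ (fun g : W ⟶ V => R.map g ≫ θ) := by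
    ext g; simp
  rw [this]
  exact Function.Bijective.comp
    ⟨fun a b hab => (cancel_epi (e.hom.app W)).1 hab, fun b => ⟨e.inv.app W ≫ b, by simp⟩⟩ (h W)

lemma of_adj {L : 𝒜 ⥤ ℬ} (adj : R ⊣ L) (Y : 𝒜) : RUniv R (adj.counit.app Y) := fun W => by
  have : (fun g : W ⟶ L.obj Y => R.map g ≫ adj.counit.app Y) = (adj.homEquiv W Y).symm := by
    ext g; rw [Adjunction.homEquiv_counit]
  rw [this]
  exact Equiv.bijective _

lemma iff_isIso {L : 𝒜 ⥤ ℬ} (adj : R ⊣ L) {m : V ⟶ L.obj Y}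
    (hm : R.map m ≫ adj.counit.app Y = θ) : RUniv R θ ↔ IsIso m :=
  ⟨fun h => (of_adj adj Y).isIso h hm, fun _ => hm ▸ (of_adj adj Y).map_comp m⟩

lemma exists_of_isLeftAdjoint (R : ℬ ⥤ 𝒜) [R.IsLeftAdjoint] (Y : 𝒜) :
    ∃ (V : ℬ) (θ : R.obj V ⟶ Y), RUniv R θ :=
  ⟨_, _, of_adj (Adjunction.ofIsLeftAdjoint R) Y⟩

lemma id_iff_unit {L : 𝒜 ⥤ ℬ} (adj : R ⊣ L) (V : ℬ) :
    RUniv R (𝟙 (R.obj V)) ↔ IsIso (adj.unit.app V) :=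
  iff_isIso adj (adj.left_triangle_components V)

end RUniv

variable {U : 𝒞 ⥤ 𝒜} {P : 𝒜 ⥤ ℰ} {V : 𝒞 ⥤ ℬ} {Q : ℬ ⥤ ℰ}

/-- The Beck–Chevalley condition for left adjoints, in terms of universal arrows. -/
def LExact (β : U ⋙ P ⟶ V ⋙ Q) : Prop :=
  ∀ ⦃X : 𝒜⦄ ⦃Z : 𝒞⦄ (η : X ⟶ U.obj Z), LUniv U η → LUniv Q (P.map η ≫ β.app Z)

/-- The Beck–Chevalley condition for right adjoints, in terms of universal arrows. -/
def RExact (β : U ⋙ P ⟶ V ⋙ Q) : Prop :=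
  ∀ ⦃X : ℬ⦄ ⦃Z : 𝒞⦄ (η : V.obj Z ⟶ X), RUniv V η → RUniv P (β.app Z ≫ Q.map η)

/-- The component of the mate at X is the factorisation of the pasted arrow through the unit of the
second adjunction, so it is invertible exactly if the pasted arrow is universal. Every other
universal arrow from X differs from the unit by an isomorphism. Thus Der4 can be used without
reference to the chosen adjoints. -/
lemma isIso_mate_iff_lExact {L₁ : 𝒜 ⥤ 𝒞} (adj₁ : L₁ ⊣ U) {L₂ : ℰ ⥤ ℬ} (adj₂ : L₂ ⊣ Q)
    (β : TwoSquare U V P Q) :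
    IsIso ((mateEquiv adj₁ adj₂).symm β).natTrans ↔ LExact β.natTrans := by
  have key (X : 𝒜) : IsIso (((mateEquiv adj₁ adj₂).symm β).natTrans.app X) ↔
      LUniv Q (P.map (adj₁.unit.app X) ≫ β.natTrans.app (L₁.obj X)) :=
    (LUniv.iff_isIso adj₂ (unit_mateEquiv_symm adj₁ adj₂ β X).symm).symm
  refine ⟨fun h X Z η hη => ?_, fun h => ?_⟩
  · obtain ⟨m, hm⟩ := (LUniv.of_adj adj₁ X).exists_desc η
    have : IsIso m := (LUniv.of_adj adj₁ X).isIso hη hm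
    have h1 := ((key X).1 inferInstance).comp_map (V.map m)
    have e : P.map η ≫ β.natTrans.app Z =
        (P.map (adj₁.unit.app X) ≫ β.natTrans.app (L₁.obj X)) ≫ Q.map (V.map m) := by
      rw [← hm, P.map_comp, Category.assoc, Category.assoc]
      exact congr(_ ≫ $(β.natTrans.naturality m))
    rw [e]
    exact h1
  · rw [NatTrans.isIso_iff_isIso_app]
    exact fun X => (key X).2 (h _ (LUniv.of_adj adj₁ X))

lemma isIso_mate_iff_rExact {R₁ : ℬ ⥤ 𝒞} (adj₁ : V ⊣ R₁) {R₂ : ℰ ⥤ 𝒜} (adj₂ : P ⊣ R₂)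
    (β : TwoSquare U V P Q) :
    IsIso (mateEquiv adj₁ adj₂ β).natTrans ↔ RExact β.natTrans := by
  have key (X : ℬ) : IsIso ((mateEquiv adj₁ adj₂ β).natTrans.app X) ↔
      RUniv P (β.natTrans.app (R₁.obj X) ≫ Q.map (adj₁.counit.app X)) :=
    (RUniv.iff_isIso adj₂ (mateEquiv_counit adj₁ adj₂ β X)).symm
  refine ⟨fun h X Z η hη => ?_, fun h => ?_⟩
  · obtain ⟨m, hm⟩ := (RUniv.of_adj adj₁ X).exists_lift η
    have : IsIso m := (RUniv.of_adj adj₁ X).isIso hη hm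
    have h1 := ((key X).1 inferInstance).map_comp (U.map m)
    have e : β.natTrans.app Z ≫ Q.map η =
        P.map (U.map m) ≫ β.natTrans.app (R₁.obj X) ≫ Q.map (adj₁.counit.app X) := by
      rw [← hm, Q.map_comp, ← Category.assoc, ← Category.assoc]
      exact congr($((β.natTrans.naturality m).symm) ≫ _)
    rw [e]
    exact h1
  · rw [NatTrans.isIso_iff_isIso_app]
    exact fun X => (key X).2 (h _ (RUniv.of_adj adj₁ X))

/-- The left and the right mate of a square determine each other on Hom-sets: for a universal arrow
ξ from W to U W', both Hom(W, U Z) and Hom(P W, Q X) are identified with Hom(W', Z), compatibly with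
the map in question. -/
lemma LExact.rExact {β : U ⋙ P ⟶ V ⋙ Q} (h : LExact β) [U.IsRightAdjoint] : RExact β := by
  intro X Z η hη W
  obtain ⟨W', ξ, hξ⟩ := LUniv.exists_of_isRightAdjoint U W
  have h1 := (h ξ hξ X).comp (hη W')
  have e : (fun g : W' ⟶ Z => (P.map ξ ≫ β.app W') ≫ Q.map (V.map g ≫ η)) =
      (fun g : W ⟶ U.obj Z => P.map g ≫ β.app Z ≫ Q.map η) ∘ (fun g => ξ ≫ U.map g) := by
    ext g
    have := β.naturality g
    simp only [Functor.comp_map] at this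
    simp [reassoc_of% this]
  exact (Function.Bijective.of_comp_iff _ (hξ Z)).1 (e ▸ h1)

lemma RExact.lExact {β : U ⋙ P ⟶ V ⋙ Q} (h : RExact β) [V.IsLeftAdjoint] : LExact β := by
  intro X Z η hη W
  obtain ⟨W', ξ, hξ⟩ := RUniv.exists_of_isLeftAdjoint V W
  have h1 := (h ξ hξ X).comp (hη W')
  have e : (fun g : Z ⟶ W' => P.map (η ≫ U.map g) ≫ β.app W' ≫ Q.map ξ) =
      (fun g : V.obj Z ⟶ W => (P.map η ≫ β.app Z) ≫ Q.map g) ∘ (fun g => V.map g ≫ ξ) := by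
    ext g
    have := β.naturality g
    simp only [Functor.comp_map] at this
    simp [reassoc_of% this]
  exact (Function.Bijective.of_comp_iff _ (hξ Z)).1 (e ▸ h1)

end Universal

namespace Prederivator

variable (D : Prederivator.{w, v, u})

/-! ### Exact squares of small categories. -/

section Exact

variable {A B C E K : Type w} [SmallCategory A] [SmallCategory B] [SmallCategory C]
  [SmallCategory E] [SmallCategory K]

/-- The base change of left Kan extensions holds for the square `α`. -/
abbrev LEx {p : E ⥤ A} {f : A ⥤ C} {q : E ⥤ B} {g : B ⥤ C} (α : p ⋙ f ⟶ q ⋙ g) : Prop :=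
  LExact (D.square α).natTrans

/-- The base change of right Kan extensions holds for the square `α`. -/
abbrev REx {p : E ⥤ A} {f : A ⥤ C} {q : E ⥤ B} {g : B ⥤ C} (α : p ⋙ f ⟶ q ⋙ g) : Prop :=
  RExact (D.square α).natTrans

/-- The arrow `p^* X ⟶ q^* g^* Z` induced by `η : X ⟶ f^* Z` and a square. -/
def sqL {p : E ⥤ A} {f : A ⥤ C} {q : E ⥤ B} {g : B ⥤ C} (α : p ⋙ f ⟶ q ⋙ g) {X : D.Diag A}
    {Z : D.Diag C} (η : X ⟶ (D.res f).obj Z) :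
    (D.res p).obj X ⟶ (D.res q).obj ((D.res g).obj Z) :=
  D.pullL p η ≫ D.tr α Z ≫ (D.cmp q g Z).hom

/-- The arrow `p^* f^* Z ⟶ q^* X` induced by `η : g^* Z ⟶ X` and a square. -/
def sqR {p : E ⥤ A} {f : A ⥤ C} {q : E ⥤ B} {g : B ⥤ C} (α : p ⋙ f ⟶ q ⋙ g) {X : D.Diag B}
    {Z : D.Diag C} (η : (D.res g).obj Z ⟶ X) :
    (D.res p).obj ((D.res f).obj Z) ⟶ (D.res q).obj X :=
  (D.cmp p f Z).inv ≫ D.tr α Z ≫ D.pullR q η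

variable {D}

lemma lEx_iff {p : E ⥤ A} {f : A ⥤ C} {q : E ⥤ B} {g : B ⥤ C} {α : p ⋙ f ⟶ q ⋙ g} :
    D.LEx α ↔ ∀ ⦃X : D.Diag A⦄ ⦃Z : D.Diag C⦄ (η : X ⟶ (D.res f).obj Z), LUniv (D.res f) η →
      LUniv (D.res q) (D.sqL α η) := by
  have (X : D.Diag A) (Z : D.Diag C) (η : X ⟶ (D.res f).obj Z) :
      (D.res p).map η ≫ (D.square α).natTrans.app Z = D.sqL α η := by
    simp [sqL, pullL, square_app]
  simp only [LEx, LExact, this]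

lemma rEx_iff {p : E ⥤ A} {f : A ⥤ C} {q : E ⥤ B} {g : B ⥤ C} {α : p ⋙ f ⟶ q ⋙ g} :
    D.REx α ↔ ∀ ⦃X : D.Diag B⦄ ⦃Z : D.Diag C⦄ (η : (D.res g).obj Z ⟶ X), RUniv (D.res g) η →
      RUniv (D.res p) (D.sqR α η) := by
  have (X : D.Diag B) (Z : D.Diag C) (η : (D.res g).obj Z ⟶ X) :
      (D.square α).natTrans.app Z ≫ (D.res q).map η = D.sqR α η := by
    simp [sqR, pullR, square_app]
  simp only [REx, RExact, this]

/-- The pasting of `α` with a square `β` over its left Kan extension side. -/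
abbrev pasteL {p : E ⥤ A} {f : A ⥤ C} {q : E ⥤ B} {g : B ⥤ C} (α : p ⋙ f ⟶ q ⋙ g)
    {B' : Type w} [SmallCategory B'] {p' : K ⥤ E} {q' : K ⥤ B'} {g' : B' ⥤ B}
    (β : p' ⋙ q ⟶ q' ⋙ g') : (p' ⋙ p) ⋙ f ⟶ q' ⋙ (g' ⋙ g) :=
  p'.whiskerLeft α ≫ Functor.whiskerRight β g

/-- The pasting of `α` with a square `β` over its right Kan extension side. -/
abbrev pasteR {p : E ⥤ A} {f : A ⥤ C} {q : E ⥤ B} {g : B ⥤ C} (α : p ⋙ f ⟶ q ⋙ g)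
    {A' : Type w} [SmallCategory A'] {p' : K ⥤ A'} {f' : A' ⥤ A} {q' : K ⥤ E}
    (β : p' ⋙ f' ⟶ q' ⋙ p) : p' ⋙ (f' ⋙ f) ⟶ (q' ⋙ q) ⋙ g :=
  Functor.whiskerRight β f ≫ q'.whiskerLeft α

/-- The pasting law on the side of left Kan extensions. The comparison isomorphisms that appear are
harmless for universality, so exactness of a square can be derived from that of its pastings. -/
lemma sqL_sqL {p : E ⥤ A} {f : A ⥤ C} {q : E ⥤ B} {g : B ⥤ C} (α : p ⋙ f ⟶ q ⋙ g)
    {B' : Type w} [SmallCategory B'] {p' : K ⥤ E} {q' : K ⥤ B'} {g' : B' ⥤ B}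
    (β : p' ⋙ q ⟶ q' ⋙ g') {X : D.Diag A} {Z : D.Diag C} (η : X ⟶ (D.res f).obj Z) :
    D.sqL β (D.sqL α η) =
      (D.cmp p' p X).inv ≫ D.sqL (pasteL α β) η ≫ (D.res q').map (D.cmp g' g Z).hom := by
  dsimp only [sqL]
  rw [pullL_comp, pullL_pullL, pull_comp, pull_tr, pull_cmp]
  simp only [Category.assoc]
  rw [← cmp_assoc, ← reassoc_of% tr_whiskerRight, tr_comp]
  simp only [Category.assoc]

lemma sqR_sqR {p : E ⥤ A} {f : A ⥤ C} {q : E ⥤ B} {g : B ⥤ C} (α : p ⋙ f ⟶ q ⋙ g)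
    {A' : Type w} [SmallCategory A'] {p' : K ⥤ A'} {f' : A' ⥤ A} {q' : K ⥤ E}
    (β : p' ⋙ f' ⟶ q' ⋙ p) {X : D.Diag B} {Z : D.Diag C} (η : (D.res g).obj Z ⟶ X) :
    D.sqR β (D.sqR α η) =
      (D.res p').map (D.cmp f' f Z).inv ≫ D.sqR (pasteR α β) η ≫ (D.cmp q' q X).hom := by
  dsimp only [sqR]
  rw [pullR_comp, pullR_comp, pullR_pullR, pull_tr, pull_cmp_inv, tr_comp]
  simp only [Category.assoc]
  rw [reassoc_of% cmp_inv_assoc']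
  congr 1
  rw [← cancel_epi (D.cmp (p' ⋙ f') f Z).hom, Iso.hom_inv_id_assoc]
  have h := D.tr_whiskerRight β f Z
  rw [← Iso.eq_comp_inv] at h
  rw [h]
  simp only [Category.assoc]

lemma sqL_comp_map {p : E ⥤ A} {f : A ⥤ C} {q : E ⥤ B} {g : B ⥤ C} (α : p ⋙ f ⟶ q ⋙ g)
    {X : D.Diag A} {Z W : D.Diag C} (η : X ⟶ (D.res f).obj Z) (m : Z ⟶ W) :
    D.sqL α (η ≫ (D.res f).map m) = D.sqL α η ≫ (D.res q).map ((D.res g).map m) := by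
  dsimp only [sqL]
  rw [pullL_comp, pull_map]
  simp only [Category.assoc]
  rw [reassoc_of% tr_naturality, cmp_naturality]

lemma sqR_map_comp {p : E ⥤ A} {f : A ⥤ C} {q : E ⥤ B} {g : B ⥤ C} (α : p ⋙ f ⟶ q ⋙ g)
    {X : D.Diag B} {Z W : D.Diag C} (η : (D.res g).obj Z ⟶ X) (m : W ⟶ Z) :
    D.sqR α ((D.res g).map m ≫ η) = (D.res p).map ((D.res f).map m) ≫ D.sqR α η := by
  dsimp only [sqR]
  rw [pullR_comp, pull_map]
  rw [reassoc_of% cmp_inv_naturality, reassoc_of% tr_naturality]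

/-- The comparison m between the universal arrow from p^* X and the arrow under test restricts along
each g' i to a comparison between two universal arrows, by the pasting law. Hence m is invertible on
a jointly conservative family. -/
lemma lEx_of_family {p : E ⥤ A} {f : A ⥤ C} {q : E ⥤ B} {g : B ⥤ C} {α : p ⋙ f ⟶ q ⋙ g}
    [(D.res q).IsRightAdjoint] {ι : Type*} (K B' : ι → Type w)
    [∀ i, SmallCategory (K i)] [∀ i, SmallCategory (B' i)]
    (p' : ∀ i, K i ⥤ E) (q' : ∀ i, K i ⥤ B' i) (g' : ∀ i, B' i ⥤ B)
    (β : ∀ i, p' i ⋙ q ⟶ q' i ⋙ g' i) (h₁ : ∀ i, D.LEx (β i)) (h₂ : ∀ i, D.LEx (pasteL α (β i)))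
    (hc : ∀ {V W : D.Diag B} (m : V ⟶ W), (∀ i, IsIso ((D.res (g' i)).map m)) → IsIso m) :
    D.LEx α := by
  rw [lEx_iff]
  intro X Z η hη
  obtain ⟨V, θ, hθ⟩ := LUniv.exists_of_isRightAdjoint (D.res q) ((D.res p).obj X)
  obtain ⟨m, hm⟩ := hθ.exists_desc (D.sqL α η)
  have : IsIso m := hc m fun i => by
    have e₁ := lEx_iff.1 (h₁ i) θ hθ
    have e₂ := ((lEx_iff.1 (h₂ i) η hη).comp_map (D.cmp (g' i) g Z).hom).comp_left
      (D.cmp (p' i) p X).inv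
    rw [← sqL_sqL, ← hm] at e₂
    exact e₁.isIso e₂ (sqL_comp_map _ _ _).symm
  rw [← hm]
  exact hθ.comp_map m

lemma rEx_of_family {p : E ⥤ A} {f : A ⥤ C} {q : E ⥤ B} {g : B ⥤ C} {α : p ⋙ f ⟶ q ⋙ g}
    [(D.res p).IsLeftAdjoint] {ι : Type*} (K A' : ι → Type w)
    [∀ i, SmallCategory (K i)] [∀ i, SmallCategory (A' i)]
    (p' : ∀ i, K i ⥤ A' i) (f' : ∀ i, A' i ⥤ A) (q' : ∀ i, K i ⥤ E)
    (β : ∀ i, p' i ⋙ f' i ⟶ q' i ⋙ p) (h₁ : ∀ i, D.REx (β i)) (h₂ : ∀ i, D.REx (pasteR α (β i)))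
    (hc : ∀ {V W : D.Diag A} (m : V ⟶ W), (∀ i, IsIso ((D.res (f' i)).map m)) → IsIso m) :
    D.REx α := by
  rw [rEx_iff]
  intro X Z η hη
  obtain ⟨V, θ, hθ⟩ := RUniv.exists_of_isLeftAdjoint (D.res p) ((D.res q).obj X)
  obtain ⟨m, hm⟩ := hθ.exists_lift (D.sqR α η)
  have : IsIso m := hc m fun i => by
    have e₁ := rEx_iff.1 (h₁ i) θ hθ
    have e₂ := ((rEx_iff.1 (h₂ i) η hη).map_comp (D.cmp (f' i) f Z).inv).comp_right
      (D.cmp (q' i) q X).hom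
    rw [Category.assoc, ← sqR_sqR, ← hm] at e₂
    exact e₁.isIso e₂ (sqR_map_comp _ _ _).symm
  rw [← hm]
  exact hθ.map_comp m

/-- Right adjoints are cofinal. If l ⊣ r and s inverts the unit, then pulling back along r
identifies arrows Y ⟶ s^* W with arrows r^* Y ⟶ (r ⋙ s)^* W: the inverse pulls back along l and
corrects with the unit. No formula for colimits is needed. -/
lemma LUniv.pullL_of_adj {l : A ⥤ E} {r : E ⥤ A} (adj : l ⊣ r) {s : A ⥤ B}
    [IsIso (Functor.whiskerRight adj.unit s)] {Y : D.Diag A} {V : D.Diag B}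
    {θ : Y ⟶ (D.res s).obj V} (hθ : LUniv (D.res s) θ) :
    LUniv (D.res (r ⋙ s)) (D.pullL r θ) := by
  intro W
  let e := Functor.whiskerRight adj.unit s
  let Φ (h : (D.res r).obj Y ⟶ (D.res (r ⋙ s)).obj W) : (D.res (𝟭 A)).obj Y ⟶ (D.res s).obj W :=
    D.tr adj.unit Y ≫ D.pull l h ≫ D.tr (inv e) W
  let Ψ (k : (D.res (𝟭 A)).obj Y ⟶ (D.res s).obj W) : (D.res r).obj Y ⟶ (D.res (r ⋙ s)).obj W :=
    D.pull r k
  have hΦ (k : (D.res (𝟭 A)).obj Y ⟶ (D.res s).obj W) : Φ (Ψ k) = k := by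
    have h₁ := D.pull_naturality adj.unit k
    rw [pull_id] at h₁
    have h₂ : D.tr e W ≫ D.tr (inv e) W = 𝟙 _ := by
      rw [← tr_comp, IsIso.hom_inv_id, tr_id]
    dsimp only [Φ, Ψ]
    rw [pull_pull]
    refine (Category.assoc _ _ _).symm.trans ?_
    exact (congr($(h₁.symm) ≫ D.tr (inv e) W).trans (Category.assoc _ _ _)).trans
      (congr(k ≫ $h₂).trans (Category.comp_id _))
  have hΨ (h : (D.res r).obj Y ⟶ (D.res (r ⋙ s)).obj W) : Ψ (Φ h) = h := by
    have h₁ := D.pull_naturality adj.counit h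
    rw [pull_id] at h₁
    -- On objects of the form r x, the inverse of the unit under s is the image of the counit, by
    -- the triangle identity.
    have h₂ : r.whiskerLeft (inv e) = Functor.whiskerRight adj.counit (r ⋙ s) := by
      rw [← cancel_epi (r.whiskerLeft e), ← Functor.whiskerLeft_comp, IsIso.hom_inv_id]
      ext x
      simp only [e, Functor.whiskerLeft_app, NatTrans.id_app, NatTrans.comp_app,
        Functor.whiskerRight_app, Functor.comp_map, ← Functor.map_comp]
      exact (congr(s.map $(adj.right_triangle_components x)).trans (s.map_id _)).symm
    have h₃ : D.tr (r.whiskerLeft adj.unit) Y ≫ D.tr (Functor.whiskerRight adj.counit r) Y =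
        𝟙 _ := by
      refine (D.tr_comp _ _ Y).symm.trans ?_
      refine Eq.trans ?_ (D.tr_id r Y)
      congr 1
      ext x
      exact adj.right_triangle_components x
    dsimp only [Φ, Ψ]
    rw [pull_comp, pull_comp, pull_pull, pull_tr, pull_tr, h₂]
    exact (congr(_ ≫ $h₁).trans (Category.assoc _ _ _).symm).trans
      (congr($h₃ ≫ h).trans (Category.id_comp _))
  have hb : Function.Bijective Ψ := Function.bijective_iff_has_inverse.2 ⟨Φ, hΦ, hΨ⟩
  have : (fun g : V ⟶ W => D.pullL r θ ≫ (D.res (r ⋙ s)).map g) =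
      Ψ ∘ (fun k => (D.rid Y).hom ≫ k) ∘ (fun g : V ⟶ W => θ ≫ (D.res s).map g) := by
    ext g
    dsimp only [Function.comp, Ψ]
    rw [← pullL_eq_pull, pullL_comp, pull_map]
  rw [this]
  exact hb.comp (Function.Bijective.comp
    ⟨fun a b hab => (cancel_epi (D.rid Y).hom).1 hab, fun b => ⟨(D.rid Y).inv ≫ b, by simp⟩⟩ (hθ W))

lemma RUniv.pullR_of_adj {l : E ⥤ A} {r : A ⥤ E} (adj : l ⊣ r) {s : A ⥤ B}
    [IsIso (Functor.whiskerRight adj.counit s)] {Y : D.Diag A} {V : D.Diag B}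
    {θ : (D.res s).obj V ⟶ Y} (hθ : RUniv (D.res s) θ) :
    RUniv (D.res (l ⋙ s)) (D.pullR l θ) := by
  intro W
  let e := Functor.whiskerRight adj.counit s
  let Φ (h : (D.res (l ⋙ s)).obj W ⟶ (D.res l).obj Y) : (D.res s).obj W ⟶ (D.res (𝟭 A)).obj Y :=
    D.tr (inv e) W ≫ D.pull r h ≫ D.tr adj.counit Y
  let Ψ (k : (D.res s).obj W ⟶ (D.res (𝟭 A)).obj Y) : (D.res (l ⋙ s)).obj W ⟶ (D.res l).obj Y :=
    D.pull l k
  have hΦ (k : (D.res s).obj W ⟶ (D.res (𝟭 A)).obj Y) : Φ (Ψ k) = k := by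
    have h₁ := D.pull_naturality adj.counit k
    rw [pull_id] at h₁
    have h₂ : D.tr (inv e) W ≫ D.tr e W = 𝟙 _ := by
      rw [← tr_comp, IsIso.inv_hom_id, tr_id]
    dsimp only [Φ, Ψ]
    rw [pull_pull]
    exact congr(D.tr (inv e) W ≫ $h₁).trans ((Category.assoc _ _ _).symm.trans
      (congr($h₂ ≫ k).trans (Category.id_comp _)))
  have hΨ (h : (D.res (l ⋙ s)).obj W ⟶ (D.res l).obj Y) : Ψ (Φ h) = h := by
    have h₁ := D.pull_naturality adj.unit h
    rw [pull_id] at h₁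
    have h₂ : l.whiskerLeft (inv e) = Functor.whiskerRight adj.unit (l ⋙ s) := by
      rw [← cancel_mono (l.whiskerLeft e), ← Functor.whiskerLeft_comp, IsIso.inv_hom_id]
      ext x
      simp only [e, Functor.whiskerLeft_app, NatTrans.id_app, NatTrans.comp_app,
        Functor.whiskerRight_app, Functor.comp_map, ← Functor.map_comp]
      exact (congr(s.map $(adj.left_triangle_components x)).trans (s.map_id _)).symm
    have h₃ : D.tr (Functor.whiskerRight adj.unit l) Y ≫ D.tr (l.whiskerLeft adj.counit) Y =
        𝟙 _ := by
      refine (D.tr_comp _ _ Y).symm.trans ?_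
      refine Eq.trans ?_ (D.tr_id l Y)
      congr 1
      ext x
      exact adj.left_triangle_components x
    dsimp only [Φ, Ψ]
    rw [pull_comp, pull_comp, pull_pull, pull_tr, pull_tr, h₂]
    refine (Category.assoc _ _ _).symm.trans ?_
    exact (congr($(h₁.symm) ≫ _).trans (Category.assoc _ _ _)).trans
      (congr(h ≫ $h₃).trans (Category.comp_id _))
  have hb : Function.Bijective Ψ := Function.bijective_iff_has_inverse.2 ⟨Φ, hΦ, hΨ⟩
  have : (fun g : W ⟶ V => (D.res (l ⋙ s)).map g ≫ D.pullR l θ) =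
      Ψ ∘ (fun k => k ≫ (D.rid Y).inv) ∘ (fun g : W ⟶ V => (D.res s).map g ≫ θ) := by
    ext g
    dsimp only [Function.comp, Ψ]
    rw [← pullR_eq_pull, pullR_comp, pull_map]
  rw [this]
  exact hb.comp (Function.Bijective.comp
    ⟨fun a b hab => (cancel_mono (D.rid Y).inv).1 hab, fun b => ⟨b ≫ (D.rid Y).hom, by simp⟩⟩ (hθ W))

/-- This supplies the hypothesis of `LUniv.pullL_of_adj` on the unit whenever s takes values in the
point, as for comma categories over an object. -/
instance {F G : A ⥤ Pt.{w}} (α : F ⟶ G) : IsIso α := by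
  have : ∀ X, IsIso (α.app X) := fun X => inferInstance
  exact NatIso.isIso_of_isIso_app α

/-- The functor from `q / b` to `f / g b` induced by a square. -/
@[simps]
def commaL {p : E ⥤ A} {f : A ⥤ C} {q : E ⥤ B} {g : B ⥤ C} (α : p ⋙ f ⟶ q ⋙ g) (b : B) :
    Comma q (pt b) ⥤ Comma f (pt (g.obj b)) where
  obj X := { left := p.obj X.left, right := X.right, hom := α.app X.left ≫ g.map X.hom }
  map {X Y} k :=
    { left := p.map k.left
      right := k.right
      w := by
        have h₁ := α.naturality k.left
        have h₂ := k.w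
        simp only [Functor.comp_map, Functor.const_obj_map] at h₁ h₂ ⊢
        rw [reassoc_of% h₁, ← g.map_comp, h₂]
        erw [Category.comp_id, Category.comp_id] }

/-- The functor from `a / p` to `f a / g` induced by a square. -/
@[simps]
def commaR {p : E ⥤ A} {f : A ⥤ C} {q : E ⥤ B} {g : B ⥤ C} (α : p ⋙ f ⟶ q ⋙ g) (a : A) :
    Comma (pt a) p ⥤ Comma (pt (f.obj a)) g where
  obj X := { left := X.left, right := q.obj X.right, hom := f.map X.hom ≫ α.app X.right }
  map {X Y} k :=
    { left := k.left
      right := q.map k.right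
      w := by
        have h₁ := α.naturality k.right
        have h₂ := k.w
        simp only [Functor.comp_map, Functor.const_obj_map, Category.assoc] at h₁ h₂ ⊢
        rw [← h₁, ← f.map_comp_assoc, ← h₂]
        erw [Category.id_comp, Category.id_comp] }

section

variable [D.IsDerivator]

/-- Der4, freed from mates. -/
lemma lEx_comma (f : A ⥤ B) (b : B) : D.LEx (Comma.natTrans f (pt b)) :=
  (isIso_mate_iff_lExact (Adjunction.ofIsRightAdjoint _) (Adjunction.ofIsRightAdjoint _) _).1
    (IsDerivator.der4_left f b (Adjunction.ofIsRightAdjoint _) (Adjunction.ofIsRightAdjoint _))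

lemma rEx_comma (f : A ⥤ B) (b : B) : D.REx (Comma.natTrans (pt b) f) :=
  (isIso_mate_iff_rExact (Adjunction.ofIsLeftAdjoint _) (Adjunction.ofIsLeftAdjoint _) _).1
    (IsDerivator.der4_right f b (Adjunction.ofIsLeftAdjoint _) (Adjunction.ofIsLeftAdjoint _))

/-- A square is exact if the induced functors on comma categories are right adjoints. -/
theorem lEx_of_isRightAdjoint {p : E ⥤ A} {f : A ⥤ C} {q : E ⥤ B} {g : B ⥤ C}
    (α : p ⋙ f ⟶ q ⋙ g) (h : ∀ b, (commaL α b).IsRightAdjoint) : D.LEx α := by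
  -- By Der2 it suffices to test at the objects b of B. Pasting α with the comma square of q / b
  -- yields the comma square of f / g b precomposed with `commaL α b`, and a right adjoint does not
  -- affect universality.
  refine lEx_of_family _ _ _ _ (fun b : B => pt b) (fun b => Comma.natTrans q (pt b))
    (fun b => lEx_comma q b) (fun b => ?_) (fun m hm => IsDerivator.der2 _ m hm)
  rw [lEx_iff]
  intro X Z η hη
  have h₁ := LUniv.pullL_of_adj (Adjunction.ofIsRightAdjoint (commaL α b))
    (lEx_iff.1 (lEx_comma f (g.obj b)) η hη)
  let e : pt (g.obj b) ⟶ pt b ⋙ g :=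
    (NatIso.ofComponents (F := pt (g.obj b)) (G := pt b ⋙ g) (fun _ => Iso.refl _)
      (fun _ => by simp)).hom
  have h₂ := (h₁.comp_left (D.cmp (commaL α b) (Comma.fst f (pt (g.obj b))) X).hom).comp_map
    (D.tr e Z)
  refine (congrArg (LUniv (D.res (Comma.snd q (pt b)))) ?_).mpr h₂
  dsimp only [sqL]
  rw [pullL_comp, pullL_pullL, pull_comp, pull_tr, pull_cmp]
  simp only [Category.assoc, Iso.hom_inv_id_assoc]
  have h₃ := D.tr_whiskerLeft (Comma.snd q (pt b)) e Z
  refine congr(D.pullL (Comma.fst q (pt b) ⋙ p) η ≫ $(Eq.trans ?_ congr(_ ≫ $h₃)))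
  refine Eq.trans ?_ (Category.assoc _ _ _)
  refine congr($(Eq.trans ?_ (D.tr_comp _ _ Z)) ≫ (D.cmp (Comma.snd q (pt b)) (pt b ⋙ g) Z).hom)
  congr 1
  ext X
  exact (Category.comp_id _).symm

/-- A square is exact if the induced functors on comma categories are left adjoints. -/
theorem rEx_of_isLeftAdjoint {p : E ⥤ A} {f : A ⥤ C} {q : E ⥤ B} {g : B ⥤ C}
    (α : p ⋙ f ⟶ q ⋙ g) (h : ∀ a, (commaR α a).IsLeftAdjoint) : D.REx α := by
  refine rEx_of_family _ _ _ (fun a : A => pt a) _ (fun a => Comma.natTrans (pt a) p)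
    (fun a => rEx_comma p a) (fun a => ?_) (fun m hm => IsDerivator.der2 _ m hm)
  rw [rEx_iff]
  intro X Z η hη
  have h₁ := RUniv.pullR_of_adj (Adjunction.ofIsLeftAdjoint (commaR α a))
    (rEx_iff.1 (rEx_comma g (f.obj a)) η hη)
  let e : pt a ⋙ f ⟶ pt (f.obj a) :=
    (NatIso.ofComponents (F := pt a ⋙ f) (G := pt (f.obj a)) (fun _ => Iso.refl _)
      (fun _ => by simp)).hom
  have h₂ := (h₁.comp_right (D.cmp (commaR α a) (Comma.snd (pt (f.obj a)) g) X).inv).map_comp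
    (D.tr e Z)
  refine (congrArg (RUniv (D.res (Comma.fst (pt a) p))) ?_).mpr h₂
  dsimp only [sqR]
  rw [pullR_comp, pullR_comp, pullR_pullR, pull_tr, pull_cmp_inv]
  simp only [Category.assoc, Iso.hom_inv_id, Category.comp_id]
  have h₃ : (D.res (Comma.fst (pt a) p)).map (D.tr e Z) ≫
      (D.cmp (Comma.fst (pt a) p) (pt (f.obj a)) Z).inv =
      (D.cmp (Comma.fst (pt a) p) (pt a ⋙ f) Z).inv ≫
        D.tr ((Comma.fst (pt a) p).whiskerLeft e) Z := by
    rw [Iso.comp_inv_eq, Category.assoc, tr_whiskerLeft, Iso.inv_hom_id_assoc]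
  refine Eq.trans ?_ ((congr($h₃ ≫ _).symm).trans (Category.assoc _ _ _))
  refine Eq.trans ?_ (Category.assoc _ _ _).symm
  refine congr((D.cmp (Comma.fst (pt a) p) (pt a ⋙ f) Z).inv ≫ $(Eq.trans ?_ (Category.assoc _ _ _)))
  refine congr($(Eq.trans ?_ (D.tr_comp _ _ Z)) ≫ D.pullR (Comma.snd (pt a) p ⋙ q) η)
  congr 1
  ext X
  exact (Category.id_comp _).symm

end

end Exact

end Prederivator

/-! ### Adjoints from universal arrows, and exactness tested on elements. -/

section Universal

universe v₁ v₂ u₁ u₂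

variable {𝒜 : Type u₁} [Category.{v₁} 𝒜] {ℬ : Type u₂} [Category.{v₂} ℬ]

lemma LUniv.isRightAdjoint {R : ℬ ⥤ 𝒜}
    (h : ∀ Y, ∃ (V : ℬ) (θ : Y ⟶ R.obj V), LUniv R θ) : R.IsRightAdjoint := by
  choose V θ hθ using h
  exact (Adjunction.adjunctionOfEquivLeft (F_obj := V)
    (fun Y W => Equiv.ofBijective _ (hθ Y W)) (by intros; simp)).isRightAdjoint

lemma RUniv.isLeftAdjoint {R : ℬ ⥤ 𝒜}
    (h : ∀ Y, ∃ (V : ℬ) (θ : R.obj V ⟶ Y), RUniv R θ) : R.IsLeftAdjoint := by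
  choose V θ hθ using h
  exact (Adjunction.adjunctionOfEquivRight (G_obj := V)
    (fun W Y => (Equiv.ofBijective _ (hθ Y W)).symm) (by
      intros X' X Y f g
      rw [Equiv.symm_apply_eq]
      simp
      congr 1
      exact (Equiv.ofBijective_apply_symm_apply _ (hθ Y X) g).symm)).isLeftAdjoint

end Universal

namespace Prederivator

section

variable {A B C E : Type w} [SmallCategory A] [SmallCategory B] [SmallCategory C]
  [SmallCategory E]

/-- The hypothesis provides an initial object in the category of factorisations of x through α.
These initial objects are the universal arrows that define a left adjoint of `commaL α b`. -/
lemma isRightAdjoint_commaL {p : E ⥤ A} {f : A ⥤ C} {q : E ⥤ B} {g : B ⥤ C}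
    (α : p ⋙ f ⟶ q ⋙ g) (b : B)
    (h : ∀ (a : A) (x : f.obj a ⟶ g.obj b), ∃ (e : E) (y : q.obj e ⟶ b) (s : a ⟶ p.obj e),
      f.map s ≫ α.app e ≫ g.map y = x ∧ ∀ (e' : E) (y' : q.obj e' ⟶ b) (s' : a ⟶ p.obj e'),
        f.map s' ≫ α.app e' ≫ g.map y' = x → ∃! t : e ⟶ e', q.map t ≫ y' = y ∧
          s ≫ p.map t = s') : (commaL α b).IsRightAdjoint := by
  refine LUniv.isRightAdjoint fun Y => ?_
  obtain ⟨e, y, s, hx, hu⟩ := h Y.left Y.hom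
  refine ⟨⟨e, Y.right, y⟩, ⟨s, 𝟙 _, hx.trans (Category.comp_id _).symm⟩, fun W => ⟨?_, ?_⟩⟩
  · intro k k' hk
    have hl : ∀ j : (⟨e, Y.right, y⟩ : Comma q (pt b)) ⟶ W, q.map j.left ≫ W.hom = y :=
      fun j => j.w.trans (Category.comp_id _)
    have h₁ := congrArg CommaMorphism.left hk
    dsimp at h₁
    have hW : f.map (s ≫ p.map k.left) ≫ α.app W.left ≫ g.map W.hom = Y.hom := by
      have := α.naturality k.left
      dsimp at this
      rw [f.map_comp, Category.assoc, reassoc_of% this, ← g.map_comp, hl k, hx]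
    apply CommaMorphism.ext
    · exact (hu _ W.hom _ hW).unique ⟨hl k, rfl⟩ ⟨hl k', h₁.symm⟩
    · exact Subsingleton.elim _ _
  · intro k
    have hk : f.map k.left ≫ α.app W.left ≫ g.map W.hom = Y.hom :=
      k.w.trans (Category.comp_id _)
    obtain ⟨t, ⟨ht₁, ht₂⟩, -⟩ := hu W.left W.hom k.left hk
    refine ⟨⟨t, k.right, ht₁.trans (Category.comp_id _).symm⟩, ?_⟩
    apply CommaMorphism.ext
    · exact ht₂
    · exact Subsingleton.elim _ _

lemma isLeftAdjoint_commaR {p : E ⥤ A} {f : A ⥤ C} {q : E ⥤ B} {g : B ⥤ C}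
    (α : p ⋙ f ⟶ q ⋙ g) (a : A)
    (h : ∀ (b : B) (x : f.obj a ⟶ g.obj b), ∃ (e : E) (y : a ⟶ p.obj e) (s : q.obj e ⟶ b),
      f.map y ≫ α.app e ≫ g.map s = x ∧ ∀ (e' : E) (y' : a ⟶ p.obj e') (s' : q.obj e' ⟶ b),
        f.map y' ≫ α.app e' ≫ g.map s' = x → ∃! t : e' ⟶ e, y' ≫ p.map t = y ∧
          q.map t ≫ s = s') : (commaR α a).IsLeftAdjoint := by
  refine RUniv.isLeftAdjoint fun Y => ?_
  obtain ⟨e, y, s, hx, hu⟩ := h Y.right Y.hom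
  have hx' : f.map y ≫ α.app e ≫ g.map s = Y.hom := hx
  refine ⟨⟨Y.left, e, y⟩, ⟨𝟙 _, s, ?_⟩, fun W => ⟨?_, ?_⟩⟩
  · exact (Category.id_comp _).trans (hx'.symm.trans (Category.assoc _ _ _).symm)
  · intro k k' hk
    have hl : ∀ j : W ⟶ (⟨Y.left, e, y⟩ : Comma (pt a) p), W.hom ≫ p.map j.right = y :=
      fun j => j.w.symm.trans (Category.id_comp _)
    have h₁ := congrArg CommaMorphism.right hk
    dsimp at h₁
    have hW : f.map W.hom ≫ α.app W.right ≫ g.map (q.map k.right ≫ s) = Y.hom := by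
      have := α.naturality k.right
      dsimp at this
      rw [g.map_comp, ← reassoc_of% this, ← f.map_comp_assoc, hl k, hx']
    apply CommaMorphism.ext
    · exact Subsingleton.elim _ _
    · exact (hu _ W.hom _ hW).unique ⟨hl k, rfl⟩ ⟨hl k', h₁.symm⟩
  · intro k
    have hk : f.map W.hom ≫ α.app W.right ≫ g.map k.right = Y.hom :=
      (Category.assoc _ _ _).symm.trans (k.w.symm.trans (Category.id_comp _))
    obtain ⟨t, ⟨ht₁, ht₂⟩, -⟩ := hu W.right W.hom k.right hk
    refine ⟨⟨k.left, t, ?_⟩, ?_⟩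
    · exact (Category.id_comp _).trans ht₁.symm
    · apply CommaMorphism.ext
      · exact Subsingleton.elim _ _
      · exact ht₂

variable {D : Prederivator.{w, v, u}} [D.IsDerivator]

lemma lEx_of_exists {p : E ⥤ A} {f : A ⥤ C} {q : E ⥤ B} {g : B ⥤ C} (α : p ⋙ f ⟶ q ⋙ g)
    (h : ∀ (b : B) (a : A) (x : f.obj a ⟶ g.obj b), ∃ (e : E) (y : q.obj e ⟶ b)
      (s : a ⟶ p.obj e), f.map s ≫ α.app e ≫ g.map y = x ∧
      ∀ (e' : E) (y' : q.obj e' ⟶ b) (s' : a ⟶ p.obj e'),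
        f.map s' ≫ α.app e' ≫ g.map y' = x → ∃! t : e ⟶ e', q.map t ≫ y' = y ∧
          s ≫ p.map t = s') : D.LEx α :=
  lEx_of_isRightAdjoint α fun b => isRightAdjoint_commaL α b (h b)

lemma rEx_of_exists {p : E ⥤ A} {f : A ⥤ C} {q : E ⥤ B} {g : B ⥤ C} (α : p ⋙ f ⟶ q ⋙ g)
    (h : ∀ (a : A) (b : B) (x : f.obj a ⟶ g.obj b), ∃ (e : E) (y : a ⟶ p.obj e)
      (s : q.obj e ⟶ b), f.map y ≫ α.app e ≫ g.map s = x ∧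
      ∀ (e' : E) (y' : a ⟶ p.obj e') (s' : q.obj e' ⟶ b),
        f.map y' ≫ α.app e' ≫ g.map s' = x → ∃! t : e' ⟶ e, y' ≫ p.map t = y ∧
          q.map t ≫ s = s') : D.REx α :=
  rEx_of_isLeftAdjoint α fun a => isLeftAdjoint_commaR α a (h a)

/-! ### Product squares -/

lemma isIso_of_family {ι : Type*} (A' : ι → Type w) [∀ i, SmallCategory (A' i)]
    (f : ∀ i, A' i ⥤ A) (hf : ∀ a, ∃ i a', (f i).obj a' = a) {X Y : D.Diag A} (m : X ⟶ Y)
    (hm : ∀ i, IsIso ((D.res (f i)).map m)) : IsIso m := by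
  refine IsDerivator.der2 _ m fun a => ?_
  obtain ⟨i, a', rfl⟩ := hf a
  have h : IsIso ((D.eval a').map ((D.res (f i)).map m)) := inferInstance
  have h₁ : IsIso ((D.res (pt a' ⋙ f i)).map m) := by
    have := D.cmp_naturality (pt a') (f i) m
    rw [← Iso.eq_comp_inv] at this
    rw [this]
    infer_instance
  let e : pt a' ⋙ f i ≅ pt ((f i).obj a') := NatIso.ofComponents (fun _ => Iso.refl _)
    (fun _ => by simp)
  have := D.tr_naturality e.inv m
  rw [← IsIso.eq_comp_inv] at this
  rw [this]
  infer_instance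

lemma isIso_of_sectL {K : Type w} [SmallCategory K] {X Y : D.Diag (A × K)} (m : X ⟶ Y)
    (hm : ∀ k, IsIso ((D.res (Prod.sectL A k)).map m)) : IsIso m :=
  isIso_of_family (fun _ : K => A) (fun k => Prod.sectL A k) (fun ⟨a, k⟩ => ⟨k, a, rfl⟩) m hm

lemma isIso_of_sectR {K : Type w} [SmallCategory K] {X Y : D.Diag (K × A)} (m : X ⟶ Y)
    (hm : ∀ k, IsIso ((D.res (Prod.sectR k A)).map m)) : IsIso m :=
  isIso_of_family (fun _ : K => A) (fun k => Prod.sectR k A) (fun ⟨k, a⟩ => ⟨k, a, rfl⟩) m hm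

/-- The square comparing `u` and `u × K` at an object of `K`. -/
abbrev sectLSq (u : A ⥤ B) {K : Type w} [SmallCategory K] (k : K) :
    Prod.sectL A k ⋙ u.prod (𝟭 K) ⟶ u ⋙ Prod.sectL B k where
  app _ := 𝟙 _
  naturality _ _ _ := (Category.comp_id _).trans (Category.id_comp _).symm

/-- The square comparing `u × K` and `u` at an object of `K`. -/
abbrev sectLSq' (u : A ⥤ B) {K : Type w} [SmallCategory K] (k : K) :
    u ⋙ Prod.sectL B k ⟶ Prod.sectL A k ⋙ u.prod (𝟭 K) where
  app _ := 𝟙 _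
  naturality _ _ _ := (Category.comp_id _).trans (Category.id_comp _).symm

/-- Left Kan extension along u × K is computed at each parameter, because the initial factorisation
of (x₁, x₂) keeps the object a and absorbs x₂ into the parameter. -/
lemma lEx_sectL (u : A ⥤ B) {K : Type w} [SmallCategory K] (k : K) : D.LEx (sectLSq u k) := by
  refine lEx_of_exists _ fun b ⟨a, k'⟩ ⟨x₁, x₂⟩ => ?_
  change u.obj a ⟶ b at x₁
  change k' ⟶ k at x₂
  refine ⟨a, x₁, (𝟙 a, x₂), Prod.ext ?_ ?_, fun e' y' ⟨s₁, s₂⟩ h => ?_⟩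
  · change u.map (𝟙 a) ≫ 𝟙 (u.obj a) ≫ x₁ = x₁
    simp
  · change x₂ ≫ 𝟙 k ≫ 𝟙 k = x₂
    simp
  · change a ⟶ e' at s₁
    change k' ⟶ k at s₂
    have h₁ : u.map s₁ ≫ 𝟙 (u.obj e') ≫ y' = x₁ := congrArg Prod.fst h
    have h₂ : s₂ ≫ 𝟙 k ≫ 𝟙 k = x₂ := congrArg Prod.snd h
    simp only [Category.id_comp, Category.comp_id] at h₁ h₂
    refine ⟨s₁, ⟨h₁, Prod.ext (Category.id_comp _) ((Category.comp_id _).trans h₂.symm)⟩,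
      fun t ht => ?_⟩
    have : 𝟙 a ≫ t = s₁ := congrArg Prod.fst ht.2
    simpa using this

lemma rEx_sectL (u : A ⥤ B) {K : Type w} [SmallCategory K] (k : K) : D.REx (sectLSq' u k) := by
  refine rEx_of_exists _ fun b ⟨a, k'⟩ ⟨x₁, x₂⟩ => ?_
  change b ⟶ u.obj a at x₁
  change k ⟶ k' at x₂
  refine ⟨a, x₁, (𝟙 a, x₂), Prod.ext ?_ ?_, fun e' y' ⟨s₁, s₂⟩ h => ?_⟩
  · change x₁ ≫ 𝟙 (u.obj a) ≫ u.map (𝟙 a) = x₁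
    simp
  · change 𝟙 k ≫ 𝟙 k ≫ x₂ = x₂
    simp
  · change e' ⟶ a at s₁
    change k ⟶ k' at s₂
    have h₁ : y' ≫ 𝟙 (u.obj e') ≫ u.map s₁ = x₁ := congrArg Prod.fst h
    have h₂ : 𝟙 k ≫ 𝟙 k ≫ s₂ = x₂ := congrArg Prod.snd h
    simp only [Category.id_comp] at h₁ h₂
    refine ⟨s₁, ⟨h₁, Prod.ext (Category.comp_id _) ((Category.id_comp _).trans h₂.symm)⟩,
      fun t ht => ?_⟩
    have : t ≫ 𝟙 a = s₁ := congrArg Prod.fst ht.2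
    simpa using this

/-- The square comparing `u` and `K × u` at an object of `K`. -/
abbrev sectRSq (u : A ⥤ B) {K : Type w} [SmallCategory K] (k : K) :
    Prod.sectR k A ⋙ (𝟭 K).prod u ⟶ u ⋙ Prod.sectR k B where
  app _ := 𝟙 _
  naturality _ _ _ := (Category.comp_id _).trans (Category.id_comp _).symm

/-- The square comparing `K × u` and `u` at an object of `K`. -/
abbrev sectRSq' (u : A ⥤ B) {K : Type w} [SmallCategory K] (k : K) :
    u ⋙ Prod.sectR k B ⟶ Prod.sectR k A ⋙ (𝟭 K).prod u where
  app _ := 𝟙 _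
  naturality _ _ _ := (Category.comp_id _).trans (Category.id_comp _).symm

lemma lEx_sectR (u : A ⥤ B) {K : Type w} [SmallCategory K] (k : K) : D.LEx (sectRSq u k) := by
  refine lEx_of_exists _ fun b ⟨k', a⟩ ⟨x₂, x₁⟩ => ?_
  change u.obj a ⟶ b at x₁
  change k' ⟶ k at x₂
  refine ⟨a, x₁, (x₂, 𝟙 a), Prod.ext ?_ ?_, fun e' y' ⟨s₂, s₁⟩ h => ?_⟩
  · change x₂ ≫ 𝟙 k ≫ 𝟙 k = x₂
    simp
  · change u.map (𝟙 a) ≫ 𝟙 (u.obj a) ≫ x₁ = x₁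
    simp
  · change a ⟶ e' at s₁
    change k' ⟶ k at s₂
    have h₁ : u.map s₁ ≫ 𝟙 (u.obj e') ≫ y' = x₁ := congrArg Prod.snd h
    have h₂ : s₂ ≫ 𝟙 k ≫ 𝟙 k = x₂ := congrArg Prod.fst h
    simp only [Category.id_comp, Category.comp_id] at h₁ h₂
    refine ⟨s₁, ⟨h₁, Prod.ext ((Category.comp_id _).trans h₂.symm) (Category.id_comp _)⟩,
      fun t ht => ?_⟩
    have : 𝟙 a ≫ t = s₁ := congrArg Prod.snd ht.2
    simpa using this

lemma rEx_sectR (u : A ⥤ B) {K : Type w} [SmallCategory K] (k : K) : D.REx (sectRSq' u k) := by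
  refine rEx_of_exists _ fun b ⟨k', a⟩ ⟨x₂, x₁⟩ => ?_
  change b ⟶ u.obj a at x₁
  change k ⟶ k' at x₂
  refine ⟨a, x₁, (x₂, 𝟙 a), Prod.ext ?_ ?_, fun e' y' ⟨s₂, s₁⟩ h => ?_⟩
  · change 𝟙 k ≫ 𝟙 k ≫ x₂ = x₂
    simp
  · change x₁ ≫ 𝟙 (u.obj a) ≫ u.map (𝟙 a) = x₁
    simp
  · change e' ⟶ a at s₁
    change k ⟶ k' at s₂
    have h₁ : y' ≫ 𝟙 (u.obj e') ≫ u.map s₁ = x₁ := congrArg Prod.snd h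
    have h₂ : 𝟙 k ≫ 𝟙 k ≫ s₂ = x₂ := congrArg Prod.fst h
    simp only [Category.id_comp] at h₁ h₂
    refine ⟨s₁, ⟨h₁, Prod.ext ((Category.id_comp _).trans h₂.symm) (Category.comp_id _)⟩,
      fun t ht => ?_⟩
    have : t ≫ 𝟙 a = s₁ := congrArg Prod.snd ht.2
    simpa using this

/-- The square exchanging `u × K` and `A × f`. -/
abbrev prodSq (u : A ⥤ B) {K K' : Type w} [SmallCategory K] [SmallCategory K'] (f : K' ⥤ K) :
    (𝟭 A).prod f ⋙ u.prod (𝟭 K) ⟶ u.prod (𝟭 K') ⋙ (𝟭 B).prod f where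
  app _ := 𝟙 _
  naturality _ _ _ := (Category.comp_id _).trans (Category.id_comp _).symm

/-- The square exchanging `A × f` and `u × K`. -/
abbrev prodSq' (u : A ⥤ B) {K K' : Type w} [SmallCategory K] [SmallCategory K'] (f : K' ⥤ K) :
    u.prod (𝟭 K') ⋙ (𝟭 B).prod f ⟶ (𝟭 A).prod f ⋙ u.prod (𝟭 K) where
  app _ := 𝟙 _
  naturality _ _ _ := (Category.comp_id _).trans (Category.id_comp _).symm

/-- Left Kan extension in the first variable commutes with restriction in the second. This is the
pseudo-naturality of `lanMor`. After pasting with the square at an object of K', the initial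
factorisation is found as in `lEx_sectL`. -/
lemma lEx_prod (u : A ⥤ B) {K K' : Type w} [SmallCategory K] [SmallCategory K'] (f : K' ⥤ K) :
    D.LEx (prodSq u f) := by
  refine lEx_of_family _ _ _ _ _ (fun k => sectLSq u k) (fun k => lEx_sectL u k) (fun k => ?_)
    (fun m hm => isIso_of_sectL m hm)
  refine lEx_of_exists _ fun b ⟨a, k'⟩ ⟨x₁, x₂⟩ => ?_
  change u.obj a ⟶ b at x₁
  change k' ⟶ f.obj k at x₂
  refine ⟨a, x₁, (𝟙 a, x₂), Prod.ext ?_ ?_, fun e' y' ⟨s₁, s₂⟩ h => ?_⟩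
  · change u.map (𝟙 a) ≫ (𝟙 (u.obj a) ≫ 𝟙 (u.obj a)) ≫ x₁ = x₁
    simp
  · change x₂ ≫ (𝟙 _ ≫ f.map (𝟙 k)) ≫ f.map (𝟙 k) = x₂
    simp
  · change a ⟶ e' at s₁
    change k' ⟶ f.obj k at s₂
    have h₁ : u.map s₁ ≫ (𝟙 (u.obj e') ≫ 𝟙 (u.obj e')) ≫ y' = x₁ := congrArg Prod.fst h
    have h₃ (z : k' ⟶ f.obj k) : z ≫ (𝟙 _ ≫ f.map (𝟙 k)) ≫ f.map (𝟙 k) = z := by simp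
    have h₂ : s₂ = x₂ := (h₃ s₂).symm.trans (congrArg Prod.snd h)
    simp only [Category.id_comp, Category.comp_id] at h₁
    refine ⟨s₁, ⟨h₁, Prod.ext (Category.id_comp _)
      ((congr(x₂ ≫ $(f.map_id k)).trans (Category.comp_id _)).trans h₂.symm)⟩, fun t ht => ?_⟩
    have : 𝟙 a ≫ t = s₁ := congrArg Prod.fst ht.2
    simpa using this

lemma rEx_prod (u : A ⥤ B) {K K' : Type w} [SmallCategory K] [SmallCategory K'] (f : K' ⥤ K) :
    D.REx (prodSq' u f) := by
  refine rEx_of_family _ _ _ _ _ (fun k => sectLSq' u k) (fun k => rEx_sectL u k) (fun k => ?_)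
    (fun m hm => isIso_of_sectL m hm)
  refine rEx_of_exists _ fun b ⟨a, k'⟩ ⟨x₁, x₂⟩ => ?_
  change b ⟶ u.obj a at x₁
  change f.obj k ⟶ k' at x₂
  refine ⟨a, x₁, (𝟙 a, x₂), Prod.ext ?_ ?_, fun e' y' ⟨s₁, s₂⟩ h => ?_⟩
  · change x₁ ≫ (𝟙 (u.obj a) ≫ 𝟙 (u.obj a)) ≫ u.map (𝟙 a) = x₁
    simp
  · change f.map (𝟙 k) ≫ (f.map (𝟙 k) ≫ 𝟙 _) ≫ x₂ = x₂
    simp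
  · change e' ⟶ a at s₁
    change f.obj k ⟶ k' at s₂
    have h₁ : y' ≫ (𝟙 (u.obj e') ≫ 𝟙 (u.obj e')) ≫ u.map s₁ = x₁ := congrArg Prod.fst h
    have h₃ (z : f.obj k ⟶ k') : f.map (𝟙 k) ≫ (f.map (𝟙 k) ≫ 𝟙 _) ≫ z = z := by simp
    have h₂ : s₂ = x₂ := (h₃ s₂).symm.trans (congrArg Prod.snd h)
    simp only [Category.id_comp, Category.comp_id] at h₁
    refine ⟨s₁, ⟨h₁, Prod.ext (Category.comp_id _)
      ((congr($(f.map_id k) ≫ x₂).trans (Category.id_comp _)).trans h₂.symm)⟩, fun t ht => ?_⟩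
    have : t ≫ 𝟙 a = s₁ := congrArg Prod.fst ht.2
    simpa using this

/-- The square comparing `b × K` and `b` at an object of `K`. -/
abbrev ptSq {K : Type w} [SmallCategory K] (b : B) (k : K) :
    pt k ⋙ Prod.sectR b K ⟶ pt b ⋙ Prod.sectL B k where
  app _ := 𝟙 _
  naturality _ _ _ := (Category.comp_id _).trans (Category.id_comp _).symm

/-- The square comparing `b` and `b × K` at an object of `K`. -/
abbrev ptSq' {K : Type w} [SmallCategory K] (b : B) (k : K) :
    pt b ⋙ Prod.sectL B k ⟶ pt k ⋙ Prod.sectR b K where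
  app _ := 𝟙 _
  naturality _ _ _ := (Category.comp_id _).trans (Category.id_comp _).symm

lemma lEx_pt {K : Type w} [SmallCategory K] (b : B) (k : K) : D.LEx (ptSq b k) := by
  refine lEx_of_exists _ fun b' k' ⟨x₁, x₂⟩ => ?_
  change b ⟶ b' at x₁
  change k' ⟶ k at x₂
  refine ⟨⟨⟨⟩⟩, x₁, x₂, Prod.ext ?_ ?_, fun e' y' s' h => ?_⟩
  · change 𝟙 b ≫ 𝟙 b ≫ x₁ = x₁
    simp
  · change x₂ ≫ 𝟙 k ≫ 𝟙 k = x₂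
    simp
  · change b ⟶ b' at y'
    change k' ⟶ k at s'
    have h₁ : 𝟙 b ≫ 𝟙 b ≫ y' = x₁ := congrArg Prod.fst h
    have h₂ : s' ≫ 𝟙 k ≫ 𝟙 k = x₂ := congrArg Prod.snd h
    simp only [Category.id_comp, Category.comp_id] at h₁ h₂
    exact ⟨eqToHom (Subsingleton.elim _ _), ⟨(Category.id_comp _).trans h₁,
      (Category.comp_id _).trans h₂.symm⟩, fun t ht => Subsingleton.elim _ _⟩

lemma rEx_pt {K : Type w} [SmallCategory K] (b : B) (k : K) : D.REx (ptSq' b k) := by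
  refine rEx_of_exists _ fun b' k' ⟨x₁, x₂⟩ => ?_
  change b' ⟶ b at x₁
  change k ⟶ k' at x₂
  refine ⟨⟨⟨⟩⟩, x₁, x₂, Prod.ext ?_ ?_, fun e' y' s' h => ?_⟩
  · change x₁ ≫ 𝟙 b ≫ 𝟙 b = x₁
    simp
  · change 𝟙 k ≫ 𝟙 k ≫ x₂ = x₂
    simp
  · change b' ⟶ b at y'
    change k ⟶ k' at s'
    have h₁ : y' ≫ 𝟙 b ≫ 𝟙 b = x₁ := congrArg Prod.fst h
    have h₂ : 𝟙 k ≫ 𝟙 k ≫ s' = x₂ := congrArg Prod.snd h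
    simp only [Category.id_comp, Category.comp_id] at h₁ h₂
    exact ⟨eqToHom (Subsingleton.elim _ _), ⟨(Category.comp_id _).trans h₁,
      (Category.id_comp _).trans h₂.symm⟩, fun t ht => Subsingleton.elim _ _⟩

/-- The square exchanging `b × K` and `B × f`. -/
abbrev sectRProdSq {K K' : Type w} [SmallCategory K] [SmallCategory K'] (b : B) (f : K' ⥤ K) :
    f ⋙ Prod.sectR b K ⟶ Prod.sectR b K' ⋙ (𝟭 B).prod f where
  app _ := 𝟙 _
  naturality _ _ _ := (Category.comp_id _).trans (Category.id_comp _).symm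

/-- The square exchanging `B × f` and `b × K`. -/
abbrev sectRProdSq' {K K' : Type w} [SmallCategory K] [SmallCategory K'] (b : B) (f : K' ⥤ K) :
    Prod.sectR b K' ⋙ (𝟭 B).prod f ⟶ f ⋙ Prod.sectR b K where
  app _ := 𝟙 _
  naturality _ _ _ := (Category.comp_id _).trans (Category.id_comp _).symm

lemma lEx_sectR_prod {K K' : Type w} [SmallCategory K] [SmallCategory K'] (b : B) (f : K' ⥤ K) :
    D.LEx (sectRProdSq b f) := by
  refine lEx_of_family _ _ _ _ _ (fun k => ptSq b k) (fun k => lEx_pt b k) (fun k => ?_)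
    (fun m hm => isIso_of_sectL m hm)
  refine lEx_of_exists _ fun b' k' ⟨x₁, x₂⟩ => ?_
  change b ⟶ b' at x₁
  change k' ⟶ f.obj k at x₂
  refine ⟨⟨⟨⟩⟩, x₁, x₂, Prod.ext ?_ ?_, fun e' y' s' h => ?_⟩
  · change 𝟙 b ≫ (𝟙 b ≫ 𝟙 b) ≫ x₁ = x₁
    simp
  · change x₂ ≫ (𝟙 _ ≫ f.map (𝟙 k)) ≫ f.map (𝟙 k) = x₂
    simp
  · change b ⟶ b' at y'
    change k' ⟶ f.obj k at s'
    have h₁ : 𝟙 b ≫ (𝟙 b ≫ 𝟙 b) ≫ y' = x₁ := congrArg Prod.fst h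
    have h₃ (z : k' ⟶ f.obj k) : z ≫ (𝟙 _ ≫ f.map (𝟙 k)) ≫ f.map (𝟙 k) = z := by simp
    have h₂ : s' = x₂ := (h₃ s').symm.trans (congrArg Prod.snd h)
    simp only [Category.id_comp, Category.comp_id] at h₁
    exact ⟨eqToHom (Subsingleton.elim _ _), ⟨(Category.id_comp _).trans h₁,
      (congr(x₂ ≫ $(f.map_id k)).trans (Category.comp_id _)).trans h₂.symm⟩,
      fun t ht => Subsingleton.elim _ _⟩

lemma rEx_sectR_prod {K K' : Type w} [SmallCategory K] [SmallCategory K'] (b : B) (f : K' ⥤ K) :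
    D.REx (sectRProdSq' b f) := by
  refine rEx_of_family _ _ _ _ _ (fun k => ptSq' b k) (fun k => rEx_pt b k) (fun k => ?_)
    (fun m hm => isIso_of_sectL m hm)
  refine rEx_of_exists _ fun b' k' ⟨x₁, x₂⟩ => ?_
  change b' ⟶ b at x₁
  change f.obj k ⟶ k' at x₂
  refine ⟨⟨⟨⟩⟩, x₁, x₂, Prod.ext ?_ ?_, fun e' y' s' h => ?_⟩
  · change x₁ ≫ (𝟙 b ≫ 𝟙 b) ≫ 𝟙 b = x₁
    simp
  · change f.map (𝟙 k) ≫ (f.map (𝟙 k) ≫ 𝟙 _) ≫ x₂ = x₂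
    simp
  · change b' ⟶ b at y'
    change f.obj k ⟶ k' at s'
    have h₁ : y' ≫ (𝟙 b ≫ 𝟙 b) ≫ 𝟙 b = x₁ := congrArg Prod.fst h
    have h₃ (z : f.obj k ⟶ k') : f.map (𝟙 k) ≫ (f.map (𝟙 k) ≫ 𝟙 _) ≫ z = z := by simp
    have h₂ : s' = x₂ := (h₃ s').symm.trans (congrArg Prod.snd h)
    simp only [Category.comp_id] at h₁
    exact ⟨eqToHom (Subsingleton.elim _ _), ⟨(Category.comp_id _).trans h₁,
      (congr($(f.map_id k) ≫ x₂).trans (Category.id_comp _)).trans h₂.symm⟩,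
      fun t ht => Subsingleton.elim _ _⟩

/-- This is Der4 for the shift of D by K, whose comma squares are products of K with those of D. -/
lemma lEx_prod_comma (K : Type w) [SmallCategory K] (f : A ⥤ B) (b : B) :
    D.LEx (p := (𝟭 K).prod (Comma.fst f (pt b))) (f := (𝟭 K).prod f)
      (q := (𝟭 K).prod (Comma.snd f (pt b))) (g := (𝟭 K).prod (pt b))
      (NatTrans.prod (𝟙 (𝟭 K)) (Comma.natTrans f (pt b))) := by
  refine lEx_of_exists _ fun ⟨k, z⟩ ⟨k', a⟩ ⟨x₁, x₂⟩ => ?_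
  change k' ⟶ k at x₁
  change f.obj a ⟶ b at x₂
  let e : Comma f (pt b) := ⟨a, z, x₂⟩
  refine ⟨(k', e), (x₁, 𝟙 z), (𝟙 k', 𝟙 a), Prod.ext ?_ ?_, fun ⟨k₁, e'⟩ ⟨y₁, y₂⟩ ⟨s₁, s₂⟩ h => ?_⟩
  · change 𝟙 k' ≫ 𝟙 k' ≫ x₁ = x₁
    simp
  · change f.map (𝟙 a) ≫ x₂ ≫ 𝟙 b = x₂
    simp
  · change k₁ ⟶ k at y₁
    change e'.right ⟶ z at y₂
    change k' ⟶ k₁ at s₁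
    change a ⟶ e'.left at s₂
    have h₁ : s₁ ≫ 𝟙 k₁ ≫ y₁ = x₁ := congrArg Prod.fst h
    have h₂ : f.map s₂ ≫ (show f.obj e'.left ⟶ b from e'.hom) ≫ 𝟙 b = x₂ := congrArg Prod.snd h
    simp only [Category.id_comp, Category.comp_id] at h₁ h₂
    refine ⟨(s₁, ⟨s₂, eqToHom (Subsingleton.elim _ _), h₂.trans (Category.comp_id _).symm⟩),
      ⟨Prod.ext h₁ (Subsingleton.elim _ _), Prod.ext (Category.id_comp _) (Category.id_comp _)⟩,
      fun ⟨t₁, t₂⟩ ht => Prod.ext ?_ ?_⟩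
    · exact (Category.id_comp _).symm.trans (congrArg Prod.fst ht.2)
    · apply CommaMorphism.ext
      · exact (Category.id_comp _).symm.trans (congrArg Prod.snd ht.2)
      · exact Subsingleton.elim _ _

lemma rEx_prod_comma (K : Type w) [SmallCategory K] (f : A ⥤ B) (b : B) :
    D.REx (p := (𝟭 K).prod (Comma.fst (pt b) f)) (f := (𝟭 K).prod (pt b))
      (q := (𝟭 K).prod (Comma.snd (pt b) f)) (g := (𝟭 K).prod f)
      (NatTrans.prod (𝟙 (𝟭 K)) (Comma.natTrans (pt b) f)) := by
  refine rEx_of_exists _ fun ⟨k, z⟩ ⟨k', a⟩ ⟨x₁, x₂⟩ => ?_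
  change k ⟶ k' at x₁
  change b ⟶ f.obj a at x₂
  let e : Comma (pt b) f := ⟨z, a, x₂⟩
  refine ⟨(k', e), (x₁, 𝟙 z), (𝟙 k', 𝟙 a), Prod.ext ?_ ?_, fun ⟨k₁, e'⟩ ⟨y₁, y₂⟩ ⟨s₁, s₂⟩ h => ?_⟩
  · change x₁ ≫ 𝟙 k' ≫ 𝟙 k' = x₁
    simp
  · change 𝟙 b ≫ x₂ ≫ f.map (𝟙 a) = x₂
    simp
  · change k ⟶ k₁ at y₁
    change z ⟶ e'.left at y₂
    change k₁ ⟶ k' at s₁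
    change e'.right ⟶ a at s₂
    have h₁ : y₁ ≫ 𝟙 k₁ ≫ s₁ = x₁ := congrArg Prod.fst h
    have h₂ : 𝟙 b ≫ (show b ⟶ f.obj e'.right from e'.hom) ≫ f.map s₂ = x₂ := congrArg Prod.snd h
    simp only [Category.id_comp] at h₁ h₂
    refine ⟨(s₁, ⟨eqToHom (Subsingleton.elim _ _), s₂, (Category.id_comp _).trans h₂.symm⟩),
      ⟨Prod.ext h₁ (Subsingleton.elim _ _), Prod.ext (Category.comp_id _) (Category.comp_id _)⟩,
      fun ⟨t₁, t₂⟩ ht => Prod.ext ?_ ?_⟩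
    · exact (Category.comp_id _).symm.trans (congrArg Prod.fst ht.2)
    · apply CommaMorphism.ext
      · exact Subsingleton.elim _ _
      · exact (Category.comp_id _).symm.trans (congrArg Prod.snd ht.2)

end

end Prederivator

section Universal

universe v₁ v₂ v₃ u₁ u₂ u₃

variable {𝒜 : Type u₁} [Category.{v₁} 𝒜] {ℬ : Type u₂} [Category.{v₂} ℬ]
  {𝒞 : Type u₃} [Category.{v₃} 𝒞]

/-- Cancellation of an inner extension: if extending along R and then along R' is universal in total
and in the first stage, it is universal in the second stage. -/
lemma LUniv.of_comp {R : ℬ ⥤ 𝒜} {R' : 𝒞 ⥤ ℬ} {Y : 𝒜} {V : ℬ} {θ : Y ⟶ R.obj V} (hθ : LUniv R θ)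
    {Z : 𝒞} {η : V ⟶ R'.obj Z} (h : LUniv (R' ⋙ R) (Y := Y) (V := Z) (θ ≫ R.map η)) :
    LUniv R' η := by
  intro W
  refine (Function.Bijective.of_comp_iff' (hθ _) _).1 ?_
  have e : (fun g : Z ⟶ W => (θ ≫ R.map η) ≫ (R' ⋙ R).map g) =
      (fun g => θ ≫ R.map g) ∘ (fun g => η ≫ R'.map g) := by
    funext g
    simp
  exact e ▸ h W

lemma RUniv.of_comp {R : ℬ ⥤ 𝒜} {R' : 𝒞 ⥤ ℬ} {Y : 𝒜} {V : ℬ} {θ : R.obj V ⟶ Y} (hθ : RUniv R θ)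
    {Z : 𝒞} {η : R'.obj Z ⟶ V} (h : RUniv (R' ⋙ R) (Y := Y) (V := Z) (R.map η ≫ θ)) :
    RUniv R' η := by
  intro W
  refine (Function.Bijective.of_comp_iff' (hθ _) _).1 ?_
  have e : (fun g : W ⟶ Z => (R' ⋙ R).map g ≫ R.map η ≫ θ) =
      (fun g => R.map g ≫ θ) ∘ (fun g => R'.map g ≫ η) := by
    funext g
    simp
  exact e ▸ h W

lemma LUniv.isIso_of_iso_id {R : 𝒜 ⥤ 𝒜} (e : R ≅ 𝟭 𝒜) {Y V : 𝒜} {θ : Y ⟶ R.obj V}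
    (h : LUniv R θ) : IsIso θ := by
  have h₁ : LUniv (𝟭 𝒜) (θ ≫ e.hom.app V) := h.of_natIso e
  have h₂ : LUniv (𝟭 𝒜) (𝟙 Y) := fun W => by
    convert Function.bijective_id
    simp
  have : IsIso (θ ≫ e.hom.app V) := h₂.isIso h₁ (Category.id_comp _)
  exact IsIso.of_isIso_comp_right θ (e.hom.app V)

lemma RUniv.isIso_of_iso_id {R : 𝒜 ⥤ 𝒜} (e : R ≅ 𝟭 𝒜) {Y V : 𝒜} {θ : R.obj V ⟶ Y}
    (h : RUniv R θ) : IsIso θ := by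
  have h₁ : RUniv (𝟭 𝒜) (e.inv.app V ≫ θ) := h.of_natIso e.symm
  have h₂ : RUniv (𝟭 𝒜) (𝟙 Y) := fun W => by
    convert Function.bijective_id
    simp
  have : IsIso (e.inv.app V ≫ θ) := h₂.isIso h₁ (Category.comp_id _)
  exact IsIso.of_isIso_comp_left (e.inv.app V) θ

end Universal

namespace Prederivator

/-! ### Diagrams that are Kan extensions of their restrictions. -/

section

variable {A B C E : Type w} [SmallCategory A] [SmallCategory B] [SmallCategory C]
  [SmallCategory E] {D : Prederivator.{w, v, u}}

variable (D) in
/-- Evaluation of a restricted diagram. -/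
def evalRes (f : A ⥤ B) (a : A) (X : D.Diag B) :
    (D.eval a).obj ((D.res f).obj X) ≅ (D.eval (f.obj a)).obj X :=
  (D.cmp (pt a) f X).symm ≪≫ (D.resIso (NatIso.ofComponents (F := pt a ⋙ f)
    (G := pt (f.obj a)) (fun _ => Iso.refl _) (fun _ => by simp))).app X

lemma isIso_eval_res_iff (f : A ⥤ B) (a : A) {X Y : D.Diag B} (m : X ⟶ Y) :
    IsIso ((D.eval a).map ((D.res f).map m)) ↔ IsIso ((D.eval (f.obj a)).map m) := by
  have h : (D.eval a).map ((D.res f).map m) ≫ (D.evalRes f a Y).hom =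
      (D.evalRes f a X).hom ≫ (D.eval (f.obj a)).map m := by
    dsimp only [evalRes, Iso.trans_hom, Iso.symm_hom]
    rw [reassoc_of% cmp_inv_naturality, Category.assoc]
    exact congr(_ ≫ $((D.resIso (NatIso.ofComponents (F := pt a ⋙ f)
      (G := pt (f.obj a)) (fun _ => Iso.refl _) (fun _ => by simp))).hom.naturality m))
  constructor
  · intro
    rw [← Iso.inv_comp_eq] at h
    rw [← h]
    infer_instance
  · intro
    rw [← Iso.eq_comp_inv] at h
    rw [h]
    infer_instance

variable (D) in
/-- `X` is a left Kan extension of its restriction along `f`. -/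
def LExt (f : A ⥤ B) (X : D.Diag B) : Prop := LUniv (D.res f) (𝟙 ((D.res f).obj X))

variable (D) in
/-- `X` is a right Kan extension of its restriction along `f`. -/
def RExt (f : A ⥤ B) (X : D.Diag B) : Prop := RUniv (D.res f) (𝟙 ((D.res f).obj X))

lemma LUniv.lExt {f : A ⥤ B} {Y : D.Diag A} {X : D.Diag B} {θ : Y ⟶ (D.res f).obj X}
    (h : LUniv (D.res f) θ) [IsIso θ] : D.LExt f X := by
  have := h.comp_left (inv θ)
  rwa [IsIso.inv_hom_id] at this

lemma RUniv.rExt {f : A ⥤ B} {Y : D.Diag A} {X : D.Diag B} {θ : (D.res f).obj X ⟶ Y}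
    (h : RUniv (D.res f) θ) [IsIso θ] : D.RExt f X := by
  have := h.comp_right (inv θ)
  rwa [IsIso.hom_inv_id] at this

lemma LExt.of_iso {f : A ⥤ B} {X Y : D.Diag B} (h : D.LExt f X) (e : X ≅ Y) : D.LExt f Y := by
  have h₁ := h.comp_map e.hom
  rw [Category.id_comp] at h₁
  exact LUniv.lExt h₁

lemma RExt.of_iso {f : A ⥤ B} {X Y : D.Diag B} (h : D.RExt f X) (e : X ≅ Y) : D.RExt f Y := by
  have h₁ := h.map_comp e.inv
  rw [Category.comp_id] at h₁
  exact RUniv.rExt h₁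

lemma LExt.isIso {f : A ⥤ B} {X Y : D.Diag B} (hX : D.LExt f X) (hY : D.LExt f Y) (m : X ⟶ Y)
    [IsIso ((D.res f).map m)] : IsIso m :=
  LUniv.isIso hX (hY.comp_left ((D.res f).map m)) ((Category.id_comp _).trans
    (Category.comp_id _).symm)

lemma RExt.isIso {f : A ⥤ B} {X Y : D.Diag B} (hX : D.RExt f X) (hY : D.RExt f Y) (m : X ⟶ Y)
    [IsIso ((D.res f).map m)] : IsIso m :=
  RUniv.isIso hY (hX.comp_right ((D.res f).map m)) ((Category.comp_id _).trans
    (Category.id_comp _).symm)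

instance {p : E ⥤ A} {f : A ⥤ C} {q : E ⥤ B} {g : B ⥤ C} (α : p ⋙ f ⟶ q ⋙ g) [IsIso α]
    {X : D.Diag A} {Z : D.Diag C} (η : X ⟶ (D.res f).obj Z) [IsIso η] : IsIso (D.sqL α η) := by
  dsimp only [sqL, pullL]
  infer_instance

instance {p : E ⥤ A} {f : A ⥤ C} {q : E ⥤ B} {g : B ⥤ C} (α : p ⋙ f ⟶ q ⋙ g) [IsIso α]
    {X : D.Diag B} {Z : D.Diag C} (η : (D.res g).obj Z ⟶ X) [IsIso η] : IsIso (D.sqR α η) := by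
  dsimp only [sqR, pullR]
  infer_instance

lemma LExt.baseChange {p : E ⥤ A} {f : A ⥤ C} {q : E ⥤ B} {g : B ⥤ C} {α : p ⋙ f ⟶ q ⋙ g}
    [IsIso α] (hα : D.LEx α) {Z : D.Diag C} (h : D.LExt f Z) : D.LExt q ((D.res g).obj Z) :=
  LUniv.lExt (lEx_iff.1 hα _ h)

lemma RExt.baseChange {p : E ⥤ A} {f : A ⥤ C} {q : E ⥤ B} {g : B ⥤ C} {α : p ⋙ f ⟶ q ⋙ g}
    [IsIso α] (hα : D.REx α) {Z : D.Diag C} (h : D.RExt g Z) : D.RExt p ((D.res f).obj Z) :=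
  RUniv.rExt (rEx_iff.1 hα _ h)

variable [D.IsDerivator]

lemma LExt.exists_desc (f : A ⥤ B) (X : D.Diag B) : ∃ (V : D.Diag B)
    (θ : (D.res f).obj X ⟶ (D.res f).obj V) (m : V ⟶ X), LUniv (D.res f) θ ∧
      θ ≫ (D.res f).map m = 𝟙 _ := by
  obtain ⟨V, θ, hθ⟩ := LUniv.exists_of_isRightAdjoint (D.res f) ((D.res f).obj X)
  obtain ⟨m, hm⟩ := hθ.exists_desc (𝟙 ((D.res f).obj X))
  exact ⟨V, θ, m, hθ, hm⟩

lemma RExt.exists_lift (f : A ⥤ B) (X : D.Diag B) : ∃ (V : D.Diag B)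
    (θ : (D.res f).obj V ⟶ (D.res f).obj X) (m : X ⟶ V), RUniv (D.res f) θ ∧
      (D.res f).map m ≫ θ = 𝟙 _ := by
  obtain ⟨V, θ, hθ⟩ := RUniv.exists_of_isLeftAdjoint (D.res f) ((D.res f).obj X)
  obtain ⟨m, hm⟩ := hθ.exists_lift (𝟙 ((D.res f).obj X))
  exact ⟨V, θ, m, hθ, hm⟩

/-- Here the counit m from the left extension of f^* X to X is tested on a jointly conservative
family. On each member it compares two universal arrows, one by base change and one by hypothesis.
-/
lemma LExt.of_family {f : A ⥤ B} {X : D.Diag B} {ι : Type*} (K B' : ι → Type w)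
    [∀ i, SmallCategory (K i)] [∀ i, SmallCategory (B' i)]
    (p : ∀ i, K i ⥤ A) (q : ∀ i, K i ⥤ B' i) (g : ∀ i, B' i ⥤ B)
    (α : ∀ i, p i ⋙ f ⟶ q i ⋙ g i) [∀ i, IsIso (α i)] (h₁ : ∀ i, D.LEx (α i))
    (hc : ∀ {V W : D.Diag B} (m : V ⟶ W), (∀ i, IsIso ((D.res (g i)).map m)) → IsIso m)
    (h : ∀ i, D.LExt (q i) ((D.res (g i)).obj X)) : D.LExt f X := by
  obtain ⟨V, θ, m, hθ, hm⟩ := LExt.exists_desc f X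
  have : IsIso m := hc m fun i => by
    have e₁ := lEx_iff.1 (h₁ i) θ hθ
    have e₂ := (h i).comp_left (D.sqL (α i) (𝟙 ((D.res f).obj X)))
    refine e₁.isIso e₂ ?_
    rw [Category.comp_id, ← sqL_comp_map, hm]
  have := hθ.comp_map m
  rwa [hm] at this

lemma RExt.of_family {f : A ⥤ B} {X : D.Diag B} {ι : Type*} (K B' : ι → Type w)
    [∀ i, SmallCategory (K i)] [∀ i, SmallCategory (B' i)]
    (p : ∀ i, K i ⥤ A) (q : ∀ i, K i ⥤ B' i) (g : ∀ i, B' i ⥤ B)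
    (α : ∀ i, q i ⋙ g i ⟶ p i ⋙ f) [∀ i, IsIso (α i)] (h₁ : ∀ i, D.REx (α i))
    (hc : ∀ {V W : D.Diag B} (m : V ⟶ W), (∀ i, IsIso ((D.res (g i)).map m)) → IsIso m)
    (h : ∀ i, D.RExt (q i) ((D.res (g i)).obj X)) : D.RExt f X := by
  obtain ⟨V, θ, m, hθ, hm⟩ := RExt.exists_lift f X
  have : IsIso m := hc m fun i => by
    have e₁ := rEx_iff.1 (h₁ i) θ hθ
    have e₂ := (h i).comp_right (D.sqR (α i) (𝟙 ((D.res f).obj X)))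
    refine e₁.isIso e₂ ?_
    rw [Category.id_comp, ← sqR_map_comp, hm]
  have := hθ.map_comp m
  rwa [hm] at this

/-! ### Fully faithful functors -/

omit [D.IsDerivator] in
lemma isIso_of_isIso_res_id {X Y : D.Diag A} (m : X ⟶ Y) [IsIso ((D.res (𝟭 A)).map m)] :
    IsIso m := by
  have h := D.rid_naturality m
  rw [← Iso.inv_comp_eq] at h
  rw [← h]
  infer_instance

/-- For f fully faithful, the square with sides f and f and two identities is exact, since preimages
under f give the initial factorisations. Base change along it turns θ into a universal arrow to a
functor isomorphic to the identity. -/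
lemma LUniv.isIso_of_fullyFaithful (f : A ⥤ B) [f.Full] [f.Faithful] {Y : D.Diag A} {V : D.Diag B}
    {θ : Y ⟶ (D.res f).obj V} (h : LUniv (D.res f) θ) : IsIso θ := by
  have hα : D.LEx (p := 𝟭 A) (f := f) (q := 𝟭 A) (g := f) (𝟙 (𝟭 A ⋙ f)) := by
    refine lEx_of_exists _ fun b a x => ⟨a, f.preimage x, 𝟙 a, by simp, fun e' y' s' h => ?_⟩
    refine ⟨s', ⟨f.map_injective ?_, Category.id_comp _⟩, ?_⟩
    · simpa using h
    · rintro t ⟨-, ht⟩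
      simpa using ht
  have h₁ : IsIso (D.sqL (p := 𝟭 A) (q := 𝟭 A) (g := f) (𝟙 (𝟭 A ⋙ f)) θ) :=
    (lEx_iff.1 hα θ h).isIso_of_iso_id (Cat.Hom.toNatIso (D.mapId (op (Cat.of A))))
  dsimp only [sqL, pullL] at h₁
  have h₂ : IsIso ((D.res (𝟭 A)).map θ) := by
    have e : IsIso ((D.res (𝟭 A)).map θ ≫ (D.cmp (𝟭 A) f V).inv ≫
      D.tr (𝟙 (𝟭 A ⋙ f)) V ≫ (D.cmp (𝟭 A) f V).hom) := by simpa using h₁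
    exact IsIso.of_isIso_comp_right _ ((D.cmp (𝟭 A) f V).inv ≫
      D.tr (𝟙 (𝟭 A ⋙ f)) V ≫ (D.cmp (𝟭 A) f V).hom)
  exact isIso_of_isIso_res_id θ

lemma RUniv.isIso_of_fullyFaithful (f : A ⥤ B) [f.Full] [f.Faithful] {Y : D.Diag A} {V : D.Diag B}
    {θ : (D.res f).obj V ⟶ Y} (h : RUniv (D.res f) θ) : IsIso θ := by
  have hα : D.REx (p := 𝟭 A) (f := f) (q := 𝟭 A) (g := f) (𝟙 (𝟭 A ⋙ f)) := by
    refine rEx_of_exists _ fun b a x => ⟨a, f.preimage x, 𝟙 a, by simp, fun e' y' s' h => ?_⟩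
    refine ⟨s', ⟨f.map_injective ?_, Category.comp_id _⟩, ?_⟩
    · simpa using h
    · rintro t ⟨-, ht⟩
      simpa using ht
  have h₁ : IsIso (D.sqR (p := 𝟭 A) (q := 𝟭 A) (g := f) (𝟙 (𝟭 A ⋙ f)) θ) :=
    (rEx_iff.1 hα θ h).isIso_of_iso_id (Cat.Hom.toNatIso (D.mapId (op (Cat.of A))))
  dsimp only [sqR, pullR] at h₁
  have h₂ : IsIso ((D.res (𝟭 A)).map θ) := by
    have e : IsIso (((D.cmp (𝟭 A) f V).inv ≫ D.tr (𝟙 (𝟭 A ⋙ f)) V ≫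
      (D.cmp (𝟭 A) f V).hom) ≫ (D.res (𝟭 A)).map θ) := by simpa using h₁
    exact IsIso.of_isIso_comp_left ((D.cmp (𝟭 A) f V).inv ≫
      D.tr (𝟙 (𝟭 A ⋙ f)) V ≫ (D.cmp (𝟭 A) f V).hom) _
  exact isIso_of_isIso_res_id θ

lemma LUniv.lExt_of_fullyFaithful {f : A ⥤ B} [f.Full] [f.Faithful] {Y : D.Diag A} {V : D.Diag B}
    {θ : Y ⟶ (D.res f).obj V} (h : LUniv (D.res f) θ) : D.LExt f V :=
  have := LUniv.isIso_of_fullyFaithful f h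
  LUniv.lExt h

lemma RUniv.rExt_of_fullyFaithful {f : A ⥤ B} [f.Full] [f.Faithful] {Y : D.Diag A} {V : D.Diag B}
    {θ : (D.res f).obj V ⟶ Y} (h : RUniv (D.res f) θ) : D.RExt f V :=
  have := RUniv.isIso_of_fullyFaithful f h
  RUniv.rExt h

lemma lExt_iff_essImage (f : A ⥤ B) [f.Full] [f.Faithful] (X : D.Diag B) :
    D.LExt f X ↔ (D.lan f).essImage X := by
  let adj := Adjunction.ofIsRightAdjoint (D.res f)
  constructor
  · intro h
    have : IsIso (adj.counit.app X) := (LUniv.id_iff_counit adj X).1 h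
    exact ⟨_, ⟨asIso (adj.counit.app X)⟩⟩
  · rintro ⟨Y, ⟨e⟩⟩
    exact (LUniv.lExt_of_fullyFaithful (LUniv.of_adj adj Y)).of_iso e

lemma rExt_iff_essImage (f : A ⥤ B) [f.Full] [f.Faithful] (X : D.Diag B) :
    D.RExt f X ↔ (D.ran f).essImage X := by
  let adj := Adjunction.ofIsLeftAdjoint (D.res f)
  constructor
  · intro h
    have : IsIso (adj.unit.app X) := (RUniv.id_iff_unit adj X).1 h
    exact ⟨_, ⟨(asIso (adj.unit.app X)).symm⟩⟩
  · rintro ⟨Y, ⟨e⟩⟩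
    exact (RUniv.rExt_of_fullyFaithful (RUniv.of_adj adj Y)).of_iso e

/-! ### Empty categories -/

variable (D) in
-- Der1 for the empty family says that the value at the empty coproduct is a terminal category. An
-- arbitrary empty K is compared with that coproduct by the unique functors in both directions.
lemma hom_pempty (K : Type w) [SmallCategory K] [IsEmpty K] (X Y : D.Diag K) :
    Nonempty (Unique (X ⟶ Y)) := by
  let S := Σ i : PEmpty.{w + 1}, (fun _ => Pt.{w}) i
  have hS (Z W : D.Diag S) : Nonempty (Unique (Z ⟶ W)) := by
    have := IsDerivator.der1 (D := D) PEmpty.{w + 1} (fun _ => Pt.{w})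
    let e := (Functor.FullyFaithful.ofFullyFaithful
      (Functor.pi' (fun i => D.res (Sigma.incl (C := fun _ : PEmpty.{w + 1} => Pt.{w}) i)))).homEquiv
        (X := Z) (Y := W)
    exact ⟨⟨⟨e.symm fun i => i.elim⟩, fun f => e.injective (funext fun i => i.elim)⟩⟩
  let F : K ⥤ S := { obj := fun k => isEmptyElim k, map := fun {k} => isEmptyElim k,
                     map_id := fun k => isEmptyElim k, map_comp := fun {k} => isEmptyElim k }
  let G : S ⥤ K := { obj := fun k => k.1.elim, map := fun {k} => k.1.elim,
                     map_id := fun k => k.1.elim, map_comp := fun {k} => k.1.elim }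
  let e : F ⋙ G ≅ 𝟭 K := NatIso.ofComponents (fun k => isEmptyElim k) (fun {k} => isEmptyElim k)
  let E : D.res G ⋙ D.res F ≅ 𝟭 _ := (D.resComp F G).symm ≪≫ D.resIso e ≪≫
    Cat.Hom.toNatIso (D.mapId (op (Cat.of K)))
  obtain ⟨U⟩ := hS ((D.res G).obj X) ((D.res G).obj Y)
  refine ⟨⟨⟨E.inv.app X ≫ (D.res F).map default ≫ E.hom.app Y⟩, fun f => ?_⟩⟩
  have h := E.hom.naturality f
  rw [← cancel_epi (E.hom.app X)]
  refine h.symm.trans ?_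
  change (D.res F).map ((D.res G).map f) ≫ _ = _
  rw [U.eq_default ((D.res G).map f)]
  exact (E.hom_inv_id_app_assoc X _).symm

/-- The comma category f / b is empty, so the value at b is a left extension from an empty category
and has exactly one arrow to every object. -/
lemma LExt.isInitial {f : A ⥤ B} {X : D.Diag B} (h : D.LExt f X) (b : B)
    (hb : ∀ a, IsEmpty (f.obj a ⟶ b)) : Nonempty (Limits.IsInitial ((D.eval b).obj X)) := by
  have : IsEmpty (Comma f (pt b)) := ⟨fun c => (hb c.left).false c.hom⟩
  have h₁ := lEx_iff.1 (lEx_comma (D := D) f b) _ h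
  refine ⟨@Limits.IsInitial.ofUnique _ _ _ fun W => ?_⟩
  have := (D.hom_pempty (Comma f (pt b)) ((D.res (Comma.fst f (pt b))).obj ((D.res f).obj X))
    ((D.res (Comma.snd f (pt b))).obj W)).some
  exact (Equiv.ofBijective _ (h₁ W)).unique

lemma RExt.isTerminal {f : A ⥤ B} {X : D.Diag B} (h : D.RExt f X) (b : B)
    (hb : ∀ a, IsEmpty (b ⟶ f.obj a)) : Nonempty (Limits.IsTerminal ((D.eval b).obj X)) := by
  have : IsEmpty (Comma (pt b) f) := ⟨fun c => (hb c.right).false c.hom⟩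
  have h₁ := rEx_iff.1 (rEx_comma (D := D) f b) _ h
  refine ⟨@Limits.IsTerminal.ofUnique _ _ _ fun W => ?_⟩
  have := (D.hom_pempty (Comma (pt b) f) ((D.res (Comma.fst (pt b) f)).obj W)
    ((D.res (Comma.snd (pt b) f)).obj ((D.res f).obj X))).some
  exact (Equiv.ofBijective _ (h₁ W)).unique

end

end Prederivator

/-! ### Posets as shapes; pushouts in left extended and pullbacks in right extended diagrams. -/

namespace Shape

variable {P Q : Type} [Preorder P] [Preorder Q]

lemma le {x y : Shape.{w} P} (f : x ⟶ y) : x.down ≤ y.down := leOfHom (X := ULift P) f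

lemma map_full {f : P → Q} (hf : Monotone f) (h : ∀ x y, f x ≤ f y → x ≤ y) :
    (map.{w} f hf).Full where
  map_surjective {x y} g := ⟨homOfLE (h x.down y.down (le (P := Q) g)), Subsingleton.elim _ _⟩

instance {f : P → Q} (hf : Monotone f) : (map.{w} f hf).Faithful where
  map_injective _ := Subsingleton.elim _ _

instance {S T : Set P} (h : S ⊆ T) : (incl.{w} h).Full := map_full _ fun _ _ h => h

instance : (spanIncl.{w}).Full := map_full _ fun _ _ h => h

instance : (spanIncl.{w}).Faithful := inferInstanceAs (map _ _).Faithful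

instance : (cospanIncl.{w}).Full := map_full _ fun _ _ h => h

instance : (cospanIncl.{w}).Faithful := inferInstanceAs (map _ _).Faithful

end Shape

/-- The square `k` is a pushout for diagrams that are left Kan extensions along `u`. -/
structure IsPushoutFor {P Q : Type} [Preorder P] [Preorder Q] (u : P → Q) (k : Sq → Q) : Prop where
  monotone : Monotone k
  cover : ∀ a, u a ≤ k (1, 1) → u a ≤ k (1, 0) ∨ u a ≤ k (0, 1)
  inter : ∀ a, u a ≤ k (1, 0) → u a ≤ k (0, 1) → u a ≤ k (0, 0)

/-- The square `k` is a pullback for diagrams that are right Kan extensions along `u`. -/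
structure IsPullbackFor {P Q : Type} [Preorder P] [Preorder Q] (u : P → Q) (k : Sq → Q) : Prop where
  monotone : Monotone k
  cover : ∀ a, k (0, 0) ≤ u a → k (1, 0) ≤ u a ∨ k (0, 1) ≤ u a
  inter : ∀ a, k (1, 0) ≤ u a → k (0, 1) ≤ u a → k (1, 1) ≤ u a

lemma sq_cases (s : Sq) : s = (0, 0) ∨ s = (1, 0) ∨ s = (0, 1) ∨ s = (1, 1) := by
  obtain ⟨a, b⟩ := s
  fin_cases a <;> fin_cases b <;> simp

lemma span_cases (s : Span) : s = ⟨(0, 0), by decide⟩ ∨ s = ⟨(1, 0), by decide⟩ ∨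
    s = ⟨(0, 1), by decide⟩ := by
  obtain ⟨s, hs⟩ := s
  rcases sq_cases s with rfl | rfl | rfl | rfl
  all_goals simp at hs ⊢

lemma cospan_cases (s : Cospan) : s = ⟨(1, 1), by decide⟩ ∨ s = ⟨(1, 0), by decide⟩ ∨
    s = ⟨(0, 1), by decide⟩ := by
  obtain ⟨s, hs⟩ := s
  rcases sq_cases s with rfl | rfl | rfl | rfl
  all_goals simp at hs ⊢

/-- This is where both conditions enter: `cover` finds a vertex of the span lying above u a, and
`inter` excludes two incomparable minimal ones. -/
lemma IsPushoutFor.exists_least {P Q : Type} [Preorder P] [Preorder Q] {u : P → Q} {k : Sq → Q}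
    (h : IsPushoutFor u k) (a : P) (b : Sq) (hab : u a ≤ k b) :
    ∃ s : Span, u a ≤ k s.1 ∧ s.1 ≤ b ∧ ∀ s' : Span, u a ≤ k s'.1 → s'.1 ≤ b → s ≤ s' := by
  by_cases h₀ : u a ≤ k (0, 0)
  · refine ⟨⟨(0, 0), by decide⟩, h₀, ⟨Fin.zero_le _, Fin.zero_le _⟩, fun s' _ _ => ?_⟩
    exact ⟨Fin.zero_le _, Fin.zero_le _⟩
  by_cases h₁ : u a ≤ k (1, 0)
  · have h₂ : ¬ u a ≤ k (0, 1) := fun h₂ => h₀ (h.inter a h₁ h₂)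
    refine ⟨⟨(1, 0), by decide⟩, h₁, ?_, fun s' hs' _ => ?_⟩
    · rcases sq_cases b with rfl | rfl | rfl | rfl
      exacts [absurd hab h₀, le_rfl, absurd hab h₂, by decide]
    · rcases span_cases s' with rfl | rfl | rfl
      exacts [absurd hs' h₀, le_rfl, absurd hs' h₂]
  · have h₂ : u a ≤ k (0, 1) := by
      rcases sq_cases b with rfl | rfl | rfl | rfl
      exacts [absurd hab h₀, absurd hab h₁, hab, (h.cover a hab).resolve_left h₁]
    refine ⟨⟨(0, 1), by decide⟩, h₂, ?_, fun s' hs' _ => ?_⟩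
    · rcases sq_cases b with rfl | rfl | rfl | rfl
      exacts [absurd hab h₀, absurd hab h₁, le_rfl, by decide]
    · rcases span_cases s' with rfl | rfl | rfl
      exacts [absurd hs' h₀, absurd hs' h₁, le_rfl]

lemma IsPullbackFor.exists_greatest {P Q : Type} [Preorder P] [Preorder Q] {u : P → Q} {k : Sq → Q}
    (h : IsPullbackFor u k) (a : P) (b : Sq) (hab : k b ≤ u a) :
    ∃ s : Cospan, k s.1 ≤ u a ∧ b ≤ s.1 ∧ ∀ s' : Cospan, k s'.1 ≤ u a → b ≤ s'.1 → s' ≤ s := by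
  by_cases h₀ : k (1, 1) ≤ u a
  · refine ⟨⟨(1, 1), by decide⟩, h₀, ⟨Fin.le_last _, Fin.le_last _⟩, fun s' _ _ => ?_⟩
    exact ⟨Fin.le_last _, Fin.le_last _⟩
  by_cases h₁ : k (1, 0) ≤ u a
  · have h₂ : ¬ k (0, 1) ≤ u a := fun h₂ => h₀ (h.inter a h₁ h₂)
    refine ⟨⟨(1, 0), by decide⟩, h₁, ?_, fun s' hs' _ => ?_⟩
    · rcases sq_cases b with rfl | rfl | rfl | rfl
      exacts [by decide, le_rfl, absurd hab h₂, absurd hab h₀]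
    · rcases cospan_cases s' with rfl | rfl | rfl
      exacts [absurd hs' h₀, le_rfl, absurd hs' h₂]
  · have h₂ : k (0, 1) ≤ u a := by
      rcases sq_cases b with rfl | rfl | rfl | rfl
      exacts [(h.cover a hab).resolve_left h₁, absurd hab h₁, hab, absurd hab h₀]
    refine ⟨⟨(0, 1), by decide⟩, h₂, ?_, fun s' hs' _ => ?_⟩
    · rcases sq_cases b with rfl | rfl | rfl | rfl
      exacts [by decide, absurd hab h₁, le_rfl, absurd hab h₀]
    · rcases cospan_cases s' with rfl | rfl | rfl
      exacts [absurd hs' h₀, absurd hs' h₁, le_rfl]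

namespace Prederivator

variable {D : Prederivator.{w, v, u}} [D.IsDerivator]

section

variable {P Q R S : Type} [Preorder P] [Preorder Q] [Preorder R] [Preorder S]

/-- For posets the factorisations form a poset, and an initial object in it is a least element. -/
lemma lEx_of_exists_le {p : R → P} {f : P → Q} {q : R → S} {g : S → Q} (hp : Monotone p)
    (hf : Monotone f) (hq : Monotone q) (hg : Monotone g)
    (α : Shape.map.{w} p hp ⋙ Shape.map f hf ⟶ Shape.map q hq ⋙ Shape.map g hg)
    (h : ∀ b a, f a ≤ g b → ∃ e, q e ≤ b ∧ a ≤ p e ∧ ∀ e', q e' ≤ b → a ≤ p e' → e ≤ e') :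
    D.LEx α := by
  refine lEx_of_exists _ fun b a x => ?_
  obtain ⟨e, h₁, h₂, h₃⟩ := h b.down a.down (Shape.le (P := Q) x)
  exact ⟨⟨e⟩, homOfLE h₁, homOfLE h₂, Subsingleton.elim _ _, fun e' y' s' _ =>
    ⟨homOfLE (h₃ e'.down (Shape.le (P := S) y') (Shape.le (P := P) s')), ⟨Subsingleton.elim _ _, Subsingleton.elim _ _⟩,
      fun _ _ => Subsingleton.elim _ _⟩⟩

lemma rEx_of_exists_le {p : R → P} {f : P → Q} {q : R → S} {g : S → Q} (hp : Monotone p)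
    (hf : Monotone f) (hq : Monotone q) (hg : Monotone g)
    (α : Shape.map.{w} p hp ⋙ Shape.map f hf ⟶ Shape.map q hq ⋙ Shape.map g hg)
    (h : ∀ a b, f a ≤ g b → ∃ e, a ≤ p e ∧ q e ≤ b ∧ ∀ e', a ≤ p e' → q e' ≤ b → e' ≤ e) :
    D.REx α := by
  refine rEx_of_exists _ fun a b x => ?_
  obtain ⟨e, h₁, h₂, h₃⟩ := h a.down b.down (Shape.le (P := Q) x)
  exact ⟨⟨e⟩, homOfLE h₁, homOfLE h₂, Subsingleton.elim _ _, fun e' y' s' _ =>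
    ⟨homOfLE (h₃ e'.down (Shape.le (P := P) y') (Shape.le (P := S) s')), ⟨Subsingleton.elim _ _, Subsingleton.elim _ _⟩,
      fun _ _ => Subsingleton.elim _ _⟩⟩

lemma isCocartesian_iff_lExt (X : D.Diag (Shape.{w} Sq)) :
    D.IsCocartesian X ↔ D.LExt spanIncl X := (lExt_iff_essImage _ _).symm

lemma isCartesian_iff_rExt (X : D.Diag (Shape.{w} Sq)) :
    D.IsCartesian X ↔ D.RExt cospanIncl X := (rExt_iff_essImage _ _).symm

/-- Let G be the poset of pairs (a, s) with u a ≤ k s, where s is a vertex of the span. By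
`exists_least`, base change holds for G over the span and for G over the whole square. So the
restrictions of Z to the span and to the square are both left extended from G, and cancelling the
first extension shows that the square is left extended from the span. -/
theorem LExt.isCocartesian {u : P → Q} {hu : Monotone u} {Z : D.Diag (Shape.{w} Q)}
    (h : D.LExt (Shape.map u hu) Z) {k : Sq → Q} (hk : IsPushoutFor u k) :
    D.IsCocartesian ((D.res (Shape.map k hk.monotone)).obj Z) := by
  rw [isCocartesian_iff_lExt]
  let G := {x : P × Span // u x.1 ≤ k x.2.1}
  let F₁ : Shape.{w} G ⥤ Shape P := Shape.map (fun x : G => x.1.1) (fun x y h => (show x.1 ≤ y.1 from h).1)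
  let F₂ : Shape.{w} G ⥤ Shape Span := Shape.map (fun x : G => x.1.2)
    (fun x y h => (show x.1 ≤ y.1 from h).2)
  let α₁ : F₁ ⋙ Shape.map u hu ⟶ F₂ ⋙ spanIncl ⋙ Shape.map k hk.monotone :=
    { app := fun x => homOfLE x.down.2, naturality := fun _ _ _ => Subsingleton.elim _ _ }
  let α₂ : F₁ ⋙ Shape.map u hu ⟶ (F₂ ⋙ spanIncl) ⋙ Shape.map k hk.monotone := α₁
  have h₁ : D.LEx α₁ := lEx_of_exists_le (q := fun x : G => x.1.2) (g := fun x : Span => k x.1)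
    _ _ (fun x y h => (show x.1 ≤ y.1 from h).2) (fun _ _ h => hk.monotone h) _ fun b a hab => by
      obtain ⟨s, hs₁, hs₂, hs₃⟩ := hk.exists_least a b.1 hab
      exact ⟨⟨(a, s), hs₁⟩, hs₂, le_rfl, fun e' he₁ he₂ =>
        ⟨he₂, hs₃ _ ((hu he₂).trans e'.2) he₁⟩⟩
  have h₂ : D.LEx α₂ := lEx_of_exists_le (q := fun x : G => x.1.2.1)
    _ _ (fun x y h => (show x.1 ≤ y.1 from h).2) hk.monotone _ fun b a hab => by
      obtain ⟨s, hs₁, hs₂, hs₃⟩ := hk.exists_least a b hab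
      exact ⟨⟨(a, s), hs₁⟩, hs₂, le_rfl, fun e' he₁ he₂ =>
        ⟨he₂, hs₃ _ ((hu he₂).trans e'.2) he₁⟩⟩
  have e₁ := (lEx_iff.1 h₁ _ h).comp_map (D.cmp spanIncl (Shape.map k hk.monotone) Z).hom
  have e₂ := (lEx_iff.1 h₂ _ h).of_natIso (D.resComp F₂ spanIncl)
  refine LUniv.of_comp (Y := _) e₁ ?_
  refine (congrArg (LUniv (D.res spanIncl ⋙ D.res F₂)) ?_).mp e₂
  rw [CategoryTheory.Functor.map_id]
  refine Eq.trans ?_ (Category.comp_id _).symm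
  dsimp only [sqL]
  simp only [Category.assoc]
  exact congr(_ ≫ _ ≫ $(D.cmp_assoc F₂ spanIncl (Shape.map k hk.monotone) Z))

theorem RExt.isCartesian {u : P → Q} {hu : Monotone u} {Z : D.Diag (Shape.{w} Q)}
    (h : D.RExt (Shape.map u hu) Z) {k : Sq → Q} (hk : IsPullbackFor u k) :
    D.IsCartesian ((D.res (Shape.map k hk.monotone)).obj Z) := by
  rw [isCartesian_iff_rExt]
  let G := {x : P × Cospan // k x.2.1 ≤ u x.1}
  let F₁ : Shape.{w} G ⥤ Shape P := Shape.map (fun x : G => x.1.1) (fun x y h => (show x.1 ≤ y.1 from h).1)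
  let F₂ : Shape.{w} G ⥤ Shape Cospan := Shape.map (fun x : G => x.1.2)
    (fun x y h => (show x.1 ≤ y.1 from h).2)
  let α₁ : F₂ ⋙ cospanIncl ⋙ Shape.map k hk.monotone ⟶ F₁ ⋙ Shape.map u hu :=
    { app := fun x => homOfLE x.down.2, naturality := fun _ _ _ => Subsingleton.elim _ _ }
  let α₂ : (F₂ ⋙ cospanIncl) ⋙ Shape.map k hk.monotone ⟶ F₁ ⋙ Shape.map u hu := α₁
  have h₁ : D.REx α₁ := rEx_of_exists_le (p := fun x : G => x.1.2) (f := fun x : Cospan => k x.1)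
    (fun x y h => (show x.1 ≤ y.1 from h).2) (fun _ _ h => hk.monotone h) _ _ _ fun b a hab => by
      obtain ⟨s, hs₁, hs₂, hs₃⟩ := hk.exists_greatest a b.1 hab
      exact ⟨⟨(a, s), hs₁⟩, hs₂, le_rfl, fun e' he₁ he₂ =>
        ⟨he₂, hs₃ _ (e'.2.trans (hu he₂)) he₁⟩⟩
  have h₂ : D.REx α₂ := rEx_of_exists_le (p := fun x : G => x.1.2.1)
    (fun x y h => (show x.1 ≤ y.1 from h).2) hk.monotone _ _ _ fun b a hab => by
      obtain ⟨s, hs₁, hs₂, hs₃⟩ := hk.exists_greatest a b hab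
      exact ⟨⟨(a, s), hs₁⟩, hs₂, le_rfl, fun e' he₁ he₂ =>
        ⟨he₂, hs₃ _ (e'.2.trans (hu he₂)) he₁⟩⟩
  have e₁ := (rEx_iff.1 h₁ _ h).map_comp (D.cmp cospanIncl (Shape.map k hk.monotone) Z).inv
  have e₂ := (rEx_iff.1 h₂ _ h).of_natIso (D.resComp F₂ cospanIncl).symm
  refine RUniv.of_comp (Y := _) e₁ ?_
  refine (congrArg (RUniv (D.res cospanIncl ⋙ D.res F₂)) ?_).mp e₂
  rw [CategoryTheory.Functor.map_id]
  refine Eq.trans ?_ (Category.id_comp _).symm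
  dsimp only [sqR]
  have e := D.cmp_inv_assoc' F₂ cospanIncl (Shape.map k hk.monotone) Z
  exact ((Category.assoc _ _ _).symm.trans congr($(e.symm) ≫ _)).trans (Category.assoc _ _ _)

lemma isIso_of_isCocartesian {k : Sq → Q} (hk : Monotone k) {X Y : D.Diag (Shape.{w} Q)}
    (hX : D.IsCocartesian ((D.res (Shape.map k hk)).obj X))
    (hY : D.IsCocartesian ((D.res (Shape.map k hk)).obj Y)) (m : X ⟶ Y)
    (h₀₀ : IsIso ((D.eval (ULift.up (k (0, 0)))).map m))
    (h₁₀ : IsIso ((D.eval (ULift.up (k (1, 0)))).map m))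
    (h₀₁ : IsIso ((D.eval (ULift.up (k (0, 1)))).map m)) :
    IsIso ((D.eval (ULift.up (k (1, 1)))).map m) := by
  rw [isCocartesian_iff_lExt] at hX hY
  have : IsIso ((D.res spanIncl).map ((D.res (Shape.map k hk)).map m)) := by
    refine IsDerivator.der2 _ _ fun s => ?_
    rw [isIso_eval_res_iff, isIso_eval_res_iff]
    obtain ⟨s⟩ := s
    rcases span_cases s with rfl | rfl | rfl <;> assumption
  have := hX.isIso hY ((D.res (Shape.map k hk)).map m)
  exact (isIso_eval_res_iff (Shape.map k hk) (ULift.up (1, 1)) m).1 inferInstance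

lemma isIso_of_isCartesian {k : Sq → Q} (hk : Monotone k) {X Y : D.Diag (Shape.{w} Q)}
    (hX : D.IsCartesian ((D.res (Shape.map k hk)).obj X))
    (hY : D.IsCartesian ((D.res (Shape.map k hk)).obj Y)) (m : X ⟶ Y)
    (h₁₁ : IsIso ((D.eval (ULift.up (k (1, 1)))).map m))
    (h₁₀ : IsIso ((D.eval (ULift.up (k (1, 0)))).map m))
    (h₀₁ : IsIso ((D.eval (ULift.up (k (0, 1)))).map m)) :
    IsIso ((D.eval (ULift.up (k (0, 0)))).map m) := by
  rw [isCartesian_iff_rExt] at hX hY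
  have : IsIso ((D.res cospanIncl).map ((D.res (Shape.map k hk)).map m)) := by
    refine IsDerivator.der2 _ _ fun s => ?_
    rw [isIso_eval_res_iff, isIso_eval_res_iff]
    obtain ⟨s⟩ := s
    rcases cospan_cases s with rfl | rfl | rfl <;> assumption
  have := hX.isIso hY ((D.res (Shape.map k hk)).map m)
  exact (isIso_eval_res_iff (Shape.map k hk) (ULift.up (0, 0)) m).1 inferInstance

/-- A diagram is a left Kan extension if every object is reached by zeros and pushouts. -/
theorem LExt.of_generation {u : P → Q} (hu : Monotone u) (huf : ∀ x y, u x ≤ u y → x ≤ y)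
    (Z : D.Diag (Shape.{w} Q)) (h : ∀ S : Set Q, (∀ a, u a ∈ S) →
      (∀ b, Limits.IsZero ((D.eval (ULift.up b)).obj Z) → (∀ a, ¬ u a ≤ b) → b ∈ S) →
      (∀ (k : Sq → Q) (hk : IsPushoutFor u k),
        D.IsCocartesian ((D.res (Shape.map k hk.monotone)).obj Z) → k (0, 0) ∈ S → k (1, 0) ∈ S →
          k (0, 1) ∈ S → k (1, 1) ∈ S) → ∀ b, b ∈ S) : D.LExt (Shape.map u hu) Z := by
  have := Shape.map_full.{w} hu huf
  -- Compare Z with the left extension V of its own restriction. The objects at which m is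
  -- invertible contain the image of u and the zeros of Z that lie above no u a, where V is initial.
  -- They are closed under the squares in question, since by `LExt.isCocartesian` these are
  -- cocartesian in V as well.
  obtain ⟨V, θ, m, hθ, hm⟩ := LExt.exists_desc (Shape.map u hu) Z
  have h₁ := LUniv.isIso_of_fullyFaithful _ hθ
  have h₂ := LUniv.lExt_of_fullyFaithful hθ
  have h₃ : IsIso ((D.res (Shape.map u hu)).map m) := by
    rw [← IsIso.inv_eq_of_hom_inv_id hm]
    infer_instance
  have h₄ := h {b | IsIso ((D.eval (ULift.up b)).map m)}
    (fun a => (isIso_eval_res_iff (Shape.map u hu) (ULift.up a) m).1 inferInstance)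
    (fun b hb ha => by
      obtain ⟨hV⟩ := h₂.isInitial (ULift.up b) (fun a => ⟨fun x => ha a.down (Shape.le (P := Q) x)⟩)
      exact ⟨hb.to_ _, hV.hom_ext _ _, hb.eq_of_src _ _⟩)
    (fun k hk hc h₀₀ h₁₀ h₀₁ => isIso_of_isCocartesian hk.monotone (h₂.isCocartesian hk) hc m
      h₀₀ h₁₀ h₀₁)
  have h₅ : IsIso m := IsDerivator.der2 _ _ fun b => h₄ b.down
  exact h₂.of_iso (asIso m)

/-- A diagram is a right Kan extension if every object is reached by zeros and pullbacks. -/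
theorem RExt.of_generation {u : P → Q} (hu : Monotone u) (huf : ∀ x y, u x ≤ u y → x ≤ y)
    (Z : D.Diag (Shape.{w} Q)) (h : ∀ S : Set Q, (∀ a, u a ∈ S) →
      (∀ b, Limits.IsZero ((D.eval (ULift.up b)).obj Z) → (∀ a, ¬ b ≤ u a) → b ∈ S) →
      (∀ (k : Sq → Q) (hk : IsPullbackFor u k),
        D.IsCartesian ((D.res (Shape.map k hk.monotone)).obj Z) → k (1, 1) ∈ S → k (1, 0) ∈ S →
          k (0, 1) ∈ S → k (0, 0) ∈ S) → ∀ b, b ∈ S) : D.RExt (Shape.map u hu) Z := by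
  have := Shape.map_full.{w} hu huf
  obtain ⟨V, θ, m, hθ, hm⟩ := RExt.exists_lift (Shape.map u hu) Z
  have h₁ := RUniv.isIso_of_fullyFaithful _ hθ
  have h₂ := RUniv.rExt_of_fullyFaithful hθ
  have h₃ : IsIso ((D.res (Shape.map u hu)).map m) := by
    rw [← IsIso.inv_eq_of_inv_hom_id hm]
    infer_instance
  have h₄ := h {b | IsIso ((D.eval (ULift.up b)).map m)}
    (fun a => (isIso_eval_res_iff (Shape.map u hu) (ULift.up a) m).1 inferInstance)
    (fun b hb ha => by
      obtain ⟨hV⟩ := h₂.isTerminal (ULift.up b) (fun a => ⟨fun x => ha a.down (Shape.le (P := Q) x)⟩)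
      exact ⟨hb.from_ _, hb.eq_of_src _ _, hV.hom_ext _ _⟩)
    (fun k hk hc h₁₁ h₁₀ h₀₁ => isIso_of_isCartesian hk.monotone hc (h₂.isCartesian hk) m
      h₁₁ h₁₀ h₀₁)
  have h₅ : IsIso m := IsDerivator.der2 _ _ fun b => h₄ b.down
  exact h₂.of_iso (asIso m).symm

end

/-! ### Zero objects -/

section

variable {A B : Type w} [SmallCategory A] [SmallCategory B]

lemma LExt.isZero [Limits.HasZeroObject (D.Diag Pt.{w})] {f : A ⥤ B} {X : D.Diag B}
    (h : D.LExt f X) (b : B) (hb : ∀ a, IsEmpty (f.obj a ⟶ b)) :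
    Limits.IsZero ((D.eval b).obj X) := by
  obtain ⟨i⟩ := h.isInitial b hb
  obtain ⟨Z, hZ⟩ := Limits.HasZeroObject.zero (C := D.Diag Pt.{w})
  exact hZ.of_iso (i.uniqueUpToIso hZ.isInitial)

lemma RExt.isZero [Limits.HasZeroObject (D.Diag Pt.{w})] {f : A ⥤ B} {X : D.Diag B}
    (h : D.RExt f X) (b : B) (hb : ∀ a, IsEmpty (b ⟶ f.obj a)) :
    Limits.IsZero ((D.eval b).obj X) := by
  obtain ⟨i⟩ := h.isTerminal b hb
  obtain ⟨Z, hZ⟩ := Limits.HasZeroObject.zero (C := D.Diag Pt.{w})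
  exact hZ.of_iso (i.uniqueUpToIso hZ.isTerminal)

end

end Prederivator

/-! ### Adjoints packaged as coherent choices of universal arrows. -/

section Universal

universe v₁ v₂ u₁ u₂

variable {𝒜 : Type u₁} [Category.{v₁} 𝒜] {ℬ : Type u₂} [Category.{v₂} ℬ]

/-- The morphism induced by a universal arrow. -/
noncomputable def LUniv.desc {R : ℬ ⥤ 𝒜} {Y : 𝒜} {V : ℬ} {θ : Y ⟶ R.obj V} (h : LUniv R θ) {W : ℬ}
    (k : Y ⟶ R.obj W) : V ⟶ W := (h.exists_desc k).choose

lemma LUniv.fac {R : ℬ ⥤ 𝒜} {Y : 𝒜} {V : ℬ} {θ : Y ⟶ R.obj V} (h : LUniv R θ) {W : ℬ}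
    (k : Y ⟶ R.obj W) : θ ≫ R.map (h.desc k) = k := (h.exists_desc k).choose_spec

/-- The morphism induced by a universal arrow. -/
noncomputable def RUniv.lift {R : ℬ ⥤ 𝒜} {Y : 𝒜} {V : ℬ} {θ : R.obj V ⟶ Y} (h : RUniv R θ) {W : ℬ}
    (k : R.obj W ⟶ Y) : W ⟶ V := (h.exists_lift k).choose

lemma RUniv.fac {R : ℬ ⥤ 𝒜} {Y : 𝒜} {V : ℬ} {θ : R.obj V ⟶ Y} (h : RUniv R θ) {W : ℬ}
    (k : R.obj W ⟶ Y) : R.map (h.lift k) ≫ θ = k := (h.exists_lift k).choose_spec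

/-- A left adjoint of a functor, in terms of universal arrows. -/
structure LData (R : ℬ ⥤ 𝒜) where
  /-- The left adjoint. -/
  fn : 𝒜 ⥤ ℬ
  /-- The universal arrows. -/
  un : ∀ Y, Y ⟶ R.obj (fn.obj Y)
  nat : ∀ {X Y : 𝒜} (g : X ⟶ Y), un X ≫ R.map (fn.map g) = g ≫ un Y
  univ : ∀ Y, LUniv R (un Y)

/-- A right adjoint of a functor, in terms of universal arrows. -/
structure RData (R : ℬ ⥤ 𝒜) where
  /-- The right adjoint. -/
  fn : 𝒜 ⥤ ℬ
  /-- The universal arrows. -/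
  un : ∀ Y, R.obj (fn.obj Y) ⟶ Y
  nat : ∀ {X Y : 𝒜} (g : X ⟶ Y), R.map (fn.map g) ≫ un Y = un X ≫ g
  univ : ∀ Y, RUniv R (un Y)

namespace LData

/-- The universal arrows of an adjunction. -/
def ofAdj {R : ℬ ⥤ 𝒜} {L : 𝒜 ⥤ ℬ} (adj : L ⊣ R) : LData R where
  fn := L
  un := adj.unit.app
  nat g := (adj.unit.naturality g).symm
  univ := LUniv.of_adj adj

variable {R : ℬ ⥤ 𝒜} (L : LData R)

/-- The counit. -/
noncomputable def ct (V : ℬ) : L.fn.obj (R.obj V) ⟶ V := (L.univ _).desc (𝟙 _)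

lemma un_ct (V : ℬ) : L.un (R.obj V) ≫ R.map (L.ct V) = 𝟙 _ := LUniv.fac _ _

lemma ct_nat {V W : ℬ} (g : V ⟶ W) : L.fn.map (R.map g) ≫ L.ct W = L.ct V ≫ g := by
  refine (L.univ _).hom_ext ?_
  rw [R.map_comp, R.map_comp, ← Category.assoc, L.nat, Category.assoc, un_ct, ← Category.assoc,
    un_ct, Category.id_comp, Category.comp_id]

lemma map_un_ct (Y : 𝒜) : L.fn.map (L.un Y) ≫ L.ct (L.fn.obj Y) = 𝟙 _ := by
  refine (L.univ _).hom_ext ?_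
  rw [R.map_comp, ← Category.assoc, L.nat, Category.assoc, un_ct, R.map_id]

end LData

namespace RData

/-- The universal arrows of an adjunction. -/
def ofAdj {R : ℬ ⥤ 𝒜} {L : 𝒜 ⥤ ℬ} (adj : R ⊣ L) : RData R where
  fn := L
  un := adj.counit.app
  nat g := adj.counit.naturality g
  univ := RUniv.of_adj adj

variable {R : ℬ ⥤ 𝒜} (L : RData R)

/-- The unit. -/
noncomputable def ct (V : ℬ) : V ⟶ L.fn.obj (R.obj V) := (L.univ _).lift (𝟙 _)

lemma ct_un (V : ℬ) : R.map (L.ct V) ≫ L.un (R.obj V) = 𝟙 _ := RUniv.fac _ _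

lemma ct_nat {V W : ℬ} (g : V ⟶ W) : L.ct V ≫ L.fn.map (R.map g) = g ≫ L.ct W := by
  refine (L.univ _).hom_ext ?_
  rw [R.map_comp, R.map_comp, Category.assoc, L.nat, ← Category.assoc, ct_un, Category.assoc,
    ct_un, Category.id_comp, Category.comp_id]

lemma ct_map_un (Y : 𝒜) : L.ct (L.fn.obj Y) ≫ L.fn.map (L.un Y) = 𝟙 _ := by
  refine (L.univ _).hom_ext ?_
  rw [R.map_comp, Category.assoc, L.nat, ← Category.assoc, ct_un, R.map_id]

end RData

end Universal

/-! ### Morphisms of pseudofunctors with values in categories -/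

namespace CatTrans

universe w₁ v₁ u₁ v₂ u₂

variable {𝓑 : Type u₁} [Bicategory.{w₁, v₁} 𝓑] {F G H : Pseudofunctor 𝓑 Cat.{v₂, u₂}}

/-- The components of a morphism, as functors. -/
abbrev fn (φ : F ⟶ G) (a : 𝓑) : F.obj a ⥤ G.obj a := (φ.app a).toFunctor

/-- The functors in the image of a pseudofunctor. -/
abbrev mp (F : Pseudofunctor 𝓑 Cat.{v₂, u₂}) {a b : 𝓑} (f : a ⟶ b) : F.obj a ⥤ F.obj b :=
  (F.map f).toFunctor

/-- The structure isomorphisms of a morphism. -/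
def nt (φ : F ⟶ G) {a b : 𝓑} (f : a ⟶ b) (X : F.obj a) :
    (fn φ b).obj ((mp F f).obj X) ≅ (mp G f).obj ((fn φ a).obj X) :=
  (Cat.Hom.toNatIso (φ.naturality f)).app X

lemma nt_naturality (φ : F ⟶ G) {a b : 𝓑} (f : a ⟶ b) {X Y : F.obj a} (m : X ⟶ Y) :
    (fn φ b).map ((mp F f).map m) ≫ (nt φ f Y).hom =
      (nt φ f X).hom ≫ (mp G f).map ((fn φ a).map m) :=
  (Cat.Hom.toNatIso (φ.naturality f)).hom.naturality m

lemma nt_inv_naturality (φ : F ⟶ G) {a b : 𝓑} (f : a ⟶ b) {X Y : F.obj a} (m : X ⟶ Y) :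
    (mp G f).map ((fn φ a).map m) ≫ (nt φ f Y).inv =
      (nt φ f X).inv ≫ (fn φ b).map ((mp F f).map m) :=
  (Cat.Hom.toNatIso (φ.naturality f)).inv.naturality m

lemma nt_map₂ (φ : F ⟶ G) {a b : 𝓑} {f g : a ⟶ b} (θ : f ⟶ g) (X : F.obj a) :
    (fn φ b).map ((F.map₂ θ).toNatTrans.app X) ≫ (nt φ g X).hom =
      (nt φ f X).hom ≫ (G.map₂ θ).toNatTrans.app ((fn φ a).obj X) :=
  congr($(φ.naturality_naturality θ).toNatTrans.app X)

lemma nt_id (φ : F ⟶ G) (a : 𝓑) (X : F.obj a) :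
    (nt φ (𝟙 a) X).hom ≫ (G.mapId a).hom.toNatTrans.app ((fn φ a).obj X) =
      (fn φ a).map ((F.mapId a).hom.toNatTrans.app X) := by
  have := congr($(φ.naturality_id a).toNatTrans.app X)
  refine this.trans ?_
  exact congr((fn φ a).map ((F.mapId a).hom.toNatTrans.app X) ≫
    $(Category.id_comp (𝟙 ((fn φ a).obj X)))).trans (Category.comp_id _)

lemma nt_comp (φ : F ⟶ G) {a b c : 𝓑} (f : a ⟶ b) (g : b ⟶ c) (X : F.obj a) :
    (nt φ (f ≫ g) X).hom ≫ (G.mapComp f g).hom.toNatTrans.app ((fn φ a).obj X) =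
      (fn φ c).map ((F.mapComp f g).hom.toNatTrans.app X) ≫ (nt φ g ((mp F f).obj X)).hom ≫
        (mp G g).map (nt φ f X).hom := by
  have := congr($(φ.naturality_comp f g).toNatTrans.app X)
  refine this.trans ?_
  refine congr(_ ≫ $(?_))
  refine (Category.id_comp _).trans ?_
  refine congr(_ ≫ $(?_))
  refine (Category.id_comp _).trans ?_
  exact Category.comp_id _

/-- A morphism of pseudofunctors with values in categories, from functors and natural
isomorphisms. -/
def mk' (app : ∀ a, F.obj a ⥤ G.obj a)
    (n : ∀ {a b : 𝓑} (f : a ⟶ b), mp F f ⋙ app b ≅ app a ⋙ mp G f)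
    (h₂ : ∀ {a b : 𝓑} {f g : a ⟶ b} (θ : f ⟶ g) (X : F.obj a),
      (app b).map ((F.map₂ θ).toNatTrans.app X) ≫ (n g).hom.app X =
        (n f).hom.app X ≫ (G.map₂ θ).toNatTrans.app ((app a).obj X))
    (hid : ∀ (a : 𝓑) (X : F.obj a),
      (n (𝟙 a)).hom.app X ≫ (G.mapId a).hom.toNatTrans.app ((app a).obj X) =
        (app a).map ((F.mapId a).hom.toNatTrans.app X))
    (hcomp : ∀ {a b c : 𝓑} (f : a ⟶ b) (g : b ⟶ c) (X : F.obj a),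
      (n (f ≫ g)).hom.app X ≫ (G.mapComp f g).hom.toNatTrans.app ((app a).obj X) =
        (app c).map ((F.mapComp f g).hom.toNatTrans.app X) ≫ (n g).hom.app ((mp F f).obj X) ≫
          (mp G g).map ((n f).hom.app X)) : F ⟶ G where
  app a := (app a).toCatHom
  naturality f := Cat.Hom.isoMk (n f)
  naturality_naturality θ := by
    apply Cat.Hom₂.ext
    ext X
    exact h₂ θ X
  naturality_id a := by
    apply Cat.Hom₂.ext
    ext X
    refine (hid a X).trans ?_
    exact (Category.comp_id _).symm.trans congr((app a).map ((F.mapId a).hom.toNatTrans.app X) ≫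
      $((Category.id_comp (𝟙 ((app a).obj X))).symm))
  naturality_comp f g := by
    apply Cat.Hom₂.ext
    ext X
    refine (hcomp f g X).trans ?_
    refine congr(_ ≫ $(?_))
    refine Eq.trans ?_ (Category.id_comp _).symm
    refine congr(_ ≫ $(?_))
    refine Eq.trans ?_ (Category.id_comp _).symm
    exact (Category.comp_id _).symm

lemma nt_vcomp (φ : F ⟶ G) (ψ : G ⟶ H) {a b : 𝓑} (f : a ⟶ b) (X : F.obj a) :
    (nt (φ ≫ ψ) f X).hom = (fn ψ b).map (nt φ f X).hom ≫ (nt ψ f ((fn φ a).obj X)).hom := by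
  refine (?_ : (nt (φ ≫ ψ) f X).hom = 𝟙 _ ≫ (fn ψ b).map (nt φ f X).hom ≫ 𝟙 _ ≫
    (nt ψ f ((fn φ a).obj X)).hom ≫ 𝟙 _).trans ?_
  · rfl
  · rw [Category.id_comp, Category.id_comp, Category.comp_id]

lemma nt_one {a b : 𝓑} (f : a ⟶ b) (X : F.obj a) : (nt (𝟙 F) f X).hom = 𝟙 _ :=
  Category.id_comp _

/-- The components of a modification. -/
def md {φ ψ : F ⟶ G} (m : φ ⟶ ψ) (a : 𝓑) (X : F.obj a) : (fn φ a).obj X ⟶ (fn ψ a).obj X :=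
  (m.as.app a).toNatTrans.app X

lemma md_naturality {φ ψ : F ⟶ G} (m : φ ⟶ ψ) (a : 𝓑) {X Y : F.obj a} (g : X ⟶ Y) :
    (fn φ a).map g ≫ md m a Y = md m a X ≫ (fn ψ a).map g :=
  (m.as.app a).toNatTrans.naturality g

lemma md_nt {φ ψ : F ⟶ G} (m : φ ⟶ ψ) {a b : 𝓑} (f : a ⟶ b) (X : F.obj a) :
    md m b ((mp F f).obj X) ≫ (nt ψ f X).hom = (nt φ f X).hom ≫ (mp G f).map (md m a X) :=
  congr($(m.as.naturality f).toNatTrans.app X)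

/-- A modification, from natural transformations. -/
def mdMk {φ ψ : F ⟶ G} (app : ∀ a, fn φ a ⟶ fn ψ a)
    (h : ∀ {a b : 𝓑} (f : a ⟶ b) (X : F.obj a), (app b).app ((mp F f).obj X) ≫ (nt ψ f X).hom =
      (nt φ f X).hom ≫ (mp G f).map ((app a).app X)) : φ ⟶ ψ where
  as :=
    { app := fun a => (app a).toCatHom₂
      naturality := fun f => by
        apply Cat.Hom₂.ext
        ext X
        exact h f X }

/-- An invertible modification, from natural isomorphisms. -/
def isoMk {φ ψ : F ⟶ G} (app : ∀ a, fn φ a ≅ fn ψ a)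
    (h : ∀ {a b : 𝓑} (f : a ⟶ b) (X : F.obj a),
      (app b).hom.app ((mp F f).obj X) ≫ (nt ψ f X).hom =
        (nt φ f X).hom ≫ (mp G f).map ((app a).hom.app X)) : φ ≅ ψ :=
  Pseudofunctor.StrongTrans.isoMk (fun a => Cat.Hom.isoMk (app a)) fun f => by
    apply Cat.Hom₂.ext
    ext X
    exact h f X

/-- A modification is invertible if its components are. -/
lemma isIso_of_md {φ ψ : F ⟶ G} (m : φ ⟶ ψ) (h : ∀ a X, IsIso (md m a X)) : IsIso m := by
  have h' : ∀ a X, IsIso ((m.as.app a).toNatTrans.app X) := h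
  let e : φ ≅ ψ := isoMk (fun a => NatIso.ofComponents
    (fun X => asIso ((m.as.app a).toNatTrans.app X)) (fun g => md_naturality m a g))
      (fun f X => md_nt m f X)
  have : m = e.hom := by
    apply Pseudofunctor.StrongTrans.homCategory.ext
    intro b
    apply Cat.Hom₂.ext
    ext X
    rfl
  rw [this]
  infer_instance

lemma leftZigzag_eq {𝓒 : Type*} [Bicategory 𝓒] {a b : 𝓒} {f : a ⟶ b} {g : b ⟶ a}
    (η : 𝟙 a ⟶ f ≫ g) (ε' : g ≫ f ⟶ 𝟙 b) :
    leftZigzag η ε' = η ▷ f ≫ (α_ f g f).hom ≫ f ◁ ε' := by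
  simp [leftZigzag, bicategoricalComp]

lemma rightZigzag_eq {𝓒 : Type*} [Bicategory 𝓒] {a b : 𝓒} {f : a ⟶ b} {g : b ⟶ a}
    (η : 𝟙 a ⟶ f ≫ g) (ε' : g ≫ f ⟶ 𝟙 b) :
    rightZigzag η ε' = g ◁ η ≫ (α_ g f g).inv ≫ ε' ▷ g := by
  simp [rightZigzag, bicategoricalComp]

section Left

variable (φ : F ⟶ G) (L : ∀ a, LData (fn φ a))

/-- The mate of a structure isomorphism. -/
noncomputable def mateL {a b : 𝓑} (f : a ⟶ b) (X : G.obj a) :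
    (L b).fn.obj ((mp G f).obj X) ⟶ (mp F f).obj ((L a).fn.obj X) :=
  ((L b).univ _).desc ((mp G f).map ((L a).un X) ≫ (nt φ f ((L a).fn.obj X)).inv)

lemma un_mateL {a b : 𝓑} (f : a ⟶ b) (X : G.obj a) :
    (L b).un ((mp G f).obj X) ≫ (fn φ b).map (mateL φ L f X) =
      (mp G f).map ((L a).un X) ≫ (nt φ f ((L a).fn.obj X)).inv :=
  LUniv.fac _ _

lemma un_mateL' {a b : 𝓑} (f : a ⟶ b) (X : G.obj a) :
    (L b).un ((mp G f).obj X) ≫ (fn φ b).map (mateL φ L f X) ≫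
      (nt φ f ((L a).fn.obj X)).hom = (mp G f).map ((L a).un X) := by
  rw [← Category.assoc, un_mateL, Category.assoc, Iso.inv_hom_id, Category.comp_id]

lemma mateL_naturality {a b : 𝓑} (f : a ⟶ b) {X Y : G.obj a} (g : X ⟶ Y) :
    (L b).fn.map ((mp G f).map g) ≫ mateL φ L f Y =
      mateL φ L f X ≫ (mp F f).map ((L a).fn.map g) := by
  refine ((L b).univ _).hom_ext ?_
  rw [Functor.map_comp, Functor.map_comp, ← Category.assoc, (L b).nat,
    Category.assoc, un_mateL, ← Category.assoc ((L b).un _), un_mateL, Category.assoc,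
    ← nt_inv_naturality, ← Category.assoc, ← Category.assoc, ← Functor.map_comp,
    ← Functor.map_comp, (L a).nat]

variable (hm : ∀ {a b : 𝓑} (f : a ⟶ b) (X : G.obj a), IsIso (mateL φ L f X))

/-- The left adjoint of a morphism with componentwise left adjoints. -/
noncomputable def leftAdj : G ⟶ F := by
  refine mk' (fun a => (L a).fn) (fun {a b} f => @NatIso.ofComponents _ _ _ _
    (mp G f ⋙ (L b).fn) ((L a).fn ⋙ mp F f)
    (fun X => @asIso _ _ _ _ (mateL φ L f X) (hm f X)) (fun g => mateL_naturality φ L f g))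
    ?_ ?_ ?_
  · intro a b f g θ X
    refine ((L b).univ _).hom_ext ?_
    change _ ≫ (fn φ b).map ((L b).fn.map _ ≫ mateL φ L g X) =
      _ ≫ (fn φ b).map (mateL φ L f X ≫ _)
    rw [← cancel_mono (nt φ g ((L a).fn.obj X)).hom]
    simp only [Functor.map_comp, Category.assoc]
    rw [nt_map₂, ← Category.assoc, (L b).nat, Category.assoc]
    have h := un_mateL' φ L f X
    refine congr(_ ≫ $(un_mateL' φ L g X)).trans ?_
    refine Eq.trans ((G.map₂ θ).toNatTrans.naturality ((L a).un X)).symm ?_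
    refine congr($(h.symm) ≫ _).trans ?_
    rw [Category.assoc, Category.assoc]
  · intro a X
    refine ((L a).univ _).hom_ext ?_
    change _ ≫ (fn φ a).map (mateL φ L (𝟙 a) X ≫ _) = _ ≫ (fn φ a).map ((L a).fn.map _)
    rw [Functor.map_comp, ← nt_id, (L a).nat]
    have h := un_mateL' φ L (𝟙 a) X
    refine Eq.trans (congr(_ ≫ $((Category.assoc _ _ _).symm)).trans (Category.assoc _ _ _).symm) ?_
    refine congr($h ≫ _).trans ?_
    exact (G.mapId a).hom.toNatTrans.naturality _
  · intro a b c f g X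
    refine ((L c).univ _).hom_ext ?_
    change _ ≫ (fn φ c).map (mateL φ L (f ≫ g) X ≫ _) =
      _ ≫ (fn φ c).map ((L c).fn.map _ ≫ mateL φ L g ((mp G f).obj X) ≫
        (mp F g).map (mateL φ L f X))
    have hc := nt_comp φ f g ((L a).fn.obj X)
    rw [← cancel_mono (nt φ g ((mp F f).obj ((L a).fn.obj X))).hom,
      ← cancel_mono ((mp G g).map (nt φ f ((L a).fn.obj X)).hom)]
    simp only [Functor.map_comp, Category.assoc]
    rw [← hc]
    have h := un_mateL' φ L (f ≫ g) X
    refine Eq.trans (congr(_ ≫ $((Category.assoc _ _ _).symm)).trans (Category.assoc _ _ _).symm) ?_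
    refine congr($h ≫ _).trans ?_
    rw [← Category.assoc ((fn φ c).map ((mp F g).map _)), nt_naturality,
      ← Category.assoc ((L c).un _), (L c).nat]
    simp only [Category.assoc]
    have h₁ := un_mateL' φ L g ((mp G f).obj X)
    have h₂ := congr((mp G g).map $(un_mateL' φ L f X))
    have h₃ := (G.mapComp f g).hom.toNatTrans.naturality ((L a).un X)
    refine h₃.trans ?_
    refine congr(_ ≫ $(?_))
    refine h₂.symm.trans ?_
    rw [Functor.map_comp, Functor.map_comp, ← h₁]
    simp only [Category.assoc]

lemma nt_leftAdj {a b : 𝓑} (f : a ⟶ b) (X : G.obj a) :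
    (nt (leftAdj φ L hm) f X).hom = mateL φ L f X := rfl

/-- The adjunction between a morphism and its componentwise left adjoint. -/
noncomputable def leftAdjAdjunction : Bicategory.Adjunction (leftAdj φ L hm) φ where
  unit := mdMk (fun a => { app := fun X => (L a).un X, naturality := fun _ _ g => ((L a).nat g).symm })
    fun {a b} f X => by
      rw [nt_vcomp, nt_one]
      exact (un_mateL' φ L f X).trans (Category.id_comp _).symm
  counit := mdMk (fun a => { app := fun X => (L a).ct X, naturality := fun _ _ g => (L a).ct_nat g })
    fun {a b} f X => by
      rw [nt_vcomp, nt_one, nt_leftAdj]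
      refine (Category.comp_id _).trans ?_
      change (L b).ct _ = ((L b).fn.map (nt φ f X).hom ≫ mateL φ L f ((fn φ a).obj X)) ≫
        (mp F f).map ((L a).ct X)
      refine ((L b).univ _).hom_ext ?_
      rw [(L b).un_ct, Functor.map_comp, Functor.map_comp, Category.assoc, ← Category.assoc,
        (L b).nat, Category.assoc, ← Category.assoc ((L b).un _), un_mateL, Category.assoc,
        ← nt_inv_naturality, ← Category.assoc ((mp G f).map _), ← Functor.map_comp, (L a).un_ct,
        CategoryTheory.Functor.map_id, Category.id_comp, Iso.hom_inv_id]
  left_triangle := by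
    rw [leftZigzag_eq]
    apply Pseudofunctor.StrongTrans.homCategory.ext
    intro a
    apply Cat.Hom₂.ext
    ext X
    refine (?_ : (L a).fn.map ((L a).un X) ≫ 𝟙 _ ≫ (L a).ct ((L a).fn.obj X) = 𝟙 _ ≫ 𝟙 _)
    rw [Category.id_comp, Category.id_comp, (L a).map_un_ct]
  right_triangle := by
    rw [rightZigzag_eq]
    apply Pseudofunctor.StrongTrans.homCategory.ext
    intro a
    apply Cat.Hom₂.ext
    ext X
    refine (?_ : (L a).un ((fn φ a).obj X) ≫ 𝟙 _ ≫ (fn φ a).map ((L a).ct X) = 𝟙 _ ≫ 𝟙 _)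
    rw [Category.id_comp, Category.id_comp, (L a).un_ct]

end Left

/-- Componentwise left adjoints assemble to a pseudo-natural transformation as soon as the mates
`mateL` are invertible. A mate compares two universal arrows precisely if the structure isomorphisms
of φ preserve universality. -/
theorem isRightAdjoint_of_lUniv (φ : F ⟶ G) [∀ a, (fn φ a).IsRightAdjoint]
    (h : ∀ {a b : 𝓑} (f : a ⟶ b) ⦃X : G.obj a⦄ ⦃Z : F.obj a⦄ (η : X ⟶ (fn φ a).obj Z),
      LUniv (fn φ a) η → LUniv (fn φ b) ((mp G f).map η ≫ (nt φ f Z).inv)) :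
    Bicategory.IsRightAdjoint φ := by
  let L (a : 𝓑) : LData (fn φ a) := LData.ofAdj (Adjunction.ofIsRightAdjoint (fn φ a))
  refine Bicategory.IsRightAdjoint.mk (leftAdjAdjunction φ L fun {a b} f X => ?_)
  exact ((L b).univ _).isIso (h f _ ((L a).univ X)) (un_mateL φ L f X)

section Right

variable (φ : F ⟶ G) (R : ∀ a, RData (fn φ a))

/-- The mate of a structure isomorphism. -/
noncomputable def mateR {a b : 𝓑} (f : a ⟶ b) (X : G.obj a) :
    (mp F f).obj ((R a).fn.obj X) ⟶ (R b).fn.obj ((mp G f).obj X) :=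
  ((R b).univ _).lift ((nt φ f ((R a).fn.obj X)).hom ≫ (mp G f).map ((R a).un X))

lemma mateR_un {a b : 𝓑} (f : a ⟶ b) (X : G.obj a) :
    (fn φ b).map (mateR φ R f X) ≫ (R b).un ((mp G f).obj X) =
      (nt φ f ((R a).fn.obj X)).hom ≫ (mp G f).map ((R a).un X) :=
  RUniv.fac _ _

lemma mateR_naturality {a b : 𝓑} (f : a ⟶ b) {X Y : G.obj a} (g : X ⟶ Y) :
    (mp F f).map ((R a).fn.map g) ≫ mateR φ R f Y =
      mateR φ R f X ≫ (R b).fn.map ((mp G f).map g) := by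
  refine ((R b).univ _).hom_ext ?_
  rw [Functor.map_comp, Functor.map_comp, Category.assoc, mateR_un, Category.assoc, (R b).nat,
    ← Category.assoc, nt_naturality, Category.assoc, ← Functor.map_comp, (R a).nat,
    Functor.map_comp, ← Category.assoc, ← Category.assoc, mateR_un]

variable (hm : ∀ {a b : 𝓑} (f : a ⟶ b) (X : G.obj a), IsIso (mateR φ R f X))

/-- The inverse of the mate of a structure isomorphism. -/
noncomputable def mateRIso {a b : 𝓑} (f : a ⟶ b) (X : G.obj a) :
    (R b).fn.obj ((mp G f).obj X) ≅ (mp F f).obj ((R a).fn.obj X) :=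
  (@asIso _ _ _ _ (mateR φ R f X) (hm f X)).symm

lemma mateRIso_un {a b : 𝓑} (f : a ⟶ b) (X : G.obj a) :
    (fn φ b).map (mateRIso φ R hm f X).hom ≫ (nt φ f ((R a).fn.obj X)).hom ≫
      (mp G f).map ((R a).un X) = (R b).un ((mp G f).obj X) := by
  rw [← mateR_un, ← Category.assoc, ← Functor.map_comp]
  have : (mateRIso φ R hm f X).hom ≫ mateR φ R f X = 𝟙 _ := (mateRIso φ R hm f X).hom_inv_id
  rw [this, CategoryTheory.Functor.map_id, Category.id_comp]

lemma mateRIso_naturality {a b : 𝓑} (f : a ⟶ b) {X Y : G.obj a} (g : X ⟶ Y) :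
    (R b).fn.map ((mp G f).map g) ≫ (mateRIso φ R hm f Y).hom =
      (mateRIso φ R hm f X).hom ≫ (mp F f).map ((R a).fn.map g) := by
  rw [← cancel_mono (mateRIso φ R hm f Y).inv, ← cancel_epi (mateRIso φ R hm f X).inv,
    Category.assoc, Iso.hom_inv_id, Category.comp_id, Category.assoc, Iso.inv_hom_id_assoc]
  exact (mateR_naturality φ R f g).symm

/-- The right adjoint of a morphism with componentwise right adjoints. -/
noncomputable def rightAdj : G ⟶ F := by
  refine mk' (fun a => (R a).fn) (fun {a b} f => @NatIso.ofComponents _ _ _ _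
    (mp G f ⋙ (R b).fn) ((R a).fn ⋙ mp F f)
    (fun X => mateRIso φ R hm f X) (fun g => mateRIso_naturality φ R hm f g))
    ?_ ?_ ?_
  · intro a b f g θ X
    change (R b).fn.map _ ≫ (mateRIso φ R hm g X).hom = (mateRIso φ R hm f X).hom ≫ _
    rw [← cancel_mono (mateRIso φ R hm g X).inv]
    refine ((R b).univ _).hom_ext ?_
    rw [Category.assoc, Iso.hom_inv_id, Category.comp_id, (R b).nat, Category.assoc]
    change _ = (fn φ b).map ((mateRIso φ R hm f X).hom ≫ _ ≫ mateR φ R g X) ≫ _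
    rw [Functor.map_comp, Functor.map_comp, Category.assoc, Category.assoc, mateR_un,
      ← Category.assoc ((fn φ b).map ((F.map₂ θ).toNatTrans.app _)), nt_map₂,
      ← mateRIso_un φ R hm f X]
    have := (G.map₂ θ).toNatTrans.naturality ((R a).un X)
    rw [Category.assoc, Category.assoc, Category.assoc]
    exact congr(_ ≫ _ ≫ $this)
  · intro a X
    change (mateRIso φ R hm (𝟙 a) X).hom ≫ _ = _
    refine ((R a).univ _).hom_ext ?_
    rw [Functor.map_comp, ← nt_id, (R a).nat, ← mateRIso_un φ R hm (𝟙 a) X]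
    have := (G.mapId a).hom.toNatTrans.naturality ((R a).un X)
    rw [Category.assoc, Category.assoc, Category.assoc, Category.assoc]
    exact congr(_ ≫ _ ≫ $(this.symm))
  · intro a b c f g X
    change (mateRIso φ R hm (f ≫ g) X).hom ≫ _ = (R c).fn.map _ ≫
      (mateRIso φ R hm g ((mp G f).obj X)).hom ≫ (mp F g).map (mateRIso φ R hm f X).hom
    have hc := nt_comp φ f g ((R a).fn.obj X)
    rw [← cancel_mono ((mp F g).map (mateRIso φ R hm f X).inv), Category.assoc, Category.assoc,
      Category.assoc, ← Functor.map_comp, Iso.hom_inv_id, CategoryTheory.Functor.map_id,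
      Category.comp_id, ← cancel_mono (mateRIso φ R hm g ((mp G f).obj X)).inv, Category.assoc,
      Category.assoc, Category.assoc, Iso.hom_inv_id, Category.comp_id]
    refine ((R c).univ _).hom_ext ?_
    rw [(R c).nat]
    change (fn φ c).map ((mateRIso φ R hm (f ≫ g) X).hom ≫ _ ≫ (mp F g).map (mateR φ R f X) ≫
      mateR φ R g ((mp G f).obj X)) ≫ _ = _
    simp only [Functor.map_comp, Category.assoc]
    rw [mateR_un, ← Category.assoc ((fn φ c).map ((mp F g).map _)), nt_naturality, Category.assoc,
      ← Functor.map_comp, mateR_un, Functor.map_comp,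
      ← Category.assoc (nt φ g _).hom, ← Category.assoc ((fn φ c).map _) (_ ≫ _)]
    refine (congr(_ ≫ $(hc.symm) ≫ _)).trans ?_
    rw [← mateRIso_un φ R hm (f ≫ g) X]
    have := (G.mapComp f g).hom.toNatTrans.naturality ((R a).un X)
    rw [Category.assoc, Category.assoc, Category.assoc]
    exact congr(_ ≫ _ ≫ $(this.symm))

lemma nt_rightAdj {a b : 𝓑} (f : a ⟶ b) (X : G.obj a) :
    (nt (rightAdj φ R hm) f X).hom = (mateRIso φ R hm f X).hom := rfl

/-- The adjunction between a morphism and its componentwise right adjoint. -/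
noncomputable def rightAdjAdjunction : Bicategory.Adjunction φ (rightAdj φ R hm) where
  counit := mdMk (fun a => { app := fun X => (R a).un X, naturality := fun _ _ g => (R a).nat g })
    fun {a b} f X => by
      rw [nt_vcomp, nt_one, nt_rightAdj]
      refine (Category.comp_id _).trans ?_
      exact (mateRIso_un φ R hm f X).symm.trans (Category.assoc _ _ _).symm
  unit := mdMk (fun a => { app := fun X => (R a).ct X, naturality := fun _ _ g => ((R a).ct_nat g).symm })
    fun {a b} f X => by
      rw [nt_vcomp, nt_one, nt_rightAdj]
      refine Eq.trans ?_ (Category.id_comp _).symm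
      change (R b).ct _ ≫ (R b).fn.map (nt φ f X).hom ≫ (mateRIso φ R hm f ((fn φ a).obj X)).hom =
        (mp F f).map ((R a).ct X)
      rw [← cancel_mono (mateRIso φ R hm f ((fn φ a).obj X)).inv]
      refine ((R b).univ _).hom_ext ?_
      simp only [Category.assoc, Iso.hom_inv_id, Category.comp_id]
      change _ = (fn φ b).map (_ ≫ mateR φ R f _) ≫ _
      rw [Functor.map_comp, Functor.map_comp, Category.assoc, (R b).nat, ← Category.assoc,
        (R b).ct_un, Category.id_comp, Category.assoc, mateR_un, ← Category.assoc, nt_naturality,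
        Category.assoc, ← Functor.map_comp, (R a).ct_un, CategoryTheory.Functor.map_id,
        Category.comp_id]
  left_triangle := by
    rw [leftZigzag_eq]
    apply Pseudofunctor.StrongTrans.homCategory.ext
    intro a
    apply Cat.Hom₂.ext
    ext X
    refine (?_ : (fn φ a).map ((R a).ct X) ≫ 𝟙 _ ≫ (R a).un ((fn φ a).obj X) = 𝟙 _ ≫ 𝟙 _)
    rw [Category.id_comp, Category.id_comp, (R a).ct_un]
  right_triangle := by
    rw [rightZigzag_eq]
    apply Pseudofunctor.StrongTrans.homCategory.ext
    intro a
    apply Cat.Hom₂.ext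
    ext X
    refine (?_ : (R a).ct ((R a).fn.obj X) ≫ 𝟙 _ ≫ (R a).fn.map ((R a).un X) = 𝟙 _ ≫ 𝟙 _)
    rw [Category.id_comp, Category.id_comp, (R a).ct_map_un]

end Right

theorem isLeftAdjoint_of_rUniv (φ : F ⟶ G) [∀ a, (fn φ a).IsLeftAdjoint]
    (h : ∀ {a b : 𝓑} (f : a ⟶ b) ⦃X : G.obj a⦄ ⦃Z : F.obj a⦄ (η : (fn φ a).obj Z ⟶ X),
      RUniv (fn φ a) η → RUniv (fn φ b) ((nt φ f Z).hom ≫ (mp G f).map η)) :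
    Bicategory.IsLeftAdjoint φ := by
  let R (a : 𝓑) : RData (fn φ a) := RData.ofAdj (Adjunction.ofIsLeftAdjoint (fn φ a))
  refine Bicategory.IsLeftAdjoint.mk (rightAdjAdjunction φ R fun {a b} f X => ?_)
  exact ((R b).univ _).isIso (h f _ ((R a).univ X)) (mateR_un φ R f X)

/-- A morphism whose components are equivalences is an equivalence. -/
theorem exists_equivalence (φ : F ⟶ G) [∀ a, (fn φ a).IsEquivalence] :
    ∃ e : Bicategory.Equivalence F G, e.hom = φ := by
  let L (a : 𝓑) : LData (fn φ a) := LData.ofAdj (fn φ a).asEquivalence.symm.toAdjunction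
  have hu (a : 𝓑) (X : G.obj a) : IsIso ((L a).un X) :=
    inferInstanceAs (IsIso ((fn φ a).asEquivalence.symm.unit.app X))
  -- The quasi-inverses of the components serve as left adjoints. Their mates are invertible because
  -- the other arrows in `un_mateL` are and φ reflects isomorphisms.
  have hm {a b : 𝓑} (f : a ⟶ b) (X : G.obj a) : IsIso (mateL φ L f X) := by
    have e := un_mateL φ L f X
    have : IsIso ((L b).un ((mp G f).obj X) ≫ (fn φ b).map (mateL φ L f X)) := by
      rw [e]
      infer_instance
    have : IsIso ((fn φ b).map (mateL φ L f X)) := IsIso.of_isIso_comp_left ((L b).un _) _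
    exact isIso_of_reflects_iso _ (fn φ b)
  have hc (a : 𝓑) (X : F.obj a) : IsIso ((L a).ct X) := by
    have e := (L a).un_ct X
    have : IsIso ((L a).un ((fn φ a).obj X) ≫ (fn φ a).map ((L a).ct X)) := by
      rw [e]
      infer_instance
    have : IsIso ((fn φ a).map ((L a).ct X)) := IsIso.of_isIso_comp_left ((L a).un _) _
    exact isIso_of_reflects_iso _ (fn φ a)
  let adj := leftAdjAdjunction φ L hm
  have h₁ : IsIso adj.unit := isIso_of_md _ fun a X => hu a X
  have h₂ : IsIso adj.counit := isIso_of_md _ fun a X => hc a X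
  exact ⟨Bicategory.Equivalence.mkOfAdjointifyCounit (asIso adj.counit).symm (asIso adj.unit).symm,
    rfl⟩

end CatTrans

/-! ### Isomorphic 1-morphisms -/

section Bicat

variable {𝓑 : Type*} [Bicategory 𝓑] {a b c d : 𝓑}

/-- Two 1-morphisms are isomorphic. -/
def IsoMor (f g : a ⟶ b) : Prop := Nonempty (f ≅ g)

namespace IsoMor

variable {f g h : a ⟶ b}

lemma refl (f : a ⟶ b) : IsoMor f f := ⟨Iso.refl _⟩

lemma symm : IsoMor f g → IsoMor g f := fun ⟨e⟩ => ⟨e.symm⟩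

lemma trans : IsoMor f g → IsoMor g h → IsoMor f h := fun ⟨e⟩ ⟨e'⟩ => ⟨e ≪≫ e'⟩

lemma left (k : d ⟶ a) : IsoMor f g → IsoMor (k ≫ f) (k ≫ g) := fun ⟨e⟩ => ⟨whiskerLeftIso k e⟩

lemma right : IsoMor f g → ∀ k : b ⟶ c, IsoMor (f ≫ k) (g ≫ k) :=
  fun ⟨e⟩ k => ⟨whiskerRightIso e k⟩

lemma assoc (f : a ⟶ b) (g : b ⟶ c) (h : c ⟶ d) : IsoMor ((f ≫ g) ≫ h) (f ≫ g ≫ h) := ⟨α_ f g h⟩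

lemma assoc' (f : a ⟶ b) (g : b ⟶ c) (h : c ⟶ d) : IsoMor (f ≫ g ≫ h) ((f ≫ g) ≫ h) :=
  ⟨(α_ f g h).symm⟩

lemma id_comp (f : a ⟶ b) : IsoMor (𝟙 a ≫ f) f := ⟨λ_ f⟩

lemma comp_id (f : a ⟶ b) : IsoMor (f ≫ 𝟙 b) f := ⟨ρ_ f⟩

/-- Rewriting the first two factors of a composition. -/
lemma head {b' : 𝓑} {f : a ⟶ b} {g : b ⟶ c} {f' : a ⟶ b'} {g' : b' ⟶ c}
    (h : IsoMor (f ≫ g) (f' ≫ g')) (k : c ⟶ d) : IsoMor (f ≫ g ≫ k) (f' ≫ g' ≫ k) :=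
  (assoc' _ _ _).trans ((h.right k).trans (assoc _ _ _))

lemma head₁ {f : a ⟶ b} {g : b ⟶ c} {f' : a ⟶ c}
    (h : IsoMor (f ≫ g) f') (k : c ⟶ d) : IsoMor (f ≫ g ≫ k) (f' ≫ k) :=
  (assoc' _ _ _).trans (h.right k)

lemma head₀ {f : a ⟶ b} {g : b ⟶ a} (h : IsoMor (f ≫ g) (𝟙 a)) (k : a ⟶ d) :
    IsoMor (f ≫ g ≫ k) k :=
  (h.head₁ k).trans (id_comp k)

end IsoMor

lemma comp_invMor (f : a ⟶ b) [IsEquivMor f] : IsoMor (f ≫ invMor f) (𝟙 a) := by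
  have h := (IsEquivMor.exists_equivalence (f := f)).choose_spec
  have := (IsEquivMor.exists_equivalence (f := f)).choose.unit.symm
  rw [h] at this
  exact ⟨this⟩

lemma invMor_comp (f : a ⟶ b) [IsEquivMor f] : IsoMor (invMor f ≫ f) (𝟙 b) := by
  have h := (IsEquivMor.exists_equivalence (f := f)).choose_spec
  have := (IsEquivMor.exists_equivalence (f := f)).choose.counit
  rw [h] at this
  exact ⟨this⟩

/-- A 1-morphism with an inverse up to isomorphism is an equivalence. -/
lemma isEquivMor_of_isoMor {f : a ⟶ b} {g : b ⟶ a} (h : IsoMor (f ≫ g) (𝟙 a))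
    (h' : IsoMor (g ≫ f) (𝟙 b)) : IsEquivMor f :=
  let ⟨e⟩ := h
  let ⟨e'⟩ := h'
  ⟨Bicategory.Equivalence.mkOfAdjointifyCounit e.symm e', rfl⟩

/-- Equivalences can be cancelled on the right. -/
lemma IsoMor.cancel_right {f g : a ⟶ b} (k : b ⟶ c) [IsEquivMor k]
    (h : IsoMor (f ≫ k) (g ≫ k)) : IsoMor f g := by
  have key (f : a ⟶ b) : IsoMor ((f ≫ k) ≫ invMor k) f :=
    (assoc _ _ _).trans (((comp_invMor k).left f).trans (comp_id f))
  exact (key f).symm.trans ((h.right _).trans (key g))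

end Bicat

/-! ### Adjoint morphisms of pseudofunctors, componentwise -/

namespace CatTrans

universe w₁ v₁ u₁ v₂ u₂

variable {𝓑 : Type u₁} [Bicategory.{w₁, v₁} 𝓑] {F G H : Pseudofunctor 𝓑 Cat.{v₂, u₂}}

/-- The adjunction between the components of adjoint morphisms. -/
def adjFn {φ : F ⟶ G} {ψ : G ⟶ F} (adj : Bicategory.Adjunction φ ψ) (a : 𝓑) : fn φ a ⊣ fn ψ a :=
  Adjunction.mkOfUnitCounit
    { unit := (adj.unit.as.app a).toNatTrans
      counit := (adj.counit.as.app a).toNatTrans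
      left_triangle := by
        have h := adj.left_triangle
        rw [leftZigzag_eq] at h
        ext X
        have h' : md _ a X = md _ a X := congr(md $h a X)
        change (fn φ a).map ((adj.unit.as.app a).toNatTrans.app X) ≫ 𝟙 _ ≫
          (adj.counit.as.app a).toNatTrans.app ((fn φ a).obj X) = 𝟙 _
        refine Eq.trans ?_ (h'.trans (Category.comp_id _))
        rfl
      right_triangle := by
        have h := adj.right_triangle
        rw [rightZigzag_eq] at h
        ext X
        have h' : md _ a X = md _ a X := congr(md $h a X)
        change (adj.unit.as.app a).toNatTrans.app ((fn ψ a).obj X) ≫ 𝟙 _ ≫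
          (fn ψ a).map ((adj.counit.as.app a).toNatTrans.app X) = 𝟙 _
        refine Eq.trans ?_ (h'.trans (Category.comp_id _))
        rfl }

variable {𝓔 : Pseudofunctor 𝓑 Cat.{v₂, u₂}}

/-- The values of `X` are determined by their image under `φ` in the sense of left extensions. -/
abbrev LValued (φ : F ⟶ G) (X : 𝓔 ⟶ F) : Prop :=
  ∀ a (Y : 𝓔.obj a), LUniv (fn φ a) (𝟙 ((fn φ a).obj ((fn X a).obj Y)))

/-- The values of `X` are determined by their image under `φ` in the sense of right extensions. -/
abbrev RValued (φ : F ⟶ G) (X : 𝓔 ⟶ F) : Prop :=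
  ∀ a (Y : 𝓔.obj a), RUniv (fn φ a) (𝟙 ((fn φ a).obj ((fn X a).obj Y)))

/-- The counit of the adjunction becomes invertible at every value of X, and a modification with
invertible components is invertible. -/
lemma LValued.isoMor_leftAdjoint {φ : F ⟶ G} [Bicategory.IsRightAdjoint φ] {X : 𝓔 ⟶ F}
    (h : LValued φ X) : IsoMor (X ≫ φ ≫ Bicategory.leftAdjoint φ) X := by
  let adj := Bicategory.Adjunction.ofIsRightAdjoint φ
  have : IsIso (X ◁ adj.counit) := isIso_of_md _ fun a Y =>
    (LUniv.id_iff_counit (adjFn adj a) _).1 (h a Y)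
  exact ⟨asIso (X ◁ adj.counit) ≪≫ ρ_ X⟩

lemma RValued.isoMor_rightAdjoint {φ : F ⟶ G} [Bicategory.IsLeftAdjoint φ] {X : 𝓔 ⟶ F}
    (h : RValued φ X) : IsoMor (X ≫ φ ≫ Bicategory.rightAdjoint φ) X := by
  let adj := Bicategory.Adjunction.ofIsLeftAdjoint φ
  have : IsIso (X ◁ adj.unit) := isIso_of_md _ fun a Y =>
    (RUniv.id_iff_unit (adjFn adj a) _).1 (h a Y)
  exact IsoMor.symm ⟨(ρ_ X).symm ≪≫ asIso (X ◁ adj.unit)⟩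

/-- Morphisms with left extended values are determined by their composition with `φ`. -/
lemma LValued.isoMor {φ : F ⟶ G} [Bicategory.IsRightAdjoint φ] {X X' : 𝓔 ⟶ F}
    (h : LValued φ X) (h' : LValued φ X') (e : IsoMor (X ≫ φ) (X' ≫ φ)) : IsoMor X X' :=
  h.isoMor_leftAdjoint.symm.trans ((e.head _).trans h'.isoMor_leftAdjoint)

/-- Morphisms with right extended values are determined by their composition with `φ`. -/
lemma RValued.isoMor {φ : F ⟶ G} [Bicategory.IsLeftAdjoint φ] {X X' : 𝓔 ⟶ F}
    (h : RValued φ X) (h' : RValued φ X') (e : IsoMor (X ≫ φ) (X' ≫ φ)) : IsoMor X X' :=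
  h.isoMor_rightAdjoint.symm.trans ((e.head _).trans h'.isoMor_rightAdjoint)

lemma lUniv_leftAdjoint (φ : F ⟶ G) [Bicategory.IsRightAdjoint φ] (a : 𝓑) (Y : G.obj a) :
    LUniv (fn φ a) ((adjFn (Bicategory.Adjunction.ofIsRightAdjoint φ) a).unit.app Y) :=
  LUniv.of_adj _ Y

lemma rUniv_rightAdjoint (φ : F ⟶ G) [Bicategory.IsLeftAdjoint φ] (a : 𝓑) (Y : G.obj a) :
    RUniv (fn φ a) ((adjFn (Bicategory.Adjunction.ofIsLeftAdjoint φ) a).counit.app Y) :=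
  RUniv.of_adj _ Y

/-- If universal arrows are invertible, the left adjoint is a section. -/
lemma leftAdjoint_comp (φ : F ⟶ G) [Bicategory.IsRightAdjoint φ]
    (h : ∀ a ⦃Y : G.obj a⦄ ⦃V : F.obj a⦄ (θ : Y ⟶ (fn φ a).obj V), LUniv (fn φ a) θ → IsIso θ) :
    IsoMor (Bicategory.leftAdjoint φ ≫ φ) (𝟙 G) := by
  have : IsIso (Bicategory.Adjunction.ofIsRightAdjoint φ).unit := isIso_of_md _ fun a Y =>
    h a _ (lUniv_leftAdjoint φ a Y)
  exact ⟨(asIso (Bicategory.Adjunction.ofIsRightAdjoint φ).unit).symm⟩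

/-- If universal arrows are invertible, the right adjoint is a section. -/
lemma rightAdjoint_comp (φ : F ⟶ G) [Bicategory.IsLeftAdjoint φ]
    (h : ∀ a ⦃Y : G.obj a⦄ ⦃V : F.obj a⦄ (θ : (fn φ a).obj V ⟶ Y), RUniv (fn φ a) θ → IsIso θ) :
    IsoMor (Bicategory.rightAdjoint φ ≫ φ) (𝟙 G) := by
  have : IsIso (Bicategory.Adjunction.ofIsLeftAdjoint φ).counit := isIso_of_md _ fun a Y =>
    h a _ (rUniv_rightAdjoint φ a Y)
  exact ⟨asIso (Bicategory.Adjunction.ofIsLeftAdjoint φ).counit⟩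

end CatTrans

lemma isIso_of_app {𝒞 𝒟 : Type*} [Category 𝒞] [Category 𝒟] {F G : 𝒞 ⥤ 𝒟} (α : F ⟶ G)
    (h : ∀ X, IsIso (α.app X)) : IsIso α := NatIso.isIso_of_isIso_app α

/-! ### Kan extensions as morphisms of prederivators. -/

namespace Prederivator

open CatTrans

variable (D : Prederivator.{w, v, u})

variable {D} [D.IsDerivator]

/-- The components of the adjoints come from Der3 for u × A, respectively for the inclusion of {b} ×
A. Their pseudo-naturality is base change for the squares that exchange these functors with a change
of the parameter category. -/
instance : D.HasKanMorphisms where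
  lan {B B'} _ _ u := by
    have (a : (Cat.{w, w})ᵒᵖ) : (fn (D.resMor u) a).IsRightAdjoint :=
      IsDerivator.der3_left (D := D) (u.prod (𝟭 a.unop))
    refine isRightAdjoint_of_lUniv _ fun {a b} f X Z η hη => ?_
    -- The square of `lEx_prod` carries an identity transformation, which the structure isomorphism
    -- of `resMor` does not mention; inserting it identifies the two arrows.
    refine (congrArg (LUniv _) ?_).mpr (lEx_iff.1 (lEx_prod (D := D) u f.unop.toFunctor) η hη)
    refine Eq.trans ?_ (Category.assoc _ _ _).symm
    exact congr(_ ≫ _ ≫ $((Category.id_comp _).symm.trans congr($((D.tr_id _ Z).symm) ≫ _)))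
  ran {B B'} _ _ u := by
    have (a : (Cat.{w, w})ᵒᵖ) : (fn (D.resMor u) a).IsLeftAdjoint :=
      IsDerivator.der3_right (D := D) (u.prod (𝟭 a.unop))
    refine isLeftAdjoint_of_rUniv _ fun {a b} f X Z η hη => ?_
    refine (congrArg (RUniv _) ?_).mpr (rEx_iff.1 (rEx_prod (D := D) u f.unop.toFunctor) η hη)
    refine (Category.assoc _ _ _).trans ?_
    exact congr(_ ≫ $((Category.id_comp _).symm.trans congr($((D.tr_id _ Z).symm) ≫ _)))
  lanEv {B} _ x := by
    have (a : (Cat.{w, w})ᵒᵖ) : (fn (D.ev x) a).IsRightAdjoint :=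
      IsDerivator.der3_left (D := D) (Prod.sectR x a.unop)
    refine isRightAdjoint_of_lUniv _ fun {a b} f X Z η hη => ?_
    refine (congrArg (LUniv _) ?_).mpr (lEx_iff.1 (lEx_sectR_prod (D := D) x f.unop.toFunctor) η hη)
    refine Eq.trans ?_ (Category.assoc _ _ _).symm
    exact congr(_ ≫ _ ≫ $((Category.id_comp _).symm.trans congr($((D.tr_id _ Z).symm) ≫ _)))
  ranEv {B} _ x := by
    have (a : (Cat.{w, w})ᵒᵖ) : (fn (D.ev x) a).IsLeftAdjoint :=
      IsDerivator.der3_right (D := D) (Prod.sectR x a.unop)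
    refine isLeftAdjoint_of_rUniv _ fun {a b} f X Z η hη => ?_
    refine (congrArg (RUniv _) ?_).mpr (rEx_iff.1 (rEx_sectR_prod (D := D) x f.unop.toFunctor) η hη)
    refine (Category.assoc _ _ _).trans ?_
    exact congr(_ ≫ $((Category.id_comp _).symm.trans congr($((D.tr_id _ Z).symm) ≫ _)))

/-! ### Pointwise criteria -/

variable {A B K : Type w} [SmallCategory A] [SmallCategory B] [SmallCategory K]

instance (u : A ⥤ B) (k : K) : IsIso (sectLSq u k) := by
  exact isIso_of_app _ fun _ => IsIso.id _
instance (u : A ⥤ B) (k : K) : IsIso (sectLSq' u k) := by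
  exact isIso_of_app _ fun _ => IsIso.id _
instance (u : A ⥤ B) (k : K) : IsIso (sectRSq u k) := by
  exact isIso_of_app _ fun _ => IsIso.id _
instance (u : A ⥤ B) (k : K) : IsIso (sectRSq' u k) := by
  exact isIso_of_app _ fun _ => IsIso.id _
instance (b : B) (k : K) : IsIso (ptSq b k) := by
  exact isIso_of_app _ fun _ => IsIso.id _
instance (b : B) (k : K) : IsIso (ptSq' b k) := by
  exact isIso_of_app _ fun _ => IsIso.id _

/-- Being left extended in the first variable is decided separately at each object of the parameter
category. All later statements about values of morphisms of prederivators are therefore made for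
single diagrams without parameter. -/
lemma lExt_prod_iff (u : A ⥤ B) (M : D.Diag (B × K)) :
    D.LExt (u.prod (𝟭 K)) M ↔ ∀ k, D.LExt u ((D.res (Prod.sectL B k)).obj M) :=
  ⟨fun h k => LExt.baseChange (lEx_sectL u k) h, fun h =>
    LExt.of_family (fun _ : K => A) (fun _ => B) (fun k => Prod.sectL A k) (fun _ => u)
      (fun k => Prod.sectL B k) (fun k => sectLSq u k) (fun k => lEx_sectL u k)
      (fun m hm => isIso_of_sectL m hm) h⟩

lemma rExt_prod_iff (u : A ⥤ B) (M : D.Diag (B × K)) :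
    D.RExt (u.prod (𝟭 K)) M ↔ ∀ k, D.RExt u ((D.res (Prod.sectL B k)).obj M) :=
  ⟨fun h k => RExt.baseChange (rEx_sectL u k) h, fun h =>
    RExt.of_family (fun _ : K => A) (fun _ => B) (fun k => Prod.sectL A k) (fun _ => u)
      (fun k => Prod.sectL B k) (fun k => sectLSq' u k) (fun k => rEx_sectL u k)
      (fun m hm => isIso_of_sectL m hm) h⟩

lemma lExt_id_prod_iff (u : A ⥤ B) (M : D.Diag (K × B)) :
    D.LExt ((𝟭 K).prod u) M ↔ ∀ k, D.LExt u ((D.res (Prod.sectR k B)).obj M) :=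
  ⟨fun h k => LExt.baseChange (lEx_sectR u k) h, fun h =>
    LExt.of_family (fun _ : K => A) (fun _ => B) (fun k => Prod.sectR k A) (fun _ => u)
      (fun k => Prod.sectR k B) (fun k => sectRSq u k) (fun k => lEx_sectR u k)
      (fun m hm => isIso_of_sectR m hm) h⟩

lemma rExt_id_prod_iff (u : A ⥤ B) (M : D.Diag (K × B)) :
    D.RExt ((𝟭 K).prod u) M ↔ ∀ k, D.RExt u ((D.res (Prod.sectR k B)).obj M) :=
  ⟨fun h k => RExt.baseChange (rEx_sectR u k) h, fun h =>
    RExt.of_family (fun _ : K => A) (fun _ => B) (fun k => Prod.sectR k A) (fun _ => u)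
      (fun k => Prod.sectR k B) (fun k => sectRSq' u k) (fun k => rEx_sectR u k)
      (fun m hm => isIso_of_sectR m hm) h⟩

lemma lExt_sectR_iff (b : B) (M : D.Diag (B × K)) :
    D.LExt (Prod.sectR b K) M ↔ ∀ k, D.LExt (pt b) ((D.res (Prod.sectL B k)).obj M) :=
  ⟨fun h k => LExt.baseChange (lEx_pt b k) h, fun h =>
    LExt.of_family (fun _ : K => Pt.{w}) (fun _ => B) (fun k => pt k) (fun _ => pt b)
      (fun k => Prod.sectL B k) (fun k => ptSq b k) (fun k => lEx_pt b k)
      (fun m hm => isIso_of_sectL m hm) h⟩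

lemma rExt_sectR_iff (b : B) (M : D.Diag (B × K)) :
    D.RExt (Prod.sectR b K) M ↔ ∀ k, D.RExt (pt b) ((D.res (Prod.sectL B k)).obj M) :=
  ⟨fun h k => RExt.baseChange (rEx_pt b k) h, fun h =>
    RExt.of_family (fun _ : K => Pt.{w}) (fun _ => B) (fun k => pt k) (fun _ => pt b)
      (fun k => Prod.sectL B k) (fun k => ptSq' b k) (fun k => rEx_pt b k)
      (fun m hm => isIso_of_sectL m hm) h⟩

end Prederivator

/-- Three commuting squares of comparison isomorphisms, each an instance of `cmp_assoc` in the
applications, are pasted to one equation of structure isomorphisms. -/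
lemma paste_isos {𝒞 : Type*} [Category 𝒞] {N X₁ X₂ Y₁ Z₂ W₁ V₂ U₁ : 𝒞} (a : N ≅ X₁) (b : X₁ ≅ X₂)
    (c : N ≅ Y₁) (d : Y₁ ≅ X₂) (h₁ : a.hom ≫ b.hom = c.hom ≫ d.hom) (e : Y₁ ≅ Z₂) (f : N ≅ W₁)
    (g : W₁ ≅ Z₂) (h₂ : f.hom ≫ g.hom = c.hom ≫ e.hom) (h : W₁ ≅ V₂) (i : N ≅ U₁) (j : U₁ ≅ V₂)
    (h₃ : f.hom ≫ h.hom = i.hom ≫ j.hom) :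
    b.inv ≫ a.inv ≫ i.hom = (d.inv ≫ e.hom) ≫ (g.inv ≫ h.hom) ≫ j.inv := by
  rw [← cancel_epi b.hom, ← cancel_epi a.hom, b.hom_inv_id_assoc, a.hom_inv_id_assoc]
  simp only [Category.assoc]
  rw [reassoc_of% h₁, d.hom_inv_id_assoc, ← reassoc_of% h₂, g.hom_inv_id_assoc, reassoc_of% h₃,
    j.hom_inv_id, Category.comp_id]

lemma paste_isos_map {𝒞 : Type*} [Category 𝒞] {N N' X₁ X₁' X₂ U U' V₂ : 𝒞} {b : X₁ ≅ X₂} {a : N ≅ X₁}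
    {i : N ⟶ U} {p : X₂ ⟶ V₂} {j : V₂ ⟶ U} (h : b.inv ≫ a.inv ≫ i = p ≫ j)
    (t : X₁ ⟶ X₁') (w : N ⟶ N') (n : N' ≅ X₁') (h₁ : w ≫ n.hom = a.hom ≫ t) (m : N' ⟶ U')
    (s : U ⟶ U') (h₂ : w ≫ m = i ≫ s) :
    (b.inv ≫ t) ≫ n.inv ≫ m = p ≫ j ≫ s := by
  have h₃ : t = a.inv ≫ w ≫ n.hom := by rw [h₁, a.inv_hom_id_assoc]
  rw [h₃]
  simp only [Category.assoc, n.hom_inv_id_assoc]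
  rw [h₂, ← reassoc_of% h]

lemma paste_nat {𝒞 : Type*} [Category 𝒞] {M M₁ M₂ N N₁ N₂ : 𝒞} {n : M ⟶ N}
    {p : M ≅ M₁} {q : N ≅ N₁} {c : M₁ ⟶ N₁} {p' : M ≅ M₂} {q' : N ≅ N₂} {c' : M₂ ⟶ N₂}
    (h : n ≫ q.hom = p.hom ≫ c) (h' : n ≫ q'.hom = p'.hom ≫ c') :
    c ≫ q.inv ≫ q'.hom = (p.inv ≫ p'.hom) ≫ c' := by
  rw [← cancel_epi p.hom, ← reassoc_of% h, q.hom_inv_id_assoc, h', Category.assoc,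
    p.hom_inv_id_assoc]

/-! ### Composition, evaluation and currying of restriction morphisms. -/

namespace Prederivator

open CatTrans

section

variable (D : Prederivator.{w, v, u})
variable {A B C E K : Type w} [SmallCategory A] [SmallCategory B] [SmallCategory C]
  [SmallCategory E] [SmallCategory K]

lemma resMor_comp (f : A ⥤ B) (g : B ⥤ C) :
    IsoMor (D.resMor g ≫ D.resMor f) (D.resMor (f ⋙ g)) := by
  refine ⟨isoMk (fun a => (D.resComp (f.prod (𝟭 a.unop)) (g.prod (𝟭 a.unop))).symm) ?_⟩
  intro a b k X
  refine Eq.trans ?_ congr($((nt_vcomp (D.resMor g) (D.resMor f) k X).symm) ≫ _)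
  refine (paste_isos (D.cmp (f.prod (𝟭 b.unop) ⋙ g.prod (𝟭 b.unop)) ((𝟭 C).prod k.unop.toFunctor) X)
    (D.cmp (f.prod (𝟭 b.unop)) (g.prod (𝟭 b.unop)) _) _
    ((D.res _).mapIso (D.cmp (g.prod (𝟭 b.unop)) ((𝟭 C).prod k.unop.toFunctor) X))
    (D.cmp_assoc _ _ _ X)
    ((D.res _).mapIso (D.cmp ((𝟭 B).prod k.unop.toFunctor) (g.prod (𝟭 a.unop)) X)) _
    (D.cmp (f.prod (𝟭 b.unop)) ((𝟭 B).prod k.unop.toFunctor) _)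
    (D.cmp_assoc (f.prod (𝟭 b.unop)) ((𝟭 B).prod k.unop.toFunctor) (g.prod (𝟭 a.unop)) X)
    (D.cmp ((𝟭 A).prod k.unop.toFunctor) (f.prod (𝟭 a.unop)) _) _
    ((D.res _).mapIso (D.cmp (f.prod (𝟭 a.unop)) (g.prod (𝟭 a.unop)) X))
    (D.cmp_assoc ((𝟭 A).prod k.unop.toFunctor) (f.prod (𝟭 a.unop)) (g.prod (𝟭 a.unop)) X)).trans ?_
  refine Eq.trans ?_ (Category.assoc _ _ _).symm
  exact congr($(((D.res _).map_comp _ _).symm) ≫ _)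

/-- The functors `k ↦ (f x, k)` obtained from `x` and `f`. -/
def sectRIso (f : A ⥤ B) (x : A) (K : Type w) [SmallCategory K] :
    Prod.sectR x K ⋙ f.prod (𝟭 K) ≅ Prod.sectR (f.obj x) K :=
  NatIso.ofComponents (fun _ => Iso.refl _) fun g => by
    refine (Category.comp_id _).trans (Eq.trans ?_ (Category.id_comp _).symm)
    exact Prod.ext (f.map_id x) rfl

lemma resMor_ev (f : A ⥤ B) (x : A) : IsoMor (D.resMor f ≫ D.ev x) (D.ev (f.obj x)) := by
  refine ⟨isoMk (fun a => (D.resComp (Prod.sectR x a.unop) (f.prod (𝟭 a.unop))).symm ≪≫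
    D.resIso (sectRIso f x a.unop)) ?_⟩
  intro a b k X
  have h := paste_isos
    (D.cmp (Prod.sectR x b.unop ⋙ f.prod (𝟭 b.unop)) ((𝟭 B).prod k.unop.toFunctor) X)
    (D.cmp (Prod.sectR x b.unop) (f.prod (𝟭 b.unop)) _) _
    ((D.res _).mapIso (D.cmp (f.prod (𝟭 b.unop)) ((𝟭 B).prod k.unop.toFunctor) X))
    (D.cmp_assoc _ _ _ X)
    ((D.res _).mapIso (D.cmp ((𝟭 A).prod k.unop.toFunctor) (f.prod (𝟭 a.unop)) X)) _
    (D.cmp (Prod.sectR x b.unop) ((𝟭 A).prod k.unop.toFunctor) _)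
    (D.cmp_assoc (Prod.sectR x b.unop) ((𝟭 A).prod k.unop.toFunctor) (f.prod (𝟭 a.unop)) X)
    (D.cmp k.unop.toFunctor (Prod.sectR x a.unop) _) _
    ((D.res _).mapIso (D.cmp (Prod.sectR x a.unop) (f.prod (𝟭 a.unop)) X))
    (D.cmp_assoc k.unop.toFunctor (Prod.sectR x a.unop) (f.prod (𝟭 a.unop)) X)
  have h₁ := D.tr_whiskerRight (sectRIso f x b.unop).hom ((𝟭 B).prod k.unop.toFunctor) X
  have h₂ := D.tr_whiskerLeft k.unop.toFunctor (sectRIso f x a.unop).hom X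
  have h₃ : Functor.whiskerRight (sectRIso f x b.unop).hom ((𝟭 B).prod k.unop.toFunctor) =
      k.unop.toFunctor.whiskerLeft (sectRIso f x a.unop).hom := by
    ext y
    · rfl
    · exact k.unop.toFunctor.map_id _
  rw [h₃] at h₁
  refine Eq.trans ?_ congr($((nt_vcomp (D.resMor f) (D.ev x) k X).symm) ≫ _)
  have e₁ := (D.res (Prod.sectR x b.unop)).map_comp
    (D.cmp (f.prod (𝟭 b.unop)) ((𝟭 B).prod k.unop.toFunctor) X).inv
    (D.cmp ((𝟭 A).prod k.unop.toFunctor) (f.prod (𝟭 a.unop)) X).hom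
  have e₂ := (D.res k.unop.toFunctor).map_comp
    (D.cmp (Prod.sectR x a.unop) (f.prod (𝟭 a.unop)) X).inv (D.tr (sectRIso f x a.unop).hom X)
  refine Eq.trans ?_ congr(($(e₁.symm) ≫ _) ≫ _)
  refine Eq.trans ?_ congr(_ ≫ $(e₂.symm))
  refine Eq.trans ?_ (Category.assoc _ _ _).symm
  exact (paste_isos_map (h.trans (Category.assoc _ _ _).symm) _ _ _ h₁ _ _ h₂).trans (Category.assoc _ _ _)

variable (B K) in
/-- The canonical functor `B × (K × A) ⥤ (B × K) × A`. -/
abbrev unassoc (A : Type w) [SmallCategory A] : B × (K × A) ⥤ (B × K) × A :=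
  prod.inverseAssociator B K A

/-- The morphism `D^{B × K} ⟶ (D^B)^K`. -/
def curryMor (B K : Type w) [SmallCategory B] [SmallCategory K] :
    D.shift (B × K) ⟶ (D.shift B).shift K where
  app A := D.map (unassoc B K A.unop).toCatHom.op
  naturality {A A'} f := (D.mapComp (shMap (B × K) f) (unassoc B K A'.unop).toCatHom.op).symm ≪≫
    D.mapComp (unassoc B K A.unop).toCatHom.op (shMap B (shMap K f))
  naturality_naturality {A A'} f g θ :=
    coh_nat (D.map₂ (shMap₂ (B × K) θ)) (D.map₂ (shMap₂ B (shMap₂ K θ))) _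
     (D.mapComp (shMap (B × K) f) (unassoc B K A'.unop).toCatHom.op)
     (D.mapComp (unassoc B K A.unop).toCatHom.op (shMap B (shMap K f)))
     (D.mapComp (shMap (B × K) g) (unassoc B K A'.unop).toCatHom.op)
     (D.mapComp (unassoc B K A.unop).toCatHom.op (shMap B (shMap K g)))
     (D.map₂_whisker_right (shMap₂ (B × K) θ) (unassoc B K A'.unop).toCatHom.op)
     (D.map₂_whisker_left (unassoc B K A.unop).toCatHom.op (shMap₂ B (shMap₂ K θ)))
  naturality_id A := coh_id (D.mapId _) (D.mapId _)
    (D.mapComp (𝟙 (op (Cat.of ((B × K) × A.unop)))) (unassoc B K A.unop).toCatHom.op)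
    (D.mapComp (unassoc B K A.unop).toCatHom.op (𝟙 (op (Cat.of (B × (K × A.unop))))))
    (D.map_lunit _) (D.map_runit _)
  naturality_comp {X Y Z} f g := coh_comp
    (D.mapComp (shMap (B × K) f) (shMap (B × K) g))
    (D.mapComp (shMap B (shMap K f)) (shMap B (shMap K g)))
    (D.mapComp (shMap (B × K) f) (unassoc B K Y.unop).toCatHom.op)
    (D.mapComp (unassoc B K X.unop).toCatHom.op (shMap B (shMap K f)))
    (D.mapComp (shMap (B × K) g) (unassoc B K Z.unop).toCatHom.op)
    (D.mapComp (unassoc B K Y.unop).toCatHom.op (shMap B (shMap K g)))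
    (D.mapComp (shMap (B × K) f ≫ shMap (B × K) g) (unassoc B K Z.unop).toCatHom.op)
    (D.mapComp (unassoc B K X.unop).toCatHom.op (shMap B (shMap K f) ≫ shMap B (shMap K g)))
    (D.mapComp (shMap (B × K) f) (shMap (B × K) g ≫ (unassoc B K Z.unop).toCatHom.op))
    (D.mapComp ((unassoc B K X.unop).toCatHom.op ≫ shMap B (shMap K f)) (shMap B (shMap K g)))
    (D.map_assoc (shMap (B × K) f) (shMap (B × K) g) (unassoc B K Z.unop).toCatHom.op)
    (D.map_assoc (shMap (B × K) f) (unassoc B K Y.unop).toCatHom.op (shMap B (shMap K g)))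
    (D.map_assoc (unassoc B K X.unop).toCatHom.op (shMap B (shMap K f)) (shMap B (shMap K g)))

lemma curryMor_ev (B : Type w) [SmallCategory B] {K : Type w} [SmallCategory K] (x : K) :
    IsoMor (D.curryMor B K ≫ (D.shift B).ev x) (D.resMor (Prod.sectL B x)) := by
  refine ⟨isoMk (fun a => (D.resComp ((𝟭 B).prod (Prod.sectR x a.unop))
    (unassoc B K a.unop)).symm) ?_⟩
  intro a b k X
  refine Eq.trans ?_ congr($((nt_vcomp (D.curryMor B K) ((D.shift B).ev x) k X).symm) ≫ _)
  have e₁ := (D.res ((𝟭 B).prod (Prod.sectR x b.unop))).map_comp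
    (D.cmp (unassoc B K b.unop) ((𝟭 (B × K)).prod k.unop.toFunctor) X).inv
    (D.cmp ((𝟭 B).prod ((𝟭 K).prod k.unop.toFunctor)) (unassoc B K a.unop) X).hom
  refine Eq.trans ?_ congr(($(e₁.symm) ≫ _) ≫ _)
  refine Eq.trans ?_ (Category.assoc _ _ _).symm
  exact paste_isos
    (D.cmp ((𝟭 B).prod (Prod.sectR x b.unop) ⋙ unassoc B K b.unop)
      ((𝟭 (B × K)).prod k.unop.toFunctor) X)
    (D.cmp ((𝟭 B).prod (Prod.sectR x b.unop)) (unassoc B K b.unop) _) _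
    ((D.res _).mapIso (D.cmp (unassoc B K b.unop) ((𝟭 (B × K)).prod k.unop.toFunctor) X))
    (D.cmp_assoc _ _ _ X)
    ((D.res _).mapIso (D.cmp ((𝟭 B).prod ((𝟭 K).prod k.unop.toFunctor)) (unassoc B K a.unop) X)) _
    (D.cmp ((𝟭 B).prod (Prod.sectR x b.unop)) ((𝟭 B).prod ((𝟭 K).prod k.unop.toFunctor)) _)
    (D.cmp_assoc ((𝟭 B).prod (Prod.sectR x b.unop)) ((𝟭 B).prod ((𝟭 K).prod k.unop.toFunctor))
      (unassoc B K a.unop) X)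
    (D.cmp ((𝟭 B).prod k.unop.toFunctor) ((𝟭 B).prod (Prod.sectR x a.unop)) _) _
    ((D.res _).mapIso (D.cmp ((𝟭 B).prod (Prod.sectR x a.unop)) (unassoc B K a.unop) X))
    (D.cmp_assoc ((𝟭 B).prod k.unop.toFunctor) ((𝟭 B).prod (Prod.sectR x a.unop))
      (unassoc B K a.unop) X)

end

section

variable {E F : Prederivator.{w, v, u}} (φ : E ⟶ F)

/-- The morphism of shifted prederivators induced by a morphism. -/
def shiftMor (B : Type w) [SmallCategory B] : E.shift B ⟶ F.shift B where
  app A := φ.app (op (Cat.of (B × A.unop)))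
  naturality f := φ.naturality (shMap B f)
  naturality_naturality θ := φ.naturality_naturality (shMap₂ B θ)
  naturality_id A := φ.naturality_id (op (Cat.of (B × A.unop)))
  naturality_comp f g := φ.naturality_comp (shMap B f) (shMap B g)

/-- The isomorphism is the structure isomorphism of φ at the inclusion of {x} × A in B × A. Its
compatibility with a change of A comes from the two ways of composing that inclusion. -/
lemma shiftMor_ev {B : Type w} [SmallCategory B] (x : B) :
    IsoMor (shiftMor φ B ≫ F.ev x) (E.ev x ≫ φ) := by
  refine IsoMor.symm ⟨isoMk (fun a : (Cat.{w, w})ᵒᵖ =>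
    Cat.Hom.toNatIso (φ.naturality (Prod.sectR x a.unop).toCatHom.op)) ?_⟩
  intro a b k X
  refine Eq.trans congr(_ ≫ $(nt_vcomp (shiftMor φ B) (F.ev x) k X)) ?_
  refine Eq.trans ?_ congr($((nt_vcomp (E.ev x) φ k X).symm) ≫ _)
  have h₁ := nt_comp φ (shMap B k) (Prod.sectR x b.unop).toCatHom.op X
  have h₂ := nt_comp φ (Prod.sectR x a.unop).toCatHom.op k X
  have h₃ := (fn φ b).map_comp (E.cmp (Prod.sectR x b.unop) ((𝟭 B).prod k.unop.toFunctor) X).inv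
    (E.cmp k.unop.toFunctor (Prod.sectR x a.unop) X).hom
  refine Eq.trans ?_ congr(($(h₃.symm) ≫ _) ≫ _)
  refine Eq.trans ?_ (Category.assoc _ _ _).symm
  refine Eq.trans (Category.assoc _ _ _).symm ?_
  exact paste_nat
    (p := (fn φ b).mapIso (E.cmp (Prod.sectR x b.unop) ((𝟭 B).prod k.unop.toFunctor) X))
    (p' := (fn φ b).mapIso (E.cmp k.unop.toFunctor (Prod.sectR x a.unop) X))
    (q := F.cmp (Prod.sectR x b.unop) ((𝟭 B).prod k.unop.toFunctor) _)
    (q' := F.cmp k.unop.toFunctor (Prod.sectR x a.unop) _) h₁ h₂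

end

end Prederivator

/-! ### Full subprederivators and pointwise properties of morphisms. -/

namespace Prederivator

open CatTrans

section Sub

variable {E F : Prederivator.{w, v, u}} (P : Pseudofunctor.ObjectProperty F)
  [P.IsClosedUnderMapObj]

/-- Morphisms to a full subprederivator are determined by their composition with the inclusion. -/
lemma isoMor_of_comp_ι {X Y : E ⟶ P.fullsubcategory} (h : IsoMor (X ≫ P.ι) (Y ≫ P.ι)) :
    IsoMor X Y := by
  obtain ⟨e⟩ := h
  refine ⟨isoMk (fun a => NatIso.ofComponents (fun M => (P.prop a).isoMk
    { hom := md e.hom a M, inv := md e.inv a M, hom_inv_id := ?_, inv_hom_id := ?_ }) ?_) ?_⟩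
  · exact congr(md $(e.hom_inv_id) a M)
  · exact congr(md $(e.inv_hom_id) a M)
  · intro M N g
    exact ObjectProperty.hom_ext _ (md_naturality e.hom a g)
  · intro a b f M
    apply ObjectProperty.hom_ext
    have h := md_nt e.hom f M
    rw [nt_vcomp, nt_vcomp] at h
    refine Eq.trans ?_ (h.trans ?_)
    · exact congr(_ ≫ $((Category.comp_id _).symm))
    · exact congr($(Category.comp_id _) ≫ _)

lemma liftSub_comp_ι (X : E ⟶ F) (h : ∀ a M, P.prop a ((X.app a).toFunctor.obj M)) :
    IsoMor (liftSub P X h ≫ P.ι) X := by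
  refine ⟨isoMk (fun a => Iso.refl _) fun {a b} f M => ?_⟩
  rw [nt_vcomp]
  have h := (mp F f).map_id ((fn X a).obj M)
  exact (Category.id_comp (nt X f M).hom).trans ((Category.comp_id (nt X f M).hom).symm.trans
    (congr($((Category.comp_id (nt X f M).hom).symm) ≫ $(h.symm))))

end Sub

section Kan

variable {A B K : Type w} [SmallCategory A] [SmallCategory B] [SmallCategory K]

instance {C : Type w} [SmallCategory C] (f : A ⥤ B) (g : K ⥤ C) [f.Full] [g.Full] :
    (f.prod g).Full where
  map_surjective h := ⟨(f.preimage h.1, g.preimage h.2),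
    Prod.ext (f.map_preimage _) (g.map_preimage _)⟩

instance {C : Type w} [SmallCategory C] (f : A ⥤ B) (g : K ⥤ C) [f.Faithful] [g.Faithful] :
    (f.prod g).Faithful where
  map_injective h := Prod.ext (f.map_injective congr($(h).1)) (g.map_injective congr($(h).2))

instance (b : B) [Subsingleton (b ⟶ b)] : (Prod.sectR b K).Full where
  map_surjective h := ⟨h.2, Prod.ext (Subsingleton.elim (α := b ⟶ b) _ _) rfl⟩

instance (b : B) : (Prod.sectR b K).Faithful where
  map_injective h := congr($(h).2)

variable {D : Prederivator.{w, v, u}} {E : Prederivator.{w, v, u}}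

/-- The restriction of a diagram in `D(B × K)` to `B × {k}`, after restriction to `A × K`. -/
def sectLRes (f : A ⥤ B) (k : K) (M : D.Diag (B × K)) :
    (D.res (Prod.sectL A k)).obj ((D.res (f.prod (𝟭 K))).obj M) ≅
      (D.res f).obj ((D.res (Prod.sectL B k)).obj M) :=
  (D.cmp _ _ M).symm ≪≫ (D.resIso (NatIso.ofComponents (F := Prod.sectL A k ⋙ f.prod (𝟭 K))
    (G := f ⋙ Prod.sectL B k) (fun _ => Iso.refl _)
    (fun _ => (Category.comp_id _).trans (Category.id_comp _).symm))).app M ≪≫ D.cmp _ _ M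

/-- The restrictions of the values of `X` to all objects of the parameter categories satisfy
`p`. -/
def PtProp (X : E ⟶ D.shift B) (p : D.Diag B → Prop) : Prop :=
  ∀ (a : (Cat.{w, w})ᵒᵖ) (Y : E.obj a) (k : a.unop),
    p ((D.res (Prod.sectL B k)).obj ((fn X a).obj Y))

namespace PtProp

variable {X : E ⟶ D.shift B} {p q : D.Diag B → Prop}

lemma imp (h : PtProp X p) (hpq : ∀ M, p M → q M) : PtProp X q := fun a Y k => hpq _ (h a Y k)

lemma and (h : PtProp X p) (h' : PtProp X q) : PtProp X (fun M => p M ∧ q M) :=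
  fun a Y k => ⟨h a Y k, h' a Y k⟩

lemma comp_left {E' : Prederivator.{w, v, u}} (h : PtProp X p) (Z : E' ⟶ E) :
    PtProp (Z ≫ X) p := fun a _ k => h a _ k

lemma resMor (h : PtProp X p) (f : A ⥤ B) {q : D.Diag A → Prop}
    (hq : ∀ M, p M → ∀ N, Nonempty ((D.res f).obj M ≅ N) → q N) : PtProp (X ≫ D.resMor f) q :=
  fun a Y k => hq _ (h a Y k) _ ⟨(sectLRes f k _).symm⟩

lemma of_resMor {f : A ⥤ B} {p : D.Diag A → Prop} (h : PtProp (X ≫ D.resMor f) p)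
    (hq : ∀ M, (∃ N, p N ∧ Nonempty (N ≅ (D.res f).obj M)) → q M) : PtProp X q :=
  fun a Y k => hq _ ⟨_, h a Y k, ⟨sectLRes f k _⟩⟩

lemma of_isoMor {X' : E ⟶ D.shift B} (h : PtProp X p) (e : IsoMor X X')
    (hp : ∀ M N, Nonempty (M ≅ N) → p M → p N) : PtProp X' p :=
  fun a Y k => hp _ _ (e.elim fun e => ⟨(D.res _).mapIso
    { hom := md e.hom a Y
      inv := md e.inv a Y
      hom_inv_id := congr(md $(e.hom_inv_id) a Y)
      inv_hom_id := congr(md $(e.inv_hom_id) a Y) }⟩) (h a Y k)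

end PtProp

variable [D.IsDerivator]

/-- Reduces the hypothesis of `LValued.isoMor`, which concerns all parameter categories, to a
property of single diagrams. -/
lemma lValued_resMor (f : A ⥤ B) {X : E ⟶ D.shift B} (h : PtProp X (D.LExt f)) :
    LValued (D.resMor f) X := fun a Y => (lExt_prod_iff f _).2 (h a Y)

lemma rValued_resMor (f : A ⥤ B) {X : E ⟶ D.shift B} (h : PtProp X (D.RExt f)) :
    RValued (D.resMor f) X := fun a Y => (rExt_prod_iff f _).2 (h a Y)

lemma rValued_ev (b : B) {X : E ⟶ D.shift B} (h : PtProp X (D.RExt (pt b))) :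
    RValued (D.ev b) X := fun a Y => (rExt_sectR_iff b _).2 (h a Y)

section

variable (D) (f : A ⥤ B) [f.Full] [f.Faithful]

lemma lanMor_resMor : IsoMor (D.lanMor f ≫ D.resMor f) (𝟙 _) :=
  leftAdjoint_comp (D.resMor f) fun a _ _ _ h => LUniv.isIso_of_fullyFaithful (f.prod (𝟭 a.unop)) h

lemma ranMor_resMor : IsoMor (D.ranMor f ≫ D.resMor f) (𝟙 _) :=
  rightAdjoint_comp (D.resMor f) fun a _ _ _ h =>
    RUniv.isIso_of_fullyFaithful (f.prod (𝟭 a.unop)) h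

lemma ptProp_lanMor : PtProp (D.lanMor f) (D.LExt f) := fun a Y =>
  (lExt_prod_iff f _).1 (LUniv.lExt_of_fullyFaithful (lUniv_leftAdjoint (D.resMor f) a Y))

lemma ptProp_ranMor : PtProp (D.ranMor f) (D.RExt f) := fun a Y =>
  (rExt_prod_iff f _).1 (RUniv.rExt_of_fullyFaithful (rUniv_rightAdjoint (D.resMor f) a Y))

variable (b : B) [Subsingleton (b ⟶ b)]

lemma lanEv_ev : IsoMor (D.lanEv b ≫ D.ev b) (𝟙 _) :=
  leftAdjoint_comp (D.ev b) fun a _ _ _ h =>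
    LUniv.isIso_of_fullyFaithful (Prod.sectR b a.unop) h

lemma ranEv_ev : IsoMor (D.ranEv b ≫ D.ev b) (𝟙 _) :=
  rightAdjoint_comp (D.ev b) fun a _ _ _ h =>
    RUniv.isIso_of_fullyFaithful (Prod.sectR b a.unop) h

lemma ptProp_lanEv : PtProp (D.lanEv b) (D.LExt (pt b)) := fun a Y =>
  (lExt_sectR_iff b _).1 (LUniv.lExt_of_fullyFaithful (lUniv_leftAdjoint (D.ev b) a Y))

lemma ptProp_ranEv : PtProp (D.ranEv b) (D.RExt (pt b)) := fun a Y =>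
  (rExt_sectR_iff b _).1 (RUniv.rExt_of_fullyFaithful (rUniv_rightAdjoint (D.ev b) a Y))

end

end Kan

end Prederivator

/-! ### Suspension and loop morphisms. -/

namespace Prederivator

open CatTrans

section

variable {D E : Prederivator.{w, v, u}} [D.IsStable]

instance : Limits.HasZeroObject (D.Diag Pt.{w}) := IsStable.hasZeroObject

instance {P : Type} [Preorder P] (x y : Shape.{w} P) : Subsingleton (x ⟶ y) :=
  ⟨fun _ _ => Subsingleton.elim (α := ULift (PLift _)) _ _⟩

lemma Shape.isEmpty_hom {P : Type} [Preorder P] {x y : Shape.{w} P} (h : ¬ x.down ≤ y.down) :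
    IsEmpty (x ⟶ y) := ⟨fun f => h (Shape.le f)⟩

/-- A diagram is right extended from the point `b` if it vanishes at the other points. -/
lemma rExt_pt_of_isZero {P : Type} [PartialOrder P] (b : P) (M : D.Diag (Shape.{w} P))
    (hb : ∀ x, x ≠ b → ¬ x ≤ b)
    (h : ∀ x, x ≠ b → Limits.IsZero ((D.eval (ULift.up x)).obj M)) :
    D.RExt (pt (ULift.up.{w} b)) M := by
  obtain ⟨V, θ, m, hθ, hm⟩ := RExt.exists_lift (pt (ULift.up.{w} b)) M
  have : (pt (ULift.up.{w} b)).Full := ⟨fun {x y} f => ⟨eqToHom (Subsingleton.elim _ _), Subsingleton.elim _ _⟩⟩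
  have : (pt (ULift.up.{w} b)).Faithful := ⟨fun {x y} f g _ => Subsingleton.elim _ _⟩
  have hV := RUniv.rExt_of_fullyFaithful hθ
  have := RUniv.isIso_of_fullyFaithful _ hθ
  -- At b, the composite of m with the invertible θ is an identity. At any other x, M vanishes by
  -- hypothesis, and V vanishes because no arrow leads from x to b.
  have : IsIso m := IsDerivator.der2 _ m fun ⟨x⟩ => by
    by_cases hx : x = b
    · subst hx
      have : IsIso ((D.eval (ULift.up x)).map m ≫ θ) := by
        rw [hm]
        infer_instance
      exact IsIso.of_isIso_comp_right _ θ
    · exact (h x hx).isIso (hV.isZero _ fun _ => Shape.isEmpty_hom (hb x hx)) _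
  exact hV.of_iso (asIso m).symm

/-- The squares computing the suspension: cocartesian squares that vanish at `(1,0)` and
`(0,1)`. -/
structure IsSuspSq (D : Prederivator.{w, v, u}) [D.IsDerivator] (M : D.Diag (Shape.{w} Sq)) :
    Prop where
  isCocartesian : D.IsCocartesian M
  isZero₁₀ : Limits.IsZero ((D.eval (ULift.up (1, 0))).obj M)
  isZero₀₁ : Limits.IsZero ((D.eval (ULift.up (0, 1))).obj M)

/-- A family of cocartesian squares with zeros at (1,0) and (0,1) has no freedom: its restriction to
the span is the right extension of its value at (0,0), and the square is the left extension of that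
restriction. These are the two steps in the definition of the suspension. All suspensions in the
proof are computed in this way. -/
theorem comp_suspension (X : E ⟶ D.shift (Shape.{w} Sq)) (h : PtProp X (IsSuspSq D)) :
    IsoMor ((X ≫ D.ev (ULift.up (0, 0))) ≫ D.suspension) (X ≫ D.ev (ULift.up (1, 1))) := by
  let o : Span := ⟨(0, 0), by decide⟩
  have ho (x : Span) (hx : x ≠ o) : ¬ x ≤ o := by
    rcases span_cases x with rfl | rfl | rfl
    · exact absurd rfl hx
    · decide
    · decide
  have h₀ : IsoMor (D.resMor spanIncl ≫ D.ev (ULift.up o)) (D.ev (ULift.up (0, 0))) :=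
    D.resMor_ev spanIncl (ULift.up.{w} o)
  have h₁ : IsoMor (X ≫ D.resMor spanIncl)
      ((X ≫ D.ev (ULift.up (0, 0))) ≫ D.ranEv (ULift.up o)) := by
    refine RValued.isoMor (φ := D.ev (ULift.up.{w} o)) (rValued_ev _ ?_) (rValued_ev _ ?_) ?_
    · refine h.resMor _ fun M hM N ⟨e⟩ => rExt_pt_of_isZero _ _ ho fun x hx => ?_
      rcases span_cases x with rfl | rfl | rfl
      · exact absurd rfl hx
      · exact hM.isZero₁₀.of_iso ((D.eval _).mapIso e.symm ≪≫ D.evalRes spanIncl _ M)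
      · exact hM.isZero₀₁.of_iso ((D.eval _).mapIso e.symm ≪≫ D.evalRes spanIncl _ M)
    · exact (ptProp_ranEv D _).comp_left _
    · refine (IsoMor.assoc _ _ _).trans ((h₀.left X).trans ?_)
      exact ((IsoMor.assoc _ _ _).trans (((ranEv_ev D _).left _).trans (IsoMor.comp_id _))).symm
  have h₂ : IsoMor X ((X ≫ D.resMor spanIncl) ≫ D.lanMor spanIncl) := by
    refine LValued.isoMor (φ := D.resMor spanIncl) (lValued_resMor _ ?_) (lValued_resMor _ ?_) ?_
    · exact h.imp fun M hM => (isCocartesian_iff_lExt M).1 hM.isCocartesian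
    · exact (ptProp_lanMor D _).comp_left _
    · exact ((IsoMor.assoc _ _ _).trans (((lanMor_resMor D _).left _).trans (IsoMor.comp_id _))).symm
  refine IsoMor.symm ((h₂.right _).trans ?_)
  refine (((h₁.right _).right _).trans ?_)
  exact (IsoMor.assoc _ _ _).trans (IsoMor.assoc _ _ _)

/-- The sections of the image of a diagram. -/
def sectLShift {B : Type w} [SmallCategory B] (φ : E ⟶ D) {a : (Cat.{w, w})ᵒᵖ} (k : a.unop)
    (M : E.Diag (B × a.unop)) :
    (D.res (Prod.sectL B k)).obj ((fn (shiftMor φ B) a).obj M) ≅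
      (fn φ (op (Cat.of B))).obj ((E.res (Prod.sectL B k)).obj M) :=
  (nt φ (Prod.sectL B k).toCatHom.op M).symm

omit [D.IsStable] in
lemma PtProp.shiftMor {B : Type w} [SmallCategory B] {E' : Prederivator.{w, v, u}}
    {X : E' ⟶ E.shift B} {p : E.Diag B → Prop} (h : PtProp X p) (φ : E ⟶ D) {q : D.Diag B → Prop}
    (hq : ∀ M, p M → ∀ N, Nonempty ((fn φ (op (Cat.of B))).obj M ≅ N) → q N) :
    PtProp (X ≫ Prederivator.shiftMor φ B) q :=
  fun a Y k => hq _ (h a Y k) _ ⟨(sectLShift φ k _).symm⟩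

variable (D) in
lemma ptProp_isSuspSq : PtProp (D.ranEv (ULift.up ⟨(0, 0), by decide⟩ : Shape.{w} Span) ≫
    D.lanMor spanIncl) (IsSuspSq D) := by
  have h₁ : PtProp (D.ranEv (ULift.up ⟨(0, 0), by decide⟩ : Shape.{w} Span) ≫ D.lanMor spanIncl)
      (fun M => ∀ x : Span, x ≠ ⟨(0, 0), by decide⟩ →
        Limits.IsZero ((D.eval (ULift.up.{w} x.1)).obj M)) := by
    have h₀ : PtProp (D.ranEv (ULift.up ⟨(0, 0), by decide⟩ : Shape.{w} Span))
        (fun M => ∀ x : Span, x ≠ ⟨(0, 0), by decide⟩ →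
          Limits.IsZero ((D.eval (ULift.up.{w} x)).obj M)) :=
      (ptProp_ranEv D _).imp fun M hM x hx => hM.isZero _ fun _ => Shape.isEmpty_hom (by
        change ¬ x ≤ (⟨(0, 0), by decide⟩ : Span)
        rcases span_cases x with rfl | rfl | rfl
        · exact absurd rfl hx
        · decide
        · decide)
    refine PtProp.of_resMor (f := spanIncl) (h₀.of_isoMor (X' := _ ≫ _) ?_ ?_) ?_
    · exact ((IsoMor.assoc _ _ _).trans (((lanMor_resMor D _).left _).trans (IsoMor.comp_id _))).symm
    · rintro M N ⟨e⟩ h x hx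
      exact (h x hx).of_iso ((D.eval _).mapIso e.symm)
    · rintro M ⟨N, h, ⟨e⟩⟩ x hx
      exact (h x hx).of_iso ((D.evalRes spanIncl (ULift.up x) M).symm ≪≫ (D.eval _).mapIso e.symm)
  have h₂ : PtProp (D.ranEv (ULift.up ⟨(0, 0), by decide⟩ : Shape.{w} Span) ≫ D.lanMor spanIncl)
      (D.LExt spanIncl) := (ptProp_lanMor D _).comp_left _
  exact (h₁.and h₂).imp fun M hM => ⟨(isCocartesian_iff_lExt M).2 hM.2,
    hM.1 ⟨(1, 0), by decide⟩ (by decide), hM.1 ⟨(0, 1), by decide⟩ (by decide)⟩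

/-- A morphism that preserves cocartesian squares and zero objects commutes with the
suspension. -/
theorem suspension_comp [E.IsStable] (φ : E ⟶ D)
    (hc : ∀ M : E.Diag (Shape.{w} Sq), E.IsCocartesian M →
      D.IsCocartesian ((fn φ (op (Cat.of (Shape.{w} Sq)))).obj M))
    (h₀ : ∀ M : E.Diag Pt.{w}, Limits.IsZero M → Limits.IsZero ((fn φ (op (Cat.of Pt.{w}))).obj M)) :
    IsoMor (E.suspension ≫ φ) (φ ≫ D.suspension) := by
  -- S is the family of squares that defines the suspension of E. By the hypotheses, φ carries it to
  -- a family of suspension squares in D with φ as its value at (0,0).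
  let S := E.ranEv (ULift.up ⟨(0, 0), by decide⟩ : Shape.{w} Span) ≫ E.lanMor spanIncl
  have h : PtProp (S ≫ shiftMor φ (Shape.{w} Sq)) (IsSuspSq D) := by
    refine (ptProp_isSuspSq E).shiftMor φ fun M hM N ⟨e⟩ => ?_
    have hz (x : Shape.{w} Sq) (hx : Limits.IsZero ((E.eval x).obj M)) :
        Limits.IsZero ((D.eval x).obj N) :=
      (h₀ _ hx).of_iso ((D.eval x).mapIso e.symm ≪≫ (nt φ (pt x).toCatHom.op M).symm)
    exact ⟨(hc M hM.isCocartesian).ofIso e, hz _ hM.isZero₁₀, hz _ hM.isZero₀₁⟩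
  have h₁ : IsoMor ((S ≫ shiftMor φ (Shape.{w} Sq)) ≫ D.ev (ULift.up (1, 1)))
      (E.suspension ≫ φ) :=
    (IsoMor.assoc _ _ _).trans (((shiftMor_ev φ _).left S).trans
      ((IsoMor.assoc' _ _ _).trans ((IsoMor.assoc _ _ _).right φ)))
  have h₂ : IsoMor (S ≫ E.ev (ULift.up (0, 0))) (𝟙 E) := by
    refine ((IsoMor.assoc _ _ _).trans (((E.resMor_ev spanIncl
      (ULift.up ⟨(0, 0), by decide⟩)).symm.left _).left _)).trans ?_
    exact (((lanMor_resMor E spanIncl).head₀ _).left _).trans (ranEv_ev E _)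
  have h₃ : IsoMor ((S ≫ shiftMor φ (Shape.{w} Sq)) ≫ D.ev (ULift.up (0, 0))) φ :=
    (IsoMor.assoc _ _ _).trans (((shiftMor_ev φ _).left S).trans
      ((IsoMor.assoc' _ _ _).trans ((h₂.right φ).trans (IsoMor.id_comp φ))))
  exact h₁.symm.trans ((comp_suspension _ h).symm.trans (h₃.right _))

variable (D) in
/-- The loop morphism is a section of the suspension. -/
theorem loops_suspension : IsoMor (D.loops ≫ D.suspension) (𝟙 D) := by
  let S := D.lanEv (ULift.up ⟨(1, 1), by decide⟩ : Shape.{w} Cospan) ≫ D.ranMor cospanIncl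
  have h₁ : PtProp S (fun M => ∀ x : Cospan, x ≠ ⟨(1, 1), by decide⟩ →
        Limits.IsZero ((D.eval (ULift.up.{w} x.1)).obj M)) := by
    have h₀ : PtProp (D.lanEv (ULift.up ⟨(1, 1), by decide⟩ : Shape.{w} Cospan))
        (fun M => ∀ x : Cospan, x ≠ ⟨(1, 1), by decide⟩ →
          Limits.IsZero ((D.eval (ULift.up.{w} x)).obj M)) :=
      (ptProp_lanEv D _).imp fun M hM x hx => hM.isZero _ fun _ => Shape.isEmpty_hom (by
        change ¬ (⟨(1, 1), by decide⟩ : Cospan) ≤ x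
        rcases cospan_cases x with rfl | rfl | rfl
        · exact absurd rfl hx
        · decide
        · decide)
    refine PtProp.of_resMor (f := cospanIncl) (h₀.of_isoMor (X' := _ ≫ _) ?_ ?_) ?_
    · exact ((IsoMor.assoc _ _ _).trans (((ranMor_resMor D _).left _).trans (IsoMor.comp_id _))).symm
    · rintro M N ⟨e⟩ h x hx
      exact (h x hx).of_iso ((D.eval _).mapIso e.symm)
    · rintro M ⟨N, h, ⟨e⟩⟩ x hx
      exact (h x hx).of_iso ((D.evalRes cospanIncl (ULift.up x) M).symm ≪≫ (D.eval _).mapIso e.symm)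
  have h₂ : PtProp S (D.RExt cospanIncl) := (ptProp_ranMor D _).comp_left _
  -- Stability enters here: the cartesian squares that define the loop morphism are cocartesian, so
  -- the same squares compute the suspension of their value at (0,0).
  have h : PtProp S (IsSuspSq D) := (h₁.and h₂).imp fun M hM =>
    ⟨(IsStable.isCocartesian_iff_isCartesian M).2 ((isCartesian_iff_rExt M).2 hM.2),
      hM.1 ⟨(1, 0), by decide⟩ (by decide), hM.1 ⟨(0, 1), by decide⟩ (by decide)⟩
  have h₃ : IsoMor (S ≫ D.ev (ULift.up (1, 1))) (𝟙 D) := by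
    refine ((IsoMor.assoc _ _ _).trans (((D.resMor_ev cospanIncl
      (ULift.up ⟨(1, 1), by decide⟩)).symm.left _).left _)).trans ?_
    exact (((ranMor_resMor D cospanIncl).head₀ _).left _).trans (lanEv_ev D _)
  exact ((IsoMor.assoc' _ _ _).right _).trans ((comp_suspension S h).trans h₃)

end

end Prederivator

/-! ### Transport of derivators along equivalences. -/

section Universal

universe v₁ v₂ u₁ u₂ v₃ v₄ u₃ u₄

variable {𝒜 : Type u₁} [Category.{v₁} 𝒜] {ℬ : Type u₂} [Category.{v₂} ℬ]
  {𝒜' : Type u₃} [Category.{v₃} 𝒜'] {ℬ' : Type u₄} [Category.{v₄} ℬ']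

/-- Universal arrows are transported along equivalences. -/
lemma LUniv.iff_of_equivalence {R : ℬ ⥤ 𝒜} {R' : ℬ' ⥤ 𝒜'} (e : ℬ ⥤ ℬ') [e.IsEquivalence]
    (e' : 𝒜 ⥤ 𝒜') [e'.IsEquivalence] (ν : R ⋙ e' ≅ e ⋙ R') {Y : 𝒜} {V : ℬ}
    (θ : Y ⟶ R.obj V) :
    LUniv R' (Y := e'.obj Y) (V := e.obj V) (e'.map θ ≫ ν.hom.app V) ↔ LUniv R θ := by
  have key (W : ℬ) : Function.Bijective (fun g : e.obj V ⟶ e.obj W =>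
      (e'.map θ ≫ ν.hom.app V) ≫ R'.map g) ↔ Function.Bijective (fun g : V ⟶ W => θ ≫ R.map g) := by
    have h₁ : (fun g : e.obj V ⟶ e.obj W => (e'.map θ ≫ ν.hom.app V) ≫ R'.map g) ∘
        (fun g : V ⟶ W => e.map g) = (fun h : e'.obj Y ⟶ e'.obj (R.obj W) => h ≫ ν.hom.app W) ∘
        (fun h : Y ⟶ R.obj W => e'.map h) ∘ (fun g : V ⟶ W => θ ≫ R.map g) := by
      ext g
      have := ν.hom.naturality g
      simp only [Functor.comp_map] at this
      simp only [Function.comp_apply, Functor.map_comp, Category.assoc]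
      exact congr(e'.map θ ≫ $(this.symm))
    have b₁ : Function.Bijective (fun g : V ⟶ W => e.map g) :=
      (Functor.FullyFaithful.ofFullyFaithful e).map_bijective V W
    have b₂ : Function.Bijective (fun h : Y ⟶ R.obj W => e'.map h) :=
      (Functor.FullyFaithful.ofFullyFaithful e').map_bijective _ _
    have b₃ : Function.Bijective (fun h : e'.obj Y ⟶ e'.obj (R.obj W) => h ≫ ν.hom.app W) :=
      ((ν.app W).homToEquiv).bijective
    rw [← Function.Bijective.of_comp_iff _ b₁, h₁, Function.Bijective.of_comp_iff' b₃,
      Function.Bijective.of_comp_iff' b₂]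
  refine ⟨fun h W => (key W).1 (h _), fun h W' => ?_⟩
  have h₁ := (key (e.objPreimage W')).2 (h _)
  let i := e.objObjPreimageIso W'
  have h₂ : (fun g : e.obj V ⟶ W' => (e'.map θ ≫ ν.hom.app V) ≫ R'.map g) =
      (fun h => h ≫ R'.map i.hom) ∘ (fun g : e.obj V ⟶ e.obj _ =>
      (e'.map θ ≫ ν.hom.app V) ≫ R'.map g) ∘ (fun g : e.obj V ⟶ W' => g ≫ i.inv) := by
    ext g
    simp [← Functor.map_comp]
  rw [h₂]
  exact ((R'.mapIso i).homToEquiv.bijective).comp (h₁.comp (i.symm.homToEquiv.bijective))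

lemma RUniv.iff_of_equivalence {R : ℬ ⥤ 𝒜} {R' : ℬ' ⥤ 𝒜'} (e : ℬ ⥤ ℬ') [e.IsEquivalence]
    (e' : 𝒜 ⥤ 𝒜') [e'.IsEquivalence] (ν : e ⋙ R' ≅ R ⋙ e') {Y : 𝒜} {V : ℬ}
    (θ : R.obj V ⟶ Y) :
    RUniv R' (Y := e'.obj Y) (V := e.obj V) (ν.hom.app V ≫ e'.map θ) ↔ RUniv R θ := by
  have key (W : ℬ) : Function.Bijective (fun g : e.obj W ⟶ e.obj V =>
      R'.map g ≫ (ν.hom.app V ≫ e'.map θ)) ↔ Function.Bijective (fun g : W ⟶ V => R.map g ≫ θ) := by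
    have h₁ : (fun g : e.obj W ⟶ e.obj V => R'.map g ≫ (ν.hom.app V ≫ e'.map θ)) ∘
        (fun g : W ⟶ V => e.map g) = (fun h : e'.obj (R.obj W) ⟶ e'.obj Y => ν.hom.app W ≫ h) ∘
        (fun h : R.obj W ⟶ Y => e'.map h) ∘ (fun g : W ⟶ V => R.map g ≫ θ) := by
      ext g
      have := ν.hom.naturality g
      simp only [Functor.comp_map] at this
      simp only [Function.comp_apply, Functor.map_comp]
      rw [← Category.assoc, ← Category.assoc]
      exact congr($this ≫ e'.map θ)
    have b₁ : Function.Bijective (fun g : W ⟶ V => e.map g) :=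
      (Functor.FullyFaithful.ofFullyFaithful e).map_bijective W V
    have b₂ : Function.Bijective (fun h : R.obj W ⟶ Y => e'.map h) :=
      (Functor.FullyFaithful.ofFullyFaithful e').map_bijective _ _
    have b₃ : Function.Bijective (fun h : e'.obj (R.obj W) ⟶ e'.obj Y => ν.hom.app W ≫ h) :=
      ((ν.app W).symm.homFromEquiv).bijective
    rw [← Function.Bijective.of_comp_iff _ b₁, h₁, Function.Bijective.of_comp_iff' b₃,
      Function.Bijective.of_comp_iff' b₂]
  refine ⟨fun h W => (key W).1 (h _), fun h W' => ?_⟩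
  have h₁ := (key (e.objPreimage W')).2 (h _)
  let i := e.objObjPreimageIso W'
  have h₂ : (fun g : W' ⟶ e.obj V => R'.map g ≫ (ν.hom.app V ≫ e'.map θ)) =
      (fun h => R'.map i.inv ≫ h) ∘ (fun g : e.obj _ ⟶ e.obj V =>
      R'.map g ≫ (ν.hom.app V ≫ e'.map θ)) ∘ (fun g : W' ⟶ e.obj V => i.hom ≫ g) := by
    ext g
    change R'.map g ≫ _ = R'.map i.inv ≫ (R'.map (i.hom ≫ g) ≫ _)
    rw [Functor.map_comp, Category.assoc, ← Category.assoc (R'.map i.inv), ← Functor.map_comp,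
      i.inv_hom_id, CategoryTheory.Functor.map_id, Category.id_comp]
  rw [h₂]
  exact ((R'.mapIso i).homFromEquiv.bijective).comp (h₁.comp (i.symm.homFromEquiv.bijective))

lemma isZero_obj_of_isEquivalence (e : 𝒜 ⥤ 𝒜') [e.IsEquivalence] {X : 𝒜} (h : Limits.IsZero X) :
    Limits.IsZero (e.obj X) := by
  have h₁ := h.isInitial.isInitialObj e
  have h₂ := h.isTerminal.isTerminalObj e
  exact ⟨fun Y => ⟨⟨⟨h₁.to Y⟩, fun _ => h₁.hom_ext _ _⟩⟩,
    fun Y => ⟨⟨⟨h₂.from Y⟩, fun _ => h₂.hom_ext _ _⟩⟩⟩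

end Universal

/-- The diagram chase for `natRes_sqL`: the hypotheses express the naturality of φ, its
compatibility with the two composites of restrictions, and its compatibility with the transformation
α. -/
lemma paste_sq {𝒞 : Type*} [Category 𝒞] {pX pfZ pZ qgZ qgZ' PX PfZ' PZ QgZ QZ QZ' : 𝒞}
    {φη : pX ⟶ pfZ} {νpf : pfZ ⟶ PfZ'} {νp : pX ⟶ PX} {Pφη : PX ⟶ PfZ'}
    (h₁ : φη ≫ νpf = νp ≫ Pφη) {ν : pZ ⟶ PZ} {PfZ'' : 𝒞} {a : PZ ≅ PfZ''} {b : pZ ≅ pfZ}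
    {Pν : PfZ' ⟶ PfZ''} (h₂ : ν ≫ a.hom = b.hom ≫ νpf ≫ Pν)
    {ν' : qgZ ⟶ QgZ} {c : QgZ ⟶ QZ'} {d : qgZ ⟶ qgZ'} {νq : qgZ' ⟶ QZ} {Qν : QZ ⟶ QZ'}
    (h₃ : ν' ≫ c = d ≫ νq ≫ Qν) {t : pZ ⟶ qgZ} {t' : PZ ⟶ QgZ} (h₄ : t ≫ ν' = ν ≫ t')
    {m : PX ⟶ PfZ''} (e₁ : m = Pφη ≫ Pν) {n : pX ⟶ qgZ'} {n₁ : pX ⟶ pZ} {n₂ : pZ ⟶ qgZ'}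
    (e₂ : n = n₁ ≫ n₂) (e₃ : n₁ = φη ≫ b.inv) (e₄ : n₂ = t ≫ d) :
    νp ≫ (m ≫ a.inv) ≫ t' ≫ c = (n ≫ νq) ≫ Qν := by
  subst e₁ e₂ e₃ e₄
  simp only [Category.assoc]
  rw [← h₃, reassoc_of% h₄, ← reassoc_of% h₁]
  have h₅ : νpf ≫ Pν ≫ a.inv = b.inv ≫ ν := by
    rw [← cancel_epi b.hom, b.hom_inv_id_assoc, ← Category.assoc, ← Category.assoc,
      Category.assoc b.hom, ← h₂, Category.assoc, a.hom_inv_id, Category.comp_id]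
  rw [reassoc_of% h₅]

namespace Prederivator

open CatTrans

section

variable {E F : Prederivator.{w, v, u}} (φ : E ⟶ F) [∀ a, (fn φ a).IsEquivalence]
variable {A B C K : Type w} [SmallCategory A] [SmallCategory B] [SmallCategory C]
  [SmallCategory K]

/-- The component of a morphism at a small category. -/
abbrev at_ (φ : E ⟶ F) (A : Type w) [SmallCategory A] : E.Diag A ⥤ F.Diag A :=
  fn φ (op (Cat.of A))

/-- The compatibility of a morphism with restriction. -/
abbrev natRes (φ : E ⟶ F) (f : A ⥤ B) : E.res f ⋙ at_ φ A ≅ at_ φ B ⋙ F.res f :=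
  Cat.Hom.toNatIso (φ.naturality f.toCatHom.op)

omit [∀ a, (fn φ a).IsEquivalence] in
lemma natRes_sqL {p : K ⥤ A} {f : A ⥤ C} {q : K ⥤ B} {g : B ⥤ C} (α : p ⋙ f ⟶ q ⋙ g)
    {X : E.Diag A} {Z : E.Diag C} (η : X ⟶ (E.res f).obj Z) :
    (natRes φ p).hom.app X ≫ F.sqL α ((at_ φ A).map η ≫ (natRes φ f).hom.app Z) =
      ((at_ φ K).map (E.sqL α η) ≫ (natRes φ q).hom.app _) ≫
        (F.res q).map ((natRes φ g).hom.app Z) := by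
  dsimp only [sqL, pullL]
  have h₁ := nt_naturality φ p.toCatHom.op η
  have h₂ := nt_comp φ f.toCatHom.op p.toCatHom.op Z
  have h₃ := nt_comp φ g.toCatHom.op q.toCatHom.op Z
  have h₄ := nt_map₂ φ (op2 (NatTrans.toCatHom₂ α)) Z
  exact paste_sq h₁ (a := F.cmp p f _) (b := (at_ φ K).mapIso (E.cmp p f Z)) h₂ h₃ h₄
    ((F.res p).map_comp _ _) ((at_ φ K).map_comp _ _) ((at_ φ K).map_comp _ _)
    ((at_ φ K).map_comp _ _)

lemma lUniv_iff_of_equivalence (f : A ⥤ B) {Y : E.Diag A} {V : E.Diag B} (θ : Y ⟶ (E.res f).obj V) :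
    LUniv (F.res f) ((at_ φ A).map θ ≫ (natRes φ f).hom.app V) ↔ LUniv (E.res f) θ :=
  LUniv.iff_of_equivalence (at_ φ B) (at_ φ A) (natRes φ f) θ

lemma rUniv_iff_of_equivalence (f : A ⥤ B) {Y : E.Diag A} {V : E.Diag B} (θ : (E.res f).obj V ⟶ Y) :
    RUniv (F.res f) ((natRes φ f).inv.app V ≫ (at_ φ A).map θ) ↔ RUniv (E.res f) θ :=
  RUniv.iff_of_equivalence (at_ φ B) (at_ φ A) (natRes φ f).symm θ

include φ in
-- Exactness speaks only of universal arrows, and these correspond under componentwise equivalences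
-- up to structure isomorphisms.
lemma lEx_of_equivalence {p : K ⥤ A} {f : A ⥤ C} {q : K ⥤ B} {g : B ⥤ C} {α : p ⋙ f ⟶ q ⋙ g}
    (h : F.LEx α) : E.LEx α := by
  rw [lEx_iff] at h ⊢
  intro X Z η hη
  have h₁ := (h _ ((lUniv_iff_of_equivalence φ f η).2 hη)).comp_left ((natRes φ p).hom.app X)
  have h₂ := h₁.comp_map ((natRes φ g).inv.app Z)
  refine (lUniv_iff_of_equivalence φ q _).1 ((congrArg (LUniv (F.res q)) ?_).mp h₂)
  rw [natRes_sqL, Category.assoc, ← Functor.map_comp, Iso.hom_inv_id_app]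
  exact congr(_ ≫ $((F.res q).map_id ((at_ φ B).obj ((E.res g).obj Z)))).trans
    (Category.comp_id _)

lemma lExt_iff_of_equivalence (f : A ⥤ B) (M : E.Diag B) :
    F.LExt f ((at_ φ B).obj M) ↔ E.LExt f M := by
  refine Iff.trans ?_ (lUniv_iff_of_equivalence φ f (𝟙 _))
  rw [CategoryTheory.Functor.map_id, Category.id_comp]
  refine ⟨fun h => ?_, fun h => LUniv.lExt h⟩
  have := h.comp_left ((natRes φ f).hom.app M)
  exact (congrArg (LUniv (F.res f)) (Category.comp_id _)).mp this

lemma rExt_iff_of_equivalence (f : A ⥤ B) (M : E.Diag B) :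
    F.RExt f ((at_ φ B).obj M) ↔ E.RExt f M := by
  refine Iff.trans ?_ (rUniv_iff_of_equivalence φ f (𝟙 _))
  rw [CategoryTheory.Functor.map_id]
  refine Iff.trans ?_ (iff_of_eq (congrArg (RUniv (F.res f)) (Category.comp_id _).symm))
  refine ⟨fun h => ?_, fun h => RUniv.rExt h⟩
  have := h.comp_right ((natRes φ f).inv.app M)
  exact (congrArg (RUniv (F.res f)) (Category.id_comp _)).mp this

include φ in
/-- Derivators are closed under equivalence. -/
theorem isDerivator_of_equivalence [F.IsDerivator] : E.IsDerivator := by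
  have hl {A B : Type w} [SmallCategory A] [SmallCategory B] (f : A ⥤ B) :
      (E.res f).IsRightAdjoint := LUniv.isRightAdjoint fun Y => by
    obtain ⟨V, θ, h⟩ := LUniv.exists_of_isRightAdjoint (F.res f) ((at_ φ A).obj Y)
    let e := (at_ φ B).objObjPreimageIso V
    let θ' : (at_ φ A).obj Y ⟶ (at_ φ A).obj ((E.res f).obj ((at_ φ B).objPreimage V)) :=
      (θ ≫ (F.res f).map e.inv) ≫ (natRes φ f).inv.app _
    refine ⟨_, (at_ φ A).preimage θ', (lUniv_iff_of_equivalence φ f _).1 ?_⟩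
    rw [Functor.map_preimage, Category.assoc, Iso.inv_hom_id_app]
    exact (congrArg (LUniv (F.res f)) (Category.comp_id _)).mpr (h.comp_map e.inv)
  have hr {A B : Type w} [SmallCategory A] [SmallCategory B] (f : A ⥤ B) :
      (E.res f).IsLeftAdjoint := RUniv.isLeftAdjoint fun Y => by
    obtain ⟨V, θ, h⟩ := RUniv.exists_of_isLeftAdjoint (F.res f) ((at_ φ A).obj Y)
    let e := (at_ φ B).objObjPreimageIso V
    let θ' : (at_ φ A).obj ((E.res f).obj ((at_ φ B).objPreimage V)) ⟶ (at_ φ A).obj Y :=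
      (natRes φ f).hom.app _ ≫ (F.res f).map e.hom ≫ θ
    refine ⟨_, (at_ φ A).preimage θ', (rUniv_iff_of_equivalence φ f _).1 ?_⟩
    rw [Functor.map_preimage, Iso.inv_hom_id_app_assoc]
    exact h.map_comp e.hom
  refine ⟨fun I A _ => ?_, fun A _ X Y m hm => ?_, hl, hr, fun f b L adj L' adj' => ?_,
    fun f b R adj R' adj' => ?_⟩
  · have h := IsDerivator.der1 (D := F) I A
    let e : Functor.pi' (fun i => E.res (Sigma.incl (C := A) i)) ⋙
        Functor.pi (fun i => at_ φ (A i)) ≅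
        at_ φ _ ⋙ Functor.pi' (fun i => F.res (Sigma.incl (C := A) i)) :=
      NatIso.pi' fun i => natRes φ (Sigma.incl (C := A) i)
    have := Functor.isEquivalence_of_iso e.symm
    exact Functor.isEquivalence_of_comp_right _ (Functor.pi (fun i => at_ φ (A i)))
  · have : IsIso ((at_ φ A).map m) := IsDerivator.der2 _ _ fun a =>
      (NatIso.isIso_map_iff (natRes φ (pt a)) m).1 (by
        have := hm a
        dsimp only [Functor.comp_map]
        infer_instance)
    exact isIso_of_reflects_iso m (at_ φ A)
  · exact (isIso_mate_iff_lExact adj adj' _).2 (lEx_of_equivalence φ (lEx_comma f b))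
  · have h : E.LEx (Comma.natTrans (pt b) f) :=
      lEx_of_equivalence φ (RExact.lExact (rEx_comma f b))
    exact (isIso_mate_iff_rExact adj adj' _).2 h.rExact

lemma isCocartesian_iff_of_equivalence [E.IsDerivator] [F.IsDerivator] (M : E.Diag (Shape.{w} Sq)) :
    F.IsCocartesian ((at_ φ _).obj M) ↔ E.IsCocartesian M := by
  rw [isCocartesian_iff_lExt, isCocartesian_iff_lExt, lExt_iff_of_equivalence]

lemma isCartesian_iff_of_equivalence [E.IsDerivator] [F.IsDerivator] (M : E.Diag (Shape.{w} Sq)) :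
    F.IsCartesian ((at_ φ _).obj M) ↔ E.IsCartesian M := by
  rw [isCartesian_iff_rExt, isCartesian_iff_rExt, rExt_iff_of_equivalence]

include φ in
/-- Stable derivators are closed under equivalence. -/
theorem isStable_of_equivalence [F.IsStable] : E.IsStable := by
  have := isDerivator_of_equivalence φ
  refine ⟨?_, fun X => ?_⟩
  · obtain ⟨Z, hZ⟩ := Limits.HasZeroObject.zero (C := F.Diag Pt.{w})
    exact ⟨_, isZero_obj_of_isEquivalence (at_ φ Pt.{w}).inv hZ⟩
  · rw [← isCocartesian_iff_of_equivalence φ, ← isCartesian_iff_of_equivalence φ,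
      IsStable.isCocartesian_iff_isCartesian]

/-- Equivalences commute with the suspension. -/
theorem suspension_comp_of_equivalence [E.IsStable] [F.IsStable] :
    IsoMor (E.suspension ≫ φ) (φ ≫ F.suspension) :=
  suspension_comp φ (fun M h => (isCocartesian_iff_of_equivalence φ M).2 h) fun _ h =>
    isZero_obj_of_isEquivalence (at_ φ Pt.{w}) h

end

end Prederivator

/-! ### Shifts of stable derivators are stable. -/

namespace Prederivator

open CatTrans

section

variable {D : Prederivator.{w, v, u}} {A B : Type w} [SmallCategory A] [SmallCategory B]

lemma isEquivalence_res (f : A ⥤ B) [f.IsEquivalence] : (D.res f).IsEquivalence := by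
  let e := f.asEquivalence
  have i (C : Type w) [SmallCategory C] : D.res (𝟭 C) ≅ 𝟭 _ := Cat.Hom.toNatIso (D.mapId _)
  exact (CategoryTheory.Equivalence.mk (D.res f) (D.res e.inverse)
    ((i _).symm ≪≫ D.resIso e.counitIso.symm ≪≫ D.resComp _ _)
    ((D.resComp _ _).symm ≪≫ D.resIso e.unitIso.symm ≪≫ i _)).isEquivalence_functor

/-- The functor `∐ (B × Aᵢ) ⥤ B × ∐ Aᵢ`. -/
def sigmaProd (B : Type w) [SmallCategory B] {I : Type w} (A : I → Type w)
    [∀ i, SmallCategory (A i)] : (Σ i, B × A i) ⥤ B × (Σ i, A i) :=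
  Sigma.desc fun i => (𝟭 B).prod (Sigma.incl i)

instance {I : Type w} (A : I → Type w) [∀ i, SmallCategory (A i)] :
    (sigmaProd B A).IsEquivalence where
  faithful := ⟨by
    rintro _ _ ⟨f⟩ ⟨g⟩ h
    congr 1
    refine Prod.ext congr($(h).1) ?_
    have h₂ : Sigma.SigmaHom.mk f.2 = Sigma.SigmaHom.mk g.2 := congr($(h).2)
    injection h₂⟩
  full := ⟨by
    rintro ⟨i, b, a⟩ ⟨j, b', a'⟩ ⟨f, g⟩
    obtain ⟨g⟩ := g
    exact ⟨Sigma.SigmaHom.mk (f, g), rfl⟩⟩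
  essSurj := ⟨fun ⟨b, i, a⟩ => ⟨⟨i, b, a⟩, ⟨Iso.refl _⟩⟩⟩

/-- Restriction has adjoints on both sides, so morphisms into and out of a restricted zero object
are morphisms into and out of a zero object. -/
lemma isZero_res [D.IsDerivator] (f : A ⥤ B) {Z : D.Diag B} (hZ : Limits.IsZero Z) :
    Limits.IsZero ((D.res f).obj Z) where
  unique_to Y := (hZ.unique_to ((D.ran f).obj Y)).map fun i =>
    @Equiv.unique _ _ i ((Adjunction.ofIsLeftAdjoint (D.res f)).homEquiv Z Y)
  unique_from Y := (hZ.unique_from ((D.lan f).obj Y)).map fun i =>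
    @Equiv.unique _ _ i ((Adjunction.ofIsRightAdjoint (D.res f)).homEquiv Y Z).symm

/-- Der1 uses that B × - commutes with coproducts up to equivalence (`sigmaProd`). Der2 holds
because the functors from B × Pt to B × A are jointly surjective on objects. Der3 and Der4 are
properties of the functors B × F in D. -/
instance [D.IsDerivator] : (D.shift B).IsDerivator where
  der1 I A _ := by
    have h := IsDerivator.der1 (D := D) I (fun i => B × A i)
    have := isEquivalence_res (D := D) (sigmaProd B A)
    let e : D.res (sigmaProd B A) ⋙
        Functor.pi' (fun i => D.res (Sigma.incl (C := fun i => B × A i) i)) ≅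
        Functor.pi' (fun i => (D.shift B).res (Sigma.incl (C := A) i)) :=
      NatIso.pi' fun i => (D.resComp (Sigma.incl i) (sigmaProd B A)).symm ≪≫
        D.resIso (Sigma.inclDesc (fun i => (𝟭 B).prod (Sigma.incl i)) i)
    have h' := @Functor.isEquivalence_trans _ _ _ _ _ _ _ _ this h
    exact @Functor.isEquivalence_of_iso _ _ _ _ _ _ e h'
  der2 A _ X Y f hf := by
    refine isIso_of_family (D := D) (fun _ : A => B × Pt.{w}) (fun a => (𝟭 B).prod (pt a))
      (fun x => ⟨x.2, (x.1, ⟨⟨⟩⟩), rfl⟩) f hf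
  der3_left F := IsDerivator.der3_left (D := D) ((𝟭 B).prod F)
  der3_right F := IsDerivator.der3_right (D := D) ((𝟭 B).prod F)
  der4_left f b _ adj _ adj' := (isIso_mate_iff_lExact adj adj' _).2
    (lEx_prod_comma (D := D) B f b)
  der4_right f b _ adj _ adj' := (isIso_mate_iff_rExact adj adj' _).2
    (rEx_prod_comma (D := D) B f b)

lemma shift_isCocartesian_iff [D.IsDerivator] (M : (D.shift B).Diag (Shape.{w} Sq)) :
    (D.shift B).IsCocartesian M ↔ ∀ b, D.IsCocartesian ((D.res (Prod.sectR b _)).obj M) := by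
  simp only [isCocartesian_iff_lExt]
  exact lExt_id_prod_iff _ M

lemma shift_isCartesian_iff [D.IsDerivator] (M : (D.shift B).Diag (Shape.{w} Sq)) :
    (D.shift B).IsCartesian M ↔ ∀ b, D.IsCartesian ((D.res (Prod.sectR b _)).obj M) := by
  simp only [isCartesian_iff_rExt]
  exact rExt_id_prod_iff _ M

instance [D.IsStable] : (D.shift B).IsStable where
  hasZeroObject := by
    obtain ⟨Z, hZ⟩ := Limits.HasZeroObject.zero (C := D.Diag Pt.{w})
    exact ⟨(D.res (CategoryTheory.Prod.snd B Pt.{w})).obj Z, isZero_res _ hZ⟩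
  isCocartesian_iff_isCartesian M := by
    rw [shift_isCocartesian_iff, shift_isCartesian_iff]
    exact forall_congr' fun b => IsStable.isCocartesian_iff_isCartesian _

end

end Prederivator

/-! ### Small squares -/

/-- The `i`-th family of points of `C` outside the chain of cubes. -/
def linkPt (i : Fin 3) (n : ℤ) : ℤ × ℤ × ℤ :=
  if i = 0 then (n, n + 2, n + 1) else if i = 1 then (n + 2, n + 1, n) else (n + 1, n, n + 2)

@[simp] lemma linkPt_zero (n : ℤ) : linkPt 0 n = (n, n + 2, n + 1) := rfl
@[simp] lemma linkPt_one (n : ℤ) : linkPt 1 n = (n + 2, n + 1, n) := rfl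
@[simp] lemma linkPt_two (n : ℤ) : linkPt 2 n = (n + 1, n, n + 2) := rfl

lemma linkPt_mem (i : Fin 3) (n : ℤ) : linkPt i n ∈ linkPoints := by
  refine ⟨n, ?_⟩
  fin_cases i <;> simp

lemma exists_linkPt {x : ℤ × ℤ × ℤ} (hx : x ∈ linkPoints) : ∃ i n, x = linkPt i n := by
  obtain ⟨n, rfl | rfl | rfl⟩ := hx
  exacts [⟨0, n, rfl⟩, ⟨1, n, rfl⟩, ⟨2, n, rfl⟩]

lemma mk_mem_cubePoints {n a b c : ℤ} (ha : a = n ∨ a = n + 1) (hb : b = n ∨ b = n + 1)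
    (hc : c = n ∨ c = n + 1) : (a, b, c) ∈ cubePoints :=
  ⟨n, a - n, b - n, c - n, by omega, by omega, by omega, by ext <;> dsimp <;> omega⟩

lemma linkPt_notMem (i : Fin 3) (n : ℤ) : linkPt i n ∉ cubePoints := by
  rintro ⟨m, e₁, e₂, e₃, h₁, h₂, h₃, h⟩
  fin_cases i <;> simp at h <;> omega

namespace IsSmallSquare

variable {p : Fin 2 → Fin 2 → ℤ × ℤ × ℤ}

lemma mem_CPts (h : IsSmallSquare p) (a b : Fin 2) : p a b ∈ CPts := by
  induction h generalizing a b with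
  | face₁₂ n e | face₁₃ n e | face₂₃ n e =>
    exact Or.inl (mk_mem_cubePoints (n := n) (by omega) (by omega) (by omega))
  | link₁ n =>
    by_cases h : a = 0 ∧ b = 1
    · obtain ⟨rfl, rfl⟩ := h
      refine Or.inr ⟨n, Or.inl (by ext <;> simp; omega)⟩
    · by_cases ha : a = 0
      · exact Or.inl (mk_mem_cubePoints (n := n) (by omega) (by omega) (by omega))
      · exact Or.inl (mk_mem_cubePoints (n := n + 1) (by omega) (by omega) (by omega))
  | link₂ n =>
    by_cases h : a = 0 ∧ b = 1
    · obtain ⟨rfl, rfl⟩ := h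
      refine Or.inr ⟨n, Or.inr (Or.inl (by ext <;> simp; omega))⟩
    · by_cases ha : a = 0
      · exact Or.inl (mk_mem_cubePoints (n := n) (by omega) (by omega) (by omega))
      · exact Or.inl (mk_mem_cubePoints (n := n + 1) (by omega) (by omega) (by omega))
  | link₃ n =>
    by_cases h : a = 0 ∧ b = 1
    · obtain ⟨rfl, rfl⟩ := h
      refine Or.inr ⟨n, Or.inr (Or.inr (by ext <;> simp; omega))⟩
    · by_cases ha : a = 0
      · exact Or.inl (mk_mem_cubePoints (n := n) (by omega) (by omega) (by omega))
      · exact Or.inl (mk_mem_cubePoints (n := n + 1) (by omega) (by omega) (by omega))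
  | swap p _ ih => exact ih b a

lemma mono (h : IsSmallSquare p) {a b a' b' : Fin 2} (ha : a ≤ a') (hb : b ≤ b') :
    p a b ≤ p a' b' := by
  induction h generalizing a b a' b' with
  | swap p _ ih => exact ih hb ha
  | _ => simp only [Prod.mk_le_mk]; omega

/-- This and the next four lemmas verify the order conditions of `IsPushoutFor` and `IsPullbackFor`
for small squares, relative to the source, the nonnegative points and the link points. -/
lemma inf_le (h : IsSmallSquare p) {x : ℤ × ℤ × ℤ} (h₁ : x ≤ p 1 0) (h₂ : x ≤ p 0 1) :
    x ≤ p 0 0 := by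
  obtain ⟨x₁, x₂, x₃⟩ := x
  induction h with
  | swap p _ ih => exact ih h₂ h₁
  | _ => simp only [Prod.mk_le_mk] at *; simp at *; omega

lemma le_sup (h : IsSmallSquare p) {x : ℤ × ℤ × ℤ} (h₁ : p 1 0 ≤ x) (h₂ : p 0 1 ≤ x) :
    p 1 1 ≤ x := by
  obtain ⟨x₁, x₂, x₃⟩ := x
  induction h with
  | swap p _ ih => exact ih h₂ h₁
  | _ => simp only [Prod.mk_le_mk] at *; simp at *; omega

lemma cover_linkPt (h : IsSmallSquare p) (i : Fin 3) (n : ℤ) (h₁ : linkPt i n ≤ p 1 1) :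
    linkPt i n ≤ p 1 0 ∨ linkPt i n ≤ p 0 1 := by
  induction h with
  | swap p _ ih => exact (ih h₁).symm
  | _ =>
    fin_cases i <;> simp [Prod.mk_le_mk] at * <;> omega

lemma cocover_linkPt (h : IsSmallSquare p) (i : Fin 3) (n : ℤ) (h₁ : p 0 0 ≤ linkPt i n) :
    p 1 0 ≤ linkPt i n ∨ p 0 1 ≤ linkPt i n := by
  induction h with
  | swap p _ ih => exact (ih h₁).symm
  | _ =>
    fin_cases i <;> simp [Prod.mk_le_mk] at * <;> omega

/-- The assumption that the square starts at a nonnegative point cannot be dropped: the face with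
corners (-1,-1,0) and (0,0,0) has the source point 000 as its last vertex. -/
lemma cover_source (h : IsSmallSquare p) (h₀ : 0 ≤ p 0 0) {x : ℤ × ℤ × ℤ} (hx : x ∈ SourcePts)
    (h₁ : x ≤ p 1 1) : x ≤ p 1 0 ∨ x ≤ p 0 1 := by
  induction h with
  | swap p _ ih => exact (ih h₀ h₁).symm
  | _ =>
    have h₀' : ((0 : ℤ), (0 : ℤ), (0 : ℤ)) ≤ _ := h₀
    rcases hx with rfl | rfl | rfl | rfl <;> simp [Prod.mk_le_mk] at * <;> omega

/-- Complementary to `cover_source`: a square that starts at 000 fails this condition for x = 000,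
while the squares not starting at a nonnegative point satisfy it. So each small square is a pushout
in the upward or a pullback in the downward extension. -/
lemma cocover_nonneg (h : IsSmallSquare p) (h₀ : ¬ 0 ≤ p 0 0) {x : ℤ × ℤ × ℤ} (hx : 0 ≤ x)
    (h₁ : p 0 0 ≤ x) : p 1 0 ≤ x ∨ p 0 1 ≤ x := by
  induction h with
  | swap p _ ih => exact (ih h₀ h₁).symm
  | _ =>
    obtain ⟨x₁, x₂, x₃⟩ := x
    have h₀' : ¬ ((0 : ℤ), (0 : ℤ), (0 : ℤ)) ≤ _ := h₀
    have hx' : ((0 : ℤ), (0 : ℤ), (0 : ℤ)) ≤ _ := hx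
    simp [Prod.mk_le_mk] at * ; omega

end IsSmallSquare

/-! ### Intermediate subposets -/

/-- The source and the zeros of `C` above it. -/
abbrev SourceZeros : Set (ℤ × ℤ × ℤ) := SourcePts ∪ {x | x ∈ linkPoints ∧ 0 ≤ x}

/-- The nonnegative points of `C`. -/
abbrev CNonneg : Set (ℤ × ℤ × ℤ) := {x | x ∈ CPts ∧ 0 ≤ x}

/-- The nonnegative points and the zeros of `C`. -/
abbrev CNonnegZeros : Set (ℤ × ℤ × ℤ) := CNonneg ∪ linkPoints

lemma sourceZeros_subset : SourceZeros ⊆ CNonneg := by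
  rintro x (hx | ⟨hx, h⟩)
  · refine ⟨sourcePts_subset hx, ?_⟩
    rcases hx with rfl | rfl | rfl | rfl <;> decide
  · exact ⟨Or.inr hx, h⟩

lemma cNonnegZeros_subset : CNonnegZeros ⊆ CPts := by
  rintro x (hx | hx)
  · exact hx.1
  · exact Or.inr hx

/-- Every nonnegative point of `C` is reached from the source and the zeros by small squares. -/
lemma cNonneg_induction (S : Set (ℤ × ℤ × ℤ)) (h₀ : SourcePts ⊆ S)
    (h₁ : ∀ i n, 0 ≤ n → linkPt i n ∈ S)
    (h₂ : ∀ p, IsSmallSquare p → 0 ≤ p 0 0 → p 0 0 ∈ S → p 1 0 ∈ S → p 0 1 ∈ S → p 1 1 ∈ S) :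
    CNonneg ⊆ S := by
  have key (m : ℕ) (n : ℤ) (hn : n = m) : (n, n, n) ∈ S ∧ (n + 1, n, n) ∈ S ∧ (n, n + 1, n) ∈ S ∧
      (n, n, n + 1) ∈ S ∧ (n + 1, n + 1, n) ∈ S ∧ (n + 1, n, n + 1) ∈ S ∧ (n, n + 1, n + 1) ∈ S ∧
      (n + 1, n + 1, n + 1) ∈ S := by
    -- One cube: the corner and its three neighbours generate the three faces at the corner, and the
    -- face at height n + 1 then gives the opposite vertex.
    have step (n : ℤ) (hn : 0 ≤ n) (a : (n, n, n) ∈ S) (b₁ : (n + 1, n, n) ∈ S)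
        (b₂ : (n, n + 1, n) ∈ S) (b₃ : (n, n, n + 1) ∈ S) :
        (n, n, n) ∈ S ∧ (n + 1, n, n) ∈ S ∧ (n, n + 1, n) ∈ S ∧
        (n, n, n + 1) ∈ S ∧ (n + 1, n + 1, n) ∈ S ∧ (n + 1, n, n + 1) ∈ S ∧
        (n, n + 1, n + 1) ∈ S ∧ (n + 1, n + 1, n + 1) ∈ S := by
      have hn' : (0 : ℤ × ℤ × ℤ) ≤ (n, n, n) := ⟨hn, hn, hn⟩
      have hn'' : (0 : ℤ × ℤ × ℤ) ≤ (n, n, n + 1) := ⟨hn, hn, by dsimp; omega⟩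
      have c₁ : (n + 1, n + 1, n) ∈ S := by
        simpa using h₂ _ (.face₁₂ n 0) (by simpa using hn') (by simpa) (by simpa) (by simpa)
      have c₂ : (n + 1, n, n + 1) ∈ S := by
        simpa using h₂ _ (.face₁₃ n 0) (by simpa using hn') (by simpa) (by simpa) (by simpa)
      have c₃ : (n, n + 1, n + 1) ∈ S := by
        simpa using h₂ _ (.face₂₃ n 0) (by simpa using hn') (by simpa) (by simpa) (by simpa)
      refine ⟨a, b₁, b₂, b₃, c₁, c₂, c₃, ?_⟩
      simpa using h₂ _ (.face₁₂ n 1) (by simpa using hn'') (by simpa) (by simpa) (by simpa)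
    induction m generalizing n with
    | zero =>
      subst hn
      exact step 0 le_rfl (h₀ (by simp)) (h₀ (by simp)) (h₀ (by simp)) (h₀ (by simp))
    | succ m ih =>
      obtain rfl : n = m + 1 := by simpa using hn
      obtain ⟨-, -, -, -, c₁, c₂, c₃, d⟩ := ih m rfl
      have e : (m : ℤ) + 1 + 1 = m + 2 := by ring
      -- Passage to the next cube: each link square has two vertices in the old cube and one zero,
      -- and its last vertex is a neighbour of the common corner (m+1, m+1, m+1).
      refine step _ (by omega) d ?_ ?_ ?_
      · have := h₂ _ (.link₂ m) ⟨by simp; omega, by simp; omega, by simp⟩ (by simpa) (by simpa)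
          (by simpa [e] using h₁ 1 m (by omega))
        simpa [e] using this
      · have := h₂ _ (.link₁ m) ⟨by simp, by simp; omega, by simp; omega⟩ (by simpa) (by simpa)
          (by simpa [e] using h₁ 0 m (by omega))
        simpa [e] using this
      · have := h₂ _ (.link₃ m) ⟨by simp; omega, by simp, by simp; omega⟩ (by simpa) (by simpa)
          (by simpa [e] using h₁ 2 m (by omega))
        simpa [e] using this
  rintro x ⟨⟨n, e₁, e₂, e₃, he₁, he₂, he₃, rfl⟩ | hx, h⟩
  · have h' : ((0 : ℤ), (0 : ℤ), (0 : ℤ)) ≤ _ := h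
    simp only [Prod.mk_le_mk] at h'
    by_cases hn : 0 ≤ n
    · obtain ⟨a, b₁, b₂, b₃, c₁, c₂, c₃, d⟩ := key n.toNat n (by omega)
      rcases he₁ with rfl | rfl <;> rcases he₂ with rfl | rfl <;> rcases he₃ with rfl | rfl <;>
        simpa
    -- The only nonnegative vertex of a cube with n < 0 is the top of the cube at -1, which is the
    -- origin.
    · obtain rfl : n = -1 := by omega
      obtain rfl : e₁ = 1 := by omega
      obtain rfl : e₂ = 1 := by omega
      obtain rfl : e₃ = 1 := by omega
      exact h₀ (by simp)
  · obtain ⟨i, n, rfl⟩ := exists_linkPt hx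
    have h' : ((0 : ℤ), (0 : ℤ), (0 : ℤ)) ≤ _ := h
    refine h₁ i n ?_
    fin_cases i <;> simp [Prod.mk_le_mk] at h' <;> omega

/-- Every point of `C` is reached from the nonnegative points and the zeros by small squares. -/
lemma cPts_induction (S : Set (ℤ × ℤ × ℤ)) (h₀ : CNonneg ⊆ S) (h₁ : linkPoints ⊆ S)
    (h₂ : ∀ p, IsSmallSquare p → ¬ 0 ≤ p 0 0 → p 1 1 ∈ S → p 1 0 ∈ S → p 0 1 ∈ S → p 0 0 ∈ S) :
    CPts ⊆ S := by
  have key (m : ℕ) (n : ℤ) (hn : n = -m) : (n, n, n) ∈ S ∧ (n + 1, n, n) ∈ S ∧ (n, n + 1, n) ∈ S ∧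
      (n, n, n + 1) ∈ S ∧ (n + 1, n + 1, n) ∈ S ∧ (n + 1, n, n + 1) ∈ S ∧ (n, n + 1, n + 1) ∈ S ∧
      (n + 1, n + 1, n + 1) ∈ S := by
    induction m generalizing n with
    | zero =>
      obtain rfl : n = 0 := by simpa using hn
      refine ⟨?_, ?_, ?_, ?_, ?_, ?_, ?_, ?_⟩ <;>
        exact h₀ ⟨Or.inl (mk_mem_cubePoints (n := 0) (by omega) (by omega) (by omega)), by decide⟩
    | succ m ih =>
      -- The step downwards runs in the opposite order: the link squares give the three neighbours
      -- of the top vertex d, and the faces of the cube then give the three neighbours of the bottom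
      -- vertex and that vertex itself.
      obtain ⟨d, b₁, b₂, b₃, -, -, -, -⟩ := ih (n + 1) (by omega)
      have e : n + 1 + 1 = n + 2 := by ring
      rw [e] at b₁ b₂ b₃
      have hn' (x : ℤ × ℤ × ℤ) (h : x.1 < 0 ∨ x.2.1 < 0 ∨ x.2.2 < 0) : ¬ 0 ≤ x := by
        intro h'
        have h₁ : 0 ≤ x.1 := h'.1
        have h₂ : 0 ≤ x.2.1 := h'.2.1
        have h₃ : 0 ≤ x.2.2 := h'.2.2
        omega
      have c₁ : (n + 1, n + 1, n) ∈ S := by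
        have := h₂ _ (.link₂ n) (hn' _ (by simp; omega)) (by simpa [e]) (by simpa [e])
          (by simpa [e] using h₁ (linkPt_mem 1 n))
        simpa [e] using this
      have c₃ : (n, n + 1, n + 1) ∈ S := by
        have := h₂ _ (.link₁ n) (hn' _ (by simp; omega)) (by simpa [e]) (by simpa [e])
          (by simpa [e] using h₁ (linkPt_mem 0 n))
        simpa [e] using this
      have c₂ : (n + 1, n, n + 1) ∈ S := by
        have := h₂ _ (.link₃ n) (hn' _ (by simp; omega)) (by simpa [e]) (by simpa [e])
          (by simpa [e] using h₁ (linkPt_mem 2 n))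
        simpa [e] using this
      have b₁ : (n + 1, n, n) ∈ S := by
        simpa using h₂ _ (.face₂₃ n 1) (hn' _ (by simp; omega)) (by simpa) (by simpa) (by simpa)
      have b₂ : (n, n + 1, n) ∈ S := by
        simpa using h₂ _ (.face₁₃ n 1) (hn' _ (by simp; omega)) (by simpa) (by simpa) (by simpa)
      have b₃ : (n, n, n + 1) ∈ S := by
        simpa using h₂ _ (.face₁₂ n 1) (hn' _ (by simp; omega)) (by simpa) (by simpa) (by simpa)
      refine ⟨?_, b₁, b₂, b₃, c₁, c₂, c₃, d⟩
      simpa using h₂ _ (.face₁₂ n 0) (hn' _ (by simp; omega)) (by simpa) (by simpa) (by simpa)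
  rintro x (⟨n, e₁, e₂, e₃, he₁, he₂, he₃, rfl⟩ | hx)
  · by_cases hn : 0 ≤ n
    · exact h₀ ⟨Or.inl ⟨n, e₁, e₂, e₃, he₁, he₂, he₃, rfl⟩, show (0 : ℤ) ≤ n + e₁ by omega,
        show (0 : ℤ) ≤ n + e₂ by omega, show (0 : ℤ) ≤ n + e₃ by omega⟩
    · obtain ⟨a, b₁, b₂, b₃, c₁, c₂, c₃, d⟩ := key (-n).toNat n (by omega)
      rcases he₁ with rfl | rfl <;> rcases he₂ with rfl | rfl <;> rcases he₃ with rfl | rfl <;>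
        simpa
  · exact h₁ hx

/-! ### Exact diagrams as iterated Kan extensions from the source. -/

namespace Prederivator

variable {D : Prederivator.{w, v, u}}

lemma isZero_eval_res_iff {A B : Type w} [SmallCategory A] [SmallCategory B] (f : A ⥤ B) (a : A)
    (X : D.Diag B) : Limits.IsZero ((D.eval a).obj ((D.res f).obj X)) ↔
      Limits.IsZero ((D.eval (f.obj a)).obj X) :=
  ⟨fun h => h.of_iso (D.evalRes f a X).symm, fun h => h.of_iso (D.evalRes f a X)⟩

/-- The conditions describing exact diagrams as iterated Kan extensions from the source. -/
structure IsKanDiagram (Z : D.Diag (Shape.{w} CPts)) : Prop where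
  rExt_C : D.RExt (Shape.incl cNonnegZeros_subset) Z
  lExt_zeros : D.LExt (Shape.incl (Set.subset_union_left : CNonneg ⊆ CNonnegZeros))
    ((D.res (Shape.incl cNonnegZeros_subset)).obj Z)
  lExt_nonneg : D.LExt (Shape.incl sourceZeros_subset)
    ((D.res (Shape.incl (Set.subset_union_left : CNonneg ⊆ CNonnegZeros))).obj
      ((D.res (Shape.incl cNonnegZeros_subset)).obj Z))
  rExt_source : D.RExt (Shape.incl (Set.subset_union_left : SourcePts ⊆ SourceZeros))
    ((D.res (Shape.incl sourceZeros_subset)).obj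
      ((D.res (Shape.incl (Set.subset_union_left : CNonneg ⊆ CNonnegZeros))).obj
        ((D.res (Shape.incl cNonnegZeros_subset)).obj Z)))

variable [D.IsStable] {Z : D.Diag (Shape.{w} CPts)}

lemma isCocartesian_res_iff {P Q : Type} [Preorder P] [Preorder Q] {k : Sq → P} (hk : Monotone k)
    {f : P → Q} (hf : Monotone f) (X : D.Diag (Shape.{w} Q)) :
    D.IsCocartesian ((D.res (Shape.map k hk)).obj ((D.res (Shape.map f hf)).obj X)) ↔
      D.IsCocartesian ((D.res (Shape.map (f ∘ k) (hf.comp hk))).obj X) := by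
  have e := (D.resComp (Shape.map k hk) (Shape.map f hf)).app X
  exact ⟨fun h => h.ofIso e.symm, fun h => h.ofIso e⟩

namespace IsExactDiagram

variable (h : D.IsExactDiagram Z)

include h

lemma isZero_linkPt {x : ℤ × ℤ × ℤ} (hx : x ∈ linkPoints) (hx' : x ∈ CPts) :
    Limits.IsZero ((D.eval (ULift.up (⟨x, hx'⟩ : CPts))).obj Z) := by
  obtain ⟨i, n, rfl⟩ := exists_linkPt hx
  exact h.isZero _ (linkPt_notMem i n)

/-- All four conditions are instances of generation. The small squares that start at nonnegative
points reach `CNonneg` from the source and its zeros; the others reach all of C downwards; the two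
extensions in between only add objects at which Z vanishes. -/
lemma isKanDiagram : D.IsKanDiagram Z where
  rExt_C := by
    refine RExt.of_generation (u := Set.inclusion cNonnegZeros_subset) _ (fun _ _ h => h) Z fun S hS _ hk => ?_
    have := cPts_induction {x | ∀ hx : x ∈ CPts, ⟨x, hx⟩ ∈ S}
      (fun x hx _ => hS ⟨x, Or.inl hx⟩) (fun x hx _ => hS ⟨x, Or.inr hx⟩)
      (fun p hp h₀ h₁₁ h₁₀ h₀₁ _ => ?_)
    · exact fun b => this b.2 b.2
    · let k : Sq → CPts := fun s => ⟨p s.1 s.2, hp.mem_CPts _ _⟩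
      have hm : Monotone k := fun s t hst => hp.mono hst.1 hst.2
      refine hk k ⟨hm, ?_, fun a h₁ h₂ => hp.le_sup h₁ h₂⟩ (h.isCartesian k hm hp) (h₁₁ _) (h₁₀ _)
        (h₀₁ _)
      rintro ⟨a, ha | ha⟩ h
      · exact hp.cocover_nonneg h₀ ha.2 h
      · obtain ⟨i, n, rfl⟩ := exists_linkPt ha
        exact hp.cocover_linkPt i n h
  lExt_zeros := by
    refine LExt.of_generation (u := Set.inclusion Set.subset_union_left) _ (fun _ _ h => h) _ fun S hS hz _ => ?_
    rintro ⟨b, hb⟩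
    by_cases hb' : b ∈ CNonneg
    · exact hS ⟨b, hb'⟩
    · have hb₁ := hb.resolve_left hb'
      -- A link point above a nonnegative point is itself nonnegative, so the added link points lie
      -- above nothing in `CNonneg`.
      refine hz _ ((isZero_eval_res_iff _ _ _).2 (h.isZero_linkPt hb₁ _)) fun a hab => ?_
      exact hb' ⟨Or.inr hb₁, a.2.2.trans hab⟩
  lExt_nonneg := by
    refine LExt.of_generation (u := Set.inclusion sourceZeros_subset) _ (fun _ _ h => h) _ fun S hS _ hk => ?_
    have := cNonneg_induction {x | ∀ hx : x ∈ CNonneg, ⟨x, hx⟩ ∈ S}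
      (fun x hx _ => hS ⟨x, Or.inl hx⟩)
      (fun i n hn _ => hS ⟨_, Or.inr ⟨linkPt_mem i n, ?_⟩⟩)
      (fun p hp h₀ h₀₀ h₁₀ h₀₁ _ => ?_)
    · exact fun b => this b.2 b.2
    · fin_cases i
      · exact ⟨hn, by dsimp; omega, by dsimp; omega⟩
      · exact ⟨by dsimp; omega, by dsimp; omega, hn⟩
      · exact ⟨by dsimp; omega, hn, by dsimp; omega⟩
    · have hp' (a b : Fin 2) : 0 ≤ p a b := h₀.trans (hp.mono (Fin.zero_le _) (Fin.zero_le _))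
      let k : Sq → CNonneg := fun s => ⟨p s.1 s.2, hp.mem_CPts _ _, hp' _ _⟩
      have hm : Monotone k := fun s t hst => hp.mono hst.1 hst.2
      refine hk k ⟨hm, ?_, fun a h₁ h₂ => hp.inf_le h₁ h₂⟩ ?_ (h₀₀ _) (h₁₀ _)
        (h₀₁ _)
      · rintro ⟨a, ha | ha⟩ h
        · exact hp.cover_source h₀ ha h
        · obtain ⟨i, n, rfl⟩ := exists_linkPt ha.1
          exact hp.cover_linkPt i n h
      · refine (isCocartesian_res_iff _ _ _).2 ((isCocartesian_res_iff _ _ _).2 ?_)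
        exact h.isCocartesian _ _ hp
  rExt_source := by
    refine RExt.of_generation (u := Set.inclusion Set.subset_union_left) _ (fun _ _ h => h) _ fun S hS hz _ => ?_
    rintro ⟨b, hb⟩
    by_cases hb' : b ∈ SourcePts
    · exact hS ⟨b, hb'⟩
    · obtain ⟨hb₁, -⟩ := hb.resolve_left hb'
      refine hz _ ((isZero_eval_res_iff _ _ _).2 ((isZero_eval_res_iff _ _ _).2
        ((isZero_eval_res_iff _ _ _).2 (h.isZero_linkPt hb₁ _)))) fun a hab => ?_
      obtain ⟨i, n, rfl⟩ := exists_linkPt hb₁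
      obtain ⟨a, ha⟩ := a
      have hb₂ := hb.resolve_left hb'
      have hab' : linkPt i n ≤ a := hab
      have hb₃ : ((0 : ℤ), (0 : ℤ), (0 : ℤ)) ≤ linkPt i n := hb₂.2
      rcases ha with rfl | rfl | rfl | rfl <;> fin_cases i <;> simp [Prod.mk_le_mk] at hab' hb₃ <;>
        omega

end IsExactDiagram

/-- According to the position of its initial vertex, a small square is a pushout for the upward left
extension or a pullback for the downward right extension. Stability then makes it bicartesian in
both cases. -/
lemma IsKanDiagram.isCartesian_or (h : D.IsKanDiagram Z) (k : Sq → CPts) (hk : Monotone k)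
    (hs : IsSmallSquare fun a b => (k (a, b)).1) :
    D.IsCocartesian ((D.res (Shape.map k hk)).obj Z) ∨
      D.IsCartesian ((D.res (Shape.map k hk)).obj Z) := by
  by_cases h₀ : 0 ≤ (k (0, 0)).1
  · left
    let k' : Sq → CNonneg := fun s => ⟨(k s).1, (k s).2,
      h₀.trans (hs.mono (a := 0) (b := 0) (Fin.zero_le s.1) (Fin.zero_le s.2))⟩
    have hk' : IsPushoutFor (Set.inclusion sourceZeros_subset) k' := by
      refine ⟨hk, ?_, fun a h₁ h₂ => hs.inf_le h₁ h₂⟩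
      rintro ⟨a, ha | ha⟩ h
      · exact hs.cover_source h₀ ha h
      · obtain ⟨i, n, rfl⟩ := exists_linkPt ha.1
        exact hs.cover_linkPt i n h
    have := h.lExt_nonneg.isCocartesian hk'
    exact (isCocartesian_res_iff (k := Set.inclusion Set.subset_union_left ∘ k')
      (f := Set.inclusion cNonnegZeros_subset) _ _ _).1 ((isCocartesian_res_iff _ _ _).1 this)
  · right
    refine h.rExt_C.isCartesian ⟨hk, ?_, fun a h₁ h₂ => hs.le_sup h₁ h₂⟩
    rintro ⟨a, ha | ha⟩ h
    · exact hs.cocover_nonneg h₀ ha.2 h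
    · obtain ⟨i, n, rfl⟩ := exists_linkPt ha
      exact hs.cocover_linkPt i n h

lemma IsKanDiagram.isExactDiagram (h : D.IsKanDiagram Z) : D.IsExactDiagram Z where
  isCocartesian k hk hs := (h.isCartesian_or k hk hs).elim id
    (IsStable.isCocartesian_iff_isCartesian _).2
  isCartesian k hk hs := (h.isCartesian_or k hk hs).elim
    (IsStable.isCocartesian_iff_isCartesian _).1 id
  isZero := by
    rintro ⟨x, hx⟩ hx'
    have hx₁ := hx.resolve_left hx'
    by_cases hx₀ : 0 ≤ x
    · have := h.rExt_source.isZero (ULift.up ⟨x, Or.inr ⟨hx₁, hx₀⟩⟩) fun a =>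
        Shape.isEmpty_hom fun hab => ?_
      · rw [isZero_eval_res_iff, isZero_eval_res_iff, isZero_eval_res_iff] at this
        exact this
      · obtain ⟨i, n, rfl⟩ := exists_linkPt hx₁
        obtain ⟨a, ha⟩ := a
        have hab' : linkPt i n ≤ a := hab
        have hb₃ : ((0 : ℤ), (0 : ℤ), (0 : ℤ)) ≤ linkPt i n := hx₀
        rcases ha with rfl | rfl | rfl | rfl <;> fin_cases i <;>
          simp [Prod.mk_le_mk] at hab' hb₃ <;> omega
    · have := h.lExt_zeros.isZero (ULift.up ⟨x, Or.inr hx₁⟩) fun a =>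
        Shape.isEmpty_hom fun hab => hx₀ (a.down.2.2.trans hab)
      rw [isZero_eval_res_iff] at this
      exact this

lemma isExactDiagram_iff : D.IsExactDiagram Z ↔ D.IsKanDiagram Z :=
  ⟨fun h => h.isKanDiagram, fun h => h.isExactDiagram⟩

end Prederivator

/-! ### Essential images of successive Kan extensions. -/

section Step

universe v₀ v₁ v₂ u₀ u₁ u₂

variable {𝒳 : Type u₀} [Category.{v₀} 𝒳] {𝒜 : Type u₁} [Category.{v₁} 𝒜] {ℬ : Type u₂}
  [Category.{v₂} ℬ]

/-- `G` identifies its source with the full subcategory of the objects satisfying `P`. -/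
structure IsEmbeddingOnto (G : 𝒳 ⥤ 𝒜) (P : 𝒜 → Prop) : Prop where
  full : G.Full
  faithful : G.Faithful
  essImage_iff : ∀ M, G.essImage M ↔ P M

/-- On the objects that are left extended from their image, R is fully faithful, and `hR` says that
every object of ℬ is such an image. Composing with R thus removes one extension condition from the
description of the essential image. -/
lemma IsEmbeddingOnto.comp_left {G : 𝒳 ⥤ 𝒜} {R : 𝒜 ⥤ ℬ} {P : ℬ → Prop}
    (h : IsEmbeddingOnto G fun M => LUniv R (𝟙 (R.obj M)) ∧ P (R.obj M))
    (hP : ∀ M N, Nonempty (M ≅ N) → P M → P N)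
    (hR : ∀ Y, ∃ V, LUniv R (𝟙 (R.obj V)) ∧ Nonempty (R.obj V ≅ Y)) :
    IsEmbeddingOnto (G ⋙ R) P := by
  have := h.full
  have := h.faithful
  have hG (x : 𝒳) := (h.essImage_iff _).1 (G.obj_mem_essImage x)
  have hb (x y : 𝒳) : Function.Bijective (fun f : G.obj x ⟶ G.obj y => R.map f) := by
    have := (hG x).1 (G.obj y)
    simpa only [Category.id_comp] using this
  refine ⟨⟨fun g => ?_⟩, ⟨fun {x y f g} hfg => G.map_injective ((hb x y).1 hfg)⟩,
    fun Y => ⟨?_, fun hY => ?_⟩⟩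
  · obtain ⟨f, hf⟩ := (hb _ _).2 g
    exact ⟨G.preimage f, by simpa using hf⟩
  · rintro ⟨x, e⟩
    exact hP _ _ e (hG x).2
  · obtain ⟨V, hV, ⟨e⟩⟩ := hR Y
    obtain ⟨x, ⟨e'⟩⟩ := (h.essImage_iff V).2 ⟨hV, hP _ _ ⟨e.symm⟩ hY⟩
    exact ⟨x, ⟨R.mapIso e' ≪≫ e⟩⟩

lemma IsEmbeddingOnto.comp_right {G : 𝒳 ⥤ 𝒜} {R : 𝒜 ⥤ ℬ} {P : ℬ → Prop}
    (h : IsEmbeddingOnto G fun M => RUniv R (𝟙 (R.obj M)) ∧ P (R.obj M))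
    (hP : ∀ M N, Nonempty (M ≅ N) → P M → P N)
    (hR : ∀ Y, ∃ V, RUniv R (𝟙 (R.obj V)) ∧ Nonempty (R.obj V ≅ Y)) :
    IsEmbeddingOnto (G ⋙ R) P := by
  have := h.full
  have := h.faithful
  have hG (x : 𝒳) := (h.essImage_iff _).1 (G.obj_mem_essImage x)
  have hb (x y : 𝒳) : Function.Bijective (fun f : G.obj x ⟶ G.obj y => R.map f) := by
    have := (hG y).1 (G.obj x)
    simpa only [Category.comp_id] using this
  refine ⟨⟨fun g => ?_⟩, ⟨fun {x y f g} hfg => G.map_injective ((hb x y).1 hfg)⟩,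
    fun Y => ⟨?_, fun hY => ?_⟩⟩
  · obtain ⟨f, hf⟩ := (hb _ _).2 g
    exact ⟨G.preimage f, by simpa using hf⟩
  · rintro ⟨x, e⟩
    exact hP _ _ e (hG x).2
  · obtain ⟨V, hV, ⟨e⟩⟩ := hR Y
    obtain ⟨x, ⟨e'⟩⟩ := (h.essImage_iff V).2 ⟨hV, hP _ _ ⟨e.symm⟩ hY⟩
    exact ⟨x, ⟨R.mapIso e' ≪≫ e⟩⟩

lemma IsEmbeddingOnto.isEquivalence {G : 𝒳 ⥤ 𝒜} (h : IsEmbeddingOnto G fun _ => True) :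
    G.IsEquivalence where
  full := h.full
  faithful := h.faithful
  essSurj := ⟨fun Y => (h.essImage_iff Y).2 trivial⟩

end Step

/-! ### The restriction to the source is an equivalence. -/

namespace Prederivator

open CatTrans

variable {D : Prederivator.{w, v, u}} {A B K : Type w} [SmallCategory A] [SmallCategory B]
  [SmallCategory K]

lemma exists_lExt [D.IsDerivator] (f : A ⥤ B) [f.Full] [f.Faithful] (Y : D.Diag A) :
    ∃ V, D.LExt f V ∧ Nonempty ((D.res f).obj V ≅ Y) := by
  obtain ⟨V, θ, h⟩ := LUniv.exists_of_isRightAdjoint (D.res f) Y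
  have := LUniv.isIso_of_fullyFaithful f h
  exact ⟨V, LUniv.lExt h, ⟨(asIso θ).symm⟩⟩

lemma exists_rExt [D.IsDerivator] (f : A ⥤ B) [f.Full] [f.Faithful] (Y : D.Diag A) :
    ∃ V, D.RExt f V ∧ Nonempty ((D.res f).obj V ≅ Y) := by
  obtain ⟨V, θ, h⟩ := RUniv.exists_of_isLeftAdjoint (D.res f) Y
  have := RUniv.isIso_of_fullyFaithful f h
  exact ⟨V, RUniv.rExt h, ⟨asIso θ⟩⟩

/-- `i^*` as an iterated restriction. -/
noncomputable def iterRes (D : Prederivator.{w, v, u}) [D.IsDerivator] :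
    D.ex ⟶ D.shift Source.{w} :=
  (((D.exIncl ≫ D.resMor (Shape.incl cNonnegZeros_subset)) ≫
    D.resMor (Shape.incl (Set.subset_union_left : CNonneg ⊆ CNonnegZeros))) ≫
    D.resMor (Shape.incl sourceZeros_subset)) ≫
    D.resMor (Shape.incl (Set.subset_union_left : SourcePts ⊆ SourceZeros))

lemma iterRes_isoMor (D : Prederivator.{w, v, u}) [D.IsDerivator] : IsoMor D.iterRes D.iStar := by
  refine (IsoMor.assoc _ _ _).trans ?_
  refine ((D.resMor_comp _ _).left _).trans ?_
  refine (IsoMor.assoc _ _ _).trans ?_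
  refine ((D.resMor_comp _ _).left _).trans ?_
  refine (IsoMor.assoc _ _ _).trans ?_
  exact (D.resMor_comp _ _).left _

/-- Exactness is imposed at each parameter, and by `rExt_prod_iff` and `lExt_prod_iff` so are the
four extension conditions. -/
lemma shape_prop_iff [D.IsStable] (Z : D.Diag (Shape.{w} CPts × K)) :
    (∀ k, D.IsExactDiagram ((D.res (Prod.sectL _ k)).obj Z)) ↔
      D.RExt ((Shape.incl cNonnegZeros_subset).prod (𝟭 K)) Z ∧
      D.LExt ((Shape.incl (Set.subset_union_left : CNonneg ⊆ CNonnegZeros)).prod (𝟭 K))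
        ((D.res ((Shape.incl cNonnegZeros_subset).prod (𝟭 K))).obj Z) ∧
      D.LExt ((Shape.incl sourceZeros_subset).prod (𝟭 K))
        ((D.res ((Shape.incl (Set.subset_union_left : CNonneg ⊆ CNonnegZeros)).prod (𝟭 K))).obj
          ((D.res ((Shape.incl cNonnegZeros_subset).prod (𝟭 K))).obj Z)) ∧
      D.RExt ((Shape.incl (Set.subset_union_left : SourcePts ⊆ SourceZeros)).prod (𝟭 K))
        ((D.res ((Shape.incl sourceZeros_subset).prod (𝟭 K))).obj
          ((D.res ((Shape.incl (Set.subset_union_left : CNonneg ⊆ CNonnegZeros)).prod (𝟭 K))).obj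
            ((D.res ((Shape.incl cNonnegZeros_subset).prod (𝟭 K))).obj Z))) := by
  rw [rExt_prod_iff, lExt_prod_iff, lExt_prod_iff, rExt_prod_iff, ← forall_and, ← forall_and,
    ← forall_and]
  refine forall_congr' fun k => ?_
  rw [isExactDiagram_iff]
  let e₁ := sectLRes (Shape.incl cNonnegZeros_subset) k Z
  let e₂ := sectLRes (Shape.incl (Set.subset_union_left : CNonneg ⊆ CNonnegZeros)) k
    ((D.res ((Shape.incl cNonnegZeros_subset).prod (𝟭 K))).obj Z) ≪≫ (D.res _).mapIso e₁
  let e₃ := sectLRes (Shape.incl sourceZeros_subset) k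
        ((D.res ((Shape.incl (Set.subset_union_left : CNonneg ⊆ CNonnegZeros)).prod (𝟭 K))).obj
          ((D.res ((Shape.incl cNonnegZeros_subset).prod (𝟭 K))).obj Z)) ≪≫ (D.res _).mapIso e₂
  exact ⟨fun h => ⟨h.1, h.2.of_iso e₁.symm, h.3.of_iso e₂.symm, h.4.of_iso e₃.symm⟩,
    fun h => ⟨h.1, h.2.1.of_iso e₁, h.2.2.1.of_iso e₂, h.2.2.2.of_iso e₃⟩⟩

/-- Starting from the inclusion of the exact diagrams, the four restrictions strip off one extension
condition each, until the image is described by no condition at all. -/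
lemma isEquivalence_iterRes (D : Prederivator.{w, v, u}) [D.IsStable] (a : (Cat.{w, w})ᵒᵖ) :
    (fn D.iterRes a).IsEquivalence := by
  let K : Type w := a.unop
  let i₁ := (Shape.incl.{w} cNonnegZeros_subset).prod (𝟭 K)
  let i₂ := (Shape.incl.{w} (Set.subset_union_left : CNonneg ⊆ CNonnegZeros)).prod (𝟭 K)
  let i₃ := (Shape.incl.{w} sourceZeros_subset).prod (𝟭 K)
  let i₄ := (Shape.incl.{w} (Set.subset_union_left : SourcePts ⊆ SourceZeros)).prod (𝟭 K)
  let P₃ : D.Diag (Shape.{w} SourceZeros × K) → Prop := fun M => D.RExt i₄ M ∧ True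
  let P₂ : D.Diag (Shape.{w} CNonneg × K) → Prop := fun M => D.LExt i₃ M ∧ P₃ ((D.res i₃).obj M)
  let P₁ : D.Diag (Shape.{w} CNonnegZeros × K) → Prop := fun M =>
    D.LExt i₂ M ∧ P₂ ((D.res i₂).obj M)
  have hP₃ (M N) : Nonempty (M ≅ N) → P₃ M → P₃ N := fun ⟨e⟩ h => ⟨h.1.of_iso e, trivial⟩
  have hP₂ (M N) : Nonempty (M ≅ N) → P₂ M → P₂ N := fun ⟨e⟩ h =>
    ⟨h.1.of_iso e, hP₃ _ _ ⟨(D.res i₃).mapIso e⟩ h.2⟩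
  have hP₁ (M N) : Nonempty (M ≅ N) → P₁ M → P₁ N := fun ⟨e⟩ h =>
    ⟨h.1.of_iso e, hP₂ _ _ ⟨(D.res i₂).mapIso e⟩ h.2⟩
  have hP₀ (M : D.Diag (Shape.{w} CPts × K)) :
      (D.exProp.prop a) M ↔ D.RExt i₁ M ∧ P₁ ((D.res i₁).obj M) :=
    (shape_prop_iff M).trans (by simp only [P₁, P₂, P₃, and_true]; rfl)
  have h₀ : IsEmbeddingOnto (D.exProp.prop a).ι fun M : D.Diag (Shape.{w} CPts × K) =>
      RUniv (D.res i₁) (𝟙 ((D.res i₁).obj M)) ∧ P₁ ((D.res i₁).obj M) := by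
    refine ⟨inferInstance, inferInstance, fun M => ⟨?_, fun h => ?_⟩⟩
    · rintro ⟨x, ⟨e⟩⟩
      have := (hP₀ _).1 x.2
      exact ⟨RExt.of_iso this.1 e, hP₁ _ _ ⟨(D.res i₁).mapIso e⟩ this.2⟩
    · exact ⟨⟨M, (hP₀ M).2 h⟩, ⟨Iso.refl _⟩⟩
  have h₁ := h₀.comp_right hP₁ (exists_rExt i₁)
  have h₂ := IsEmbeddingOnto.comp_left h₁ hP₂ (exists_lExt i₂)
  have h₃ := IsEmbeddingOnto.comp_left h₂ hP₃ (exists_lExt i₃)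
  have h₄ := IsEmbeddingOnto.comp_right (P := fun _ => True) h₃ (fun _ _ _ _ => trivial)
    (exists_rExt i₄)
  exact h₄.isEquivalence

instance (D : Prederivator.{w, v, u}) [D.IsStable] : IsEquivMor D.iStar := by
  have := isEquivalence_iterRes D
  have : IsEquivMor D.iterRes := ⟨exists_equivalence D.iterRes⟩
  exact isEquivMor_of_isoMor ((D.iterRes_isoMor.right _).symm.trans (comp_invMor _))
    ((D.iterRes_isoMor.left _).symm.trans (invMor_comp _))

instance isStable_ex (D : Prederivator.{w, v, u}) [D.IsStable] : D.ex.IsStable := by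
  have := isEquivalence_iterRes D
  exact isStable_of_equivalence D.iterRes

lemma suspension_comp_iStar (D : Prederivator.{w, v, u}) [D.IsStable] :
    IsoMor (D.ex.suspension ≫ D.iStar) (D.iStar ≫ (D.shift Source.{w}).suspension) := by
  have := isEquivalence_iterRes D
  exact ((D.iterRes_isoMor.left _).symm.trans (suspension_comp_of_equivalence D.iterRes)).trans
    (D.iterRes_isoMor.right _)

end Prederivator

/-- The functor of two variables given by a monotone map. -/
def Shape.map₂ {P Q R : Type} [Preorder P] [Preorder Q] [Preorder R] (f : P → Q → R)
    (hf : ∀ p p' q q', p ≤ p' → q ≤ q' → f p q ≤ f p' q') :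
    Shape.{w} P × Shape.{w} Q ⥤ Shape.{w} R where
  obj x := ULift.up (f x.1.down x.2.down)
  map {x _} g := homOfLE (hf _ _ _ _ (Shape.le (x := x.1) g.1) (Shape.le (x := x.2) g.2))
  map_id _ := Subsingleton.elim _ _
  map_comp _ _ := Subsingleton.elim _ _

/-! ### Suspension in shifted derivators. -/

namespace Prederivator

open CatTrans

section

variable {D E : Prederivator.{w, v, u}} {A B C K : Type w} [SmallCategory A] [SmallCategory B]
  [SmallCategory C] [SmallCategory K]

section

variable [D.IsDerivator]

lemma rExt_of_isZero (f : A ⥤ B) {Z : D.Diag B} (hZ : Limits.IsZero Z) : D.RExt f Z := fun _ =>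
  ⟨fun _ _ _ => hZ.eq_of_tgt _ _, fun _ => ⟨hZ.from_ _, (isZero_res f hZ).eq_of_tgt _ _⟩⟩

variable [Limits.HasZeroObject (D.Diag Pt.{w})]

variable (D A) in
lemma exists_isZero : ∃ Z : D.Diag A, Limits.IsZero Z := by
  obtain ⟨Z, hZ⟩ := Limits.HasZeroObject.zero (C := D.Diag Pt.{w})
  exact ⟨(D.res ((Functor.const A).obj ⟨⟨⟩⟩)).obj Z, isZero_res _ hZ⟩

lemma isZero_of_eval {Z : D.Diag A} (h : ∀ a, Limits.IsZero ((D.eval a).obj Z)) :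
    Limits.IsZero Z := by
  obtain ⟨Z₀, hZ₀⟩ := exists_isZero D A
  let m : Z ⟶ Z₀ := hZ₀.from_ Z
  have : IsIso m := IsDerivator.der2 _ _ fun a => (h a).isIso (isZero_res (pt a) hZ₀) _
  exact hZ₀.of_iso (asIso m)

/-- The map to the zero square is invertible on the cospan, and both squares are right extended from
there. -/
lemma isZero_of_isCartesian {M : D.Diag (Shape.{w} Sq)} (h : D.IsCartesian M)
    (h₁₀ : Limits.IsZero ((D.eval (ULift.up (1, 0))).obj M))
    (h₀₁ : Limits.IsZero ((D.eval (ULift.up (0, 1))).obj M))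
    (h₁₁ : Limits.IsZero ((D.eval (ULift.up (1, 1))).obj M)) :
    Limits.IsZero ((D.eval (ULift.up (0, 0))).obj M) := by
  obtain ⟨Z, hZ⟩ := exists_isZero D (Shape.{w} Sq)
  rw [isCartesian_iff_rExt] at h
  let m : M ⟶ Z := hZ.from_ M
  have : IsIso ((D.res cospanIncl).map m) := IsDerivator.der2 _ _ fun ⟨s⟩ => by
    rw [isIso_eval_res_iff]
    rcases cospan_cases s with rfl | rfl | rfl
    exacts [h₁₁.isIso (isZero_res _ hZ) _, h₁₀.isIso (isZero_res _ hZ) _,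
      h₀₁.isIso (isZero_res _ hZ) _]
  have := h.isIso (rExt_of_isZero _ hZ) m
  exact isZero_res _ (hZ.of_iso (asIso m))

end

lemma comp_shift_suspension [D.IsStable] (X : E ⟶ (D.shift B).shift (Shape.{w} Sq))
    (h : PtProp X fun M => ∀ b, IsSuspSq D ((D.res (Prod.sectR b (Shape.{w} Sq))).obj M)) :
    IsoMor ((X ≫ (D.shift B).ev (ULift.up (0, 0))) ≫ (D.shift B).suspension)
      (X ≫ (D.shift B).ev (ULift.up (1, 1))) := by
  refine comp_suspension X (h.imp fun M hM => ⟨?_, ?_, ?_⟩)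
  · exact (shift_isCocartesian_iff M).2 fun b => (hM b).isCocartesian
  · exact isZero_of_eval (D := D) fun ⟨b, p⟩ => (isZero_eval_res_iff _ _ _).2
      ((isZero_eval_res_iff (D := D) (Prod.sectR b (Shape.{w} Sq)) (ULift.up (1, 0)) M).1
        (hM b).isZero₁₀)
  · exact isZero_of_eval (D := D) fun ⟨b, p⟩ => (isZero_eval_res_iff _ _ _).2
      ((isZero_eval_res_iff (D := D) (Prod.sectR b (Shape.{w} Sq)) (ULift.up (0, 1)) M).1
        (hM b).isZero₀₁)

lemma sectR_curryMor (Ξ : B × K ⥤ C) {a : (Cat.{w, w})ᵒᵖ} (k : a.unop) (b : B)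
    (Z : D.Diag (C × a.unop)) : Nonempty ((D.res (Prod.sectR b K)).obj
      (((D.shift B).res (Prod.sectL K k)).obj
        ((fn (D.resMor Ξ ≫ D.curryMor B K) a).obj Z)) ≅
      (D.res (Prod.sectR b K ⋙ Ξ)).obj ((D.res (Prod.sectL C k)).obj Z)) := by
  let f₁ := Ξ.prod (𝟭 a.unop)
  let f₂ := unassoc B K a.unop
  let f₃ := (𝟭 B).prod (Prod.sectL K k)
  let e : Prod.sectR b K ⋙ f₃ ⋙ f₂ ⋙ f₁ ≅ (Prod.sectR b K ⋙ Ξ) ⋙ Prod.sectL C k :=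
    NatIso.ofComponents (fun _ => Iso.refl _) fun g => Prod.ext
      ((Category.comp_id _).trans (Category.id_comp _).symm) rfl
  exact ⟨(D.res (Prod.sectR b K)).mapIso ((D.res f₃).mapIso (D.cmp f₂ f₁ Z).symm ≪≫
    (D.cmp f₃ (f₂ ⋙ f₁) Z).symm) ≪≫ (D.cmp (Prod.sectR b K) (f₃ ⋙ f₂ ⋙ f₁) Z).symm ≪≫
    (D.resIso e).app Z ≪≫ D.cmp _ _ Z⟩

/-- A family of squares in the values of `X` computes the suspension. -/
theorem resMor_shift_suspension [D.IsStable] (X : E ⟶ D.shift C) (Ξ : B × Shape.{w} Sq ⥤ C)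
    (h : PtProp X fun Z => ∀ b, IsSuspSq D ((D.res (Prod.sectR b (Shape.{w} Sq) ⋙ Ξ)).obj Z)) :
    IsoMor ((X ≫ D.resMor (Prod.sectL B (ULift.up (0, 0)) ⋙ Ξ)) ≫ (D.shift B).suspension)
      (X ≫ D.resMor (Prod.sectL B (ULift.up (1, 1)) ⋙ Ξ)) := by
  -- Restriction along Ξ followed by currying turns X into a family of squares in the shift of D by
  -- B, to which the criterion for suspension squares applies.
  have key (s : Shape.{w} Sq) : IsoMor ((X ≫ D.resMor Ξ ≫ D.curryMor B _) ≫ (D.shift B).ev s)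
      (X ≫ D.resMor (Prod.sectL B s ⋙ Ξ)) :=
    (IsoMor.assoc _ _ _).trans (((IsoMor.assoc _ _ _).trans
      (((D.curryMor_ev B s).left _).trans (D.resMor_comp _ _))).left _)
  refine ((key _).symm.right _).trans (IsoMor.trans ?_ (key _))
  refine comp_shift_suspension _ fun a Y k b => ?_
  obtain ⟨e⟩ := sectR_curryMor Ξ k b ((fn X a).obj Y)
  have := h a Y k b
  exact ⟨this.isCocartesian.ofIso e.symm, this.isZero₁₀.of_iso ((D.eval _).mapIso e),
    this.isZero₀₁.of_iso ((D.eval _).mapIso e)⟩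

end

end Prederivator

/-! ### Explicit squares -/

/-- The points of `SourceZeros` below `(5, 5, 5)`. -/
def smallPts : List (ℤ × ℤ × ℤ) :=
  [(0, 0, 0), (1, 0, 0), (0, 1, 0), (0, 0, 1), (0, 2, 1), (2, 1, 0), (1, 0, 2), (1, 3, 2),
    (3, 2, 1), (2, 1, 3), (2, 4, 3), (4, 3, 2), (3, 2, 4), (3, 5, 4), (5, 4, 3), (4, 3, 5)]

/-- The bound (5, 5, 5) leaves finitely many points of `SourceZeros`, so the pushout conditions for
the explicit squares below become decidable. It is large enough for the source translated by 3. -/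
lemma mem_smallPts {x : ℤ × ℤ × ℤ} (hx : x ∈ SourceZeros) (h : x ≤ (5, 5, 5)) : x ∈ smallPts := by
  rcases hx with hx | ⟨hx, h₀⟩
  · rcases hx with rfl | rfl | rfl | rfl <;> decide
  · obtain ⟨i, n, rfl⟩ := exists_linkPt hx
    have h₀' : ((0 : ℤ), (0 : ℤ), (0 : ℤ)) ≤ linkPt i n := h₀
    -- The coordinates of a link point range from n to n + 2.
    have hn : 0 ≤ n ∧ n ≤ 3 := by
      fin_cases i <;> simp [Prod.mk_le_mk] at h h₀' <;> omega
    obtain ⟨h₁, h₂⟩ := hn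
    interval_cases n <;> fin_cases i <;> decide

/-- The square with the given vertices is a pushout in diagrams left extended from
`SourceZeros`. -/
def IsPushoutSq (a b c d : ℤ × ℤ × ℤ) : Prop :=
  0 ≤ a ∧ a ≤ b ∧ a ≤ c ∧ b ≤ d ∧ c ≤ d ∧ d ≤ (5, 5, 5) ∧
    ∀ x ∈ smallPts, (x ≤ d → x ≤ b ∨ x ≤ c) ∧ (x ≤ b → x ≤ c → x ≤ a)

instance (a b c d : ℤ × ℤ × ℤ) : Decidable (IsPushoutSq a b c d) :=
  inferInstanceAs (Decidable (_ ∧ _))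

/-- A test for being a point of `C`. -/
def IsPoint (x : ℤ × ℤ × ℤ) : Prop :=
  (∃ n ∈ [x.1, x.1 - 1], (x.1 = n ∨ x.1 = n + 1) ∧ (x.2.1 = n ∨ x.2.1 = n + 1) ∧
    (x.2.2 = n ∨ x.2.2 = n + 1)) ∨ ∃ i, ∃ n ∈ [x.1, x.1 - 1, x.1 - 2], x = linkPt i n

instance (x : ℤ × ℤ × ℤ) : Decidable (IsPoint x) := inferInstanceAs (Decidable (_ ∨ _))

lemma IsPoint.mem {x : ℤ × ℤ × ℤ} (h : IsPoint x) : x ∈ CPts := by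
  rcases h with ⟨n, -, h₁, h₂, h₃⟩ | ⟨i, n, -, rfl⟩
  · exact Or.inl (mk_mem_cubePoints h₁ h₂ h₃)
  · exact Or.inr (linkPt_mem i n)

/-- The square in a preorder with the given vertices. -/
def sqMap {P : Type} (a b c d : P) (s : Sq) : P :=
  if s = (0, 0) then a else if s = (1, 0) then b else if s = (0, 1) then c else d

lemma sqMap_monotone {P : Type} [Preorder P] {a b c d : P} (h₁ : a ≤ b) (h₂ : a ≤ c) (h₃ : b ≤ d)
    (h₄ : c ≤ d) : Monotone (sqMap a b c d) := by
  intro s t hst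
  rcases sq_cases s with rfl | rfl | rfl | rfl <;> rcases sq_cases t with rfl | rfl | rfl | rfl <;>
    first
    | exact absurd hst (by decide)
    | exact le_rfl
    | assumption
    | exact h₁.trans h₃

/-! ### Suspensions read off from squares in C. -/

namespace Prederivator

open CatTrans

variable {D E : Prederivator.{w, v, u}} [D.IsStable]

/-- The nonnegative part of an exact diagram is left extended from `SourceZeros`. So every square
that satisfies the order conditions is cocartesian, and no decomposition into small squares is
required. -/
theorem IsExactDiagram.isCocartesian_of_isPushoutSq {Z : D.Diag (Shape.{w} CPts)}
    (h : D.IsExactDiagram Z) (k : Sq → CPts) (hk : Monotone k)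
    (hs : IsPushoutSq (k (0, 0)).1 (k (1, 0)).1 (k (0, 1)).1 (k (1, 1)).1) :
    D.IsCocartesian ((D.res (Shape.map k hk)).obj Z) := by
  obtain ⟨h₀, -, -, -, -, h₁, h₂⟩ := hs
  let k' : Sq → CNonneg := fun s => ⟨(k s).1, (k s).2, h₀.trans (hk (by
    exact ⟨Fin.zero_le _, Fin.zero_le _⟩))⟩
  have hle (s : Sq) : (k s).1 ≤ (k (1, 1)).1 := hk ⟨Fin.le_last _, Fin.le_last _⟩
  have hk' : IsPushoutFor (Set.inclusion sourceZeros_subset) k' :=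
    ⟨hk, fun a ha => (h₂ a.1 (mem_smallPts a.2 (le_trans ha h₁))).1 ha, fun a hb hc =>
      (h₂ a.1 (mem_smallPts a.2 (le_trans (le_trans hb (hle _)) h₁))).2 hb hc⟩
  have := h.isKanDiagram.lExt_nonneg.isCocartesian hk'
  exact (isCocartesian_res_iff (k := Set.inclusion Set.subset_union_left ∘ k')
      (f := Set.inclusion cNonnegZeros_subset) _ _ _).1 ((isCocartesian_res_iff _ _ _).1 this)

lemma ptProp_exIncl (D : Prederivator.{w, v, u}) [D.IsStable] : PtProp D.exIncl D.IsExactDiagram :=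
  fun _ Y k => Y.2 k

/-- A pushout square in `C` with zeros at two opposite vertices computes the suspension. -/
theorem exEv_suspension (k : Sq → CPts) (hk : Monotone k) (h₁₀ : (k (1, 0)).1 ∈ linkPoints)
    (h₀₁ : (k (0, 1)).1 ∈ linkPoints)
    (h : IsPushoutSq (k (0, 0)).1 (k (1, 0)).1 (k (0, 1)).1 (k (1, 1)).1) :
    IsoMor (D.exEv (k (0, 0)) ≫ D.suspension) (D.exEv (k (1, 1))) := by
  have key (s : Sq) : IsoMor ((D.exIncl ≫ D.resMor (Shape.map k hk)) ≫ D.ev (ULift.up s))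
      (D.exEv (k s)) := (IsoMor.assoc _ _ _).trans ((D.resMor_ev _ _).left _)
  refine ((key _).symm.right _).trans (IsoMor.trans ?_ (key _))
  refine comp_suspension _ ((ptProp_exIncl D).resMor _ fun M hM N ⟨e⟩ => ⟨?_, ?_, ?_⟩)
  · exact (hM.isCocartesian_of_isPushoutSq k hk h).ofIso e
  · exact ((isZero_eval_res_iff (Shape.map k hk) (ULift.up (1, 0)) M).2
      (hM.isZero_linkPt h₁₀ _)).of_iso ((D.eval _).mapIso e.symm)
  · exact ((isZero_eval_res_iff (Shape.map k hk) (ULift.up (0, 1)) M).2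
      (hM.isZero_linkPt h₀₁ _)).of_iso ((D.eval _).mapIso e.symm)

lemma sqMap_val (a b c d : CPts) (s : Sq) : (sqMap a b c d s).1 = sqMap a.1 b.1 c.1 d.1 s := by
  rcases sq_cases s with rfl | rfl | rfl | rfl <;> rfl

/-- The square from 100 to 212 through the zeros 210 and 102. The next two lemmas use its images
under the rotation. -/
lemma exEv_suspension₁ (D : Prederivator.{w, v, u}) [D.IsStable] :
    IsoMor (D.exEv (cubePt 0 1 0 0) ≫ D.suspension) (D.exEv (cubePt 1 1 0 1)) :=
  exEv_suspension (sqMap (cubePt 0 1 0 0) ⟨(2, 1, 0), Or.inr ⟨0, by simp⟩⟩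
    ⟨(1, 0, 2), Or.inr ⟨0, by simp⟩⟩ (cubePt 1 1 0 1))
    (sqMap_monotone (by decide) (by decide) (by decide) (by decide)) ⟨0, by simp [sqMap]⟩
    ⟨0, by simp [sqMap]⟩ (by simp only [sqMap_val]; decide)

lemma exEv_suspension₂ (D : Prederivator.{w, v, u}) [D.IsStable] :
    IsoMor (D.exEv (cubePt 0 0 1 0) ≫ D.suspension) (D.exEv (cubePt 1 1 1 0)) :=
  exEv_suspension (sqMap (cubePt 0 0 1 0) ⟨(0, 2, 1), Or.inr ⟨0, by simp⟩⟩
    ⟨(2, 1, 0), Or.inr ⟨0, by simp⟩⟩ (cubePt 1 1 1 0))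
    (sqMap_monotone (by decide) (by decide) (by decide) (by decide)) ⟨0, by simp [sqMap]⟩
    ⟨0, by simp [sqMap]⟩ (by simp only [sqMap_val]; decide)

lemma exEv_suspension₃ (D : Prederivator.{w, v, u}) [D.IsStable] :
    IsoMor (D.exEv (cubePt 0 0 0 1) ≫ D.suspension) (D.exEv (cubePt 1 0 1 1)) :=
  exEv_suspension (sqMap (cubePt 0 0 0 1) ⟨(1, 0, 2), Or.inr ⟨0, by simp⟩⟩
    ⟨(0, 2, 1), Or.inr ⟨0, by simp⟩⟩ (cubePt 1 0 1 1))
    (sqMap_monotone (by decide) (by decide) (by decide) (by decide)) ⟨0, by simp [sqMap]⟩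
    ⟨0, by simp [sqMap]⟩ (by simp only [sqMap_val]; decide)

end Prederivator

/-! ### The table of the double suspension -/

/-- The shape of the table: cofibre direction, suspension direction. -/
abbrev Table : Type := (Fin 3 × Fin 2) × Sq

/-- The part of the table that is given by points of `C`. -/
abbrev TableBase : Type := {q : Table // q.1 = (0, 0) → q.2 = (0, 0)}

/-- The points of `C` in the table, for the objects of the source in the order `000`, `100`, `010`,
`001`. -/
def tablePt (s : Fin 4) (q : Table) : ℤ × ℤ × ℤ :=
  match q.1 with
  | (0, 0) => ![(0, 0, 0), (1, 0, 0), (0, 1, 0), (0, 0, 1)] s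
  | (1, 0) => sqMap (![(0, 1, 0), (1, 1, 0), (0, 1, 0), (0, 1, 1)] s)
      (![(2, 1, 0), (2, 1, 0), (2, 1, 0), (2, 1, 3)] s)
      (![(0, 2, 1), (1, 3, 2), (0, 2, 1), (0, 2, 1)] s)
      (![(2, 2, 1), (2, 3, 2), (2, 2, 1), (2, 2, 3)] s) q.2
  | (0, 1) => if s = 2 then sqMap (1, 3, 2) (2, 4, 3) (1, 3, 2) (2, 4, 3) q.2 else (1, 0, 2)
  | (1, 1) => if s = 2 then sqMap (1, 3, 2) (2, 4, 3) (1, 3, 2) (2, 4, 3) q.2 else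
      sqMap (1, 1, 2) (2, 1, 3) (1, 3, 2) (2, 3, 3) q.2
  | (2, 0) => ![(3, 2, 1), (4, 3, 2), (3, 2, 1), (3, 2, 4)] s
  | (2, 1) => ![(3, 3, 3), (4, 3, 3), (3, 4, 3), (3, 3, 4)] s

/-- The number of an object of the source. -/
def sourceIdx (s : SourcePts) : Fin 4 :=
  if s.1 = (0, 0, 0) then 0 else if s.1 = (1, 0, 0) then 1 else if s.1 = (0, 1, 0) then 2 else 3

lemma sourceIdx_of_le {s t : SourcePts} (h : s ≤ t) :
    sourceIdx s = 0 ∨ sourceIdx s = sourceIdx t := by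
  obtain ⟨s, rfl | rfl | rfl | rfl⟩ := s <;> obtain ⟨t, rfl | rfl | rfl | rfl⟩ := t <;>
    first
    | exact Or.inl rfl
    | exact Or.inr rfl
    | (exfalso
       have h' : (_ : ℤ × ℤ × ℤ) ≤ _ := h
       simp [Prod.mk_le_mk] at h')

lemma tablePt_isPoint : ∀ s q, IsPoint (tablePt s q) := by decide +kernel
lemma tablePt_le_left : ∀ s q, tablePt 0 q ≤ tablePt s q := by decide +kernel
lemma tablePt_le_right : ∀ s q q', q ≤ q' → tablePt s q ≤ tablePt s q' := by decide +kernel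
-- The third entry is a zero of C, so the row is a cofibre sequence that starts with Y_s ⟶ Y_t,
-- where t is the join of s and 010. For s = 010 this map is an identity and the cofibre is a link
-- point; the table stays monotone in s.
lemma tablePt_row : ∀ s, IsPushoutSq (tablePt s ((0, 0), (0, 0))) (tablePt s ((1, 0), (0, 0)))
  (tablePt s ((0, 1), (0, 0))) (tablePt s ((1, 1), (0, 0))) := by decide +kernel
-- The second and third terms of the cofibre sequence have suspensions in C, and the zero is
-- suspended trivially. The column of Y_s itself is left open, to be filled in by fibres.
lemma tablePt_col : ∀ s c, c ∈ [((1 : Fin 3), (0 : Fin 2)), (0, 1), (1, 1)] → 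
  IsPushoutSq (tablePt s (c, (0, 0))) (tablePt s (c, (1, 0)))
  (tablePt s (c, (0, 1))) (tablePt s (c, (1, 1))) := by decide +kernel
-- This square continues the suspended cofibre sequence by one step and ends at the point s
-- translated by 3.
lemma tablePt_last : ∀ s, IsPushoutSq (tablePt s ((1, 0), (1, 1))) (tablePt s ((2, 0), (1, 1)))
  (tablePt s ((1, 1), (1, 1))) (tablePt s ((2, 1), (1, 1))) := by decide +kernel

namespace Prederivator

open CatTrans

variable {D E : Prederivator.{w, v, u}} [D.IsStable]

lemma isCartesian_res_iff {P Q : Type} [Preorder P] [Preorder Q] {k : Sq → P} (hk : Monotone k)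
    {f : P → Q} (hf : Monotone f) (X : D.Diag (Shape.{w} Q)) :
    D.IsCartesian ((D.res (Shape.map k hk)).obj ((D.res (Shape.map f hf)).obj X)) ↔
      D.IsCartesian ((D.res (Shape.map (f ∘ k) (hf.comp hk))).obj X) := by
  have e := (D.resComp (Shape.map k hk) (Shape.map f hf)).app X
  exact ⟨fun h => h.ofIso e.symm, fun h => h.ofIso e⟩

/-- The front square of a square of squares is cartesian if all other squares are. -/
theorem isCartesian_front (N : D.Diag (Shape.{w} (Sq × Sq)))
    (h₁ : ∀ (d : Sq) (hd : Monotone fun c : Sq => (c, d)),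
      D.IsCartesian ((D.res (Shape.map (fun c : Sq => (c, d)) hd)).obj N))
    (h₂ : ∀ (c : Sq) (hc : Monotone fun d : Sq => (c, d)), c ≠ (0, 0) →
      D.IsCartesian ((D.res (Shape.map (fun d : Sq => (c, d)) hc)).obj N))
    (hm : Monotone fun d : Sq => (((0, 0) : Sq), d)) :
    D.IsCartesian ((D.res (Shape.map (fun d : Sq => (((0, 0) : Sq), d)) hm)).obj N) := by
  let u : Cospan × Cospan → Sq × Sq := fun x => (x.1.1, x.2.1)
  have hu : Monotone u := fun x y h => ⟨h.1, h.2⟩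
  have hc (c : Sq) : Monotone fun d : Sq => (c, d) := fun x y h => ⟨le_rfl, h⟩
  have hd (d : Sq) : Monotone fun c : Sq => (c, d) := fun x y h => ⟨h, le_rfl⟩
  have pd (d : Sq) : IsPullbackFor u fun c : Sq => (c, d) :=
    ⟨hd d, by revert d; decide, by revert d; decide⟩
  have pc (c : Sq) : IsPullbackFor u fun d : Sq => (c, d) :=
    ⟨hc c, by revert c; decide, by revert c; decide⟩
  -- N is right extended from the product of two cospans: pullbacks in the columns with c ≠ (0,0)
  -- come first, then pullbacks in all rows. For such diagrams every column is a pullback, the front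
  -- one included.
  have key : D.RExt (Shape.map u hu) N := by
    refine RExt.of_generation hu (fun _ _ h => h) N fun S hS _ hk => ?_
    have s₁ (c d : Sq) (h : c ≠ (0, 0)) (h' : d ≠ (0, 0)) : (c, d) ∈ S := hS (⟨c, h⟩, ⟨d, h'⟩)
    have s₂ (c d : Sq) (h : c ≠ (0, 0)) : (c, d) ∈ S := by
      by_cases h' : d = (0, 0)
      · subst h'
        exact hk _ (pc c) (h₂ c _ h) (s₁ _ _ h (by decide)) (s₁ _ _ h (by decide))
          (s₁ _ _ h (by decide))
      · exact s₁ c d h h'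
    rintro ⟨c, d⟩
    by_cases h : c = (0, 0)
    · subst h
      exact hk _ (pd d) (h₁ d _) (s₂ _ _ (by decide)) (s₂ _ _ (by decide)) (s₂ _ _ (by decide))
    · exact s₂ c d h
  exact key.isCartesian (pc (0, 0))

/-- Cartesian squares can be pasted. -/
theorem isCartesian_paste (N : D.Diag (Shape.{w} (Fin 3 × Fin 2)))
    (m₁ : Monotone fun s : Sq => (s.1.castSucc, s.2)) (m₂ : Monotone fun s : Sq => (s.1.succ, s.2))
    (m : Monotone fun s : Sq => (((2 : Fin 3) * s.1.castSucc, s.2) : Fin 3 × Fin 2))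
    (h₁ : D.IsCartesian ((D.res (Shape.map _ m₁)).obj N))
    (h₂ : D.IsCartesian ((D.res (Shape.map _ m₂)).obj N)) :
    D.IsCartesian ((D.res (Shape.map _ m)).obj N) := by
  -- The diagram is right extended from its bottom row and its upper right corner, and the outer
  -- rectangle is a pullback for such diagrams. The factor 2 in `m` skips the middle column.
  let u : {x : Fin 3 × Fin 2 // x.2 = 1 ∨ x = (2, 0)} → Fin 3 × Fin 2 := Subtype.val
  have hu : Monotone u := fun x y h => h
  have key : D.RExt (Shape.map u hu) N := by
    refine RExt.of_generation hu (fun _ _ h => h) N fun S hS _ hk => ?_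
    have s₁ (c : Fin 3) : (c, 1) ∈ S := hS ⟨(c, 1), Or.inl rfl⟩
    have s₂ : (2, 0) ∈ S := hS ⟨(2, 0), Or.inr rfl⟩
    have s₃ : (1, 0) ∈ S := hk _ ⟨m₂, by decide, by decide⟩ h₂ (s₁ _) s₂ (s₁ _)
    have s₄ : (0, 0) ∈ S := hk _ ⟨m₁, by decide, by decide⟩ h₁ (s₁ _) s₃ (s₁ _)
    rintro ⟨c, d⟩
    fin_cases c <;> fin_cases d <;> first | exact s₁ _ | assumption
  exact key.isCartesian ⟨m, by decide, by decide⟩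

end Prederivator

/-- The table as a map to `C`. -/
def tableFun (s : SourcePts) (q : Table) : CPts :=
  ⟨tablePt (sourceIdx s) q, (tablePt_isPoint _ _).mem⟩

lemma tableFun_mono (s s' : SourcePts) (q q' : Table) (h : s ≤ s') (h' : q ≤ q') :
    tableFun s q ≤ tableFun s' q' := by
  refine (tablePt_le_right _ _ _ h').trans ?_
  rcases sourceIdx_of_le h with h | h
  · rw [h]
    exact tablePt_le_left _ _
  · rw [h]
    exact le_rfl

/-- The inclusion of the base of the table. -/
abbrev baseIncl : Shape.{w} TableBase ⥤ Shape.{w} Table := Shape.map Subtype.val fun _ _ h => h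

instance : (baseIncl.{w}).Full := Shape.map_full _ fun _ _ h => h

/-- The square of the table in suspension direction at the fibre. -/
abbrev fibreSq (d : Sq) : Table := ((0, 0), d)

/-- The square of the table that computes the second suspension. -/
abbrev outerSq (s : Sq) : Table := (((2 : Fin 3) * s.1.castSucc, s.2), (1, 1))

lemma fibreSq_monotone : Monotone fibreSq := fun _ _ h => ⟨le_rfl, h⟩

lemma outerSq_monotone : Monotone outerSq := by
  intro x y
  revert x y
  decide

lemma isLink_of_check {x : ℤ × ℤ × ℤ} (h : ∃ i, ∃ n ∈ [x.1, x.1 - 1, x.1 - 2], x = linkPt i n) :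
    x ∈ linkPoints := by
  obtain ⟨i, n, -, h⟩ := h
  exact h ▸ linkPt_mem i n

lemma tablePt_link (s : Fin 4) (q : Table) (h : q ∈ [((((1 : Fin 3), (0 : Fin 2)), ((1 : Fin 2), (0 : Fin 2))) : Table),
    ((0, 1), (1, 0)), ((1, 1), (1, 0)), ((1, 0), (0, 1)), ((0, 1), (0, 1)), ((1, 1), (0, 1)),
    ((0, 1), (1, 1)), ((2, 0), (1, 1))]) : tablePt s q ∈ linkPoints := by
  have : ∀ s : Fin 4, ∀ q ∈ [((((1 : Fin 3), (0 : Fin 2)), ((1 : Fin 2), (0 : Fin 2))) : Table),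
    ((0, 1), (1, 0)), ((1, 1), (1, 0)), ((1, 0), (0, 1)), ((0, 1), (0, 1)), ((1, 1), (0, 1)),
    ((0, 1), (1, 1)), ((2, 0), (1, 1))], ∃ i, ∃ n ∈ [(tablePt s q).1, (tablePt s q).1 - 1,
      (tablePt s q).1 - 2], tablePt s q = linkPt i n := by decide +kernel
  exact isLink_of_check (this s q h)

namespace Prederivator

open CatTrans

variable {D E : Prederivator.{w, v, u}} [D.IsStable]

/-- The right extension fills the open column with fibres. That column is then cartesian as a limit
of cartesian columns, and its off-diagonal entries are fibres of maps between zeros: it exhibits the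
suspension of Y_s. In the slice d = (1,1), pasting the fibre square with the last square of the
table exhibits the second suspension. -/
lemma table_squares (s : SourcePts) {Z : D.Diag (Shape.{w} CPts)} (hZ : D.IsExactDiagram Z)
    (M : D.Diag (Shape.{w} Table)) (hM : D.RExt baseIncl M)
    (hf : Monotone fun q : TableBase => tableFun s q.1)
    (e : (D.res baseIncl).obj M ≅ (D.res (Shape.map (fun q : TableBase => tableFun s q.1) hf)).obj Z) :
    IsSuspSq D ((D.res (Shape.map fibreSq fibreSq_monotone)).obj M) ∧
      IsSuspSq D ((D.res (Shape.map outerSq outerSq_monotone)).obj M) := by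
  have base (k : Sq → Table) (hk : Monotone k) (hb : ∀ t, (k t).1 = (0, 0) → (k t).2 = (0, 0))
      (h : IsPushoutSq (tablePt (sourceIdx s) (k (0, 0))) (tablePt (sourceIdx s) (k (1, 0)))
        (tablePt (sourceIdx s) (k (0, 1))) (tablePt (sourceIdx s) (k (1, 1)))) :
      D.IsCartesian ((D.res (Shape.map k hk)).obj M) := by
    let k' : Sq → TableBase := fun t => ⟨k t, hb t⟩
    have h₁ := hZ.isCocartesian_of_isPushoutSq (fun t => tableFun s (k t)) (hf.comp (f := k') hk) h
    have h₂ := (isCocartesian_res_iff (k := k') hk hf Z).2 h₁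
    have h₃ := h₂.ofIso ((D.res (Shape.map k' hk)).mapIso e.symm)
    have h₄ := (isCocartesian_res_iff (k := k') hk (f := Subtype.val) (fun _ _ h => h) M).1 h₃
    exact (IsStable.isCocartesian_iff_isCartesian _).1 h₄
  have zero (q : Table) (hq : q.1 = (0, 0) → q.2 = (0, 0))
      (hl : tablePt (sourceIdx s) q ∈ linkPoints) :
      Limits.IsZero ((D.eval (ULift.up.{w} q)).obj M) := by
    have h₁ := (isZero_eval_res_iff (Shape.map (fun q : TableBase => tableFun s q.1) hf)
      (ULift.up ⟨q, hq⟩) Z).2 (hZ.isZero_linkPt hl _)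
    exact (isZero_eval_res_iff baseIncl (ULift.up ⟨q, hq⟩) M).1
      (h₁.of_iso ((D.eval _).mapIso e))
  have hc₁ (d : Sq) : Monotone fun c : Sq => (((c.1.castSucc, c.2), d) : Table) :=
    fun x y h => ⟨h, le_rfl⟩
  have hd₁ (c : Fin 3 × Fin 2) : Monotone fun d : Sq => ((c, d) : Table) :=
    fun x y h => ⟨le_rfl, h⟩
  -- For d = (0,0) this is a row of points of C. For the other d, the vertex ((0,0), d) is missing
  -- from the base, and the right extension makes it the pullback of the remaining three.
  have fib (d : Sq) : D.IsCartesian ((D.res (Shape.map _ (hc₁ d))).obj M) := by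
    by_cases hd : d = (0, 0)
    · subst hd
      exact base _ _ (fun _ _ => rfl) (tablePt_row _)
    · refine hM.isCartesian ⟨hc₁ d, ?_, ?_⟩
      · revert d; decide
      · revert d; decide
  have col (c : Fin 3 × Fin 2) (hc : c ∈ [((1 : Fin 3), (0 : Fin 2)), (0, 1), (1, 1)]) :
      D.IsCartesian ((D.res (Shape.map _ (hd₁ c))).obj M) :=
    base _ _ (fun t h => by
      change c = (0, 0) at h
      subst h
      exact absurd hc (by decide)) (tablePt_col _ _ hc)
  have hφ : Monotone fun x : Sq × Sq => (((x.1.1.castSucc, x.1.2), x.2) : Table) :=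
    fun x y h => h
  -- The three other columns are cartesian in C and all rows are cartesian by `fib`.
  have front : D.IsCartesian ((D.res (Shape.map fibreSq fibreSq_monotone)).obj M) := by
    refine (isCartesian_res_iff (k := fun d : Sq => (((0, 0) : Sq), d))
      (fun x y h => Prod.mk_le_mk.2 ⟨le_rfl, h⟩) hφ M).1 (isCartesian_front _ (fun d hd => ?_) (fun c hc hc' => ?_) _)
    · exact (isCartesian_res_iff hd hφ M).2 (fib d)
    · refine (isCartesian_res_iff hc hφ M).2 (col (c.1.castSucc, c.2) ?_)
      revert hc'
      clear hc
      revert c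
      decide
  have hψ : Monotone fun x : Fin 3 × Fin 2 => ((x, (1, 1)) : Table) := fun x y h => ⟨h, le_rfl⟩
  -- Paste the fibre square over d = (1,1) with the square of `tablePt_last`.
  have outer : D.IsCartesian ((D.res (Shape.map outerSq outerSq_monotone)).obj M) := by
    refine (isCartesian_res_iff (by decide) hψ M).1 (isCartesian_paste _ (by decide) (by decide)
      (by decide) ?_ ?_)
    · exact (isCartesian_res_iff (by decide) hψ M).2 (fib (1, 1))
    · refine (isCartesian_res_iff (by decide) hψ M).2 (base _ _ ?_ (tablePt_last _))
      decide
  have zfib (d : Sq) (h₁ : Limits.IsZero ((D.eval (ULift.up.{w} ((1, 0), d))).obj M))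
      (h₂ : Limits.IsZero ((D.eval (ULift.up.{w} ((0, 1), d))).obj M))
      (h₃ : Limits.IsZero ((D.eval (ULift.up.{w} ((1, 1), d))).obj M)) :
      Limits.IsZero ((D.eval (ULift.up.{w} (((0, 0), d) : Table))).obj M) :=
    (isZero_eval_res_iff (Shape.map _ (hc₁ d)) (ULift.up (0, 0)) M).1
      (isZero_of_isCartesian (fib d)
        ((isZero_eval_res_iff (Shape.map _ (hc₁ d)) (ULift.up (1, 0)) M).2 h₁)
        ((isZero_eval_res_iff (Shape.map _ (hc₁ d)) (ULift.up (0, 1)) M).2 h₂)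
        ((isZero_eval_res_iff (Shape.map _ (hc₁ d)) (ULift.up (1, 1)) M).2 h₃))
  have zl (q : Table) (hq : q.1 = (0, 0) → q.2 = (0, 0)) (h) := zero q hq (tablePt_link _ q h)
  refine ⟨⟨(IsStable.isCocartesian_iff_isCartesian _).2 front, ?_, ?_⟩,
    (IsStable.isCocartesian_iff_isCartesian _).2 outer, ?_, ?_⟩
  · exact (isZero_eval_res_iff _ (ULift.up (1, 0)) M).2 (zfib (1, 0)
      (zl _ (by decide) (by decide)) (zl _ (by decide) (by decide)) (zl _ (by decide) (by decide)))
  · exact (isZero_eval_res_iff _ (ULift.up (0, 1)) M).2 (zfib (0, 1)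
      (zl _ (by decide) (by decide)) (zl _ (by decide) (by decide)) (zl _ (by decide) (by decide)))
  · exact (isZero_eval_res_iff _ (ULift.up (1, 0)) M).2 (zl _ (by decide) (by decide))
  · exact (isZero_eval_res_iff _ (ULift.up (0, 1)) M).2 (zl _ (by decide) (by decide))

end Prederivator

/-! ### The square of the suspension. -/

namespace Prederivator

open CatTrans

variable {D E : Prederivator.{w, v, u}} {A B K : Type w} [SmallCategory A] [SmallCategory B]
  [SmallCategory K]

lemma Shape.functor_ext {P : Type} [Preorder P] {F G : A ⥤ Shape.{w} P}
    (h : ∀ x, F.obj x = G.obj x) : F = G :=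
  CategoryTheory.Functor.ext h fun _ _ _ => Subsingleton.elim _ _

/-- Restriction to `{k} × A` after restriction along `K × f`. -/
def sectRRes (f : A ⥤ B) (k : K) (M : D.Diag (K × B)) :
    (D.res (Prod.sectR k A)).obj ((D.res ((𝟭 K).prod f)).obj M) ≅
      (D.res f).obj ((D.res (Prod.sectR k B)).obj M) :=
  (D.cmp _ _ M).symm ≪≫ (D.resIso (NatIso.ofComponents (F := Prod.sectR k A ⋙ (𝟭 K).prod f)
    (G := f ⋙ Prod.sectR k B) (fun _ => Iso.refl _)
    (fun _ => (Category.comp_id _).trans (Category.id_comp _).symm))).app M ≪≫ D.cmp _ _ M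

lemma IsSuspSq.of_iso [D.IsDerivator] {M N : D.Diag (Shape.{w} Sq)} (h : IsSuspSq D M) (e : M ≅ N) :
    IsSuspSq D N :=
  ⟨h.isCocartesian.ofIso e, h.isZero₁₀.of_iso ((D.eval _).mapIso e.symm),
    h.isZero₀₁.of_iso ((D.eval _).mapIso e.symm)⟩

/-- The base of the table as a family of diagrams in `C`. -/
noncomputable def tableFunctor : Source.{w} × Shape.{w} TableBase ⥤ Shape.{w} CPts :=
  Shape.map₂ (fun s q => tableFun s q.1) fun s s' q q' h h' => tableFun_mono s s' q.1 q'.1 h h'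

variable [D.IsStable]

/-- The table of the double suspension. -/
noncomputable def tableMor (D : Prederivator.{w, v, u}) [D.IsStable] :
    D.ex ⟶ D.shift (Source.{w} × Shape.{w} Table) :=
  (D.exIncl ≫ D.resMor tableFunctor) ≫ D.ranMor ((𝟭 Source.{w}).prod baseIncl)

lemma tableMor_resMor : IsoMor (D.tableMor ≫ D.resMor ((𝟭 Source.{w}).prod baseIncl))
    (D.exIncl ≫ D.resMor tableFunctor) :=
  (IsoMor.assoc _ _ _).trans (((ranMor_resMor D _).left _).trans (IsoMor.comp_id _))

/-- Over the base, the table of a value is an exact diagram restricted along `tableFunctor`;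
elsewhere it is right extended. So `table_squares` applies at each object of the source. -/
lemma ptProp_tableMor : PtProp D.tableMor fun M => ∀ s : Source.{w},
    IsSuspSq D ((D.res (Shape.map fibreSq fibreSq_monotone)).obj
      ((D.res (Prod.sectR s (Shape.{w} Table))).obj M)) ∧
    IsSuspSq D ((D.res (Shape.map outerSq outerSq_monotone)).obj
      ((D.res (Prod.sectR s (Shape.{w} Table))).obj M)) := by
  have h₁ : PtProp D.tableMor (D.RExt ((𝟭 Source.{w}).prod baseIncl)) :=
    (ptProp_ranMor D _).comp_left _
  have h₂ : PtProp D.tableMor fun M => ∃ Z, D.IsExactDiagram Z ∧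
      Nonempty ((D.res tableFunctor).obj Z ≅ (D.res ((𝟭 Source.{w}).prod baseIncl)).obj M) := by
    refine PtProp.of_resMor (f := (𝟭 Source.{w}).prod baseIncl)
      (p := fun N => ∃ Z, D.IsExactDiagram Z ∧ Nonempty ((D.res tableFunctor).obj Z ≅ N)) ?_ ?_
    · refine PtProp.of_isoMor (X := D.exIncl ≫ D.resMor tableFunctor) ?_ tableMor_resMor.symm ?_
      · exact (ptProp_exIncl D).resMor _ fun M hM N e => ⟨M, hM, e⟩
      · rintro M N ⟨e⟩ ⟨Z, hZ, ⟨e'⟩⟩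
        exact ⟨Z, hZ, ⟨e' ≪≫ e⟩⟩
    · rintro M ⟨N, ⟨Z, hZ, ⟨e⟩⟩, ⟨e'⟩⟩
      exact ⟨Z, hZ, ⟨e ≪≫ e'⟩⟩
  refine (h₁.and h₂).imp ?_
  rintro M ⟨hM, Z, hZ, ⟨e⟩⟩ s
  refine table_squares s.down hZ _ ((rExt_id_prod_iff _ _).1 hM s)
    (fun q q' h => tableFun_mono _ _ _ _ le_rfl h) ?_
  exact (sectRRes baseIncl s M).symm ≪≫ (D.res (Prod.sectR s _)).mapIso e.symm ≪≫
    (D.cmp (Prod.sectR s _) tableFunctor Z).symm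

lemma tableMor_suspension (k : Sq → Table) (hk : Monotone k)
    (h : PtProp D.tableMor fun M => ∀ s : Source.{w}, IsSuspSq D ((D.res (Shape.map k hk)).obj
      ((D.res (Prod.sectR s (Shape.{w} Table))).obj M))) :
    IsoMor ((D.tableMor ≫ D.resMor (Prod.sectL Source.{w} (ULift.up (k (0, 0))))) ≫
      (D.shift Source.{w}).suspension)
      (D.tableMor ≫ D.resMor (Prod.sectL Source.{w} (ULift.up (k (1, 1))))) := by
  refine resMor_shift_suspension D.tableMor ((𝟭 Source.{w}).prod (Shape.map k hk))
    (h.imp fun M hM s => (hM s).of_iso ?_)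
  exact (sectRRes (Shape.map k hk) s M).symm ≪≫ (D.cmp _ _ M).symm

lemma tableMor_base (q : TableBase) : IsoMor
    (D.tableMor ≫ D.resMor (Prod.sectL Source.{w} (ULift.up q.1)))
    (D.exIncl ≫ D.resMor (Prod.sectL Source.{w} (ULift.up q) ⋙ tableFunctor)) := by
  have h := (D.resMor_comp (Prod.sectL Source.{w} (ULift.up.{w} q))
    ((𝟭 Source.{w}).prod baseIncl)).left D.tableMor
  refine h.symm.trans ((IsoMor.assoc' _ _ _).trans ((tableMor_resMor.right _).trans
    ((IsoMor.assoc _ _ _).trans ((D.resMor_comp _ _).left _))))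

lemma exRes_iStar (f : CPts → CPts) (hf : IsExactMap f) : IsoMor (D.exRes f hf ≫ D.iStar)
    (D.exIncl ≫ D.resMor (Shape.incl sourcePts_subset ⋙ Shape.map f hf.monotone)) :=
  (IsoMor.head₁ (liftSub_comp_ι _ _ _) _).trans
    ((IsoMor.assoc _ _ _).trans ((D.resMor_comp _ _).left _))

/-- The square of the suspension is a translation. -/
theorem suspension_suspension (D : Prederivator.{w, v, u}) [D.IsStable] :
    IsoMor (D.ex.suspension ≫ D.ex.suspension) (D.sh 3) := by
  -- After the equivalence i^*, the two squares of the table compute two successive suspensions,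
  -- because `fibreSq (1, 1)` and `outerSq (0, 0)` are the same entry. The final entry `outerSq (1,
  -- 1)` is the source translated by 3.
  refine IsoMor.cancel_right D.iStar ?_
  have h₁ := tableMor_suspension (D := D) fibreSq fibreSq_monotone
    (ptProp_tableMor.imp fun M h s => (h s).1)
  have h₂ := tableMor_suspension (D := D) outerSq outerSq_monotone
    (ptProp_tableMor.imp fun M h s => (h s).2)
  have h₃ : IsoMor (D.tableMor ≫ D.resMor (Prod.sectL Source.{w} (ULift.up (fibreSq (0, 0)))))
      D.iStar := by
    refine (tableMor_base ⟨fibreSq (0, 0), fun _ => rfl⟩).trans ?_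
    have : Prod.sectL Source.{w} (ULift.up ⟨fibreSq (0, 0), fun _ => rfl⟩) ⋙ tableFunctor =
        Shape.incl sourcePts_subset := by
      refine Shape.functor_ext ?_
      rintro ⟨x, rfl | rfl | rfl | rfl⟩ <;> rfl
    rw [this]
    exact IsoMor.refl _
  have h₄ : IsoMor (D.tableMor ≫ D.resMor (Prod.sectL Source.{w} (ULift.up (outerSq (1, 1)))))
      (D.sh 3 ≫ D.iStar) := by
    refine (tableMor_base ⟨outerSq (1, 1), by decide⟩).trans (IsoMor.trans ?_
      (exRes_iStar (translate 3) (isExactMap_translate 3)).symm)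
    have : Prod.sectL Source.{w} (ULift.up ⟨outerSq (1, 1), by decide⟩) ⋙ tableFunctor =
        Shape.incl sourcePts_subset ⋙ Shape.map (translate 3) (isExactMap_translate 3).monotone := by
      refine Shape.functor_ext ?_
      rintro ⟨x, rfl | rfl | rfl | rfl⟩ <;> rfl
    rw [this]
    exact IsoMor.refl _
  have e := suspension_comp_iStar D
  refine (IsoMor.assoc _ _ _).trans ((e.left _).trans ((e.head _).trans ?_))
  refine (IsoMor.head₁ ((h₃.symm.right _).trans h₁) _).trans (h₂.trans h₄)

end Prederivator

/-! ### Calculus of bicartesian squares. -/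

namespace Prederivator

open CatTrans

section

variable {D E : Prederivator.{w, v, u}} [D.IsDerivator] {A B : Type w} [SmallCategory A]
  [SmallCategory B]

/-- Extension along a fully faithful functor does not change the restriction, so the conditions
collected from earlier extensions persist and one more is added. -/
lemma PtProp.comp_lanMor {X : E ⟶ D.shift A} {p : D.Diag A → Prop} (h : PtProp X p)
    (hp : ∀ M N, Nonempty (M ≅ N) → p M → p N) (f : A ⥤ B) [f.Full] [f.Faithful] :
    PtProp (X ≫ D.lanMor f) fun M => D.LExt f M ∧ p ((D.res f).obj M) := by
  refine PtProp.and ((ptProp_lanMor D f).comp_left X) (PtProp.of_resMor (f := f) (p := p) ?_ ?_)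
  · exact h.of_isoMor ((IsoMor.assoc _ _ _).trans
      (((lanMor_resMor D f).left _).trans (IsoMor.comp_id _))).symm hp
  · rintro M ⟨N, hN, e⟩
    exact hp _ _ e hN

lemma PtProp.comp_ranMor {X : E ⟶ D.shift A} {p : D.Diag A → Prop} (h : PtProp X p)
    (hp : ∀ M N, Nonempty (M ≅ N) → p M → p N) (f : A ⥤ B) [f.Full] [f.Faithful] :
    PtProp (X ≫ D.ranMor f) fun M => D.RExt f M ∧ p ((D.res f).obj M) := by
  refine PtProp.and ((ptProp_ranMor D f).comp_left X) (PtProp.of_resMor (f := f) (p := p) ?_ ?_)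
  · exact h.of_isoMor ((IsoMor.assoc _ _ _).trans
      (((ranMor_resMor D f).left _).trans (IsoMor.comp_id _))).symm hp
  · rintro M ⟨N, hN, e⟩
    exact hp _ _ e hN

end

variable {D : Prederivator.{w, v, u}} [D.IsStable] {P Q : Type} [Preorder P] [Preorder Q]

/-- The square of `M` with the given vertices is bicartesian. -/
def BicartSq (M : D.Diag (Shape.{w} Q)) (a b c d : Q) : Prop :=
  ∃ hk : Monotone (sqMap a b c d), D.IsCocartesian ((D.res (Shape.map _ hk)).obj M)

omit [Preorder P] [Preorder Q] in
lemma comp_sqMap (f : P → Q) (a b c d : P) :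
    f ∘ sqMap a b c d = sqMap (f a) (f b) (f c) (f d) := by
  funext s
  rcases sq_cases s with rfl | rfl | rfl | rfl <;> rfl

variable {M : D.Diag (Shape.{w} Q)}

lemma BicartSq.of_comp {k : Sq → Q} {a b c d : Q} (h : k = sqMap a b c d) {hk : Monotone k}
    (hM : D.IsCocartesian ((D.res (Shape.map k hk)).obj M)) : BicartSq M a b c d := by
  subst h
  exact ⟨hk, hM⟩

lemma BicartSq.of_res {f : P → Q} {hf : Monotone f} {a b c d : P}
    (h : BicartSq ((D.res (Shape.map f hf)).obj M) a b c d) :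
    BicartSq M (f a) (f b) (f c) (f d) := by
  obtain ⟨hk, h⟩ := h
  exact .of_comp (comp_sqMap f a b c d) ((isCocartesian_res_iff _ _ _).1 h)

lemma BicartSq.res {f : P → Q} (hf : Monotone f) {a b c d : P}
    (h : BicartSq M (f a) (f b) (f c) (f d)) (h₁ : a ≤ b) (h₂ : a ≤ c) (h₃ : b ≤ d)
    (h₄ : c ≤ d) : BicartSq ((D.res (Shape.map f hf)).obj M) a b c d := by
  obtain ⟨hk, h⟩ := h
  refine ⟨sqMap_monotone h₁ h₂ h₃ h₄, (isCocartesian_res_iff _ _ _).2 ?_⟩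
  have e := comp_sqMap f a b c d
  have (k : Sq → Q) (hk' : Monotone k) (he : k = sqMap (f a) (f b) (f c) (f d)) :
      D.IsCocartesian ((D.res (Shape.map k hk')).obj M) := by
    subst he
    exact h
  exact this _ _ e

lemma BicartSq.monotone {a b c d : Q} (h : BicartSq M a b c d) :
    a ≤ b ∧ a ≤ c ∧ b ≤ d ∧ c ≤ d := by
  obtain ⟨hk, -⟩ := h
  exact ⟨hk (a := (0, 0)) (b := (1, 0)) (by decide), hk (a := (0, 0)) (b := (0, 1)) (by decide),
    hk (a := (1, 0)) (b := (1, 1)) (by decide), hk (a := (0, 1)) (b := (1, 1)) (by decide)⟩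

lemma BicartSq.of_iso {M' : D.Diag (Shape.{w} Q)} {a b c d : Q} (h : BicartSq M a b c d)
    (e : M ≅ M') : BicartSq M' a b c d :=
  ⟨h.1, h.2.ofIso ((D.res _).mapIso e)⟩

/-- A square that is a pushout for left extensions along `u`. -/
lemma LExt.bicartSq {u : P → Q} {hu : Monotone u} (h : D.LExt (Shape.map u hu) M) {a b c d : Q}
    (hk : Monotone (sqMap a b c d)) (hc : ∀ x, u x ≤ d → u x ≤ b ∨ u x ≤ c)
    (hi : ∀ x, u x ≤ b → u x ≤ c → u x ≤ a) : BicartSq M a b c d :=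
  ⟨hk, h.isCocartesian ⟨hk, hc, hi⟩⟩

/-- A square that is a pullback for right extensions along `u`. -/
lemma RExt.bicartSq {u : P → Q} {hu : Monotone u} (h : D.RExt (Shape.map u hu) M) {a b c d : Q}
    (hk : Monotone (sqMap a b c d)) (hc : ∀ x, a ≤ u x → b ≤ u x ∨ c ≤ u x)
    (hi : ∀ x, b ≤ u x → c ≤ u x → d ≤ u x) : BicartSq M a b c d :=
  ⟨hk, (IsStable.isCocartesian_iff_isCartesian _).2 (h.isCartesian ⟨hk, hc, hi⟩)⟩

/-- Bicartesian squares can be pasted. -/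
theorem BicartSq.paste {a b c d e f : Q} (h₁ : BicartSq M a b d e) (h₂ : BicartSq M b c e f) :
    BicartSq M a c d f := by
  let g : Fin 3 × Fin 2 → Q := fun x => if x.2 = 0 then ![a, b, c] x.1 else ![d, e, f] x.1
  obtain ⟨ab, ad, be, de⟩ := h₁.monotone
  obtain ⟨bc, -, cf, ef⟩ := h₂.monotone
  have hg : Monotone g := by
    rintro ⟨x, y⟩ ⟨x', y'⟩ h
    fin_cases x <;> fin_cases x' <;> fin_cases y <;> fin_cases y' <;>
      first
      | exact absurd h (by decide)
      | exact le_rfl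
      | assumption
      | exact ab.trans bc
      | exact de.trans ef
      | exact ab.trans be
      | exact bc.trans cf
      | exact ab.trans (bc.trans cf)
  obtain ⟨m₁, h₁⟩ := h₁.res (a := ((0 : Fin 3), (0 : Fin 2))) (b := (1, 0)) (c := (0, 1)) (d := (1, 1)) hg
    (by decide) (by decide) (by decide) (by decide)
  obtain ⟨m₂, h₂⟩ := h₂.res (a := ((1 : Fin 3), (0 : Fin 2))) (b := (2, 0)) (c := (1, 1)) (d := (2, 1)) hg
    (by decide) (by decide) (by decide) (by decide)
  have e₁ : sqMap ((0 : Fin 3), (0 : Fin 2)) (1, 0) (0, 1) (1, 1) =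
      fun s : Sq => (s.1.castSucc, s.2) := by decide
  have e₂ : sqMap ((1 : Fin 3), (0 : Fin 2)) (2, 0) (1, 1) (2, 1) =
      fun s : Sq => (s.1.succ, s.2) := by decide
  have h₁' : BicartSq ((D.res (Shape.map g hg)).obj M) (0, 0) (2, 0) (0, 1) (2, 1) := by
    refine .of_comp (k := fun s : Sq => (((2 : Fin 3) * s.1.castSucc, s.2) : Fin 3 × Fin 2))
      (hk := by decide) (by decide) ((IsStable.isCocartesian_iff_isCartesian _).2
        (isCartesian_paste _ (by decide) (by decide) (by decide) ?_ ?_))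
    · simp only [e₁] at h₁
      exact (IsStable.isCocartesian_iff_isCartesian _).1 h₁
    · simp only [e₂] at h₂
      exact (IsStable.isCocartesian_iff_isCartesian _).1 h₂
  exact h₁'.of_res

/-- The bottom of a prism is bicartesian if the other faces are. -/
theorem BicartSq.prism {a b c d a' b' c' d' : Q} (h : BicartSq M a b c d)
    (h₁ : BicartSq M a b a' b') (h₂ : BicartSq M a c a' c') (h₃ : BicartSq M b d b' d')
    (hcd : c' ≤ d') : BicartSq M a' b' c' d' := by
  let g : Sq × Fin 2 → Q := fun x => if x.2 = 0 then sqMap a b c d x.1 else sqMap a' b' c' d' x.1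
  obtain ⟨ab, ac, bd, cd⟩ := h.monotone
  obtain ⟨-, aa, bb, ab'⟩ := h₁.monotone
  obtain ⟨-, -, cc, ac'⟩ := h₂.monotone
  obtain ⟨-, -, dd, bd'⟩ := h₃.monotone
  have hl (x : Sq) : g (x, 0) ≤ g (x, 1) := by
    rcases sq_cases x with rfl | rfl | rfl | rfl <;> assumption
  have hg : Monotone g := by
    rintro ⟨x, y⟩ ⟨x', y'⟩ ⟨h, h'⟩
    have m₁ := sqMap_monotone ab ac bd cd h
    have m₂ := sqMap_monotone ab' ac' bd' hcd h
    change y ≤ y' at h'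
    fin_cases y <;> fin_cases y'
    · exact m₁
    · exact m₁.trans (hl x')
    · exact absurd h' (by decide)
    · exact m₂
  let N := (D.res (Shape.map g hg)).obj M
  have k₀ : BicartSq N ((0, 0), 0) ((1, 0), 0) ((0, 1), 0) ((1, 1), 0) :=
    h.res hg (by decide) (by decide) (by decide) (by decide)
  have k₁ : BicartSq N ((0, 0), 0) ((1, 0), 0) ((0, 0), 1) ((1, 0), 1) :=
    h₁.res hg (by decide) (by decide) (by decide) (by decide)
  have k₂ : BicartSq N ((0, 0), 0) ((0, 1), 0) ((0, 0), 1) ((0, 1), 1) :=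
    h₂.res hg (by decide) (by decide) (by decide) (by decide)
  have k₃ : BicartSq N ((1, 0), 0) ((1, 1), 0) ((1, 0), 1) ((1, 1), 1) :=
    h₃.res hg (by decide) (by decide) (by decide) (by decide)
  -- The prism is left extended from the span on its top together with the corner of its bottom: all
  -- other vertices are pushouts in the top or in one of the three given sides. For such a diagram
  -- the bottom square is a pushout.
  let S := {x : Sq × Fin 2 // x = ((0, 0), 0) ∨ x = ((1, 0), 0) ∨ x = ((0, 1), 0) ∨ x = ((0, 0), 1)}
  have hu : Monotone (Subtype.val : S → Sq × Fin 2) := fun x y h => h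
  have key : D.LExt (Shape.map _ hu) N := by
    refine LExt.of_generation hu (fun _ _ h => h) N fun S hS _ hk => ?_
    have s₁ : ((0, 0), 0) ∈ S := hS ⟨_, Or.inl rfl⟩
    have s₂ : ((1, 0), 0) ∈ S := hS ⟨_, Or.inr (Or.inl rfl)⟩
    have s₃ : ((0, 1), 0) ∈ S := hS ⟨_, Or.inr (Or.inr (Or.inl rfl))⟩
    have s₄ : ((0, 0), 1) ∈ S := hS ⟨_, Or.inr (Or.inr (Or.inr rfl))⟩
    have s₅ : ((1, 1), 0) ∈ S := hk _ ⟨k₀.1, by decide, by decide⟩ k₀.2 s₁ s₂ s₃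
    have s₆ : ((1, 0), 1) ∈ S := hk _ ⟨k₁.1, by decide, by decide⟩ k₁.2 s₁ s₂ s₄
    have s₇ : ((0, 1), 1) ∈ S := hk _ ⟨k₂.1, by decide, by decide⟩ k₂.2 s₁ s₃ s₄
    have s₈ : ((1, 1), 1) ∈ S := hk _ ⟨k₃.1, by decide, by decide⟩ k₃.2 s₂ s₅ s₆
    rintro ⟨x, y⟩
    rcases sq_cases x with rfl | rfl | rfl | rfl <;> fin_cases y <;> assumption
  have := key.bicartSq (a := ((0, 0), 1)) (b := ((1, 0), 1)) (c := ((0, 1), 1)) (d := ((1, 1), 1))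
    (by decide) (by decide) (by decide)
  exact this.of_res

end Prederivator

namespace Prederivator

/-! ### The diagrams in the image of `H` -/

/-- The iterated Kan extensions from which `H` is composed. -/
structure IsHDiagram (D : Prederivator.{w, v, u}) [D.IsDerivator]
    (M : D.Diag (Shape.{w} EPts)) : Prop where
  lExt₆ : D.LExt (Shape.incl (Set.subset_union_left : E₅ ⊆ EPts)) M
  rExt₅ : D.RExt (Shape.incl (Set.subset_union_left : E₄ ⊆ E₅))
    ((D.res (Shape.incl (Set.subset_union_left : E₅ ⊆ EPts))).obj M)
  lExt₄ : D.LExt (Shape.incl (Set.subset_union_left : E₃ ⊆ E₄))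
    ((D.res (Shape.incl (Set.subset_union_left : E₄ ⊆ E₅))).obj
      ((D.res (Shape.incl (Set.subset_union_left : E₅ ⊆ EPts))).obj M))
  rExt₃ : D.RExt (Shape.incl (Set.subset_union_left : E₂ ⊆ E₃))
    ((D.res (Shape.incl (Set.subset_union_left : E₃ ⊆ E₄))).obj
      ((D.res (Shape.incl (Set.subset_union_left : E₄ ⊆ E₅))).obj
        ((D.res (Shape.incl (Set.subset_union_left : E₅ ⊆ EPts))).obj M)))
  rExt₂ : D.RExt (Shape.incl (Set.subset_union_left : E₁ ⊆ E₂))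
    ((D.res (Shape.incl (Set.subset_union_left : E₂ ⊆ E₃))).obj
      ((D.res (Shape.incl (Set.subset_union_left : E₃ ⊆ E₄))).obj
        ((D.res (Shape.incl (Set.subset_union_left : E₄ ⊆ E₅))).obj
          ((D.res (Shape.incl (Set.subset_union_left : E₅ ⊆ EPts))).obj M))))
  rExt₁ : D.RExt (Shape.map v₁Fun v₁Fun_monotone)
    ((D.res (Shape.incl (Set.subset_union_left : E₁ ⊆ E₂))).obj
      ((D.res (Shape.incl (Set.subset_union_left : E₂ ⊆ E₃))).obj
        ((D.res (Shape.incl (Set.subset_union_left : E₃ ⊆ E₄))).obj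
          ((D.res (Shape.incl (Set.subset_union_left : E₄ ⊆ E₅))).obj
            ((D.res (Shape.incl (Set.subset_union_left : E₅ ⊆ EPts))).obj M)))))

instance : (Shape.map.{w} v₁Fun v₁Fun_monotone).Full := Shape.map_full _ <| by
  rintro ⟨x, rfl | rfl | rfl | rfl⟩ ⟨y, rfl | rfl | rfl | rfl⟩ h <;>
    first
    | (change (_ : ℤ × ℤ × ℤ) ≤ _; decide)
    | exact absurd (show (_ : ℤ × ℤ × ℤ × ℤ) ≤ _ from h) (by decide)

variable {D : Prederivator.{w, v, u}}

section

variable {A B : Type w} [SmallCategory A] [SmallCategory B]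

lemma lExt_closed (f : A ⥤ B) (M N : D.Diag B) (h : Nonempty (M ≅ N)) (hM : D.LExt f M) :
    D.LExt f N := hM.of_iso h.some

lemma rExt_closed (f : A ⥤ B) (M N : D.Diag B) (h : Nonempty (M ≅ N)) (hM : D.RExt f M) :
    D.RExt f N := hM.of_iso h.some

lemma closed_and_res (f : A ⥤ B) {p : D.Diag B → Prop} {q : D.Diag A → Prop}
    (hp : ∀ M N, Nonempty (M ≅ N) → p M → p N) (hq : ∀ M N, Nonempty (M ≅ N) → q M → q N)
    (M N : D.Diag B) : Nonempty (M ≅ N) → p M ∧ q ((D.res f).obj M) → p N ∧ q ((D.res f).obj N) :=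
  fun ⟨e⟩ h => ⟨hp _ _ ⟨e⟩ h.1, hq _ _ ⟨(D.res f).mapIso e⟩ h.2⟩

variable [D.IsDerivator]

lemma ptProp_H : PtProp D.H D.IsHDiagram := by
  have h₁ := ptProp_ranMor D (Shape.map.{w} v₁Fun v₁Fun_monotone)
  have c₁ := rExt_closed (D := D) (Shape.map.{w} v₁Fun v₁Fun_monotone)
  have h₂ := h₁.comp_ranMor c₁ (Shape.incl.{w} (Set.subset_union_left : E₁ ⊆ E₂))
  have c₂ := closed_and_res (Shape.incl.{w} (Set.subset_union_left : E₁ ⊆ E₂))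
    (rExt_closed (D := D) (Shape.incl.{w} (Set.subset_union_left : E₁ ⊆ E₂))) c₁
  have h₃ := h₂.comp_ranMor c₂ (Shape.incl.{w} (Set.subset_union_left : E₂ ⊆ E₃))
  have c₃ := closed_and_res (Shape.incl.{w} (Set.subset_union_left : E₂ ⊆ E₃))
    (rExt_closed (D := D) (Shape.incl.{w} (Set.subset_union_left : E₂ ⊆ E₃))) c₂
  have h₄ := h₃.comp_lanMor c₃ (Shape.incl.{w} (Set.subset_union_left : E₃ ⊆ E₄))
  have c₄ := closed_and_res (Shape.incl.{w} (Set.subset_union_left : E₃ ⊆ E₄))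
    (lExt_closed (D := D) (Shape.incl.{w} (Set.subset_union_left : E₃ ⊆ E₄))) c₃
  have h₅ := h₄.comp_ranMor c₄ (Shape.incl.{w} (Set.subset_union_left : E₄ ⊆ E₅))
  have c₅ := closed_and_res (Shape.incl.{w} (Set.subset_union_left : E₄ ⊆ E₅))
    (rExt_closed (D := D) (Shape.incl.{w} (Set.subset_union_left : E₄ ⊆ E₅))) c₄
  have h₆ := h₅.comp_lanMor c₅ (Shape.incl.{w} (Set.subset_union_left : E₅ ⊆ EPts))
  have c₆ := closed_and_res (Shape.incl.{w} (Set.subset_union_left : E₅ ⊆ EPts))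
    (lExt_closed (D := D) (Shape.incl.{w} (Set.subset_union_left : E₅ ⊆ EPts))) c₅
  have := h₆.of_isoMor (X' := D.H) ?_ c₆
  · exact this.imp fun M h => ⟨h.1, h.2.1, h.2.2.1, h.2.2.2.1, h.2.2.2.2.1, h.2.2.2.2.2⟩
  · have a {a b c d e f g : Prederivator.{w, v, u}} (x₁ : a ⟶ b) (x₂ : b ⟶ c) (x₃ : c ⟶ d)
        (x₄ : d ⟶ e) (x₅ : e ⟶ f) (x₆ : f ⟶ g) : IsoMor
        (((((x₁ ≫ x₂) ≫ x₃) ≫ x₄) ≫ x₅) ≫ x₆) (x₁ ≫ x₂ ≫ x₃ ≫ x₄ ≫ x₅ ≫ x₆) :=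
      ((IsoMor.assoc _ _ _).trans ((IsoMor.assoc _ _ _).trans
        ((IsoMor.assoc _ _ _).trans (IsoMor.assoc _ _ _))))
    exact a _ _ _ _ _ _

end

variable [D.IsStable] {M : D.Diag (Shape.{w} EPts)}

namespace IsHDiagram

/-- The upper cube is right extended from `E₁`, so squares with the pullback condition relative to
`E₁` are bicartesian. -/
lemma bicartSq_upper (h : D.IsHDiagram M) {a b c d : E₂} (hab : a ≤ b) (hac : a ≤ c) (hbd : b ≤ d)
    (hcd : c ≤ d) (hc : ∀ x : E₁, a.1 ≤ x.1 → b.1 ≤ x.1 ∨ c.1 ≤ x.1)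
    (hi : ∀ x : E₁, b.1 ≤ x.1 → c.1 ≤ x.1 → d.1 ≤ x.1) :
    BicartSq M (⟨a.1, Or.inl (Or.inl (Or.inl (Or.inl a.2)))⟩ : EPts)
      ⟨b.1, Or.inl (Or.inl (Or.inl (Or.inl b.2)))⟩
      ⟨c.1, Or.inl (Or.inl (Or.inl (Or.inl c.2)))⟩
      ⟨d.1, Or.inl (Or.inl (Or.inl (Or.inl d.2)))⟩ :=
  (h.rExt₂.bicartSq (sqMap_monotone hab hac hbd hcd) hc hi).of_res.of_res.of_res.of_res

/-- The lower cube is left extended from `E₃`, whose only object with last coordinate 1 is the zero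
(-∞,1), and this lies below all of the lower cube. The value at (x, 1) is thus the cofibre of the
map from (-∞,0) to (x, 0), and squares between the two layers are pushouts. The bound -1 in `hl`
admits (-∞,0) itself as initial vertex. -/
lemma bicartSq_vertical (h : D.IsHDiagram M) {a b c : ℤ} {a' b' c' : ℤ}
    (h₀ : ((a, b, c, 0) : ℤ × ℤ × ℤ × ℤ) ∈ E₄) (h₁ : ((a', b', c', 0) : ℤ × ℤ × ℤ × ℤ) ∈ E₄)
    (h₂ : ((a, b, c, 1) : ℤ × ℤ × ℤ × ℤ) ∈ E₄) (h₃ : ((a', b', c', 1) : ℤ × ℤ × ℤ × ℤ) ∈ E₄)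
    (hl : -1 ≤ a ∧ -1 ≤ b ∧ -1 ≤ c) (ha : a ≤ a') (hb : b ≤ b') (hc : c ≤ c') :
    BicartSq M (⟨_, Or.inl (Or.inl h₀)⟩ : EPts) ⟨_, Or.inl (Or.inl h₁)⟩ ⟨_, Or.inl (Or.inl h₂)⟩
      ⟨_, Or.inl (Or.inl h₃)⟩ := by
  have key : ∀ x : E₃, x.1.2.2.2 ≤ 0 ∨ x.1 = (-1, -1, -1, 1) := by
    rintro ⟨x, ((rfl | rfl | rfl | rfl | rfl) | hx) | rfl⟩
    iterate 5 exact Or.inl (by decide)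
    · exact Or.inl hx.2.2.2.2
    · exact Or.inr rfl
  refine (h.lExt₄.bicartSq (a := (⟨_, h₀⟩ : E₄)) (b := ⟨_, h₁⟩) (c := ⟨_, h₂⟩) (d := ⟨_, h₃⟩)
    (sqMap_monotone ?_ ?_ ?_ ?_) ?_ ?_).of_res.of_res
  · exact ⟨ha, hb, hc, le_rfl⟩
  · exact ⟨le_rfl, le_rfl, le_rfl, (by decide : (0 : ℤ) ≤ 1)⟩
  · exact ⟨le_rfl, le_rfl, le_rfl, (by decide : (0 : ℤ) ≤ 1)⟩
  · exact ⟨ha, hb, hc, le_rfl⟩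
  · rintro x ⟨x₁, x₂, x₃, x₄⟩
    rcases key x with hx | hx
    · exact Or.inl ⟨x₁, x₂, x₃, hx⟩
    · refine Or.inr ?_
      change x.1 ≤ _
      rw [hx]
      exact ⟨hl.1, hl.2.1, hl.2.2, le_rfl⟩
  · rintro x ⟨_, _, _, x₄⟩ ⟨x₁, x₂, x₃, _⟩
    exact ⟨x₁, x₂, x₃, x₄⟩

/-- All of `E₄` lies below 1111, the vertex b. An object of `E₅` below d is therefore below b,
unless it is one of the three zeros, and these are then required to lie below c. -/
lemma bicartSq_link (h : D.IsHDiagram M) {a b c d : EPts} (hab : a ≤ b)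
    (hac : a ≤ c) (hbd : b ≤ d) (hcd : c ≤ d)
    (hc : ∀ x : ({(0, 2, 1, 1), (2, 1, 0, 1), (1, 0, 2, 1)} : Set (ℤ × ℤ × ℤ × ℤ)),
      x.1 ≤ d.1 → x.1 ≤ c.1) (hb : b.1 = (1, 1, 1, 1))
    (hi : ∀ x : ℤ × ℤ × ℤ × ℤ, x ≤ b.1 → x ≤ c.1 → x ≤ a.1) :
    BicartSq M a b c d := by
  have key : ∀ x : E₄, x.1 ≤ (1, 1, 1, 1) := by
    rintro ⟨x, (((rfl | rfl | rfl | rfl | rfl) | hx) | rfl) | hx⟩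
    iterate 5 decide
    · exact hx.2.trans (by decide)
    · decide
    · exact hx.2
  refine h.lExt₆.bicartSq (sqMap_monotone hab hac hbd hcd) ?_ ?_
  · rintro ⟨x, hx | hx⟩ h'
    · left
      change x ≤ b.1
      rw [hb]
      exact key ⟨x, hx⟩
    · exact Or.inr (hc ⟨x, hx⟩ h')
  · exact fun x => hi x.1

/-- The three vanishing statements have the same reason: a right extension is terminal at an object
that precedes no object of the smaller poset. -/
lemma isZero_1110 (h : D.IsHDiagram M) (hx : ((1, 1, 1, 0) : ℤ × ℤ × ℤ × ℤ) ∈ EPts) :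
    Limits.IsZero ((D.eval (ULift.up.{w} (⟨(1, 1, 1, 0), hx⟩ : EPts))).obj M) := by
  have := IsStable.hasZeroObject (D := D)
  have h' := h.rExt₁.isZero (ULift.up ⟨(1, 1, 1, 0), by decide⟩) fun a =>
    Shape.isEmpty_hom (by revert a; rintro ⟨a⟩; revert a; decide)
  simp only [isZero_eval_res_iff] at h'
  exact h'

lemma isZero_bot (h : D.IsHDiagram M) (hx : ((-1, -1, -1, 1) : ℤ × ℤ × ℤ × ℤ) ∈ EPts) :
    Limits.IsZero ((D.eval (ULift.up.{w} (⟨(-1, -1, -1, 1), hx⟩ : EPts))).obj M) := by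
  have := IsStable.hasZeroObject (D := D)
  have h' := h.rExt₃.isZero (ULift.up ⟨(-1, -1, -1, 1), Or.inr rfl⟩) fun a =>
    Shape.isEmpty_hom (by
      obtain ⟨x, (rfl | rfl | rfl | rfl | rfl) | hx⟩ := a
      iterate 5 decide
      exact fun h' => absurd (h'.2.2.2.trans hx.2.2.2.2) (by decide))
  simp only [isZero_eval_res_iff] at h'
  exact h'

lemma isZero_link (h : D.IsHDiagram M) {x : ℤ × ℤ × ℤ × ℤ}
    (hx' : x ∈ ({(0, 2, 1, 1), (2, 1, 0, 1), (1, 0, 2, 1)} : Set (ℤ × ℤ × ℤ × ℤ)))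
    (hx : x ∈ EPts) :
    Limits.IsZero ((D.eval (ULift.up.{w} (⟨x, hx⟩ : EPts))).obj M) := by
  have := IsStable.hasZeroObject (D := D)
  have key : ∀ x : E₄, x.1 ≤ (1, 1, 1, 1) := by
    rintro ⟨x, (((rfl | rfl | rfl | rfl | rfl) | hx) | rfl) | hx⟩
    iterate 5 decide
    · exact hx.2.trans (by decide)
    · decide
    · exact hx.2
  have h' := h.rExt₅.isZero (ULift.up ⟨x, Or.inr hx'⟩) fun a =>
    Shape.isEmpty_hom (fun h' => absurd (le_trans (α := ℤ × ℤ × ℤ × ℤ) h' (key _)) (by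
      rcases hx' with rfl | rfl | rfl <;> decide))
  simp only [isZero_eval_res_iff] at h'
  exact h'

end IsHDiagram

end Prederivator

/-! ### Suspension squares in the values of `H`. -/

namespace Prederivator

variable {D : Prederivator.{w, v, u}} [D.IsStable]

lemma BicartSq.swap {Q : Type} [Preorder Q] {M : D.Diag (Shape.{w} Q)} {a b c d : Q}
    (h : BicartSq M a b c d) : BicartSq M a c b d := by
  obtain ⟨hk, h⟩ := h
  have h' : BicartSq ((D.res (Shape.map _ hk)).obj M) (0, 0) (0, 1) (1, 0) (1, 1) :=
    ((isCocartesian_iff_lExt _).1 h).bicartSq (u := Subtype.val) (hu := fun _ _ h => h)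
      (by decide) (by decide) (by decide)
  exact h'.of_res

instance (x : ℤ × ℤ × ℤ × ℤ) : Decidable (x ∈ E₄) :=
  decidable_of_iff ((((x = (-1, -1, -1, 0) ∨ x = (1, 1, 0, 0) ∨ x = (0, 1, 1, 0) ∨
    x = (1, 0, 1, 0) ∨ x = (1, 1, 1, 0)) ∨ ((0, 0, 0, 0) ≤ x ∧ x ≤ (1, 1, 1, 0))) ∨
    x = (-1, -1, -1, 1)) ∨ ((0, 0, 0, 1) ≤ x ∧ x ≤ (1, 1, 1, 1))) Iff.rfl

instance (x : ℤ × ℤ × ℤ × ℤ) : Decidable (x ∈ EPts) :=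
  decidable_of_iff ((x ∈ E₄ ∨ x = (0, 2, 1, 1) ∨ x = (2, 1, 0, 1) ∨ x = (1, 0, 2, 1)) ∨
    x = (2, 1, 1, 1) ∨ x = (1, 2, 1, 1) ∨ x = (1, 1, 2, 1)) Iff.rfl

/-- The vertices of the squares in the values of `H` which compute suspensions. -/
def hTable (i : Fin 4) : Sq → ℤ × ℤ × ℤ × ℤ :=
  sqMap (![(-1, -1, -1, 0), (1, 1, 0, 0), (0, 1, 1, 0), (1, 0, 1, 0)] i)
    (![(-1, -1, -1, 1), (2, 1, 0, 1), (0, 2, 1, 1), (1, 0, 2, 1)] i) (1, 1, 1, 0)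
    (![(1, 1, 1, 1), (2, 1, 1, 1), (1, 2, 1, 1), (1, 1, 2, 1)] i)

lemma hTable_mem : ∀ i q, hTable i q ∈ EPts := by decide +kernel
lemma hTable_le_left : ∀ i q, hTable 0 q ≤ hTable i q := by decide +kernel
lemma hTable_le_right : ∀ i q q', q ≤ q' → hTable i q ≤ hTable i q' := by decide +kernel

/-- The family of squares in `E` which compute suspensions. -/
noncomputable def hSquares : Source.{w} × Shape.{w} Sq ⥤ Shape.{w} EPts :=
  Shape.map₂ (fun s q => ⟨hTable (sourceIdx s) q, hTable_mem _ _⟩) fun s s' q q' h h' => by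
    change hTable _ _ ≤ hTable _ _
    rcases sourceIdx_of_le h with h | h <;> rw [h]
    · exact (hTable_le_left (sourceIdx s') q).trans (hTable_le_right _ _ _ h')
    · exact hTable_le_right _ _ _ h'

namespace IsHDiagram

variable {M : D.Diag (Shape.{w} EPts)}

/-- From (-∞,0) to 1111 there is a single vertical square, with zeros at (-∞,1) and 1110. From 1100,
the vertical square over 1100 ≤ 1110 is pasted with the link square through the zero 2101, which
leads to 2111. The two remaining cases are rotations of this one. -/
lemma isSuspSq (h : D.IsHDiagram M) (s : Source.{w}) :
    IsSuspSq D ((D.res (Prod.sectR s (Shape.{w} Sq) ⋙ hSquares)).obj M) := by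
  have key (i : Fin 4) (hk : Monotone fun q => (⟨hTable i q, hTable_mem i q⟩ : EPts)) :
      IsSuspSq D ((D.res (Shape.map _ hk)).obj M) := by
    refine ⟨?_, (isZero_eval_res_iff _ _ _).2 ?_,
      (isZero_eval_res_iff _ _ _).2 (h.isZero_1110 _)⟩
    · have : BicartSq M ⟨hTable i (0, 0), hTable_mem _ _⟩ ⟨hTable i (1, 0), hTable_mem _ _⟩
          ⟨hTable i (0, 1), hTable_mem _ _⟩ ⟨hTable i (1, 1), hTable_mem _ _⟩ := by
        fin_cases i
        · exact (h.bicartSq_vertical (a := -1) (b := -1) (c := -1) (a' := 1) (b' := 1) (c' := 1)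
            (by decide) (by decide) (by decide) (by decide) (by decide) (by decide) (by decide)
            (by decide)).swap
        · exact (h.bicartSq_vertical (a := 1) (b := 1) (c := 0) (a' := 1) (b' := 1) (c' := 1)
            (by decide) (by decide) (by decide) (by decide) (by decide) (by decide) (by decide)
            (by decide)).swap.paste (h.bicartSq_link (a := ⟨(1, 1, 0, 1), by decide⟩)
              (b := ⟨(1, 1, 1, 1), by decide⟩) (c := ⟨(2, 1, 0, 1), by decide⟩)
              (d := ⟨(2, 1, 1, 1), by decide⟩) (by decide) (by decide) (by decide) (by decide)
              (by rintro ⟨x, rfl | rfl | rfl⟩ <;> decide) rfl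
              fun x ⟨x₁, x₂, x₃, x₄⟩ ⟨y₁, y₂, y₃, y₄⟩ => ⟨x₁, x₂, y₃, x₄⟩).swap
        · exact (h.bicartSq_vertical (a := 0) (b := 1) (c := 1) (a' := 1) (b' := 1) (c' := 1)
            (by decide) (by decide) (by decide) (by decide) (by decide) (by decide) (by decide)
            (by decide)).swap.paste (h.bicartSq_link (a := ⟨(0, 1, 1, 1), by decide⟩)
              (b := ⟨(1, 1, 1, 1), by decide⟩) (c := ⟨(0, 2, 1, 1), by decide⟩)
              (d := ⟨(1, 2, 1, 1), by decide⟩) (by decide) (by decide) (by decide) (by decide)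
              (by rintro ⟨x, rfl | rfl | rfl⟩ <;> decide) rfl
              fun x ⟨x₁, x₂, x₃, x₄⟩ ⟨y₁, y₂, y₃, y₄⟩ => ⟨y₁, x₂, x₃, x₄⟩).swap
        · exact (h.bicartSq_vertical (a := 1) (b := 0) (c := 1) (a' := 1) (b' := 1) (c' := 1)
            (by decide) (by decide) (by decide) (by decide) (by decide) (by decide) (by decide)
            (by decide)).swap.paste (h.bicartSq_link (a := ⟨(1, 0, 1, 1), by decide⟩)
              (b := ⟨(1, 1, 1, 1), by decide⟩) (c := ⟨(1, 0, 2, 1), by decide⟩)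
              (d := ⟨(1, 1, 2, 1), by decide⟩) (by decide) (by decide) (by decide) (by decide)
              (by rintro ⟨x, rfl | rfl | rfl⟩ <;> decide) rfl
              fun x ⟨x₁, x₂, x₃, x₄⟩ ⟨y₁, y₂, y₃, y₄⟩ => ⟨x₁, y₂, x₃, x₄⟩).swap
      obtain ⟨hk', h'⟩ := this
      have aux (k : Sq → EPts) (hk₁ : Monotone k) (e : k = sqMap (k (0, 0)) (k (1, 0)) (k (0, 1))
          (k (1, 1))) (hk₂ : Monotone (sqMap (k (0, 0)) (k (1, 0)) (k (0, 1)) (k (1, 1))))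
          (h' : D.IsCocartesian ((D.res (Shape.map _ hk₂)).obj M)) :
          D.IsCocartesian ((D.res (Shape.map k hk₁)).obj M) := by
        have (k' : Sq → EPts) (hk₂ : Monotone k') (e : k = k')
            (h' : D.IsCocartesian ((D.res (Shape.map _ hk₂)).obj M)) :
            D.IsCocartesian ((D.res (Shape.map k hk₁)).obj M) := by
          subst e
          exact h'
        exact this _ hk₂ e h'
      refine aux _ hk ?_ hk' h'
      funext q
      rcases sq_cases q with rfl | rfl | rfl | rfl <;> rfl
    · fin_cases i
      · exact h.isZero_bot _
      · exact h.isZero_link (Or.inr (Or.inl rfl)) _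
      · exact h.isZero_link (Or.inl rfl) _
      · exact h.isZero_link (Or.inr (Or.inr rfl)) _
  exact key (sourceIdx s.down) fun q q' h => hTable_le_right _ _ _ h

end IsHDiagram

/-- All six extensions that compose `H` are along fully faithful functors, so the restrictions undo
them one after another. -/
lemma H_resMor_v : IsoMor (D.H ≫ D.resMor (Prod.sectL Source.{w} (ULift.up (0, 0)) ⋙ hSquares))
    (𝟙 _) := by
  have e : Prod.sectL Source.{w} (ULift.up (0, 0)) ⋙ hSquares =
      Shape.map v₁Fun v₁Fun_monotone ⋙ Shape.incl (Set.subset_union_left : E₁ ⊆ E₂) ⋙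
        Shape.incl (Set.subset_union_left : E₂ ⊆ E₃) ⋙
        Shape.incl (Set.subset_union_left : E₃ ⊆ E₄) ⋙
        Shape.incl (Set.subset_union_left : E₄ ⊆ E₅) ⋙
        Shape.incl (Set.subset_union_left : E₅ ⊆ EPts) := by
    refine Shape.functor_ext ?_
    rintro ⟨x, rfl | rfl | rfl | rfl⟩ <;> rfl
  rw [e]
  have key {A B C : Type w} [SmallCategory A] [SmallCategory B] [SmallCategory C] (f : A ⥤ B)
      (g : B ⥤ C) (z : D.shift A ⟶ D.shift B) (y : D.shift B ⟶ D.shift C)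
      (hz : IsoMor (z ≫ D.resMor f) (𝟙 _)) (hy : IsoMor (y ≫ D.resMor g) (𝟙 _)) :
      IsoMor ((z ≫ y) ≫ D.resMor (f ⋙ g)) (𝟙 _) :=
    ((D.resMor_comp f g).symm.left _).trans ((IsoMor.assoc _ _ _).trans
      ((((IsoMor.head₀ hy _).left z)).trans hz))
  exact key _ _ _ _ (ranMor_resMor D _) (key _ _ _ _ (ranMor_resMor D _)
    (key _ _ _ _ (ranMor_resMor D _) (key _ _ _ _ (lanMor_resMor D _)
      (key _ _ _ _ (ranMor_resMor D _) (lanMor_resMor D _)))))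

/-- The suspension of the trivalent source as a part of the values of `H`. -/
lemma H_suspension : IsoMor (D.shift Source.{w}).suspension
    (D.H ≫ D.resMor (Prod.sectL Source.{w} (ULift.up (1, 1)) ⋙ hSquares)) :=
  (IsoMor.head₀ H_resMor_v _).symm.trans ((IsoMor.assoc' _ _ _).trans
    (resMor_shift_suspension D.H hSquares (ptProp_H.imp fun _ h => h.isSuspSq)))

end Prederivator

namespace Prederivator

/-! ### Comparison of `H` with the exact diagrams -/

/-- The source and the first link points. -/
abbrev CoreBase : Set (ℤ × ℤ × ℤ) := SourcePts ∪ {(0, 2, 1), (2, 1, 0), (1, 0, 2)}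

/-- The points of `C` which occur in the values of `H`. -/
abbrev Core : Set (ℤ × ℤ × ℤ) :=
  CoreBase ∪ {(1, 1, 0), (1, 0, 1), (0, 1, 1), (1, 1, 1), (2, 1, 1), (1, 2, 1), (1, 1, 2)}

instance (x : ℤ × ℤ × ℤ) : Decidable (x ∈ Core) :=
  decidable_of_iff (((x = (0, 0, 0) ∨ x = (1, 0, 0) ∨ x = (0, 1, 0) ∨ x = (0, 0, 1)) ∨
    x = (0, 2, 1) ∨ x = (2, 1, 0) ∨ x = (1, 0, 2)) ∨ x = (1, 1, 0) ∨ x = (1, 0, 1) ∨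
    x = (0, 1, 1) ∨ x = (1, 1, 1) ∨ x = (2, 1, 1) ∨ x = (1, 2, 1) ∨ x = (1, 1, 2)) Iff.rfl

/-- The vertices of the squares which generate diagrams of shape `Core`. -/
def coreSquares : Fin 7 → Sq → ℤ × ℤ × ℤ :=
  ![sqMap (0, 0, 0) (1, 0, 0) (0, 1, 0) (1, 1, 0), sqMap (0, 0, 0) (1, 0, 0) (0, 0, 1) (1, 0, 1),
    sqMap (0, 0, 0) (0, 1, 0) (0, 0, 1) (0, 1, 1), sqMap (0, 0, 1) (1, 0, 1) (0, 1, 1) (1, 1, 1),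
    sqMap (0, 1, 1) (1, 1, 1) (0, 2, 1) (1, 2, 1), sqMap (1, 1, 0) (1, 1, 1) (2, 1, 0) (2, 1, 1),
    sqMap (1, 0, 1) (1, 1, 1) (1, 0, 2) (1, 1, 2)]

lemma coreSquares_mem : ∀ i q, coreSquares i q ∈ Core := by decide +kernel

lemma coreSquares_le : ∀ i q q', q ≤ q' → coreSquares i q ≤ coreSquares i q' := by decide +kernel

/-- The squares in `Core`. -/
def coreSq (i : Fin 7) (q : Sq) : Core := ⟨coreSquares i q, coreSquares_mem i q⟩

lemma coreSq_monotone (i : Fin 7) : Monotone (coreSq i) := fun _ _ h => coreSquares_le i _ _ h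

variable {D E : Prederivator.{w, v, u}} [D.IsStable]

/-- The diagrams of shape `Core` which are generated by their restriction to the source. -/
structure IsCoreDiagram (D : Prederivator.{w, v, u}) [D.IsStable]
    (M : D.Diag (Shape.{w} Core)) : Prop where
  bicartSq : ∀ i, BicartSq M (coreSq i (0, 0)) (coreSq i (1, 0)) (coreSq i (0, 1)) (coreSq i (1, 1))
  isZero : ∀ x : Core, x.1 ∈ ({(0, 2, 1), (2, 1, 0), (1, 0, 2)} : Set (ℤ × ℤ × ℤ)) →
    Limits.IsZero ((D.eval (ULift.up.{w} x)).obj M)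

lemma coreSq_pushout : ∀ i, ∀ x ∈ [((0 : ℤ), (0 : ℤ), (0 : ℤ)), (1, 0, 0), (0, 1, 0), (0, 0, 1),
    (0, 2, 1), (2, 1, 0), (1, 0, 2)],
    (x ≤ coreSquares i (1, 1) → x ≤ coreSquares i (1, 0) ∨ x ≤ coreSquares i (0, 1)) ∧
    (x ≤ coreSquares i (1, 0) → x ≤ coreSquares i (0, 1) → x ≤ coreSquares i (0, 0)) := by
  decide +kernel

namespace IsCoreDiagram

variable {M : D.Diag (Shape.{w} Core)}

/-- The seven squares reach the remaining points in the order 110, 101, 011, 111 and then, through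
the zeros, 121, 211, 112. -/
lemma lExt (h : D.IsCoreDiagram M) :
    D.LExt (Shape.incl (Set.subset_union_left : CoreBase ⊆ Core)) M := by
  refine LExt.of_generation (u := Set.inclusion (Set.subset_union_left : CoreBase ⊆ Core)) _
    (fun _ _ h => h) _ fun S hS _ hk => ?_
  have key (i : Fin 7) (h₁ : coreSq i (0, 0) ∈ S) (h₂ : coreSq i (1, 0) ∈ S)
      (h₃ : coreSq i (0, 1) ∈ S) : coreSq i (1, 1) ∈ S := by
    obtain ⟨hm, h'⟩ := h.bicartSq i
    have hx (x : CoreBase) : x.1 ∈ [((0 : ℤ), (0 : ℤ), (0 : ℤ)), (1, 0, 0), (0, 1, 0), (0, 0, 1),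
        (0, 2, 1), (2, 1, 0), (1, 0, 2)] := by
      obtain ⟨x, (rfl | rfl | rfl | rfl) | (rfl | rfl | rfl)⟩ := x <;> decide
    exact hk (sqMap _ _ _ _) ⟨hm, fun x => (coreSq_pushout i x.1 (hx x)).1,
      fun x => (coreSq_pushout i x.1 (hx x)).2⟩ h' h₁ h₂ h₃
  have s₁ : coreSq 0 (0, 0) ∈ S := hS ⟨_, Or.inl (Or.inl rfl)⟩
  have s₂ : coreSq 0 (1, 0) ∈ S := hS ⟨_, Or.inl (Or.inr (Or.inl rfl))⟩
  have s₃ : coreSq 0 (0, 1) ∈ S := hS ⟨_, Or.inl (Or.inr (Or.inr (Or.inl rfl)))⟩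
  have s₄ : coreSq 1 (0, 1) ∈ S := hS ⟨_, Or.inl (Or.inr (Or.inr (Or.inr rfl)))⟩
  have s₅ : coreSq 4 (0, 1) ∈ S := hS ⟨_, Or.inr (Or.inl rfl)⟩
  have s₆ : coreSq 5 (0, 1) ∈ S := hS ⟨_, Or.inr (Or.inr (Or.inl rfl))⟩
  have s₇ : coreSq 6 (0, 1) ∈ S := hS ⟨_, Or.inr (Or.inr (Or.inr rfl))⟩
  have t₀ := key 0 s₁ s₂ s₃
  have t₁ := key 1 s₁ s₂ s₄
  have t₂ := key 2 s₁ s₃ s₄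
  have t₃ := key 3 s₄ t₁ t₂
  have t₄ := key 4 t₂ t₃ s₅
  have t₅ := key 5 t₀ t₃ s₆
  have t₆ := key 6 t₁ t₃ s₇
  rintro ⟨x, ((rfl | rfl | rfl | rfl) | (rfl | rfl | rfl)) |
    (rfl | rfl | rfl | rfl | rfl | rfl | rfl)⟩
  exacts [s₁, s₂, s₃, s₄, s₅, s₆, s₇, t₀, t₁, t₂, t₃, t₅, t₄, t₆]

lemma rExt (h : D.IsCoreDiagram M) :
    D.RExt (Shape.incl (Set.subset_union_left : SourcePts ⊆ CoreBase))
      ((D.res (Shape.incl (Set.subset_union_left : CoreBase ⊆ Core))).obj M) := by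
  refine RExt.of_generation (u := Set.inclusion (Set.subset_union_left : SourcePts ⊆ CoreBase)) _
    (fun _ _ h => h) _ fun S hS hz _ => ?_
  rintro ⟨x, hx | hx⟩
  · exact hS ⟨x, hx⟩
  · refine hz _ ((isZero_eval_res_iff _ _ _).2 (h.isZero _ hx)) ?_
    rintro ⟨y, hy⟩ (h' : x ≤ y)
    revert h'
    rcases hx with rfl | rfl | rfl <;> rcases hy with rfl | rfl | rfl | rfl <;> decide

end IsCoreDiagram

/-- Families of diagrams of shape `Core` are determined by their restriction to the source. -/
theorem isoMor_of_isCoreDiagram {X X' : E ⟶ D.shift (Shape.{w} Core)}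
    (h : PtProp X D.IsCoreDiagram) (h' : PtProp X' D.IsCoreDiagram)
    (e : IsoMor (X ≫ D.resMor (Shape.incl (Set.subset_union_left : SourcePts ⊆ CoreBase) ⋙
        Shape.incl (Set.subset_union_left : CoreBase ⊆ Core)))
      (X' ≫ D.resMor (Shape.incl (Set.subset_union_left : SourcePts ⊆ CoreBase) ⋙
        Shape.incl (Set.subset_union_left : CoreBase ⊆ Core)))) : IsoMor X X' := by
  -- A core diagram is the left extension of its restriction to `CoreBase`, which in turn is the
  -- right extension by zero of its restriction to the source.
  refine (lValued_resMor _ (h.imp fun _ h => h.lExt)).isoMor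
    (lValued_resMor _ (h'.imp fun _ h => h.lExt)) ?_
  have aux {X : E ⟶ D.shift (Shape.{w} Core)} (h : PtProp X D.IsCoreDiagram) :
      PtProp (X ≫ D.resMor (Shape.incl (Set.subset_union_left : CoreBase ⊆ Core)))
        (D.RExt (Shape.incl (Set.subset_union_left : SourcePts ⊆ CoreBase))) :=
    h.resMor _ fun M hM N ⟨e⟩ => hM.rExt.of_iso e
  refine (rValued_resMor _ (aux h)).isoMor (rValued_resMor _ (aux h')) ?_
  exact (IsoMor.assoc _ _ _).trans (((D.resMor_comp _ _).left _).trans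
    (e.trans (((D.resMor_comp _ _).symm.left _).trans (IsoMor.assoc' _ _ _))))

/-- The points `(n₁, n₂, n₃, 1)` in `E`. -/
def coreFun (x : Core) : EPts := ⟨(x.1.1, x.1.2.1, x.1.2.2, 1), by
  obtain ⟨x, ((rfl | rfl | rfl | rfl) | (rfl | rfl | rfl)) |
    (rfl | rfl | rfl | rfl | rfl | rfl | rfl)⟩ := x <;> decide⟩

lemma coreFun_monotone : Monotone coreFun := fun _ _ h => ⟨h.1, h.2.1, h.2.2, le_rfl⟩

lemma core_subset : Core ⊆ CPts := by
  rintro x (((rfl | rfl | rfl | rfl) | (rfl | rfl | rfl)) |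
    (rfl | rfl | rfl | rfl | rfl | rfl | rfl)) <;> exact IsPoint.mem (by decide)

/-- A face of the lower cube is the bottom of a prism whose top is a face of the upper cube and
whose sides are vertical squares; all of these are bicartesian. The conditions only have to be
tested at 110, 011, 101, 111, the cube points of `E₁`. -/
lemma IsHDiagram.bicartSq_face {M : D.Diag (Shape.{w} EPts)} (h : D.IsHDiagram M)
    {a b c d : ℤ × ℤ × ℤ} (ha : 0 ≤ a) (hab : a ≤ b ∧ a ≤ c) (hd : b ≤ d ∧ c ≤ d)
    (hd' : d ≤ (1, 1, 1))
    (hc : ∀ x ∈ [((1 : ℤ), (1 : ℤ), (0 : ℤ)), (0, 1, 1), (1, 0, 1), (1, 1, 1)],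
      a ≤ x → b ≤ x ∨ c ≤ x)
    (hi : ∀ x ∈ [((1 : ℤ), (1 : ℤ), (0 : ℤ)), (0, 1, 1), (1, 0, 1), (1, 1, 1)],
      b ≤ x → c ≤ x → d ≤ x) :
    BicartSq M (⟨(a.1, a.2.1, a.2.2, 1), Or.inl (Or.inl (Or.inr
        ⟨⟨ha.1, ha.2.1, ha.2.2, le_rfl⟩, (hab.1.trans (hd.1.trans hd')).1,
          (hab.1.trans (hd.1.trans hd')).2.1, (hab.1.trans (hd.1.trans hd')).2.2, le_rfl⟩))⟩ : EPts)
      ⟨(b.1, b.2.1, b.2.2, 1), Or.inl (Or.inl (Or.inr ⟨⟨(ha.trans hab.1).1, (ha.trans hab.1).2.1,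
        (ha.trans hab.1).2.2, le_rfl⟩, (hd.1.trans hd').1, (hd.1.trans hd').2.1,
        (hd.1.trans hd').2.2, le_rfl⟩))⟩
      ⟨(c.1, c.2.1, c.2.2, 1), Or.inl (Or.inl (Or.inr ⟨⟨(ha.trans hab.2).1, (ha.trans hab.2).2.1,
        (ha.trans hab.2).2.2, le_rfl⟩, (hd.2.trans hd').1, (hd.2.trans hd').2.1,
        (hd.2.trans hd').2.2, le_rfl⟩))⟩
      ⟨(d.1, d.2.1, d.2.2, 1), Or.inl (Or.inl (Or.inr ⟨⟨(ha.trans (hab.1.trans hd.1)).1,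
        (ha.trans (hab.1.trans hd.1)).2.1, (ha.trans (hab.1.trans hd.1)).2.2, le_rfl⟩,
        hd'.1, hd'.2.1, hd'.2.2, le_rfl⟩))⟩ := by
  have hm₀ {x : ℤ × ℤ × ℤ} (h : 0 ≤ x) (h' : x ≤ (1, 1, 1)) : (x.1, x.2.1, x.2.2, 0) ∈ E₂ :=
    Or.inr ⟨⟨h.1, h.2.1, h.2.2, le_rfl⟩, h'.1, h'.2.1, h'.2.2, le_rfl⟩
  have hm₁ {x : ℤ × ℤ × ℤ} (h : 0 ≤ x) (h' : x ≤ (1, 1, 1)) : (x.1, x.2.1, x.2.2, 1) ∈ E₄ :=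
    Or.inr ⟨⟨h.1, h.2.1, h.2.2, le_rfl⟩, h'.1, h'.2.1, h'.2.2, le_rfl⟩
  have hb := ha.trans hab.1
  have hc₀ := ha.trans hab.2
  have hb' := hd.1.trans hd'
  have hc' := hd.2.trans hd'
  have ha' := hab.1.trans hb'
  have hd₀ := hb.trans hd.1
  have vert {x y : ℤ × ℤ × ℤ} (h₀ : 0 ≤ x) (hxy : x ≤ y) (h₁ : y ≤ (1, 1, 1)) :=
    h.bicartSq_vertical (Or.inl (Or.inl (hm₀ h₀ (hxy.trans h₁))))
      (Or.inl (Or.inl (hm₀ (h₀.trans hxy) h₁))) (hm₁ h₀ (hxy.trans h₁)) (hm₁ (h₀.trans hxy) h₁)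
      ⟨le_trans (by decide) h₀.1, le_trans (by decide) h₀.2.1, le_trans (by decide) h₀.2.2⟩
      hxy.1 hxy.2.1 hxy.2.2
  have he : ∀ x : E₁, x.1 = (-1, -1, -1, 0) ∨ (x.1.1, x.1.2.1, x.1.2.2.1) ∈
      [((1 : ℤ), (1 : ℤ), (0 : ℤ)), (0, 1, 1), (1, 0, 1), (1, 1, 1)] ∧ x.1.2.2.2 = 0 := by
    rintro ⟨x, rfl | rfl | rfl | rfl | rfl⟩ <;> decide
  -- The encoding of (-∞,0) has negative coordinates, so it never lies above a point of the cube.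
  have bot {x : E₁} {y : ℤ × ℤ × ℤ} (hx : x.1 = (-1, -1, -1, 0)) (hy : 0 ≤ y)
      (h : (y.1, y.2.1, y.2.2, (0 : ℤ)) ≤ x.1) : False := by
    rw [hx] at h
    exact absurd (hy.1.trans h.1) (by decide)
  refine BicartSq.prism (h.bicartSq_upper (a := ⟨_, hm₀ ha ha'⟩) (b := ⟨_, hm₀ hb hb'⟩)
    (c := ⟨_, hm₀ hc₀ hc'⟩) (d := ⟨_, hm₀ hd₀ hd'⟩) ⟨hab.1.1, hab.1.2.1, hab.1.2.2, le_rfl⟩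
    ⟨hab.2.1, hab.2.2.1, hab.2.2.2, le_rfl⟩ ⟨hd.1.1, hd.1.2.1, hd.1.2.2, le_rfl⟩
    ⟨hd.2.1, hd.2.2.1, hd.2.2.2, le_rfl⟩ (fun x hx => ?_) fun x hx hx' => ?_)
    (vert ha hab.1 hb') (vert ha hab.2 hc') (vert hb hd.1 hd')
    ⟨hd.2.1, hd.2.2.1, hd.2.2.2, le_rfl⟩
  · rcases he x with h' | ⟨h', h₀⟩
    · exact (bot h' ha hx).elim
    · exact (hc _ h' ⟨hx.1, hx.2.1, hx.2.2.1⟩).imp (fun h => ⟨h.1, h.2.1, h.2.2, h₀.ge⟩)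
        fun h => ⟨h.1, h.2.1, h.2.2, h₀.ge⟩
  · rcases he x with h' | ⟨h', h₀⟩
    · exact (bot h' hb hx).elim
    · have := hi _ h' ⟨hx.1, hx.2.1, hx.2.2.1⟩ ⟨hx'.1, hx'.2.1, hx'.2.2.1⟩
      exact ⟨this.1, this.2.1, this.2.2, h₀.ge⟩

lemma IsHDiagram.isCoreDiagram {M : D.Diag (Shape.{w} EPts)} (h : D.IsHDiagram M) :
    D.IsCoreDiagram ((D.res (Shape.map coreFun coreFun_monotone)).obj M) where
  bicartSq i := by
    refine BicartSq.res coreFun_monotone ?_ (coreSq_monotone i (by decide))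
      (coreSq_monotone i (by decide)) (coreSq_monotone i (by decide))
      (coreSq_monotone i (by decide))
    fin_cases i
    · exact h.bicartSq_face (a := (0, 0, 0)) (b := (1, 0, 0)) (c := (0, 1, 0)) (d := (1, 1, 0))
        (by decide) (by decide) (by decide) (by decide) (by decide) (by decide)
    · exact h.bicartSq_face (a := (0, 0, 0)) (b := (1, 0, 0)) (c := (0, 0, 1)) (d := (1, 0, 1))
        (by decide) (by decide) (by decide) (by decide) (by decide) (by decide)
    · exact h.bicartSq_face (a := (0, 0, 0)) (b := (0, 1, 0)) (c := (0, 0, 1)) (d := (0, 1, 1))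
        (by decide) (by decide) (by decide) (by decide) (by decide) (by decide)
    · exact h.bicartSq_face (a := (0, 0, 1)) (b := (1, 0, 1)) (c := (0, 1, 1)) (d := (1, 1, 1))
        (by decide) (by decide) (by decide) (by decide) (by decide) (by decide)
    · exact h.bicartSq_link (a := ⟨(0, 1, 1, 1), by decide⟩) (b := ⟨(1, 1, 1, 1), by decide⟩)
        (c := ⟨(0, 2, 1, 1), by decide⟩) (d := ⟨(1, 2, 1, 1), by decide⟩) (by decide) (by decide)
        (by decide) (by decide) (by rintro ⟨x, rfl | rfl | rfl⟩ <;> decide) rfl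
        fun x ⟨x₁, x₂, x₃, x₄⟩ ⟨y₁, y₂, y₃, y₄⟩ => ⟨y₁, x₂, x₃, x₄⟩
    · exact h.bicartSq_link (a := ⟨(1, 1, 0, 1), by decide⟩) (b := ⟨(1, 1, 1, 1), by decide⟩)
        (c := ⟨(2, 1, 0, 1), by decide⟩) (d := ⟨(2, 1, 1, 1), by decide⟩) (by decide) (by decide)
        (by decide) (by decide) (by rintro ⟨x, rfl | rfl | rfl⟩ <;> decide) rfl
        fun x ⟨x₁, x₂, x₃, x₄⟩ ⟨y₁, y₂, y₃, y₄⟩ => ⟨x₁, x₂, y₃, x₄⟩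
    · exact h.bicartSq_link (a := ⟨(1, 0, 1, 1), by decide⟩) (b := ⟨(1, 1, 1, 1), by decide⟩)
        (c := ⟨(1, 0, 2, 1), by decide⟩) (d := ⟨(1, 1, 2, 1), by decide⟩) (by decide) (by decide)
        (by decide) (by decide) (by rintro ⟨x, rfl | rfl | rfl⟩ <;> decide) rfl
        fun x ⟨x₁, x₂, x₃, x₄⟩ ⟨y₁, y₂, y₃, y₄⟩ => ⟨x₁, y₂, x₃, x₄⟩
  isZero := by
    rintro ⟨x, hx'⟩ hx
    refine (isZero_eval_res_iff _ _ _).2 (h.isZero_link ?_ _)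
    rcases hx with rfl | rfl | rfl <;> simp

lemma isCoreDiagram_exIncl : PtProp (D.exIncl ≫ D.resMor (Shape.incl core_subset))
    D.IsCoreDiagram := by
  refine (ptProp_exIncl D).resMor _ fun M hM N ⟨e⟩ => ⟨fun i => BicartSq.of_iso ?_ e,
    fun x hx => Limits.IsZero.of_iso ?_ ((D.eval _).mapIso e.symm)⟩
  · refine BicartSq.res _ ?_ (coreSq_monotone i (by decide))
      (coreSq_monotone i (by decide)) (coreSq_monotone i (by decide))
      (coreSq_monotone i (by decide))
    have hs : ∀ i, IsPushoutSq (coreSquares i (0, 0)) (coreSquares i (1, 0)) (coreSquares i (0, 1))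
      (coreSquares i (1, 1)) := by decide +kernel
    have hk : Monotone (sqMap (Set.inclusion core_subset (coreSq i (0, 0)))
      (Set.inclusion core_subset (coreSq i (1, 0))) (Set.inclusion core_subset (coreSq i (0, 1)))
      (Set.inclusion core_subset (coreSq i (1, 1)))) := sqMap_monotone
        (coreSq_monotone i (by decide)) (coreSq_monotone i (by decide))
        (coreSq_monotone i (by decide)) (coreSq_monotone i (by decide))
    exact ⟨hk, hM.isCocartesian_of_isPushoutSq _ hk (hs i)⟩
  · refine (isZero_eval_res_iff _ _ _).2 (hM.isZero_linkPt ?_ _)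
    rcases hx with hx | hx | hx
    · exact ⟨0, Or.inl hx⟩
    · exact ⟨0, Or.inr (Or.inl hx)⟩
    · exact ⟨0, Or.inr (Or.inr hx)⟩

/-- The translation of the source in `Core`. -/
noncomputable def coreTop : Source.{w} ⥤ Shape.{w} Core :=
  Shape.map (fun x => ⟨(translate 1 ⟨x.1, sourcePts_subset x.2⟩).1, by
    obtain ⟨x, rfl | rfl | rfl | rfl⟩ := x <;> decide⟩)
    fun x y h => (isExactMap_translate 1).monotone h

/-- The fundamental relation between `T`, the suspension and the translation. -/
theorem suspension_isoMor_T : IsoMor D.ex.suspension (D.T ≫ D.sh 1) := by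
  have hF := invMor_comp D.iStar
  -- The layer of H X with last coordinate 1 and the exact diagram F T' X are both core diagrams,
  -- and both restrict to T' X on the source. Hence they agree on `Core`.
  have key : IsoMor (D.H ≫ D.resMor (Shape.map coreFun coreFun_monotone))
      ((D.T' ≫ invMor D.iStar) ≫ D.exIncl ≫ D.resMor (Shape.incl core_subset)) := by
    refine isoMor_of_isCoreDiagram (ptProp_H.resMor _ fun M hM N ⟨e⟩ => ?_)
      (isCoreDiagram_exIncl.comp_left _) ?_
    · exact ⟨fun i => (hM.isCoreDiagram.bicartSq i).of_iso e,
        fun x hx => (hM.isCoreDiagram.isZero x hx).of_iso ((D.eval _).mapIso e.symm)⟩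
    · let g : Source.{w} ⥤ Shape.{w} Core :=
        Shape.incl (Set.subset_union_left : SourcePts ⊆ CoreBase) ⋙
          Shape.incl (Set.subset_union_left : CoreBase ⊆ Core)
      have e₁ : g ⋙ Shape.map coreFun coreFun_monotone = Shape.map wFun wFun_monotone :=
        Shape.functor_ext fun _ => rfl
      have e₂ : g ⋙ Shape.incl core_subset = Shape.incl sourcePts_subset :=
        Shape.functor_ext fun _ => rfl
      have h₁ : IsoMor ((D.H ≫ D.resMor (Shape.map coreFun coreFun_monotone)) ≫ D.resMor g)
          D.T' := by
        have := (D.resMor_comp g (Shape.map coreFun coreFun_monotone)).left D.H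
        rw [e₁] at this
        exact (IsoMor.assoc _ _ _).trans this
      have h₂ : IsoMor ((D.exIncl ≫ D.resMor (Shape.incl core_subset)) ≫ D.resMor g)
          D.iStar := by
        have := (D.resMor_comp g (Shape.incl core_subset)).left D.exIncl
        rw [e₂] at this
        exact (IsoMor.assoc _ _ _).trans this
      have h₃ : IsoMor ((D.T' ≫ invMor D.iStar) ≫ D.iStar) D.T' :=
        (IsoMor.assoc _ _ _).trans ((hF.left _).trans (IsoMor.comp_id _))
      exact h₁.trans (h₃.symm.trans ((h₂.symm.left _).trans (IsoMor.assoc' _ _ _)))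
  -- The same values of `H` also compute the suspension of the given source diagram.
  have h₁ := H_suspension (D := D)
  -- The end points 1111, 2111, 1211, 1121 of the suspension squares are the source translated by 1
  -- in the layer `Core`.
  have h₂ : Prod.sectL Source.{w} (ULift.up (1, 1)) ⋙ hSquares =
      coreTop ⋙ Shape.map coreFun coreFun_monotone := by
    refine Shape.functor_ext ?_
    rintro ⟨x, rfl | rfl | rfl | rfl⟩ <;> rfl
  rw [h₂] at h₁
  have h₃ : IsoMor (D.shift Source.{w}).suspension
      ((D.T' ≫ invMor D.iStar) ≫ D.sh 1 ≫ D.iStar) := by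
    refine h₁.trans (((D.resMor_comp _ _).symm.left _).trans ((IsoMor.assoc' _ _ _).trans
      ((key.right _).trans ((IsoMor.assoc _ _ _).trans (IsoMor.left _ ?_)))))
    refine (IsoMor.assoc _ _ _).trans (((D.resMor_comp _ _).left _).trans
      (IsoMor.trans ?_ (exRes_iStar _ _).symm))
    exact IsoMor.refl _
  refine IsoMor.cancel_right D.iStar ((suspension_comp_iStar D).trans ((h₃.left _).trans ?_))
  exact (IsoMor.assoc' _ _ _).trans (IsoMor.assoc' _ _ _)

end Prederivator

namespace Prederivator

open CatTrans

variable {D E F : Prederivator.{w, v, u}}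

/-! ### Morphisms which commute with the suspension -/

lemma isEquivalence_fn (φ : E ⟶ F) [IsEquivMor φ] (a : (Cat.{w, w})ᵒᵖ) :
    (fn φ a).IsEquivalence := by
  obtain ⟨e⟩ := comp_invMor φ
  obtain ⟨e'⟩ := invMor_comp φ
  have aux {E : Prederivator.{w, v, u}} {X Y : E ⟶ E} (e : X ≅ Y) : Nonempty (fn X a ≅ fn Y a) :=
    ⟨NatIso.ofComponents (fun M => ⟨md e.hom a M, md e.inv a M, congr(md $(e.hom_inv_id) a M),
      congr(md $(e.inv_hom_id) a M)⟩) fun g => md_naturality e.hom a g⟩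
  obtain ⟨i⟩ := aux e
  obtain ⟨i'⟩ := aux e'
  exact (CategoryTheory.Equivalence.mk (fn φ a) (fn (invMor φ) a) i.symm i').isEquivalence_functor

lemma suspension_comp_of_isEquivMor [E.IsStable] [F.IsStable] (φ : E ⟶ F) [IsEquivMor φ] :
    IsoMor (E.suspension ≫ φ) (φ ≫ F.suspension) :=
  have := isEquivalence_fn φ
  suspension_comp_of_equivalence φ

lemma suspension_comp_ev [D.IsStable] {B : Type w} [SmallCategory B] (b : B) :
    IsoMor ((D.shift B).suspension ≫ D.ev b) (D.ev b ≫ D.suspension) :=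
  suspension_comp (D.ev b) (fun M h => (shift_isCocartesian_iff M).1 h b)
    fun _ h => isZero_res (D := D) (Prod.sectR b Pt.{w}) h

/-! ### Restriction along automorphisms of `C` -/

/-- Restriction along the identity is idempotent up to isomorphism and has a one-sided inverse, the
right Kan extension; such a morphism is isomorphic to the identity. -/
lemma resMor_id {B : Type w} [SmallCategory B] [D.IsDerivator] :
    IsoMor (D.resMor (𝟭 B)) (𝟙 (D.shift B)) := by
  have h := ranMor_resMor D (𝟭 B)
  exact (h.head₀ _).symm.trans (((D.resMor_comp (𝟭 B) (𝟭 B)).left _).trans h)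

lemma IsExactMap.comp {f g : CPts → CPts} (hg : IsExactMap g) (hf : IsExactMap f) :
    IsExactMap (g ∘ f) where
  monotone := hg.monotone.comp hf.monotone
  notMem x hx := hg.notMem _ (hf.notMem x hx)
  isSmallSquare k hk := hg.isSmallSquare (f ∘ k) (hf.isSmallSquare k hk)

section

variable [D.IsDerivator] {f g k : CPts → CPts} (hf : IsExactMap f) (hg : IsExactMap g)
  (hk : IsExactMap k)

lemma exRes_exIncl : IsoMor (D.exRes f hf ≫ D.exIncl)
    (D.exIncl ≫ D.resMor (Shape.map f hf.monotone)) :=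
  liftSub_comp_ι _ _ _

lemma exRes_comp (h : ∀ x, g (f x) = k x) : IsoMor (D.exRes g hg ≫ D.exRes f hf)
    (D.exRes k hk) := by
  have e : Shape.map f hf.monotone ⋙ Shape.map g hg.monotone = Shape.map k hk.monotone :=
    Shape.functor_ext fun x => congrArg ULift.up (h x.down)
  have e' := (D.resMor_comp (Shape.map f hf.monotone) (Shape.map g hg.monotone)).left D.exIncl
  rw [e] at e'
  exact isoMor_of_comp_ι _ ((IsoMor.assoc _ _ _).trans (((exRes_exIncl hf).left _).trans
    ((IsoMor.head (exRes_exIncl hg) _).trans (e'.trans (exRes_exIncl hk).symm))))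

lemma exRes_id (h : ∀ x, f x = x) : IsoMor (D.exRes f hf) (𝟙 D.ex) := by
  have e : Shape.map f hf.monotone = 𝟭 (Shape.{w} CPts) :=
    Shape.functor_ext fun x => congrArg ULift.up (h x.down)
  have e' := resMor_id (D := D) (B := Shape.{w} CPts)
  rw [← e] at e'
  exact isoMor_of_comp_ι _ ((exRes_exIncl hf).trans ((e'.left _).trans
    ((IsoMor.comp_id _).trans (IsoMor.id_comp _).symm)))

lemma exRes_exEv (x : CPts) : IsoMor (D.exRes f hf ≫ D.exEv x) (D.exEv (f x)) :=
  (IsoMor.head (exRes_exIncl hf) _).trans ((D.resMor_ev (Shape.map f hf.monotone) _).left _)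

end

lemma translate_translate (m n : ℤ) (x : CPts) :
    translate m (translate n x) = translate (n + m) x :=
  Subtype.ext (Prod.ext (add_assoc _ _ _) (Prod.ext (add_assoc _ _ _) (add_assoc _ _ _)))

lemma translate_cubePt {m n k : ℤ} (h : n + m = k) (e₁ e₂ e₃ : Fin 2) :
    translate m (cubePt n e₁ e₂ e₃) = cubePt k e₁ e₂ e₃ := by
  subst h
  exact Subtype.ext (Prod.ext (add_right_comm _ _ _)
    (Prod.ext (add_right_comm _ _ _) (add_right_comm _ _ _)))

lemma translate_zero (x : CPts) : translate 0 x = x :=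
  Subtype.ext (Prod.ext (add_zero _) (Prod.ext (add_zero _) (add_zero _)))

section

variable [D.IsDerivator]

lemma sh_sh {m n k : ℤ} (h : m + n = k) : IsoMor (D.sh m ≫ D.sh n) (D.sh k) :=
  exRes_comp _ _ _ fun x => by rw [translate_translate, add_comm n m, h]

lemma sh_zero : IsoMor (D.sh 0) (𝟙 D.ex) := exRes_id _ translate_zero

lemma sh_neg {m n : ℤ} (h : m + n = 0) : IsoMor (D.sh m ≫ D.sh n) (𝟙 D.ex) :=
  (sh_sh h).trans sh_zero

instance (m : ℤ) : IsEquivMor (D.sh m) :=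
  isEquivMor_of_isoMor (sh_neg (add_neg_cancel m)) (sh_neg (neg_add_cancel m))

lemma sh_exEv (m : ℤ) (x : CPts) : IsoMor (D.sh m ≫ D.exEv x) (D.exEv (translate m x)) :=
  exRes_exEv _ _

lemma rot_sh (m : ℤ) : IsoMor (D.rot ≫ D.sh m) (D.sh m ≫ D.rot) :=
  have h := isExactMap_rotate.comp (isExactMap_translate m)
  (exRes_comp (isExactMap_translate m) isExactMap_rotate h fun _ => rfl).trans
    (exRes_comp isExactMap_rotate (isExactMap_translate m) h fun _ => rfl).symm

lemma rot_rot_rot : IsoMor (D.rot ≫ D.rot ≫ D.rot) (𝟙 D.ex) :=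
  have h := isExactMap_rotate.comp isExactMap_rotate
  have h' := isExactMap_rotate.comp h
  ((exRes_comp isExactMap_rotate isExactMap_rotate h fun _ => rfl).left _).trans
    ((exRes_comp h isExactMap_rotate h' fun _ => rfl).trans (exRes_id h' fun _ => rfl))

instance : IsEquivMor D.rot :=
  isEquivMor_of_isoMor rot_rot_rot ((IsoMor.assoc _ _ _).trans rot_rot_rot)

end

/-! ### The relations between `T`, the suspension and the translation -/

variable [D.IsStable]

lemma suspension_sh (m : ℤ) : IsoMor (D.ex.suspension ≫ D.sh m) (D.sh m ≫ D.ex.suspension) :=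
  suspension_comp_of_isEquivMor _

lemma T_isoMor : IsoMor D.T (D.ex.suspension ≫ D.sh (-1)) :=
  (IsoMor.comp_id _).symm.trans (((sh_neg (add_neg_cancel 1)).symm.left _).trans
    ((IsoMor.assoc' _ _ _).trans (suspension_isoMor_T.symm.right _)))

lemma T_isoMor' : IsoMor D.T (D.sh (-1) ≫ D.ex.suspension) := T_isoMor.trans (suspension_sh _)

/-- One factor is written as sh^{-1} Σ and the other as Σ sh^{-1}; with Σ² ≅ (sh^*)³ the exponents
add up to 3 - 1 - 1 = 1. -/
lemma T_T : IsoMor (D.T ≫ D.T) (D.sh 1) :=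
  (T_isoMor'.right _).trans ((T_isoMor.left _).trans ((IsoMor.assoc _ _ _).trans
    (((IsoMor.head₁ D.suspension_suspension _).left _).trans
      (((sh_sh (by norm_num : (3 : ℤ) + -1 = 2)).left _).trans (sh_sh (by norm_num))))))

lemma T_T_T : IsoMor (D.T ≫ D.T ≫ D.T) D.ex.suspension :=
  (T_T.left _).trans suspension_isoMor_T.symm

/-- Both sides are T³, since sh^* ≅ T². -/
lemma T_sh_one : IsoMor (D.T ≫ D.sh 1) (D.sh 1 ≫ D.T) :=
  (T_T.symm.left _).trans ((IsoMor.assoc' _ _ _).trans (T_T.right _))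

/-- From T² ≅ sh^*, composing T with sh^{-1} on one side gives a right inverse and on the other a
left inverse. The two are then isomorphic. -/
instance : IsEquivMor D.T := by
  have h₁ : IsoMor (D.T ≫ D.T ≫ D.sh (-1)) (𝟙 D.ex) :=
    (T_T.head₁ _).trans (sh_neg (by norm_num))
  have h₂ : IsoMor ((D.sh (-1) ≫ D.T) ≫ D.T) (𝟙 D.ex) :=
    (IsoMor.assoc _ _ _).trans ((T_T.left _).trans (sh_neg (by norm_num)))
  have h₃ : IsoMor (D.sh (-1) ≫ D.T) (D.T ≫ D.sh (-1)) :=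
    (IsoMor.comp_id _).symm.trans ((h₁.symm.left _).trans ((IsoMor.assoc' _ _ _).trans
      ((h₂.right _).trans (IsoMor.id_comp _))))
  exact isEquivMor_of_isoMor h₁ ((h₃.symm.right _).trans h₂)

lemma T_suspension : IsoMor (D.T ≫ D.ex.suspension) (D.ex.suspension ≫ D.T) :=
  (suspension_comp_of_isEquivMor D.T).symm

instance : IsEquivMor D.ex.suspension := by
  have h := T_T_T (D := D)
  have h₁ : IsoMor (D.ex.suspension ≫ invMor D.T ≫ invMor D.T ≫ invMor D.T) (𝟙 D.ex) :=
    (h.symm.right _).trans ((IsoMor.assoc _ _ _).trans (((IsoMor.assoc _ _ _).trans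
      (((((comp_invMor D.T).head₀ _).left _).trans ((comp_invMor D.T).head₀ _)))).left _ |>.trans
        (comp_invMor D.T)))
  have h₂ : IsoMor ((invMor D.T ≫ invMor D.T ≫ invMor D.T) ≫ D.ex.suspension) (𝟙 D.ex) :=
    (h.symm.left _).trans ((IsoMor.assoc _ _ _).trans (((IsoMor.assoc _ _ _).trans
      (((((invMor_comp D.T).head₀ _).left _).trans ((invMor_comp D.T).head₀ _)))).left _ |>.trans
        (invMor_comp D.T)))
  exact isEquivMor_of_isoMor h₁ h₂

/-! ### The values of `T` -/

lemma T_exEv_of_comm (x : CPts)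
    (h : IsoMor (D.ex.suspension ≫ D.exEv (translate (-1) x))
      (D.exEv (translate (-1) x) ≫ D.suspension)) :
    IsoMor (D.T ≫ D.exEv x) (D.exEv (translate (-1) x) ≫ D.suspension) :=
  (T_isoMor.right _).trans ((IsoMor.assoc _ _ _).trans (((sh_exEv _ _).left _).trans h))

lemma iStar_ev (x : SourcePts) {y : CPts} (h : y = ⟨x.1, sourcePts_subset x.2⟩) :
    IsoMor (D.iStar ≫ D.ev (ULift.up.{w} x)) (D.exEv y) := by
  subst h
  exact (IsoMor.assoc _ _ _).trans ((D.resMor_ev (Shape.incl sourcePts_subset) _).left _)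

/-- At a point of the source, evaluation factors through i^* and an evaluation of a shifted
derivator, and both commute with the suspension. -/
lemma suspension_exEv_source {y : CPts} (x : SourcePts)
    (h : y = ⟨x.1, sourcePts_subset x.2⟩) :
    IsoMor (D.ex.suspension ≫ D.exEv y) (D.exEv y ≫ D.suspension) :=
  ((iStar_ev x h).symm.left _).trans ((IsoMor.head D.suspension_comp_iStar _).trans
    (((suspension_comp_ev _).left _).trans ((IsoMor.assoc' _ _ _).trans
      ((iStar_ev x h).right _))))

lemma suspension_exEv_translate {x : CPts} (m : ℤ)
    (h : IsoMor (D.ex.suspension ≫ D.exEv x) (D.exEv x ≫ D.suspension)) :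
    IsoMor (D.ex.suspension ≫ D.exEv (translate m x)) (D.exEv (translate m x) ≫ D.suspension) :=
  ((sh_exEv m x).symm.left _).trans ((IsoMor.head (suspension_sh m) _).trans
    ((h.left _).trans ((IsoMor.assoc' _ _ _).trans ((sh_exEv m x).right _))))

/-- If evaluation of T at x is evaluation at y, then y inherits the property from x because T
commutes with Σ. This reaches the points of the cube outside the source without a direct study of
cocartesian squares in `D.ex`. -/
lemma suspension_exEv_T {x y : CPts}
    (h : IsoMor (D.ex.suspension ≫ D.exEv x) (D.exEv x ≫ D.suspension))
    (h' : IsoMor (D.T ≫ D.exEv x) (D.exEv y)) :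
    IsoMor (D.ex.suspension ≫ D.exEv y) (D.exEv y ≫ D.suspension) :=
  (h'.symm.left _).trans ((IsoMor.head T_suspension.symm _).trans
    ((h.left _).trans ((IsoMor.assoc' _ _ _).trans (h'.right _))))

/-- The values of `T` at points where the suspension is computed by evaluation. -/
lemma T_exEv {x y z : CPts}
    (h : IsoMor (D.ex.suspension ≫ D.exEv x) (D.exEv x ≫ D.suspension))
    (h' : IsoMor (D.exEv x ≫ D.suspension) (D.exEv y)) (hz : translate (-1) y = z) :
    IsoMor (D.T ≫ D.exEv x) (D.exEv z) := by
  subst hz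
  exact (T_isoMor'.right _).trans ((IsoMor.assoc _ _ _).trans (((h.trans h').left _).trans
    (sh_exEv _ _)))

lemma T_exEv_100 : IsoMor (D.T ≫ D.exEv (cubePt 0 1 0 0)) (D.exEv (cubePt 0 1 0 1)) :=
  T_exEv (suspension_exEv_source ⟨(1, 0, 0), Or.inr (Or.inl rfl)⟩ (by decide)) D.exEv_suspension₁ (translate_cubePt rfl _ _ _)

lemma T_exEv_010 : IsoMor (D.T ≫ D.exEv (cubePt 0 0 1 0)) (D.exEv (cubePt 0 1 1 0)) :=
  T_exEv (suspension_exEv_source ⟨(0, 1, 0), Or.inr (Or.inr (Or.inl rfl))⟩ (by decide)) D.exEv_suspension₂ (translate_cubePt rfl _ _ _)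

lemma T_exEv_001 : IsoMor (D.T ≫ D.exEv (cubePt 0 0 0 1)) (D.exEv (cubePt 0 0 1 1)) :=
  T_exEv (suspension_exEv_source ⟨(0, 0, 1), Or.inr (Or.inr (Or.inr rfl))⟩ (by decide)) D.exEv_suspension₃ (translate_cubePt rfl _ _ _)

/-- Applying T once more gives T² ≅ sh^* at x, which is evaluation at x translated by 1. -/
lemma T_exEv_of_T {x y z : CPts} (h : IsoMor (D.T ≫ D.exEv x) (D.exEv y))
    (hz : translate 1 x = z) : IsoMor (D.T ≫ D.exEv y) (D.exEv z) := by
  subst hz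
  exact (h.symm.left _).trans ((T_T.head₁ _).trans (sh_exEv _ _))

lemma isZero_exEv {x : CPts} (hx : x.1 ∉ cubePoints) (a : (Cat.{w, w})ᵒᵖ) (M : D.ex.obj a) :
    Limits.IsZero ((fn (D.exEv x) a).obj M) := by
  have := IsStable.hasZeroObject (D := D)
  refine isZero_of_eval (D := D) fun k => (isZero_eval_res_iff (D := D)
    (Prod.sectR (ULift.up.{w} x) a.unop) k _).2 ?_
  exact (isZero_eval_res_iff (D := D) (Prod.sectL (Shape.{w} CPts) k) (ULift.up x) M.1).1
    ((M.2 k).isZero x hx)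

/-- Evaluation commutes with the suspension. -/
theorem suspension_exEv (x : CPts) :
    IsoMor (D.ex.suspension ≫ D.exEv x) (D.exEv x ≫ D.suspension) := by
  by_cases hx : x.1 ∈ cubePoints
  · obtain ⟨x, hx'⟩ := x
    obtain ⟨n, e₁, e₂, e₃, h₁, h₂, h₃, rfl : x = _⟩ := hx
    -- Up to translation, a vertex of a cube is a source point or one of 011, 101, 110, which are
    -- reached by T from 001, 100 and 010. The top vertex 111 is the origin of the next cube.
    have base : ∃ m y, (⟨_, hx'⟩ : CPts) = translate m y ∧
        IsoMor (D.ex.suspension ≫ D.exEv y) (D.exEv y ≫ D.suspension) := by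
      have key (m : ℤ) (y : CPts) (h : IsoMor (D.ex.suspension ≫ D.exEv y)
          (D.exEv y ≫ D.suspension)) (e : (n + e₁, n + e₂, n + e₃) = (translate m y).1) :
          ∃ m y, (⟨_, hx'⟩ : CPts) = translate m y ∧
            IsoMor (D.ex.suspension ≫ D.exEv y) (D.exEv y ≫ D.suspension) :=
        ⟨m, y, Subtype.ext e, h⟩
      have c₁ : IsoMor (D.ex.suspension ≫ D.exEv (cubePt 0 1 0 0)) _ :=
        suspension_exEv_source (D := D) ⟨(1, 0, 0), Or.inr (Or.inl rfl)⟩ (by decide)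
      have c₂ : IsoMor (D.ex.suspension ≫ D.exEv (cubePt 0 0 1 0)) _ :=
        suspension_exEv_source (D := D) ⟨(0, 1, 0), Or.inr (Or.inr (Or.inl rfl))⟩ (by decide)
      have c₃ : IsoMor (D.ex.suspension ≫ D.exEv (cubePt 0 0 0 1)) _ :=
        suspension_exEv_source (D := D) ⟨(0, 0, 1), Or.inr (Or.inr (Or.inr rfl))⟩ (by decide)
      have c₀ : IsoMor (D.ex.suspension ≫ D.exEv (cubePt 0 0 0 0)) _ :=
        suspension_exEv_source (D := D) ⟨(0, 0, 0), Or.inl rfl⟩ (by decide)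
      rcases h₁ with rfl | rfl <;> rcases h₂ with rfl | rfl <;> rcases h₃ with rfl | rfl
      · exact key n _ c₀ (by simp [translate, cubePt])
      · exact key n _ c₃ (by simp [translate, cubePt, add_comm])
      · exact key n _ c₂ (by simp [translate, cubePt, add_comm])
      · exact key n _ (suspension_exEv_T c₃ T_exEv_001) (by simp [translate, cubePt, add_comm])
      · exact key n _ c₁ (by simp [translate, cubePt, add_comm])
      · exact key n _ (suspension_exEv_T c₁ T_exEv_100) (by simp [translate, cubePt, add_comm])
      · exact key n _ (suspension_exEv_T c₂ T_exEv_010) (by simp [translate, cubePt, add_comm])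
      · exact key (n + 1) _ c₀ (by simp [translate, cubePt])
    obtain ⟨m, y, e, h⟩ := base
    rw [e]
    exact suspension_exEv_translate m h
  -- At a link point every value is zero, so cocartesian squares and zero objects are preserved
  -- trivially.
  · refine suspension_comp (D.exEv x) (fun M _ => ?_) fun M _ => isZero_exEv hx _ M
    exact (IsStable.isCocartesian_iff_isCartesian _).2 ((isCartesian_iff_rExt _).2
      (rExt_of_isZero _ (isZero_exEv hx _ M)))

lemma T_exEv_000 : IsoMor (D.T ≫ D.exEv (cubePt 0 0 0 0))
    (D.iStar ≫ D.H ≫ D.ev (ULift.up.{w} ePt)) := by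
  have h₁ : IsoMor (D.T ≫ D.iStar) (D.iStar ≫ D.T') :=
    (IsoMor.assoc _ _ _).trans (((IsoMor.assoc _ _ _).trans (((invMor_comp _).left _).trans
      (IsoMor.comp_id _))).left _)
  have h₂ := (iStar_ev (D := D) ⟨(0, 0, 0), Or.inl rfl⟩ (y := cubePt 0 0 0 0) (by decide)).symm.left D.T
  refine h₂.trans ((IsoMor.head h₁ _).trans (IsoMor.left _ ((IsoMor.assoc _ _ _).trans
    (IsoMor.left _ (D.resMor_ev (Shape.map wFun wFun_monotone) _)))))

/-- Σ T ≅ T⁴ ≅ (sh^*)², evaluated at the origin. -/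
lemma T_exEv_000_suspension :
    IsoMor (D.T ≫ D.exEv (cubePt 0 0 0 0) ≫ D.suspension) (D.exEv (cubePt 2 0 0 0)) := by
  have h₁ : IsoMor (D.T ≫ D.ex.suspension) (D.sh 2) :=
    (T_T_T.symm.left _).trans ((T_T.head₁ _).trans ((T_T.left _).trans (sh_sh (by norm_num))))
  have h₂ := sh_exEv (D := D) 2 (cubePt 0 0 0 0)
  rw [translate_cubePt (zero_add 2)] at h₂
  exact ((suspension_exEv _).symm.left _).trans ((h₁.head₁ _).trans h₂)

/-- T is composed of Σ and a translation. The rotation commutes with Σ as an equivalence, and with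
translations because the underlying maps of C commute. -/
lemma rot_T : IsoMor (D.rot ≫ D.T) (D.T ≫ D.rot) :=
  (T_isoMor.left _).trans ((IsoMor.head (suspension_comp_of_isEquivMor D.rot).symm _).trans
    (((rot_sh _).left _).trans ((IsoMor.assoc' _ _ _).trans (T_isoMor.symm.right _))))

lemma tau_T : IsoMor (D.tau ≫ D.T) D.rot :=
  (IsoMor.assoc _ _ _).trans ((rot_T.left _).trans ((invMor_comp _).head₀ _))

/-- As the loop morphism followed by Σ is the identity, it suffices to show that τ³ followed by Σ is
the identity. With Σ ≅ T³, three cancellations of τ against T each leave a rotation, which is moved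
past the remaining factors T, and r³ = 1. -/
lemma tau_tau_tau : IsoMor (D.tau ≫ D.tau ≫ D.tau) D.ex.loops := by
  refine IsoMor.cancel_right D.ex.suspension (IsoMor.trans ?_ (loops_suspension D.ex).symm)
  have h₁ : IsoMor (D.tau ≫ D.T ≫ D.T ≫ D.T) (D.T ≫ D.T ≫ D.rot) :=
    (tau_T.head₁ _).trans ((IsoMor.head rot_T _).trans (rot_T.left _))
  have h₂ : IsoMor (D.tau ≫ D.T ≫ D.T ≫ D.rot) (D.T ≫ D.rot ≫ D.rot) :=
    (tau_T.head₁ _).trans (IsoMor.head rot_T _)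
  refine (T_T_T.symm.left _).trans ((IsoMor.assoc _ _ _).trans
    (((IsoMor.assoc _ _ _).trans (h₁.left _)).left _ |>.trans ((h₂.left _).trans
      ((tau_T.head₁ _).trans rot_rot_rot))))

end Prederivator

open Prederivator in
theorem mainTheorem10 (D : Prederivator.{w, v, u}) [D.IsStable] :
    D.ex.IsStable ∧
    ∃ (_ : D.HasKanMorphisms) (_ : D.ex.HasKanMorphisms) (_ : IsEquivMor D.iStar)
      (_ : IsEquivMor D.T),
      -- the canonical isomorphisms for `T`
      Nonempty (D.T ≅ D.ex.suspension ≫ D.sh (-1)) ∧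
      Nonempty (D.T ≅ D.sh (-1) ≫ D.ex.suspension) ∧
      Nonempty (D.T ≫ D.T ≅ D.sh 1) ∧
      Nonempty (D.T ≫ D.T ≫ D.T ≅ D.ex.suspension) ∧
      Nonempty (D.T ≫ D.sh 1 ≅ D.sh 1 ≫ D.T) ∧
      Nonempty (D.T ≫ D.ex.suspension ≅ D.ex.suspension ≫ D.T) ∧
      -- the underlying diagram of `T Y`
      (∀ x : CPts, Nonempty
        (D.T ≫ D.exEv x ≅ D.exEv (Prederivator.translate (-1) x) ≫ D.suspension)) ∧
      Nonempty (D.T ≫ D.exEv (cubePt 0 0 0 0) ≅ D.iStar ≫ D.H ≫ D.ev (ULift.up.{w} ePt)) ∧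
      Nonempty (D.T ≫ D.exEv (cubePt 0 0 0 0) ≫ D.suspension ≅ D.exEv (cubePt 2 0 0 0)) ∧
      Nonempty (D.T ≫ D.exEv (cubePt 0 1 0 0) ≅ D.exEv (cubePt 0 1 0 1)) ∧
      Nonempty (D.T ≫ D.exEv (cubePt 0 0 1 0) ≅ D.exEv (cubePt 0 1 1 0)) ∧
      Nonempty (D.T ≫ D.exEv (cubePt 0 0 0 1) ≅ D.exEv (cubePt 0 0 1 1)) ∧
      Nonempty (D.T ≫ D.exEv (cubePt 0 1 1 0) ≅ D.exEv (cubePt 1 0 1 0)) ∧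
      Nonempty (D.T ≫ D.exEv (cubePt 0 1 0 1) ≅ D.exEv (cubePt 1 1 0 0)) ∧
      Nonempty (D.T ≫ D.exEv (cubePt 0 0 1 1) ≅ D.exEv (cubePt 1 0 0 1)) ∧
      -- the Auslander–Reiten translation
      Nonempty (D.tau ≫ D.tau ≫ D.tau ≅ D.ex.loops) :=
  ⟨inferInstance, inferInstance, inferInstance, inferInstance, inferInstance, T_isoMor, T_isoMor',
    T_T, T_T_T, T_sh_one, T_suspension, fun x => T_exEv_of_comm x (suspension_exEv _), T_exEv_000,
    T_exEv_000_suspension, T_exEv_100, T_exEv_010, T_exEv_001, T_exEv_of_T T_exEv_010 (translate_cubePt rfl _ _ _),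
    T_exEv_of_T T_exEv_100 (translate_cubePt rfl _ _ _), T_exEv_of_T T_exEv_001 (translate_cubePt rfl _ _ _), tau_tau_tau⟩
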